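/- **Setting.** Let $N\ge 1$ and $k\ge 1$ be integers, let $\Delta$ be a fundamental discriminant ($\Delta=1$ allowed), and let $r\in\mathbb Z$ with $\Delta\equiv r^2 \pmod{4N}$. Write $e(x)=e^{2\pi i x}$. Let $V(\mathbb R)$ be the space of traceless real $2\times2$ matrices with $Q(\lambda)=-N\det\lambda$ and $(\lambda,\mu)=N\,\mathrm{tr}(\lambda\mu)$. Let $$L=\left\{\begin{pmatrix} b&-a/N\\ c&-b\end{pmatrix}: a,b,c\in\mathbb Z\right\},\qquad L'=\left\{\begin{pmatrix} b/2N&-a/N\\ c&-b/2N\end{pmatrix}: a,b,c\in\mathbb Z\right\}$$ ($L'$ is the dual of $L$). The genus character $\chi_\Delta$ on $L'$ is defined as follows. If $(b^2-4Nac)/\Delta$ is an integer that is a square modulo $4N$, and $\gcd(a,b,c,\Delta)=1$, then $\chi_\Delta(\lambda)=\left(\frac{\Delta}{n}\right)$ for any integer $n$ coprime to $\Delta$ that is represented by a form $[N_1a,b,N_2c]$ with $N_1N_2=N$, $N_1,N_2>0$; otherwise $\chi_\Delta(\lambda)=0$. For $z=x+iy\in\mathbb H$ put $g_z=\begin{pmatrix}\sqrt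 y&x/\sqrt y\\0&1/\sqrt y\end{pmatrix}$ and $b_i(z)=g_ze_ig_z^{-1}$, where $e_1,e_2,e_3=\frac1{\sqrt{2N}}\begin{pmatrix}0&1\\1&0\end{pmatrix},\ \frac1{\sqrt{2N}}\begin{pmatrix}1&0\\0&-1\end{pmatrix},\ \frac1{\sqrt{2N}}\begin{pmatrix}0&1\\-1&0\end{pmatrix}$. Put $p_z(\lambda)=-(\lambda,b_3(z))$ and $q_z(\lambda)=y(\lambda,b_1(z)+ib_2(z))$. Let $\lambda_z$ and $\lambda_{z^\perp}$ be the orthogonal projections of $\lambda$ to $\mathbb Rb_3(z)$ and to its orthogonal complement, and let $Q_z(\lambda)=Q(\lambda_{z^\perp})-Q(\lambda_z)$. For $\tau=u+iv\in\mathbb H$ let $\Theta_k(\tau,z)=\sum_{h\in L'/L}\theta_{h,k}(\tau,z)\mathfrak e_h$ with $$\theta_{h,k}(\tau,z)=v^{3/2}\sum_{\substack{\lambda\in L+rh\\ Q(\lambda)\equiv\Delta Q(h)\,(\Delta)}}\chi_\Delta(\lambda)\,p_z(\lambda)\,q_z(\lambda)^{k-1}\,e\!\left(\tfrac{Q(\lambda)}{|\Delta|}u+\tfrac{Q_z(\lambda)}{|\Delta|}iv\right).$$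 Let $l,l'\in L$ be isotropic with $(l,l')=1$ (so $l$ is primitive and $(l,L)=\mathbb Z$), with the sign of $l$ chosen such that $p_z(l)>0$. Let $K=L\cap l^\perp\cap l'^\perp$, with dual lattice $K'=L'\cap l^\perp\cap l'^\perp$. Put $$\mathfrak w^\perp=(l,b_2(z))b_1(z)-(l,b_1(z))b_2(z),\qquad \mu=-l'+\frac{l_z}{2(l_z,l_z)}+\frac{l_{z^\perp}}{2(l_{z^\perp},l_{z^\perp})},$$ and let $\mu_K$ be the orthogonal projection of $\mu$ to $K\otimes\mathbb R$. With $H_\kappa(x)=(-1)^\kappa e^{x^2}\frac{d^\kappa}{dx^\kappa}e^{-x^2}$, define for $\kappa\ge0$, $\alpha,\beta\in\mathbb Z$, $h\in K'/K$ and $\nu\in K\otimes\mathbb R$ $$\xi_{\kappa,h}(\tau,\nu,\alpha,\beta)=v^{-\kappa/2}\sum_{\substack{\lambda\in K+rh,\ t\,(\Delta)\\ Q(\lambda-\beta l'+tl)\equiv\Delta Q(h)\,(\Delta)}}H_\kappa\!\left(\frac{\sqrt\pi\,(\alpha-\beta\bar\tau-2v(\lambda+\beta\nu,\mathfrak w^\perp))}{\sqrt{2|\Delta|vQ_z(l)}}\right)\chi_\Delta(\lambda-\beta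 l'+tl)\,e\!\left(\tfrac{-\alpha t}{|\Delta|}\right)e\!\left(\tfrac{Q(\lambda+\beta\nu)\tau}{|\Delta|}-\tfrac{(\lambda+\beta\nu/2,\,\alpha\nu)}{|\Delta|}\right)$$ and $\Xi_\kappa=\sum_{h\in K'/K}\xi_{\kappa,h}\mathfrak e_h$. Put $$c_{z,k,j}=\frac{i}{2\sqrt{2|\Delta|}\,Q_z(l)}\left(\frac{q_z(l)\,i\sqrt{|\Delta|}}{2\sqrt{2\pi Q_z(l)}}\right)^{k-1}\left(\frac{(1-k)\sqrt{2|\Delta|Q_z(l)}}{\sqrt\pi}\right)^{j}.$$ Let $\tilde\Gamma$ be the group of pairs $(\gamma,\phi)$ with $\gamma=\begin{pmatrix}a&b\\c&d\end{pmatrix}\in\mathrm{SL}_2(\mathbb Z)$ and $\phi$ holomorphic on $\mathbb H$ with $\phi(\tau)^2=c\tau+d$, with product $(\gamma,\phi)(\gamma',\phi')=(\gamma\gamma',\phi(\gamma'\tau)\phi'(\tau))$. It is generated by $T=\left(\begin{pmatrix}1&1\\0&1\end{pmatrix},1\right)$ and $S=\left(\begin{pmatrix}0&-1\\1&0\end{pmatrix},\sqrt\tau\right)$.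 Let $\tilde\Gamma_\infty=\{T^n:n\in\mathbb Z\}$. Let $\rho_K$ be the Weil representation of $\tilde\Gamma$ on $\mathbb C[K'/K]$, given by $\rho_K(T)\mathfrak e_h=e(Q(h))\mathfrak e_h$ and $\rho_K(S)\mathfrak e_h=\frac{e(-1/8)}{\sqrt{|K'/K|}}\sum_{h'}e(-(h,h'))\mathfrak e_{h'}$. Let $\tilde\rho_K=\rho_K$ if $\Delta>0$ and $\tilde\rho_K=\overline{\rho_K}$ if $\Delta<0$. For $\tilde\gamma=(\gamma,\phi)\in\tilde\Gamma$ let $(f|_{\kappa,\tilde\rho_K}\tilde\gamma)(\tau)=\phi(\tau)^{-2\kappa}\tilde\rho_K(\tilde\gamma)^{-1}f(\gamma\tau)$. **Theorem 5.8.** The inclusion $K'\subseteq L'$ induces an isomorphism $K'/K\cong L'/L$. The series that define $\Theta_k$ and $\Xi_\kappa$ converge absolutely. With $\mathbb C[L'/L]$ and $\mathbb C[K'/K]$ identified through this isomorphism, $$\Theta_k(\tau,z)=\frac12\sum_{n\ge1}\ \sum_{\tilde\gamma\in\tilde\Gamma_\infty\backslash\tilde\Gamma}\ \sum_{0\le j\le\min(k-1,1)}c_{z,k,j}(-n)^{1-j}\left[e\!\left(-\tfrac{n^2}{4|\Delta|\,i\,\mathrm{Im}(\tau)\,Q_z(l)}\right)\Xi_{k-1-j}(\tau,\mu_K,-n,0)\right]\bigg|_{k-3/2,\tilde\rho_K}\tilde\gamma\;+\;\begin{cases}c_{z,k,1}\,\Xi_{k-2}(\tau,0,0,0)&\text{if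 }k\ge2,\\0&\text{if }k=1,\end{cases}$$ where the summand (the sum over $j$) depends only on the coset of $\tilde\gamma$ and the series over the pairs $(n,\tilde\gamma)$ converges absolutely. -/

import Mathlib

noncomputable section

namespace ShimuraTheta

open UpperHalfPlane Matrix MatrixGroups Manifold

/-! ### Elementary notation -/

/-- `e(x) = exp(2πix)`. -/
def e (x : ℂ) : ℂ := Complex.exp (2 * Real.pi * Complex.I * x)

/-- The (physicists') Hermite polynomial function `H_n(x) = (-1)^n e^{x²} (d/dx)^n e^{-x²}`. -/
def hermiteH (n : ℕ) (x : ℂ) : ℂ :=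
  (-1) ^ n * Complex.exp (x ^ 2) * iteratedDeriv n (fun w : ℂ => Complex.exp (-w ^ 2)) x

/-- `Δ` is `1` or the discriminant of a quadratic field. -/
def IsFundamentalDiscriminant (D : ℤ) : Prop :=
  (D % 4 = 1 ∧ Squarefree D) ∨
    ∃ m : ℤ, D = 4 * m ∧ (m % 4 = 2 ∨ m % 4 = 3) ∧ Squarefree m

/-- The Kronecker symbol `(a / n)` for arbitrary integers `a`, `n`. -/
def kronecker (a n : ℤ) : ℤ :=
  if n = 0 then (if a = 1 ∨ a = -1 then 1 else 0)
  else
    (if a < 0 ∧ n < 0 then -1 else 1) *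
      (if a % 2 = 0 then 0 else if a % 8 = 1 ∨ a % 8 = 7 then 1 else -1) ^
        (padicValNat 2 n.natAbs) *
      jacobiSym a (n.natAbs / 2 ^ padicValNat 2 n.natAbs)

/-! ### The quadratic space and the lattices -/

/-- Real `2 × 2` matrices; `V(ℝ)` consists of the traceless ones, and every matrix to which the
form is applied below (lattice vectors, the basis `b_i(z)` and their combinations) is traceless. -/
abbrev V := Matrix (Fin 2) (Fin 2) ℝ

/-- The bilinear form `(x, y) = N tr(xy)`. -/
def form (N : ℕ) (x y : V) : ℝ := N * (x * y).trace

/-- The quadratic form `Q(x) = -N det x` (equal to `(x, x) / 2` on traceless matrices). -/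
def Q (N : ℕ) (x : V) : ℝ := -N * x.det

/-- The lattice `L` of all `[[b, -a/N], [c, -b]]` with integers `a, b, c`. -/
def latL (N : ℕ) : AddSubgroup V where
  carrier := {x | ∃ a b c : ℤ, x = !![(b : ℝ), -a / N; c, -b]}
  zero_mem' := ⟨0, 0, 0, by ext i j; fin_cases i <;> fin_cases j <;> simp⟩
  add_mem' := by
    rintro _ _ ⟨a, b, c, rfl⟩ ⟨a', b', c', rfl⟩
    refine ⟨a + a', b + b', c + c', ?_⟩
    ext i j; fin_cases i <;> fin_cases j <;> simp <;> ring
  neg_mem' := by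
    rintro _ ⟨a, b, c, rfl⟩
    refine ⟨-a, -b, -c, ?_⟩
    ext i j; fin_cases i <;> fin_cases j <;> simp
    ring

/-- The dual lattice `L'` of all `[[b/2N, -a/N], [c, -b/2N]]` with integers `a, b, c`. -/
def latL' (N : ℕ) : AddSubgroup V where
  carrier := {x | ∃ a b c : ℤ, x = !![(b : ℝ) / (2 * N), -a / N; c, -(b / (2 * N))]}
  zero_mem' := ⟨0, 0, 0, by ext i j; fin_cases i <;> fin_cases j <;> simp⟩
  add_mem' := by
    rintro _ _ ⟨a, b, c, rfl⟩ ⟨a', b', c', rfl⟩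
    refine ⟨a + a', b + b', c + c', ?_⟩
    ext i j; fin_cases i <;> fin_cases j <;> simp <;> ring
  neg_mem' := by
    rintro _ ⟨a, b, c, rfl⟩
    refine ⟨-a, -b, -c, ?_⟩
    ext i j; fin_cases i <;> fin_cases j <;> simp <;> ring

/-- The orthogonal complement of `l` and `l'`. -/
def perp (N : ℕ) (l l' : V) : AddSubgroup V where
  carrier := {x | form N x l = 0 ∧ form N x l' = 0}
  zero_mem' := by simp [form]
  add_mem' := by
    rintro x y ⟨h1, h2⟩ ⟨h3, h4⟩
    simp only [form, Set.mem_ofPred_eq] at *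
    constructor
    · rw [add_mul, trace_add, mul_add, h1, h3, add_zero]
    · rw [add_mul, trace_add, mul_add, h2, h4, add_zero]
  neg_mem' := by
    rintro x ⟨h1, h2⟩
    simp only [form, Set.mem_ofPred_eq] at *
    constructor
    · rw [neg_mul, trace_neg, mul_neg, h1, neg_zero]
    · rw [neg_mul, trace_neg, mul_neg, h2, neg_zero]

/-- `K = L ∩ l^⊥ ∩ l'^⊥`. -/
def latK (N : ℕ) (l l' : V) : AddSubgroup V := latL N ⊓ perp N l l'

/-- The dual lattice `K' = L' ∩ l^⊥ ∩ l'^⊥` of `K`. (For isotropic `l, l' ∈ L` with `(l, l') = 1`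
one has `L = K ⊕ ℤl' ⊕ ℤl` and hence `L' = K' ⊕ ℤl' ⊕ ℤl`.) -/
def latK' (N : ℕ) (l l' : V) : AddSubgroup V := latL' N ⊓ perp N l l'

/-- The discriminant group `L'/L`. -/
abbrev DiscL (N : ℕ) := latL' N ⧸ (latL N).addSubgroupOf (latL' N)

/-- The discriminant group `K'/K`. -/
abbrev DiscK (N : ℕ) (l l' : V) := latK' N l l' ⧸ (latK N l l').addSubgroupOf (latK' N l l')

/-- The natural map `K'/K → L'/L` induced by the inclusion `K' ⊆ L'`. -/
def discMap (N : ℕ) (l l' : V) : DiscK N l l' →+ DiscL N :=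
  QuotientAddGroup.map _ _ (AddSubgroup.inclusion (inf_le_left : latK' N l l' ≤ latL' N))
    (fun _ hx => hx.1)

/-- A representative in `V(ℝ)` of a class in `L'/L`. -/
def repL (N : ℕ) (h : DiscL N) : V := (Quotient.out h : latL' N)

/-- A representative in `V(ℝ)` of a class in `K'/K`. -/
def repK (N : ℕ) (l l' : V) (h : DiscK N l l') : V := (Quotient.out h : latK' N l l')

instance finite_discL (N : ℕ) [NeZero N] : Finite (DiscL N) := by
  have hN : (N : ℝ) ≠ 0 := Nat.cast_ne_zero.mpr (NeZero.ne N)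
  let f : Fin (2 * N) → DiscL N := fun i =>
    QuotientAddGroup.mk ⟨!![((i : ℕ) : ℝ) / (2 * N), 0; 0, -(((i : ℕ) : ℝ) / (2 * N))],
      ⟨0, ((i : ℕ) : ℤ), 0, by ext i j; fin_cases i <;> fin_cases j <;> simp⟩⟩
  refine Finite.of_surjective f fun q => ?_
  induction q using QuotientAddGroup.induction_on with
  | H x =>
    obtain ⟨_, a, b, c, rfl⟩ := x
    have hpos : (0 : ℤ) < 2 * N := by
      have := Nat.pos_of_ne_zero (NeZero.ne N); omega
    have h0 := Int.emod_nonneg b hpos.ne'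
    have h1 := Int.emod_lt_of_pos b hpos
    refine ⟨⟨(b % (2 * N)).toNat, by omega⟩, ?_⟩
    refine (QuotientAddGroup.eq).mpr ?_
    refine ⟨a, b / (2 * N), c, ?_⟩
    have hb : (b : ℝ) = ((b % (2 * N) : ℤ) : ℝ) + (2 * N) * ((b / (2 * N) : ℤ) : ℝ) := by
      exact_mod_cast (Int.emod_add_mul_ediv b (2 * N)).symm
    have hc : (((b % (2 * N)).toNat : ℕ) : ℝ) = ((b % (2 * N) : ℤ) : ℝ) := by
      exact_mod_cast Int.toNat_of_nonneg h0
    ext i j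
    fin_cases i <;> fin_cases j <;> simp [hc]
    · rw [hb]; field_simp; ring
    · rw [hb]; field_simp; ring

instance finite_discK (N : ℕ) [NeZero N] (l l' : V) : Finite (DiscK N l l') := by
  refine Finite.of_injective (discMap N l l') ?_
  rw [injective_iff_map_eq_zero]
  intro q hq
  induction q using QuotientAddGroup.induction_on with
  | H x =>
    have h1 : (AddSubgroup.inclusion (inf_le_left : latK' N l l' ≤ latL' N) x) ∈
        (latL N).addSubgroupOf (latL' N) := (QuotientAddGroup.eq_zero_iff _).mp hq
    exact (QuotientAddGroup.eq_zero_iff _).mpr ⟨h1, x.2.2⟩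

instance fintypeDiscK (N : ℕ) [NeZero N] (l l' : V) : Fintype (DiscK N l l') := Fintype.ofFinite _

instance decidableEqDiscK (N : ℕ) (l l' : V) : DecidableEq (DiscK N l l') := Classical.decEq _

/-! ### The generalised genus character -/

/-- `n` is represented by one of the forms `[N₁a, b, N₂c]` with `N₁N₂ = N`, `N₁, N₂ > 0`. -/
def IsRepresented (N : ℕ) (a b c n : ℤ) : Prop :=
  ∃ N₁ N₂ : ℕ, 0 < N₁ ∧ 0 < N₂ ∧ N₁ * N₂ = N ∧
    ∃ x y : ℤ, n = N₁ * a * x ^ 2 + b * x * y + N₂ * c * y ^ 2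

open Classical in
/-- The genus character in terms of the coefficients `a, b, c` of `[[b/2N, -a/N], [c, -b/2N]]`;
for this vector `4N Q = b² - 4Nac`. The symbol does not depend on the integer `n` chosen. -/
def genusCharCoeff (N : ℕ) (D a b c : ℤ) : ℤ :=
  if h : ((∃ s m : ℤ, b ^ 2 - 4 * N * a * c = D * (s ^ 2 + 4 * N * m)) ∧
      Int.gcd (Int.gcd a b) (Int.gcd c D) = 1) ∧
      ∃ n : ℤ, IsCoprime n D ∧ IsRepresented N a b c n
  then kronecker D h.2.choose else 0

/-- The generalised genus character `χ_Δ` on `L'`; the floors recover the integers `a, b, c`. -/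
def genusChar (N : ℕ) (D : ℤ) (x : V) : ℤ :=
  genusCharCoeff N D ⌊-(N : ℝ) * x 0 1⌋ ⌊2 * (N : ℝ) * x 0 0⌋ ⌊x 1 0⌋

/-! ### Objects attached to a point `z = x + iy` of the upper half plane -/

/-- `g_z`, with `g_z i = z`. -/
def gz (z : ℍ) : V := !![√z.im, z.re / √z.im; 0, 1 / √z.im]

/-- `b_1(z) = g_z . e_1`. -/
def b1 (N : ℕ) (z : ℍ) : V := gz z * ((1 / √(2 * N)) • !![0, 1; 1, 0]) * (gz z)⁻¹

/-- `b_2(z) = g_z . e_2`. -/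
def b2 (N : ℕ) (z : ℍ) : V := gz z * ((1 / √(2 * N)) • !![1, 0; 0, -1]) * (gz z)⁻¹

/-- `b_3(z) = g_z . e_3`, a vector of norm `(b_3, b_3) = -1` spanning the negative line of `z`. -/
def b3 (N : ℕ) (z : ℍ) : V := gz z * ((1 / √(2 * N)) • !![0, 1; -1, 0]) * (gz z)⁻¹

/-- `p_z(x) = -(x, b_3(z))`. -/
def pz (N : ℕ) (z : ℍ) (x : V) : ℝ := -form N x (b3 N z)

/-- `q_z(x) = y (x, b_1(z) + i b_2(z))`. -/
def qz (N : ℕ) (z : ℍ) (x : V) : ℂ :=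
  (z.im : ℂ) * ((form N x (b1 N z) : ℂ) + Complex.I * (form N x (b2 N z) : ℂ))

/-- The orthogonal projection `x_z` of `x` to the negative line `ℝ b_3(z)`. -/
def projNeg (N : ℕ) (z : ℍ) (x : V) : V :=
  (form N x (b3 N z) / form N (b3 N z) (b3 N z)) • b3 N z

/-- The orthogonal projection `x_{z^⊥}` of `x` to the positive plane. -/
def projPos (N : ℕ) (z : ℍ) (x : V) : V := x - projNeg N z x

/-- The majorant `Q_z(x) = Q(x_{z^⊥}) - Q(x_z)`. -/
def Qz (N : ℕ) (z : ℍ) (x : V) : ℝ := Q N (projPos N z x) - Q N (projNeg N z x)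

/-- The vector `𝔴^⊥ = (l, b_2(z)) b_1(z) - (l, b_1(z)) b_2(z)`. -/
def wPerp (N : ℕ) (z : ℍ) (l : V) : V :=
  form N l (b2 N z) • b1 N z - form N l (b1 N z) • b2 N z

/-- `μ(z) = -l' + l_z / (2 (l_z, l_z)) + l_{z^⊥} / (2 (l_{z^⊥}, l_{z^⊥}))`. -/
def mu (N : ℕ) (l l' : V) (z : ℍ) : V :=
  -l' + (1 / (2 * form N (projNeg N z l) (projNeg N z l))) • projNeg N z l
    + (1 / (2 * form N (projPos N z l) (projPos N z l))) • projPos N z l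

/-- The orthogonal projection `μ_K` of `μ(z)` to `K ⊗ ℝ`, the orthogonal complement of the
hyperbolic plane spanned by `l` and `l'`. -/
def muK (N : ℕ) (l l' : V) (z : ℍ) : V :=
  mu N l l' z - form N (mu N l l' z) l' • l - form N (mu N l l' z) l • l'

/-! ### The kernel function -/

/-- The vectors `λ ∈ L + rh` with `Q(λ) ≡ Δ Q(h) (mod Δ)`. -/
def thetaIndex (N : ℕ) (D r : ℤ) (h : DiscL N) : Set (latL' N) :=
  {x | (QuotientAddGroup.mk x : DiscL N) = r • h ∧
    ∃ m : ℤ, Q N x - D * Q N (repL N h) = D * m}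

/-- The summand `χ_Δ(λ) p_z(λ) q_z(λ)^{k-1} e(Q(λ) u / |Δ| + Q_z(λ) i v / |Δ|)`. -/
def thetaTerm (N : ℕ) (D : ℤ) (k : ℕ) (τ z : ℍ) (x : V) : ℂ :=
  (genusChar N D x : ℂ) * (pz N z x : ℂ) * qz N z x ^ (k - 1) *
    e ((Q N x : ℂ) / (|D| : ℤ) * (τ.re : ℂ) + (Qz N z x : ℂ) / (|D| : ℤ) * Complex.I * (τ.im : ℂ))

/-- The kernel function `Θ_k(τ, z)`, a vector in `ℂ[L'/L]` with components `θ_{h,k}(τ, z)`. -/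
def Theta (N : ℕ) (D r : ℤ) (k : ℕ) (τ z : ℍ) (h : DiscL N) : ℂ :=
  ((τ.im ^ (3 / 2 : ℝ) : ℝ) : ℂ) * ∑' x : thetaIndex N D r h, thetaTerm N D k τ z (x : latL' N)

/-! ### The theta functions on `K` -/

/-- The summand of `ξ_{κ,h}(τ, μ, α, β)` at `λ ∈ K + rh`: the sum over `t` modulo `Δ`, restricted
to `Q(λ - βl' + tl) ≡ Δ Q(h) (mod Δ)`. -/
def xiTerm (N : ℕ) (D : ℤ) (l l' : V) (z : ℍ) (κ : ℕ) (τ : ℍ) (μ : V) (α β : ℤ)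
    (h : DiscK N l l') (x : V) : ℂ :=
  open Classical in
  ∑ t ∈ Finset.range D.natAbs,
    if ∃ m : ℤ, Q N (x - (β : ℝ) • l' + (t : ℝ) • l) - D * Q N (repK N l l' h) = D * m then
      hermiteH κ (((√Real.pi : ℝ) : ℂ) *
          ((α : ℂ) - β * (starRingEnd ℂ) (τ : ℂ)
            - 2 * (τ.im : ℂ) * (form N (x + (β : ℝ) • μ) (wPerp N z l) : ℂ)) /
          ((√(2 * (|D| : ℤ) * τ.im * Qz N z l) : ℝ) : ℂ)) *
        (genusChar N D (x - (β : ℝ) • l' + (t : ℝ) • l) : ℂ) *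
        e (-(α : ℂ) * t / (|D| : ℤ)) *
        e ((Q N (x + (β : ℝ) • μ) : ℂ) * (τ : ℂ) / (|D| : ℤ)
          - (form N (x + ((β : ℝ) / 2) • μ) ((α : ℝ) • μ) : ℂ) / (|D| : ℤ))
    else 0

/-- The vector-valued theta function `Ξ_κ(τ, μ, α, β) ∈ ℂ[K'/K]`, with components
`ξ_{κ,h}(τ, μ, α, β)`. It depends on `z` through `𝔴^⊥` and `Q_z(l)`. -/
def Xi (N : ℕ) (D r : ℤ) (l l' : V) (z : ℍ) (κ : ℕ) (τ : ℍ) (μ : V) (α β : ℤ)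
    (h : DiscK N l l') : ℂ :=
  ((τ.im ^ (-(κ : ℝ) / 2) : ℝ) : ℂ) *
    ∑' x : {x : latK' N l l' // (QuotientAddGroup.mk x : DiscK N l l') = r • h},
      xiTerm N D l l' z κ τ μ α β h (x : latK' N l l')

/-- The constant `c_{z,k,j}`. -/
def cConst (N : ℕ) (D : ℤ) (l : V) (z : ℍ) (k j : ℕ) : ℂ :=
  Complex.I / (2 * ((√(2 * (|D| : ℤ)) : ℝ) : ℂ) * (Qz N z l : ℂ)) *
    (qz N z l * Complex.I * ((√((|D| : ℤ) : ℝ) : ℝ) : ℂ) /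
      (2 * ((√(2 * Real.pi * Qz N z l) : ℝ) : ℂ))) ^ (k - 1) *
    ((1 - (k : ℂ)) * ((√(2 * (|D| : ℤ) * Qz N z l) : ℝ) : ℂ) / ((√Real.pi : ℝ) : ℂ)) ^ j

/-! ### The metaplectic cover of `SL(2, ℤ)` -/

/-- `Γ̃`: pairs `(g, φ)` with `g ∈ SL(2, ℤ)` and `φ` holomorphic on `ℍ` with `φ(τ)² = cτ + d`. -/
@[ext]
structure Mp2Z where
  /-- the matrix -/
  g : SL(2, ℤ)
  /-- the chosen square root of `cτ + d` -/
  φ : ℍ → ℂ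
  hol : MDifferentiable 𝓘(ℂ) 𝓘(ℂ) φ
  sq : ∀ τ : ℍ, φ τ ^ 2 = ((g 1 0 : ℤ) : ℂ) * (τ : ℂ) + ((g 1 1 : ℤ) : ℂ)

namespace Mp2Z

lemma sq' (γ : Mp2Z) (τ : ℍ) : γ.φ τ ^ 2 = denom (γ.g : GL (Fin 2) ℝ) τ := by
  rw [γ.sq, ModularGroup.denom_apply]

lemma φ_ne_zero (γ : Mp2Z) (τ : ℍ) : γ.φ τ ≠ 0 := by
  intro h
  have := γ.sq' τ
  rw [h] at this
  exact denom_ne_zero (γ.g : GL (Fin 2) ℝ) τ (by simpa using this.symm)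

lemma mdiff_smul (g : SL(2, ℤ)) : MDifferentiable 𝓘(ℂ) 𝓘(ℂ) (fun τ : ℍ => g • τ) := by
  have := mdifferentiable_smul (g := (g : GL (Fin 2) ℝ)) (by simp)
  exact this

lemma denom_mul' (g g' : SL(2, ℤ)) (τ : ℍ) :
    denom ((g * g' : SL(2, ℤ)) : GL (Fin 2) ℝ) τ =
      denom (g : GL (Fin 2) ℝ) (g' • τ : ℍ) * denom (g' : GL (Fin 2) ℝ) τ := by
  have := denom_cocycle_σ (g : GL (Fin 2) ℝ) (g' : GL (Fin 2) ℝ) τ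
  simpa [σ] using this

/-- `(g, φ)(g', φ') = (gg', φ(g'τ) φ'(τ))`. -/
instance : Mul Mp2Z where
  mul x y :=
    { g := x.g * y.g
      φ := fun τ => x.φ (y.g • τ) * y.φ τ
      hol := (x.hol.comp (mdiff_smul y.g)).mul y.hol
      sq := fun τ => by
        have := denom_mul' x.g y.g τ
        rw [mul_pow, sq', sq', ← this, ModularGroup.denom_apply] }

instance : One Mp2Z where
  one :=
    { g := 1
      φ := fun _ => 1
      hol := mdifferentiable_const
      sq := fun τ => by simp }

instance : Inv Mp2Z where
  inv x :=
    { g := x.g⁻¹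
      φ := fun τ => (x.φ (x.g⁻¹ • τ))⁻¹
      hol := by
        have h := x.hol.comp (mdiff_smul x.g⁻¹)
        rw [UpperHalfPlane.mdifferentiable_iff] at h ⊢
        exact h.inv fun w _ => x.φ_ne_zero _
      sq := fun τ => by
        have h1 := denom_mul' x.g x.g⁻¹ τ
        have h2 := x.sq' (x.g⁻¹ • τ)
        rw [mul_inv_cancel] at h1
        have h3 : denom ((1 : SL(2, ℤ)) : GL (Fin 2) ℝ) τ = 1 := by simp [denom]
        rw [h3, ← h2] at h1
        rw [← ModularGroup.denom_apply, inv_pow]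
        exact inv_eq_of_mul_eq_one_right h1.symm }

@[simp] lemma mul_g (x y : Mp2Z) : (x * y).g = x.g * y.g := rfl
@[simp] lemma mul_φ (x y : Mp2Z) (τ : ℍ) : (x * y).φ τ = x.φ (y.g • τ) * y.φ τ := rfl
@[simp] lemma one_g : (1 : Mp2Z).g = 1 := rfl
@[simp] lemma one_φ (τ : ℍ) : (1 : Mp2Z).φ τ = 1 := rfl
@[simp] lemma inv_g (x : Mp2Z) : (x⁻¹).g = x.g⁻¹ := rfl
@[simp] lemma inv_φ (x : Mp2Z) (τ : ℍ) : (x⁻¹).φ τ = (x.φ (x.g⁻¹ • τ))⁻¹ := rfl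

instance : Group Mp2Z where
  mul_assoc x y z := by
    ext1
    · simp [mul_assoc]
    · funext τ
      simp only [mul_φ, mul_g, mul_smul, mul_assoc]
  one_mul x := by
    ext1
    · simp
    · funext τ
      simp
  mul_one x := by
    ext1
    · simp
    · funext τ
      simp only [mul_φ, one_g, one_φ, one_smul, mul_one]
  inv_mul_cancel x := by
    ext1
    · simp
    · funext τ
      simp only [mul_φ, inv_φ, one_φ, inv_smul_smul]
      exact inv_mul_cancel₀ (x.φ_ne_zero τ)

/-- `T = ([[1, 1], [0, 1]], 1)`. -/
def T : Mp2Z where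
  g := ModularGroup.T
  φ := fun _ => 1
  hol := mdifferentiable_const
  sq := fun τ => by simp [ModularGroup.T]

/-- `S = ([[0, -1], [1, 0]], √τ)` with the principal branch of the square root. -/
def S : Mp2Z where
  g := ModularGroup.S
  φ := fun τ => (τ : ℂ) ^ (1 / 2 : ℂ)
  hol := by
    rw [UpperHalfPlane.mdifferentiable_iff]
    have h : DifferentiableOn ℂ (fun w : ℂ => w ^ (1 / 2 : ℂ)) {w | 0 < w.im} := by
      intro w hw
      refine (DifferentiableAt.cpow_const differentiableAt_id ?_).differentiableWithinAt
      exact Or.inr (ne_of_gt hw)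
    refine h.congr fun w hw => ?_
    simp [Function.comp, ofComplex_apply_of_im_pos hw]
  sq := fun τ => by
    rw [← Complex.cpow_nat_mul]
    simp [ModularGroup.S]

/-- `Γ̃_∞`, the group of all `T^n = ([[1, n], [0, 1]], 1)` with `n ∈ ℤ`. -/
def GammaInf : Subgroup Mp2Z := Subgroup.zpowers T

/-- The element of `Γ̃` spelled by a word in the letters `T` (for `0`) and `S` (for `1`). -/
def evalWord : FreeMonoid (Fin 2) →* Mp2Z := FreeMonoid.lift ![T, S]

lemma S_sq_g : (S * S).g = -1 := by
  change ModularGroup.S * ModularGroup.S = -1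
  decide

lemma eq_or_eq_of_g_eq {x y : Mp2Z} (h : x.g = y.g) : x.φ = y.φ ∨ x.φ = -y.φ := by
  have h0 : (x.φ - y.φ) * (x.φ + y.φ) = 0 := by
    funext τ
    have h1 := x.sq τ
    rw [h, ← y.sq τ] at h1
    simp only [Pi.mul_apply, Pi.sub_apply, Pi.add_apply, Pi.zero_apply]
    linear_combination h1
  rcases (UpperHalfPlane.mul_eq_zero_iff (x.hol.sub y.hol) (x.hol.add y.hol)).mp h0 with h1 | h1
  · exact Or.inl (sub_eq_zero.mp h1)
  · exact Or.inr (eq_neg_of_add_eq_zero_left h1)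

lemma S_sq_φ (τ : ℍ) : ((S * S).φ τ) ^ 2 = -1 := by
  rw [(S * S).sq, S_sq_g]; simp

lemma S_four : (S * S * (S * S)).g = 1 ∧ ∀ τ, (S * S * (S * S)).φ τ = -1 := by
  constructor
  · rw [mul_g, S_sq_g]; simp
  · intro τ
    rw [mul_φ, S_sq_g]
    have h : (-1 : SL(2, ℤ)) • τ = τ := by
      rw [ModularGroup.SL_neg_smul, one_smul]
    rw [h, ← pow_two, S_sq_φ]

/-- `Γ̃` is generated, even as a monoid, by `T` and `S`. -/
theorem evalWord_surjective : Function.Surjective evalWord := by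
  set M : Submonoid Mp2Z := MonoidHom.mrange evalWord with hM
  have hT : T ∈ M := ⟨FreeMonoid.of 0, by simp [evalWord]⟩
  have hS : S ∈ M := ⟨FreeMonoid.of 1, by simp [evalWord]⟩
  let pr : Mp2Z →* SL(2, ℤ) := { toFun := Mp2Z.g, map_one' := rfl, map_mul' := fun _ _ => rfl }
  have htop : M.map pr = ⊤ := by
    have h1 := congrArg Subgroup.toSubmonoid SpecialLinearGroup.SL2Z_generators
    rw [Subgroup.closure_toSubmonoid] at h1
    rw [eq_top_iff, ← Subgroup.top_toSubmonoid, ← h1, Submonoid.closure_le]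
    have hS' : ModularGroup.S ∈ M.map pr := ⟨S, hS, rfl⟩
    have hT' : ModularGroup.T ∈ M.map pr := ⟨T, hT, rfl⟩
    have hSi : ModularGroup.S⁻¹ ∈ M.map pr := by
      have : ModularGroup.S⁻¹ = ModularGroup.S * ModularGroup.S * ModularGroup.S := by
        decide
      rw [this]
      exact mul_mem (mul_mem hS' hS') hS'
    have hTi : ModularGroup.T⁻¹ ∈ M.map pr := by
      have : ModularGroup.T⁻¹ = ModularGroup.S⁻¹ * ModularGroup.T * ModularGroup.S *
          ModularGroup.T * ModularGroup.S := by
        decide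
      rw [this]
      exact mul_mem (mul_mem (mul_mem (mul_mem hSi hT') hS') hT') hS'
    rintro g (hg | hg)
    · rcases hg with rfl | rfl
      · exact hS'
      · exact hT'
    · rcases (Set.mem_inv.mp hg) with h | h
      · rw [inv_eq_iff_eq_inv.mp h]; exact hSi
      · rw [inv_eq_iff_eq_inv.mp h]; exact hTi
  intro γ
  obtain ⟨x, hx, hxg⟩ : γ.g ∈ M.map pr := htop ▸ Submonoid.mem_top _
  have hxg : x.g = γ.g := hxg
  rcases eq_or_eq_of_g_eq hxg with h | h
  · have : x = γ := Mp2Z.ext hxg h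
    exact this ▸ hx
  · have : x * (S * S * (S * S)) = γ := by
      refine Mp2Z.ext ?_ ?_
      · rw [mul_g, S_four.1, mul_one, hxg]
      · funext τ
        rw [mul_φ, S_four.1, S_four.2, one_smul, h]
        simp
    rw [← this]
    exact mul_mem hx (mul_mem (mul_mem hS hS) (mul_mem hS hS))

end Mp2Z

/-! ### The Weil representation of `K` and the slash operator -/

/-- `ρ_K(T) 𝔢_h = e(Q(h)) 𝔢_h`. -/
def weilT (N : ℕ) (l l' : V) : Matrix (DiscK N l l') (DiscK N l l') ℂ :=
  Matrix.diagonal fun h => e (Q N (repK N l l' h))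

/-- `ρ_K(S) 𝔢_h = e((b⁻ - b⁺)/8) |K'/K|^{-1/2} ∑_{h'} e(-(h, h')) 𝔢_{h'}`, where `K` has signature
`(b⁺, b⁻) = (1, 0)`. -/
def weilS (N : ℕ) [NeZero N] (l l' : V) : Matrix (DiscK N l l') (DiscK N l l') ℂ :=
  Matrix.of fun h' h =>
    e (-1 / 8) / ((√(Fintype.card (DiscK N l l')) : ℝ) : ℂ) *
      e (-(form N (repK N l l' h) (repK N l l' h') : ℂ))

/-- The product of the operators `ρ_K(T)`, `ρ_K(S)` along a word. -/
def weilWord (N : ℕ) [NeZero N] (l l' : V) :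
    FreeMonoid (Fin 2) →* Matrix (DiscK N l l') (DiscK N l l') ℂ :=
  FreeMonoid.lift ![weilT N l l', weilS N l l']

/-- The Weil representation `ρ_K` of `Γ̃` on `ℂ[K'/K]`, given by its values on the generators:
`ρ_K(γ)` is the product of `ρ_K(T)`, `ρ_K(S)` along a word in `T`, `S` that spells `γ`. As `ρ_K` is
a representation, all words that spell `γ` give the same operator. -/
def weilRep (N : ℕ) [NeZero N] (l l' : V) (γ : Mp2Z) : Matrix (DiscK N l l') (DiscK N l l') ℂ :=
  weilWord N l l' (Function.surjInv Mp2Z.evalWord_surjective γ)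

/-- The twisted Weil representation: `ρ_K` if `Δ > 0`, its complex conjugate if `Δ < 0`. -/
def weilRepTwisted (N : ℕ) [NeZero N] (D : ℤ) (l l' : V) (γ : Mp2Z) :
    Matrix (DiscK N l l') (DiscK N l l') ℂ :=
  if 0 < D then weilRep N l l' γ else (weilRep N l l' γ).map (starRingEnd ℂ)

/-- The slash operator `(f |_{κ,ρ̃} γ)(τ) = φ_γ(τ)^{-2κ} ρ̃(γ)^{-1} f(γτ)`, where `m = 2κ`. -/
def slash (N : ℕ) [NeZero N] (D : ℤ) (l l' : V) (m : ℤ) (f : ℍ → DiscK N l l' → ℂ) (γ : Mp2Z)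
    (τ : ℍ) : DiscK N l l' → ℂ :=
  γ.φ τ ^ (-m) • ((weilRepTwisted N D l l' γ)⁻¹ *ᵥ f (γ.g • τ))

/-- The function `τ ↦ e(-n² / (4|Δ| i Im(τ) Q_z(l))) Ξ_{k-1-j}(τ, μ_K, -n, 0)`. -/
def seed (N : ℕ) (D r : ℤ) (l l' : V) (z : ℍ) (k j n : ℕ) (τ : ℍ) : DiscK N l l' → ℂ :=
  e (-(n : ℂ) ^ 2 / (4 * (|D| : ℤ) * Complex.I * (τ.im : ℂ) * (Qz N z l : ℂ))) •
    Xi N D r l l' z (k - 1 - j) τ (muK N l l' z) (-n) 0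

/-- The summand `∑_j c_{z,k,j} (-n)^{1-j} [...]|_{k-3/2, ρ̃_K} γ` of the Poincaré series, where
`0 ≤ j ≤ min(k-1, 1)`. -/
def poincareTerm (N : ℕ) [NeZero N] (D r : ℤ) (l l' : V) (z : ℍ) (k n : ℕ) (γ : Mp2Z) (τ : ℍ) :
    DiscK N l l' → ℂ :=
  ∑ j ∈ Finset.range (min (k - 1) 1 + 1),
    (cConst N D l z k j * (-(n : ℂ)) ^ (1 - j)) •
      slash N D l l' (2 * (k : ℤ) - 3) (seed N D r l l' z k j n) γ τ

/-- `Γ̃_∞ \ Γ̃`. -/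
abbrev CosetSpace := Quotient (QuotientGroup.rightRel Mp2Z.GammaInf)

end ShimuraTheta

end

open ShimuraTheta UpperHalfPlane

/-! Since `l` and `l'` span a unimodular hyperbolic plane, every vector of `L'` is `x k + m l + n
l'` with integers `x`, `m`, `n`, where `k` generates `K'`. The weights have period `|Δ|` in `m`, and
Poisson summation in `m` replaces `m` by a dual variable `α`. The kernel `Θ_k` thereby becomes a
sum, over all pairs of integers `(n, α)`, of theta functions of the rank one lattice `K'`
(`tsum_thetaCoord`, `HypPair.Theta_eq`).

Attach to such a pair the row vector `u = (n, -α)` and call its contribution `latVec u`. The heart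
of the matter is that the group permutes these contributions: slashing `latVec u` by `γ` in weight
`k - 3/2` gives `latVec (u γ)` (`HypPair.slash_latVec`). The zero vector yields the term outside the
series. A nonzero vector is `-n (c, d)` with `n ≥ 1` and `(c, d)` coprime, hence is obtained from
`(0, -n)` by an element with bottom row `(c, d)`, and `latVec (0, -n)` is the sum over `j` of the
functions inside the bracket (`HypPair.sum_seed`). A coset of `Γ̃_∞` is a primitive row together
with one of two square roots, so each nonzero vector is met twice; this is the factor `1/2`
(`Mp2Z.cosetEquiv`).

The permutation law is checked on `T` and `S`. For `T` it is the congruence that defines the index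
sets. For `S` it is Poisson summation on `K'`, and it needs that the finite Fourier transform along
`K'` of the weights, already transformed in the direction of `l`, exchanges the two coordinates of
the hyperbolic plane (`fourier_wgtF`). This follows from the Fourier transform over `L'/ΔL` of `χ_Δ`
restricted to the index sets (`fourier_phi`).

That transform is the arithmetic part. Write `Δ = r² - 4Nm` and `b = r h + 2 N j`. Then `(a, h, j,
c)` are the coefficients of a binary Hermitian form over the quadratic order of discriminant `Δ`,
with determinant divisible by `Δ`, and `χ_Δ` is the character `(Δ / ·)` of any value of that form
prime to `Δ` (`genusCharCoeff_eq_chi`). Shears carry each vector of the support to `(0, 0, 0, c)`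
and commute with the Fourier transform; at `(0, 0, 0, c)` the transform is a Gauss sum
(`psiHat_eq`). Off the support nothing has to be computed: by Parseval no mass is left there
(`fourier_eq_of_eq_on_support`).

Two devices keep the analysis uniform. Heat polynomials contain the powers and the Hermite
polynomials and are stable under the Fourier transform of Gaussians (`integral_heatPoly_gauss`). The
sign of the Gauss sum is extracted from the same transformation laws at level one, through the
relations between `S` and `T` (`gauss_eq`). -/

noncomputable section

namespace ShimuraTheta

open UpperHalfPlane Matrix MatrixGroups Manifold

/-! ### Heat polynomials and Gaussian integrals -/

/-- The heat polynomials, with generating function `exp (X s + t s²)`. -/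
def heatPoly (t : ℂ) : ℕ → ℂ → ℂ
  | 0, _ => 1
  | 1, X => X
  | n + 2, X => X * heatPoly t (n + 1) X + 2 * t * (n + 1) * heatPoly t n X

@[simp] lemma heatPoly_zero (t X : ℂ) : heatPoly t 0 X = 1 := rfl

lemma heatPoly_succ (t : ℂ) (n : ℕ) (X : ℂ) :
    heatPoly t (n + 1) X = X * heatPoly t n X + 2 * t * n * heatPoly t (n - 1) X := by
  cases n with
  | zero => simp [heatPoly]
  | succ n => simp [heatPoly]

/-- The Appell property: differentiating `exp (X s + t s²)` in `X` multiplies it by `s`. At `n = 0`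
the truncated index is harmless because of the factor `n`. -/
lemma hasDerivAt_heatPoly (t : ℂ) (n : ℕ) (X : ℂ) :
    HasDerivAt (heatPoly t n) (n * heatPoly t (n - 1) X) X := by
  induction n using Nat.strong_induction_on generalizing X with
  | _ n ih =>
    match n with
    | 0 =>
      simp only [Nat.cast_zero, zero_mul]
      exact hasDerivAt_const X (1 : ℂ)
    | 1 =>
      simp only [Nat.cast_one, one_mul, Nat.sub_self, heatPoly_zero]
      exact hasDerivAt_id X
    | n + 2 =>
      have h1 := ih (n + 1) (by omega) X
      have h2 := ih n (by omega) X
      have h := ((hasDerivAt_id X).mul h1).add (h2.const_mul (2 * t * (n + 1)))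
      refine h.congr_deriv ?_
      have h3 := heatPoly_succ t n X
      simp only [id, Nat.add_sub_cancel, Nat.cast_add, Nat.cast_one, Nat.cast_ofNat,
        show n + 2 - 1 = n + 1 from rfl]
      rw [h3]; ring

/-- Replace `s` by `c s` in the generating function. This homogeneity later produces the powers of
`τ`, of `i` and of `√v`. -/
lemma heatPoly_mul (c t : ℂ) (n : ℕ) (X : ℂ) :
    heatPoly (c ^ 2 * t) n (c * X) = c ^ n * heatPoly t n X := by
  induction n using Nat.strong_induction_on with
  | _ n ih =>
    match n with
    | 0 => simp
    | 1 => simp [heatPoly]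
    | n + 2 =>
      simp only [heatPoly]
      rw [ih (n + 1) (by omega), ih n (by omega)]
      ring

/-- The Hermite polynomials have generating function `exp (2 x s - s²)`, the case `t = -1`, `X = 2
x`. -/
lemma hermiteH_eq_heatPoly (n : ℕ) (x : ℂ) : hermiteH n x = heatPoly (-1) n (2 * x) := by
  have key : ∀ n : ℕ, iteratedDeriv n (fun w : ℂ => Complex.exp (-w ^ 2)) =
      fun w => (-1) ^ n * heatPoly (-1) n (2 * w) * Complex.exp (-w ^ 2) := by
    intro n
    induction n with
    | zero => funext w; simp
    | succ n ih =>
      rw [iteratedDeriv_succ, ih]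
      funext w
      have h1 : HasDerivAt (fun w : ℂ => heatPoly (-1) n (2 * w))
          (n * heatPoly (-1) (n - 1) (2 * w) * 2) w :=
        (hasDerivAt_heatPoly (-1) n (2 * w)).comp w
          (by simpa using (hasDerivAt_id w).const_mul (2 : ℂ))
      have h2 : HasDerivAt (fun w : ℂ => Complex.exp (-w ^ 2))
          (Complex.exp (-w ^ 2) * (-(2 * w))) w := by
        have := ((hasDerivAt_pow 2 w).neg).cexp
        simpa using this
      refine ((h1.const_mul ((-1) ^ n)).mul h2).deriv.trans ?_
      rw [heatPoly_succ]
      ring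
  rw [hermiteH, key]
  have h2 : Complex.exp (x ^ 2) * Complex.exp (-x ^ 2) = 1 := by
    rw [← Complex.exp_add]; simp
  have h3 : ((-1 : ℂ) ^ n) * (-1) ^ n = 1 := by rw [← mul_pow]; simp
  linear_combination heatPoly (-1) n (2 * x) * (Complex.exp (x ^ 2) * Complex.exp (-x ^ 2)) * h3 +
    heatPoly (-1) n (2 * x) * h2

lemma exists_norm_heatPoly_le (t : ℂ) (n : ℕ) :
    ∃ C : ℝ, 0 ≤ C ∧ ∀ X : ℂ, ‖heatPoly t n X‖ ≤ C * (1 + ‖X‖) ^ n := by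
  induction n using Nat.strong_induction_on with
  | _ n ih =>
    match n with
    | 0 => exact ⟨1, by simp, fun X => by simp⟩
    | 1 => exact ⟨1, by simp, fun X => by simp [heatPoly]⟩
    | n + 2 =>
      obtain ⟨C₁, h₁, H₁⟩ := ih (n + 1) (by omega)
      obtain ⟨C₂, h₂, H₂⟩ := ih n (by omega)
      refine ⟨C₁ + ‖2 * t * (n + 1)‖ * C₂, by positivity, fun X => ?_⟩
      have hX : 0 ≤ ‖X‖ := norm_nonneg X
      have e1 : ‖X * heatPoly t (n + 1) X‖ ≤ C₁ * (1 + ‖X‖) ^ (n + 2) := by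
        rw [norm_mul]
        calc ‖X‖ * ‖heatPoly t (n + 1) X‖ ≤ (1 + ‖X‖) * (C₁ * (1 + ‖X‖) ^ (n + 1)) := by
              gcongr
              · linarith
              · exact H₁ X
          _ = _ := by ring
      have e2 : ‖2 * t * (n + 1) * heatPoly t n X‖ ≤
          ‖2 * t * (n + 1)‖ * C₂ * (1 + ‖X‖) ^ (n + 2) := by
        rw [norm_mul, mul_assoc ‖2 * t * (n + 1)‖]
        refine mul_le_mul_of_nonneg_left ((H₂ X).trans ?_) (norm_nonneg _)
        gcongr
        · linarith
        · omega
      calc ‖heatPoly t (n + 2) X‖ ≤ _ := norm_add_le _ _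
        _ ≤ _ := add_le_add e1 e2
        _ = _ := by ring

lemma continuous_heatPoly (t : ℂ) (n : ℕ) : Continuous (heatPoly t n) :=
  continuous_iff_continuousAt.mpr fun X => (hasDerivAt_heatPoly t n X).continuousAt

open Asymptotics Filter in
lemma heatPoly_gauss_isBigO {a : ℂ} (ha : 0 < a.re) (t α β γ : ℂ) (n : ℕ) :
    (fun x : ℝ => heatPoly t n (α * x + β) * Complex.exp (-Real.pi * a * x ^ 2 + γ * x))
      =O[cocompact ℝ] fun x => |x| ^ (-2 : ℝ) := by
  obtain ⟨C, hC, hb⟩ := exists_norm_heatPoly_le t n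
  have h1 : (fun x : ℝ => heatPoly t n (α * x + β)) =O[cocompact ℝ] fun x => |x| ^ (n : ℝ) := by
    refine IsBigO.of_bound (C * (1 + ‖α‖ + ‖β‖) ^ n) ?_
    have : ∀ᶠ x : ℝ in cocompact ℝ, 1 ≤ ‖x‖ := tendsto_norm_cocompact_atTop.eventually_ge_atTop 1
    filter_upwards [this] with x hx
    refine (hb _).trans ?_
    rw [Real.rpow_natCast, norm_pow, norm_abs_eq_norm, mul_assoc, ← mul_pow]
    have h2 : ‖α * x + β‖ ≤ ‖α‖ * ‖x‖ + ‖β‖ := by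
      refine (norm_add_le _ _).trans ?_
      rw [norm_mul, Complex.norm_real]
    have h3 : 0 ≤ ‖β‖ := norm_nonneg _
    have h4 : 0 ≤ ‖α‖ := norm_nonneg _
    gcongr
    nlinarith
  have h2 := cexp_neg_quadratic_isLittleO_abs_rpow_cocompact (a := -Real.pi * a)
    (by simpa using mul_pos Real.pi_pos ha) γ (-2 - n)
  refine (h1.mul h2.isBigO).trans ?_
  refine IsBigO.of_bound 1 ?_
  have : ∀ᶠ x : ℝ in cocompact ℝ, 1 ≤ ‖x‖ := tendsto_norm_cocompact_atTop.eventually_ge_atTop 1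
  filter_upwards [this] with x hx
  rw [Real.norm_eq_abs] at hx
  rw [← Real.rpow_add (by linarith)]
  simp

lemma continuous_heatPoly_gauss (a t α β γ : ℂ) (n : ℕ) :
    Continuous fun x : ℝ =>
      heatPoly t n (α * x + β) * Complex.exp (-Real.pi * a * x ^ 2 + γ * x) := by
  have := continuous_heatPoly t n
  fun_prop

lemma integrable_heatPoly_gauss {a : ℂ} (ha : 0 < a.re) (t α β γ : ℂ) (n : ℕ) :
    MeasureTheory.Integrable fun x : ℝ =>
      heatPoly t n (α * x + β) * Complex.exp (-Real.pi * a * x ^ 2 + γ * x) := by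
  refine (continuous_heatPoly_gauss a t α β γ n).locallyIntegrable.integrable_of_isBigO_cocompact
    (g := fun x : ℝ => (1 + x ^ 2)⁻¹) ((heatPoly_gauss_isBigO ha t α β γ n).trans ?_)
    (integrable_inv_one_add_sq.integrableAtFilter _)
  refine Asymptotics.IsBigO.of_bound 2 ?_
  have : ∀ᶠ x : ℝ in Filter.cocompact ℝ, 1 ≤ ‖x‖ :=
    tendsto_norm_cocompact_atTop.eventually_ge_atTop 1
  filter_upwards [this] with x hx
  rw [Real.norm_eq_abs] at hx
  have hx2 : 1 ≤ x ^ 2 := by rw [← sq_abs]; nlinarith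
  rw [Real.rpow_neg (abs_nonneg x), Real.rpow_two, sq_abs, Real.norm_of_nonneg (by positivity),
    Real.norm_of_nonneg (by positivity), inv_eq_one_div, inv_eq_one_div, mul_one_div,
    div_le_div_iff₀ (by positivity) (by positivity)]
  linarith

/-- The Fourier–Laplace transform of a heat polynomial times a Gaussian. -/
lemma integral_heatPoly_gauss {a : ℂ} (ha : 0 < a.re) (t α β γ : ℂ) (n : ℕ) :
    ∫ x : ℝ, heatPoly t n (α * x + β) * Complex.exp (-Real.pi * a * x ^ 2 + γ * x) =
      (1 / a ^ (1 / 2 : ℂ)) * Complex.exp (γ ^ 2 / (4 * Real.pi * a)) *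
        heatPoly (t + α ^ 2 / (4 * Real.pi * a)) n (β + α * γ / (2 * Real.pi * a)) := by
  have ha0 : a ≠ 0 := fun h => by simp [h] at ha
  have hpi : (Real.pi : ℂ) ≠ 0 := by exact_mod_cast Real.pi_ne_zero
  induction n using Nat.strong_induction_on with
  | _ n ih =>
    match n with
    | 0 =>
      simp only [heatPoly_zero, one_mul, mul_one]
      have h := integral_cexp_quadratic (b := -Real.pi * a)
        (by simpa using mul_pos Real.pi_pos ha) γ 0
      simp only [add_zero, zero_sub] at h
      rw [h, show (Real.pi : ℂ) / -(-Real.pi * a) = a⁻¹ by field_simp,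
        Complex.inv_cpow _ _ ?_]
      · rw [one_div (a ^ (1 / 2 : ℂ))]
        congr 2
        field_simp
      · intro h
        rw [Complex.arg_eq_pi_iff] at h
        linarith [h.1]
    | n + 1 =>
      -- Integration by parts: the derivative of `p n * E` has integral zero, which expresses the
      -- integral of `α x p n E` through those for `n` and `n - 1`. The recursion for `heatPoly`
      -- then gives degree `n + 1`.
      set E : ℝ → ℂ := fun x => Complex.exp (-Real.pi * a * x ^ 2 + γ * x) with hE
      set p : ℕ → ℝ → ℂ := fun k x => heatPoly t k (α * x + β) with hp
      have hi : ∀ k, MeasureTheory.Integrable fun x => p k x * E x := fun k =>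
        integrable_heatPoly_gauss ha t α β γ k
      have hder : ∀ x : ℝ, HasDerivAt (fun x : ℝ => p n x * E x)
          (α * n * (p (n - 1) x * E x) + γ * (p n x * E x) -
            2 * Real.pi * a * (x * (p n x * E x))) x := by
        intro x
        have h1 : HasDerivAt (fun w : ℂ => heatPoly t n (α * w + β))
            (n * heatPoly t (n - 1) (α * x + β) * α) (x : ℂ) :=
          (hasDerivAt_heatPoly t n (α * x + β)).comp (x : ℂ)
            (by simpa using ((hasDerivAt_id (x : ℂ)).const_mul α).add_const β)
        have h2 : HasDerivAt (fun w : ℂ => Complex.exp (-Real.pi * a * w ^ 2 + γ * w))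
            (Complex.exp (-Real.pi * a * (x : ℂ) ^ 2 + γ * x) *
              (-Real.pi * a * (2 * x) + γ)) (x : ℂ) := by
          have := (((hasDerivAt_pow 2 (x : ℂ)).const_mul (-Real.pi * a)).add
            ((hasDerivAt_id (x : ℂ)).const_mul γ)).cexp
          simpa using this
        refine ((h1.mul h2).comp_ofReal).congr_deriv ?_
        simp only [hp, hE]
        ring
      have hrec : ∀ x, α * (x * (p n x * E x)) =
          p (n + 1) x * E x - β * (p n x * E x) - 2 * t * n * (p (n - 1) x * E x) := by
        intro x
        have := heatPoly_succ t n (α * x + β)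
        simp only [hp]
        rw [this]; ring
      -- The factor `α` stays with `x`: the product is a combination of integrable terms even when
      -- `α = 0`, and no division by `α` occurs.
      have hxi : MeasureTheory.Integrable fun x : ℝ => α * (x * (p n x * E x)) := by
        simp_rw [hrec]
        exact ((hi (n + 1)).sub ((hi n).const_mul β)).sub ((hi (n - 1)).const_mul _)
      have hd' : ∀ x : ℝ, HasDerivAt (fun x : ℝ => α * (p n x * E x))
          (α * (α * n) * (p (n - 1) x * E x) + α * γ * (p n x * E x) -
            2 * Real.pi * a * (α * (x * (p n x * E x)))) x := by
        intro x
        refine ((hder x).const_mul α).congr_deriv ?_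
        ring
      have i1 := (hi (n - 1)).const_mul (α * (α * n))
      have i2 := (hi n).const_mul (α * γ)
      have i3 := hxi.const_mul (2 * Real.pi * a)
      have h0 := MeasureTheory.integral_eq_zero_of_hasDerivAt_of_integrable hd'
        ((i1.add i2).sub i3) ((hi n).const_mul α)
      have h1 : ∫ x, p (n + 1) x * E x = ∫ x, (α * (x * (p n x * E x)) +
          β * (p n x * E x) + 2 * t * n * (p (n - 1) x * E x)) := by
        congr 1; funext x; rw [hrec]; ring
      have h2 : ∫ x, (α * (α * n) * (p (n - 1) x * E x) + α * γ * (p n x * E x) -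
            2 * Real.pi * a * (α * (x * (p n x * E x)))) =
          α * (α * n) * (∫ x, p (n - 1) x * E x) + α * γ * (∫ x, p n x * E x) -
            2 * Real.pi * a * ∫ x : ℝ, α * (x * (p n x * E x)) := by
        refine (MeasureTheory.integral_sub (i1.add i2) i3).trans ?_
        refine (congrArg (· - _) (MeasureTheory.integral_add i1 i2)).trans ?_
        simp_rw [MeasureTheory.integral_const_mul]
      have h3 : ∫ x, (α * (x * (p n x * E x)) +
          β * (p n x * E x) + 2 * t * n * (p (n - 1) x * E x)) =
          (∫ x : ℝ, α * (x * (p n x * E x))) + β * (∫ x, p n x * E x) +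
            2 * t * n * ∫ x, p (n - 1) x * E x := by
        refine (MeasureTheory.integral_add (hxi.add ((hi n).const_mul β))
          ((hi (n - 1)).const_mul _)).trans ?_
        refine (congrArg (· + _) (MeasureTheory.integral_add hxi ((hi n).const_mul β))).trans ?_
        simp_rw [MeasureTheory.integral_const_mul]
      rw [h2] at h0
      rw [h1, h3, heatPoly_succ]
      have e1 := ih n (by omega)
      -- The factor `n` is kept because for `n = 0` the index `n - 1` is truncated; both sides then
      -- vanish.
      have e2 : (n : ℂ) * ∫ x, p (n - 1) x * E x = n * ((1 / a ^ (1 / 2 : ℂ)) *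
          Complex.exp (γ ^ 2 / (4 * Real.pi * a)) *
        heatPoly (t + α ^ 2 / (4 * Real.pi * a)) (n - 1) (β + α * γ / (2 * Real.pi * a))) := by
        rcases n with _ | n
        · simp
        · rw [ih (n + 1 - 1) (by omega)]
      set I0 := ∫ x : ℝ, α * (x * (p n x * E x))
      set I1 := ∫ x, p n x * E x
      set I2 := ∫ x, p (n - 1) x * E x
      have hI0 : I0 = (α * α * (n * I2) + α * γ * I1) / (2 * Real.pi * a) := by
        field_simp
        linear_combination -h0
      rw [show 2 * t * n * I2 = 2 * t * (n * I2) by ring, hI0, e2, e1]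
      field_simp
      ring

open Real in
lemma fourier_heatPoly_gauss {a : ℂ} (ha : 0 < a.re) (t α β γ : ℂ) (n : ℕ) (ξ : ℝ) :
    FourierTransform.fourier (fun x : ℝ =>
      heatPoly t n (α * x + β) * Complex.exp (-Real.pi * a * x ^ 2 + γ * x)) ξ =
      (1 / a ^ (1 / 2 : ℂ)) *
        Complex.exp ((γ - 2 * Real.pi * Complex.I * ξ) ^ 2 / (4 * Real.pi * a)) *
        heatPoly (t + α ^ 2 / (4 * Real.pi * a)) n
          (β + α * (γ - 2 * Real.pi * Complex.I * ξ) / (2 * Real.pi * a)) := by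
  rw [← integral_heatPoly_gauss ha, Real.fourier_real_eq_integral_exp_smul]
  congr 1
  funext x
  rw [smul_eq_mul, mul_left_comm, ← Complex.exp_add]
  congr 2
  push_cast
  ring

/-- Poisson summation for a heat polynomial times a Gaussian. -/
lemma tsum_heatPoly_gauss {a : ℂ} (ha : 0 < a.re) (t α β γ : ℂ) (n : ℕ) :
    ∑' m : ℤ, heatPoly t n (α * m + β) * Complex.exp (-Real.pi * a * m ^ 2 + γ * m) =
      ∑' k : ℤ, (1 / a ^ (1 / 2 : ℂ)) *
        Complex.exp ((γ - 2 * Real.pi * Complex.I * k) ^ 2 / (4 * Real.pi * a)) *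
        heatPoly (t + α ^ 2 / (4 * Real.pi * a)) n
          (β + α * (γ - 2 * Real.pi * Complex.I * k) / (2 * Real.pi * a)) := by
  have ha0 : a ≠ 0 := fun h => by simp [h] at ha
  have hpi : (Real.pi : ℂ) ≠ 0 := by exact_mod_cast Real.pi_ne_zero
  have hinv : 0 < (a⁻¹).re := by
    rw [Complex.inv_re]
    exact div_pos ha (Complex.normSq_pos.mpr ha0)
  set f : ℝ → ℂ := fun x =>
    heatPoly t n (α * x + β) * Complex.exp (-Real.pi * a * x ^ 2 + γ * x) with hf
  -- The transform is again a heat polynomial times a Gaussian, now with parameter `a⁻¹`, so the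
  -- decay required by Poisson summation is the same lemma as for `f`.
  have hF : FourierTransform.fourier f = fun ξ : ℝ => ((1 / a ^ (1 / 2 : ℂ)) *
        Complex.exp (γ ^ 2 / (4 * Real.pi * a))) *
        (heatPoly (t + α ^ 2 / (4 * Real.pi * a)) n
          (-(Complex.I * α / a) * ξ + (β + α * γ / (2 * Real.pi * a))) *
        Complex.exp (-Real.pi * a⁻¹ * ξ ^ 2 + -(Complex.I * γ / a) * ξ)) := by
    funext ξ
    rw [fourier_heatPoly_gauss ha]
    have h1 : (γ - 2 * Real.pi * Complex.I * ξ) ^ 2 / (4 * Real.pi * a) =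
        γ ^ 2 / (4 * Real.pi * a) + (-Real.pi * a⁻¹ * ξ ^ 2 + -(Complex.I * γ / a) * ξ) := by
      field_simp
      ring_nf
      rw [Complex.I_sq]
      ring
    have h2 : β + α * (γ - 2 * Real.pi * Complex.I * ξ) / (2 * Real.pi * a) =
        -(Complex.I * α / a) * ξ + (β + α * γ / (2 * Real.pi * a)) := by
      field_simp
      ring
    rw [h1, h2, Complex.exp_add]
    ring
  have h := Real.tsum_eq_tsum_fourier_of_rpow_decay
    (f := f) (continuous_heatPoly_gauss a t α β γ n) one_lt_two
    (heatPoly_gauss_isBigO ha t α β γ n)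
    (by rw [hF]; exact (heatPoly_gauss_isBigO hinv _ _ _ _ n).const_mul_left _) 0
  calc _ = ∑' m : ℤ, f (0 + m) := by simp [hf]
    _ = _ := h
    _ = _ := by
      refine tsum_congr fun k => ?_
      have h0 : (fourier k ((0 : ℝ) : UnitAddCircle) : ℂ) = 1 := by simp
      rw [h0, mul_one, hf, fourier_heatPoly_gauss ha]
      push_cast
      rfl

lemma summable_heatPoly_gauss {a : ℂ} (ha : 0 < a.re) (t α β γ : ℂ) (n : ℕ) :
    Summable fun m : ℤ =>
      heatPoly t n (α * m + β) * Complex.exp (-Real.pi * a * m ^ 2 + γ * m) := by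
  have := summable_of_isBigO (Real.summable_abs_int_rpow one_lt_two)
    ((heatPoly_gauss_isBigO ha t α β γ n).comp_tendsto Int.tendsto_coe_cofinite)
  simpa [Function.comp_def] using this

lemma summable_heatPoly_gauss_dual {a : ℂ} (ha : 0 < a.re) (t α β γ : ℂ) (n : ℕ) :
    Summable fun k : ℤ => (1 / a ^ (1 / 2 : ℂ)) *
        Complex.exp ((γ - 2 * Real.pi * Complex.I * k) ^ 2 / (4 * Real.pi * a)) *
        heatPoly t n (β + α * (γ - 2 * Real.pi * Complex.I * k) / (2 * Real.pi * a)) := by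
  have ha0 : a ≠ 0 := fun h => by simp [h] at ha
  have hpi : (Real.pi : ℂ) ≠ 0 := by exact_mod_cast Real.pi_ne_zero
  have hinv : 0 < (a⁻¹).re := by
    rw [Complex.inv_re]
    exact div_pos ha (Complex.normSq_pos.mpr ha0)
  refine ((summable_heatPoly_gauss hinv t (-(Complex.I * α / a)) (β + α * γ / (2 * Real.pi * a))
    (-(Complex.I * γ / a)) n).mul_left ((1 / a ^ (1 / 2 : ℂ)) *
        Complex.exp (γ ^ 2 / (4 * Real.pi * a)))).congr fun k => ?_
  have h1 : (γ - 2 * Real.pi * Complex.I * k) ^ 2 / (4 * Real.pi * a) =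
      γ ^ 2 / (4 * Real.pi * a) + (-Real.pi * a⁻¹ * k ^ 2 + -(Complex.I * γ / a) * k) := by
    field_simp
    ring_nf
    rw [Complex.I_sq]
    ring
  have h2 : β + α * (γ - 2 * Real.pi * Complex.I * k) / (2 * Real.pi * a) =
      -(Complex.I * α / a) * k + (β + α * γ / (2 * Real.pi * a)) := by
    field_simp
    ring
  rw [h1, h2, Complex.exp_add (γ ^ 2 / (4 * Real.pi * a))]
  ring

lemma periodic_add_mul {c : ℤ → ℂ} {M : ℕ} (hc : ∀ m, c (m + M) = c m) (m q : ℤ) :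
    c (q * M + m) = c m := by
  have : Function.Periodic c (M : ℤ) := hc
  simpa [add_comm] using this.int_mul q m

lemma exists_norm_le_of_periodic {c : ℤ → ℂ} {M : ℕ} [NeZero M] (hc : ∀ m, c (m + M) = c m) :
    ∃ C : ℝ, ∀ m, ‖c m‖ ≤ C := by
  refine ⟨∑ s ∈ Finset.range M, ‖c s‖, fun m => ?_⟩
  have hM : (0 : ℤ) < M := by exact_mod_cast Nat.pos_of_neZero M
  have h0 := Int.emod_nonneg m hM.ne'
  have h1 := Int.emod_lt_of_pos m hM
  have h2 : c m = c ((m % M).toNat : ℕ) := by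
    rw [Int.toNat_of_nonneg h0]
    conv_lhs => rw [← Int.ediv_mul_add_emod m M]
    exact periodic_add_mul hc _ _
  rw [h2]
  exact Finset.single_le_sum (f := fun s : ℕ => ‖c s‖) (fun _ _ => norm_nonneg _)
    (Finset.mem_range.mpr (by omega))

lemma ofReal_mul_cpow_half {r : ℝ} (hr : 0 < r) {a : ℂ} (ha : a ≠ 0) :
    ((r : ℂ) * a) ^ (1 / 2 : ℂ) = (√r : ℝ) * a ^ (1 / 2 : ℂ) := by
  have hr' : (r : ℂ) ≠ 0 := by exact_mod_cast hr.ne'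
  rw [Complex.cpow_def_of_ne_zero (mul_ne_zero hr' ha), Complex.cpow_def_of_ne_zero ha,
    Complex.log_ofReal_mul hr ha, add_mul, Complex.exp_add, Real.sqrt_eq_rpow,
    Complex.ofReal_cpow hr.le, Complex.cpow_def_of_ne_zero hr', Complex.ofReal_log hr.le]
  push_cast
  rfl

lemma cpow_half_mul_sq {a : ℂ} (ha : a ≠ 0) {M : ℕ} (hM : M ≠ 0) :
    (a * M ^ 2) ^ (1 / 2 : ℂ) = a ^ (1 / 2 : ℂ) * M := by
  have h : a * (M : ℂ) ^ 2 = (((M : ℝ) ^ 2 : ℝ) : ℂ) * a := by push_cast; ring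
  have hM' : (0 : ℝ) < M := by exact_mod_cast Nat.pos_of_ne_zero hM
  rw [h, ofReal_mul_cpow_half (by positivity) ha, Real.sqrt_sq hM'.le]
  push_cast; ring

/-- Poisson summation for a heat polynomial times a Gaussian with periodic weights. -/
theorem tsum_periodic_heatPoly_gauss {a : ℂ} (ha : 0 < a.re) (t α β γ : ℂ) (n : ℕ)
    (M : ℕ) [NeZero M] (c : ℤ → ℂ) (hc : ∀ m, c (m + M) = c m) :
    ∑' m : ℤ, c m * (heatPoly t n (α * m + β) * Complex.exp (-Real.pi * a * m ^ 2 + γ * m)) =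
      ∑' k : ℤ, ((1 / M : ℂ) * ∑ s ∈ Finset.range M, c s * e (k * s / M)) *
        ((1 / a ^ (1 / 2 : ℂ)) *
        Complex.exp ((γ - 2 * Real.pi * Complex.I * (k / M)) ^ 2 / (4 * Real.pi * a)) *
        heatPoly (t + α ^ 2 / (4 * Real.pi * a)) n
          (β + α * (γ - 2 * Real.pi * Complex.I * (k / M)) / (2 * Real.pi * a))) := by
  have ha0 : a ≠ 0 := fun h => by simp [h] at ha
  have hpi : (Real.pi : ℂ) ≠ 0 := by exact_mod_cast Real.pi_ne_zero
  have hM : (M : ℂ) ≠ 0 := by exact_mod_cast NeZero.ne M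
  have hMr : (0 : ℝ) < M := by exact_mod_cast Nat.pos_of_neZero M
  have haM : 0 < (a * M ^ 2).re := by
    have : (a * M ^ 2) = ((M ^ 2 : ℝ) : ℂ) * a := by push_cast; ring
    rw [this, Complex.re_ofReal_mul]; positivity
  obtain ⟨C, hC⟩ := exists_norm_le_of_periodic hc
  set f : ℤ → ℂ := fun m => c m * (heatPoly t n (α * m + β) *
    Complex.exp (-Real.pi * a * m ^ 2 + γ * m)) with hf
  have hs : Summable f := by
    refine Summable.of_norm_bounded (((summable_heatPoly_gauss ha t α β γ n).norm).mul_left C)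
      fun m => ?_
    rw [hf, norm_mul]
    exact mul_le_mul_of_nonneg_right (hC m) (norm_nonneg _)
  set g : ℕ → ℤ → ℂ := fun s k => c s * e (k * s / M) * ((1 / M : ℂ) * ((1 / a ^ (1 / 2 : ℂ)) *
        Complex.exp ((γ - 2 * Real.pi * Complex.I * (k / M)) ^ 2 / (4 * Real.pi * a)) *
        heatPoly (t + α ^ 2 / (4 * Real.pi * a)) n
          (β + α * (γ - 2 * Real.pi * Complex.I * (k / M)) / (2 * Real.pi * a)))) with hg
  -- The terms `m = q M + s` form a Gaussian sum over `q` with parameter `a M²`. Its Poisson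
  -- transform at `k` is `e(k s / M) / M` times the transform of the original Gaussian at `k / M`.
  have hterm : ∀ (s : ℕ) (k : ℤ), c s * Complex.exp (-Real.pi * a * s ^ 2 + γ * s) *
      ((1 / (a * M ^ 2) ^ (1 / 2 : ℂ)) *
        Complex.exp (((γ * M - 2 * Real.pi * a * M * s) - 2 * Real.pi * Complex.I * k) ^ 2 /
          (4 * Real.pi * (a * M ^ 2))) *
        heatPoly (t + (α * M) ^ 2 / (4 * Real.pi * (a * M ^ 2))) n
          ((α * s + β) + (α * M) * ((γ * M - 2 * Real.pi * a * M * s) -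
            2 * Real.pi * Complex.I * k) / (2 * Real.pi * (a * M ^ 2)))) = g s k := by
    intro s k
    have h1 : t + (α * M) ^ 2 / (4 * Real.pi * (a * M ^ 2)) = t + α ^ 2 / (4 * Real.pi * a) := by
      field_simp
    have h2 : (α * s + β) + (α * M) * ((γ * M - 2 * Real.pi * a * M * s) -
            2 * Real.pi * Complex.I * k) / (2 * Real.pi * (a * M ^ 2)) =
        β + α * (γ - 2 * Real.pi * Complex.I * (k / M)) / (2 * Real.pi * a) := by
      field_simp
      ring
    have h3 : Complex.exp (-Real.pi * a * s ^ 2 + γ * s) *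
        Complex.exp (((γ * M - 2 * Real.pi * a * M * s) - 2 * Real.pi * Complex.I * k) ^ 2 /
          (4 * Real.pi * (a * M ^ 2))) = e (k * s / M) *
        Complex.exp ((γ - 2 * Real.pi * Complex.I * (k / M)) ^ 2 / (4 * Real.pi * a)) := by
      rw [e, ← Complex.exp_add, ← Complex.exp_add]
      congr 1
      field_simp
      ring
    rw [h1, h2, cpow_half_mul_sq ha0 (NeZero.ne M), hg]
    simp only
    rw [show (1 : ℂ) / (a ^ (1 / 2 : ℂ) * M) = (1 / M) * (1 / a ^ (1 / 2 : ℂ)) by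
      rw [one_div_mul_one_div, mul_comm]]
    linear_combination (c s * ((1 / M) * (1 / a ^ (1 / 2 : ℂ))) *
      heatPoly (t + α ^ 2 / (4 * Real.pi * a)) n
          (β + α * (γ - 2 * Real.pi * Complex.I * (k / M)) / (2 * Real.pi * a))) * h3
  have hgs : ∀ s, Summable (g s) := by
    intro s
    refine ((summable_heatPoly_gauss_dual haM (t + (α * M) ^ 2 / (4 * Real.pi * (a * M ^ 2)))
      (α * M) (α * s + β) (γ * M - 2 * Real.pi * a * M * s) n).mul_left
      (c s * Complex.exp (-Real.pi * a * s ^ 2 + γ * s))).congr fun k => hterm s k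
  have hres : ∀ s : ℕ, ∑' q : ℤ, f (q * M + s) = ∑' k : ℤ, g s k := by
    intro s
    calc ∑' q : ℤ, f (q * M + s) = ∑' q : ℤ, c s * Complex.exp (-Real.pi * a * s ^ 2 + γ * s) *
          (heatPoly t n ((α * M) * q + (α * s + β)) *
            Complex.exp (-Real.pi * (a * M ^ 2) * q ^ 2 +
              (γ * M - 2 * Real.pi * a * M * s) * q)) := by
          refine tsum_congr fun q => ?_
          rw [hf]
          simp only
          rw [periodic_add_mul hc]
          have h4 : α * ((q * M + s : ℤ) : ℂ) + β = (α * M) * q + (α * s + β) := by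
            push_cast; ring
          have h5 : Complex.exp (-Real.pi * a * ((q * M + s : ℤ) : ℂ) ^ 2 +
              γ * ((q * M + s : ℤ) : ℂ)) = Complex.exp (-Real.pi * a * s ^ 2 + γ * s) *
              Complex.exp (-Real.pi * (a * M ^ 2) * q ^ 2 +
              (γ * M - 2 * Real.pi * a * M * s) * q) := by
            rw [← Complex.exp_add]
            congr 1
            push_cast; ring
          rw [h4, h5]; ring
      _ = _ := by
          rw [tsum_mul_left, tsum_heatPoly_gauss haM, ← tsum_mul_left]
          exact tsum_congr fun k => hterm s k
  calc ∑' m : ℤ, f m = ∑' p : ℤ × Fin M, f (p.1 * M + (p.2 : ℕ)) :=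
        ((Int.divModEquiv M).symm.tsum_eq f).symm
    _ = ∑' p : Fin M × ℤ, f (p.2 * M + (p.1 : ℕ)) :=
        ((Equiv.prodComm (Fin M) ℤ).tsum_eq (fun p : ℤ × Fin M => f (p.1 * M + (p.2 : ℕ)))).symm
    _ = ∑' s : Fin M, ∑' q : ℤ, f (q * M + (s : ℕ)) := by
        have h1 : Summable fun p : ℤ × Fin M => f (p.1 * M + (p.2 : ℕ)) :=
          ((Int.divModEquiv M).symm.summable_iff (f := f)).mpr hs
        exact ((Equiv.prodComm (Fin M) ℤ).summable_iff.mpr h1).tsum_prod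
    _ = ∑ s ∈ Finset.range M, ∑' k : ℤ, g s k := by
        rw [tsum_fintype, ← Fin.sum_univ_eq_sum_range (fun s : ℕ => ∑' k : ℤ, g s k)]
        exact Finset.sum_congr rfl fun s _ => hres s
    _ = ∑' k : ℤ, ∑ s ∈ Finset.range M, g s k :=
        (Summable.tsum_finsetSum fun s _ => hgs s).symm
    _ = _ := by
        refine tsum_congr fun k => ?_
        rw [hg, Finset.mul_sum, Finset.sum_mul]
        refine Finset.sum_congr rfl fun s _ => ?_
        ring

/-! ### The quadratic character of a fundamental discriminant -/

/-- The Kronecker symbol `(Δ / ·)`, extended by zero to the integers that are not coprime to `Δ`. -/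
def chi (D n : ℤ) : ℤ := open Classical in if IsCoprime n D then kronecker D n else 0

/-- The quadratic characters of the prime discriminants `1`, `-4`, `8`, `-8`. -/
def chiTwo (t n : ℤ) : ℤ :=
  if t = -4 then ZMod.χ₄ n else if t = 8 then ZMod.χ₈ n else if t = -8 then ZMod.χ₈' n else 1

/-- Splits off the prime discriminant at `2`. Reciprocity then moves the other factor to the lower
argument, where multiplicativity and periodicity in `n` become visible. -/
lemma IsFundamentalDiscriminant.exists_eq_mul {D : ℤ} (hD : IsFundamentalDiscriminant D) :
    ∃ t d : ℤ, D = t * d ∧ d % 4 = 1 ∧ Squarefree d ∧ (t = 1 ∨ t = -4 ∨ t = 8 ∨ t = -8) := by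
  rcases hD with ⟨h, hs⟩ | ⟨m, rfl, hm, hs⟩
  · exact ⟨1, D, by ring, h, hs, Or.inl rfl⟩
  · rcases hm with hm | hm
    · obtain ⟨k, rfl⟩ : (2 : ℤ) ∣ m := by omega
      have hk : Squarefree k := hs.squarefree_of_dvd (dvd_mul_left k 2)
      rcases (by omega : k % 4 = 1 ∨ k % 4 = 3) with h | h
      · exact ⟨8, k, by ring, h, hk, by simp⟩
      · exact ⟨-8, -k, by ring, by omega, hk.squarefree_of_dvd (neg_dvd.mpr dvd_rfl), by simp⟩
    · exact ⟨-4, -m, by ring, by omega, hs.squarefree_of_dvd (neg_dvd.mpr dvd_rfl), by simp⟩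

/-- Quadratic reciprocity; for negative `d` the sign `(-1 / b)` cancels the sign in the reciprocity
law. -/
lemma jacobiSym_eq_of_mod_four {d : ℤ} (hd : d % 4 = 1) {b : ℕ} (hb : Odd b) :
    jacobiSym d b = jacobiSym b d.natAbs := by
  rcases Int.natAbs_eq d with h | h
  · have h1 : d.natAbs % 4 = 1 := by omega
    conv_lhs => rw [h]
    exact jacobiSym.quadratic_reciprocity_one_mod_four h1 hb
  · have h1 : d.natAbs % 4 = 3 := by omega
    have ho : Odd d.natAbs := by rw [Nat.odd_iff]; omega
    conv_lhs => rw [h]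
    rw [jacobiSym.neg _ hb]
    rcases (by have := Nat.odd_iff.mp hb; omega : b % 4 = 1 ∨ b % 4 = 3) with h2 | h2
    · rw [ZMod.χ₄_nat_one_mod_four h2, one_mul]
      exact jacobiSym.quadratic_reciprocity_one_mod_four' ho h2
    · rw [ZMod.χ₄_nat_three_mod_four h2, jacobiSym.quadratic_reciprocity_three_mod_four h1 h2]
      ring

lemma jacobiSym_neg_one_natAbs {d : ℤ} (hd : d % 4 = 1) :
    jacobiSym (-1) d.natAbs = if d < 0 then -1 else 1 := by
  have ho : Odd d.natAbs := by rw [Nat.odd_iff]; omega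
  rw [jacobiSym.at_neg_one ho]
  split_ifs with h
  · exact ZMod.χ₄_nat_three_mod_four (by omega)
  · exact ZMod.χ₄_nat_one_mod_four (by omega)

lemma chiTwo_mul (t m n : ℤ) : chiTwo t (m * n) = chiTwo t m * chiTwo t n := by
  unfold chiTwo
  split_ifs <;> simp only [Int.cast_mul, map_mul, mul_one]

lemma chiTwo_natAbs {t : ℤ} (ht : t = 1 ∨ t = -4 ∨ t = 8 ∨ t = -8) {b : ℕ} (hb : Odd b) :
    jacobiSym t b = chiTwo t b := by
  have h4 : jacobiSym 4 b = 1 := jacobiSym.at_four hb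
  rcases ht with rfl | rfl | rfl | rfl
  · simp [chiTwo]
  · rw [show (-4 : ℤ) = -1 * 4 by norm_num, jacobiSym.mul_left, h4, jacobiSym.at_neg_one hb]
    simp [chiTwo]
  · rw [show (8 : ℤ) = 2 * 4 by norm_num, jacobiSym.mul_left, h4, jacobiSym.at_two hb]
    simp [chiTwo]
  · rw [show (-8 : ℤ) = -2 * 4 by norm_num, jacobiSym.mul_left, h4, jacobiSym.at_neg_two hb]
    simp [chiTwo]

lemma chiTwo_eq_zero {t : ℤ} (ht : t = -4 ∨ t = 8 ∨ t = -8) {n : ℤ} (hn : n % 2 = 0) :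
    chiTwo t n = 0 := by
  have h4 : ∀ x : ZMod 4, x = 0 ∨ x = 2 → ZMod.χ₄ x = 0 := by decide
  have h8 : ∀ x : ZMod 8, x = 0 ∨ x = 2 ∨ x = 4 ∨ x = 6 → ZMod.χ₈ x = 0 ∧ ZMod.χ₈' x = 0 := by
    decide
  have e4 : (n : ZMod 4) = ((n % 4 : ℤ) : ZMod 4) := by
    exact_mod_cast (ZMod.intCast_mod n 4).symm
  have e8 : (n : ZMod 8) = ((n % 8 : ℤ) : ZMod 8) := by
    exact_mod_cast (ZMod.intCast_mod n 8).symm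
  have g4 : (n : ZMod 4) = 0 ∨ (n : ZMod 4) = 2 := by
    rcases (by omega : n % 4 = 0 ∨ n % 4 = 2) with h | h <;> rw [e4, h] <;> simp
  have g8 : (n : ZMod 8) = 0 ∨ (n : ZMod 8) = 2 ∨ (n : ZMod 8) = 4 ∨ (n : ZMod 8) = 6 := by
    rcases (by omega : n % 8 = 0 ∨ n % 8 = 2 ∨ n % 8 = 4 ∨ n % 8 = 6) with h | h | h | h <;>
      rw [e8, h] <;> simp
  rcases ht with rfl | rfl | rfl
  · simpa [chiTwo] using h4 _ g4
  · simpa [chiTwo] using (h8 _ g8).1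
  · simpa [chiTwo] using (h8 _ g8).2

lemma chiTwo_neg_one {t : ℤ} (ht : t = 1 ∨ t = -4 ∨ t = 8 ∨ t = -8) :
    chiTwo t (-1) = if t < 0 then -1 else 1 := by
  rcases ht with rfl | rfl | rfl | rfl <;> simp [chiTwo] <;> decide

lemma two_factor_eq {d : ℤ} (hd : d % 4 = 1) :
    (if d % 2 = 0 then 0 else if d % 8 = 1 ∨ d % 8 = 7 then 1 else -1 : ℤ) =
      jacobiSym 2 d.natAbs := by
  have ho : Odd d.natAbs := by rw [Nat.odd_iff]; omega
  rw [jacobiSym.at_two ho, ZMod.χ₈_nat_eq_if_mod_eight]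
  have : d.natAbs % 2 ≠ 0 := by omega
  rw [if_neg this, if_neg (by omega : ¬ d % 2 = 0)]
  by_cases h : d % 8 = 1 ∨ d % 8 = 7
  · rw [if_pos h, if_pos (by omega)]
  · rw [if_neg h, if_neg (by omega)]

lemma sign_mul_eq {t d : ℤ} (ht : t = 1 ∨ t = -4 ∨ t = 8 ∨ t = -8) (hd : d % 4 = 1) :
    (if t < 0 then -1 else 1 : ℤ) * (if d < 0 then -1 else 1) = if t * d < 0 then -1 else 1 := by
  have hd0 : d ≠ 0 := by rintro rfl; simp at hd
  rcases lt_or_gt_of_ne hd0 with h | h <;> rcases ht with rfl | rfl | rfl | rfl <;>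
    · split_ifs <;> first | rfl | (exfalso; omega)

/-- The Kronecker symbol of a fundamental discriminant as a product of a character modulo `8` and
a Jacobi symbol in the upper argument. -/
theorem chi_eq_mul {t d : ℤ} (hd : d % 4 = 1) (ht : t = 1 ∨ t = -4 ∨ t = 8 ∨ t = -8) (n : ℤ) :
    chi (t * d) n = chiTwo t n * jacobiSym n d.natAbs := by
  have hd0 : d.natAbs ≠ 0 := by omega
  have ho : Odd d.natAbs := by rw [Nat.odd_iff]; omega
  by_cases hc : IsCoprime n (t * d)
  · rw [chi, if_pos hc]
    by_cases hn : n = 0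
    · subst hn
      have hu : IsUnit (t * d) := isCoprime_zero_left.mp hc
      have htd := Int.isUnit_iff.mp hu
      have hd1 := Int.isUnit_iff.mp (isUnit_of_mul_isUnit_right hu)
      have hd1 : d = 1 := by omega
      subst hd1
      have ht1 : t = 1 := by omega
      subst ht1
      simp [kronecker, chiTwo]
    -- With `n = ± 2^v o` and `o` odd, the three factors in the definition of `kronecker` correspond
    -- to the sign, to the power of `2` and to `o`.
    · set v := padicValNat 2 n.natAbs with hv
      set o := n.natAbs / 2 ^ v with hodef
      have hn' : n.natAbs ≠ 0 := by omega
      have hno : n.natAbs = 2 ^ v * o := (Nat.mul_div_cancel' pow_padicValNat_dvd).symm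
      have hoo : Odd o := by
        have := Nat.not_dvd_ordCompl (n := n.natAbs) (p := 2) Nat.prime_two hn'
        rw [Nat.factorization_def _ Nat.prime_two] at this
        change ¬ 2 ∣ o at this
        rw [Nat.odd_iff]
        omega
      have hsn : n = (if n < 0 then -1 else 1) * ((2 : ℤ) ^ v * (o : ℤ)) := by
        have : ((n.natAbs : ℕ) : ℤ) = 2 ^ v * o := by rw [hno]; push_cast; rfl
        rw [← this]
        split_ifs <;> omega
      have hJ1 : jacobiSym (t * d) o = chiTwo t o * jacobiSym o d.natAbs := by
        rw [jacobiSym.mul_left, chiTwo_natAbs ht hoo, jacobiSym_eq_of_mod_four hd hoo]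
      have hsgn : (if t * d < 0 ∧ n < 0 then -1 else 1 : ℤ) =
          chiTwo t (if n < 0 then -1 else 1) * jacobiSym (if n < 0 then -1 else 1) d.natAbs := by
        by_cases h : n < 0
        · simp only [h, and_true, if_true]
          rw [chiTwo_neg_one ht, jacobiSym_neg_one_natAbs hd, sign_mul_eq ht hd]
        · simp only [h, and_false, if_false]
          rw [jacobiSym.one_left, mul_one, chiTwo]
          split_ifs <;> simp
      have htwo : (if (t * d) % 2 = 0 then 0
          else if (t * d) % 8 = 1 ∨ (t * d) % 8 = 7 then 1 else -1 : ℤ) ^ v =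
          chiTwo t (2 ^ v) * jacobiSym (2 ^ v) d.natAbs := by
        by_cases h1 : t = 1
        · subst h1
          rw [one_mul, two_factor_eq hd, jacobiSym.pow_left]
          simp [chiTwo]
        -- An even `t` forces `n` to be odd by coprimality, so `v = 0`.
        · have hte : t % 2 = 0 := by omega
          have hnodd : n % 2 = 1 := by
            by_contra h
            have h2 : (2 : ℤ) ∣ n := by omega
            have h3 : (2 : ℤ) ∣ t * d := Dvd.dvd.mul_right (by omega) d
            exact absurd (hc.isUnit_of_dvd' h2 h3) (by decide)
          have hv0 : v = 0 := by
            rw [hv]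
            exact padicValNat.eq_zero_of_not_dvd (by omega)
          rw [hv0, pow_zero, pow_zero, jacobiSym.one_left, mul_one, chiTwo]
          split_ifs <;> simp
      rw [kronecker, if_neg hn, hsgn, htwo, ← hv, ← hodef, hJ1]
      conv_rhs => rw [hsn]
      rw [chiTwo_mul, chiTwo_mul, jacobiSym.mul_left, jacobiSym.mul_left]
      ring
  · rw [chi, if_neg hc]
    by_cases h1 : IsCoprime n d
    · have h2 : ¬ IsCoprime n t := fun h => hc (h.mul_right h1)
      have ht1 : t ≠ 1 := fun h => h2 (h ▸ isCoprime_one_right)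
      have hn2 : n % 2 = 0 := by
        by_contra h
        apply h2
        have h3 : IsCoprime n (2 : ℤ) := by
          refine (Int.prime_two.coprime_iff_not_dvd.mpr (by omega)).symm
        have h4 : IsCoprime n ((2 : ℤ) ^ 3) := h3.pow_right
        rcases ht with rfl | rfl | rfl | rfl
        · exact isCoprime_one_right
        · exact h4.of_isCoprime_of_dvd_right ⟨-2, by norm_num⟩
        · exact h4.of_isCoprime_of_dvd_right ⟨1, by norm_num⟩
        · exact h4.of_isCoprime_of_dvd_right ⟨-1, by norm_num⟩
      rw [chiTwo_eq_zero (by tauto) hn2, zero_mul]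
    · have : jacobiSym n d.natAbs = 0 := by
        rw [jacobiSym.eq_zero_iff]
        refine ⟨hd0, fun h => h1 ?_⟩
        rw [Int.isCoprime_iff_gcd_eq_one]
        rw [Int.gcd]
        exact h
      rw [this, mul_zero]

variable {D : ℤ}

lemma chi_mul (hD : IsFundamentalDiscriminant D) (m n : ℤ) : chi D (m * n) = chi D m * chi D n := by
  obtain ⟨t, d, rfl, hd, -, ht⟩ := hD.exists_eq_mul
  rw [chi_eq_mul hd ht, chi_eq_mul hd ht, chi_eq_mul hd ht, chiTwo_mul, jacobiSym.mul_left]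
  ring

lemma chiTwo_congr {t : ℤ} {m n : ℤ} (h : t ∣ m - n) : chiTwo t m = chiTwo t n := by
  unfold chiTwo
  split_ifs with h1 h2 h3
  · have : (m : ZMod 4) = n := by
      rw [← sub_eq_zero, ← Int.cast_sub]
      exact (ZMod.intCast_zmod_eq_zero_iff_dvd _ 4).mpr (by subst h1; exact neg_dvd.mp h)
    rw [this]
  · have : (m : ZMod 8) = n := by
      rw [← sub_eq_zero, ← Int.cast_sub]
      exact (ZMod.intCast_zmod_eq_zero_iff_dvd _ 8).mpr (by subst h2; omega)
    rw [this]
  · have : (m : ZMod 8) = n := by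
      rw [← sub_eq_zero, ← Int.cast_sub]
      exact (ZMod.intCast_zmod_eq_zero_iff_dvd _ 8).mpr (by subst h3; exact neg_dvd.mp h)
    rw [this]
  · rfl

lemma chi_congr (hD : IsFundamentalDiscriminant D) {m n : ℤ} (h : D ∣ m - n) :
    chi D m = chi D n := by
  obtain ⟨t, d, rfl, hd, -, ht⟩ := hD.exists_eq_mul
  rw [chi_eq_mul hd ht, chi_eq_mul hd ht, chiTwo_congr (dvd_of_mul_right_dvd h)]
  congr 1
  apply jacobiSym.mod_left'
  exact Int.ModEq.symm ((Int.modEq_iff_dvd).mpr (Int.natAbs_dvd.mpr (dvd_of_mul_left_dvd h)))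

lemma chi_one (hD : IsFundamentalDiscriminant D) : chi D 1 = 1 := by
  obtain ⟨t, d, rfl, hd, -, ht⟩ := hD.exists_eq_mul
  rw [chi_eq_mul hd ht, jacobiSym.one_left, chiTwo]
  split_ifs <;> simp

lemma chi_of_not_coprime {n : ℤ} (h : ¬ IsCoprime n D) : chi D n = 0 := if_neg h

lemma chi_of_coprime {n : ℤ} (h : IsCoprime n D) : chi D n = kronecker D n := if_pos h

lemma IsFundamentalDiscriminant.ne_zero (hD : IsFundamentalDiscriminant D) : D ≠ 0 := by
  rcases hD with ⟨h, -⟩ | ⟨m, rfl, h, -⟩ <;> omega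

lemma chi_mul_self (hD : IsFundamentalDiscriminant D) {n : ℤ} (h : IsCoprime n D) :
    chi D n * chi D n = 1 := by
  obtain ⟨m, k, hmk⟩ := h
  have h1 : chi D (m * n) = 1 := by
    rw [← chi_one hD]
    exact chi_congr hD ⟨-k, by linear_combination hmk⟩
  rw [chi_mul hD] at h1
  rcases Int.eq_one_or_neg_one_of_mul_eq_one (by linarith [mul_comm (chi D m) (chi D n)] :
    chi D n * chi D m = 1) with h | h <;> rw [h] <;> rfl

lemma chi_eq_one_or (hD : IsFundamentalDiscriminant D) {n : ℤ} (h : IsCoprime n D) :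
    chi D n = 1 ∨ chi D n = -1 := by
  have := chi_mul_self hD h
  exact mul_self_eq_one_iff.mp this

/-- The character of a fundamental discriminant is primitive. -/
lemma exists_chi_eq_neg_one (hD : IsFundamentalDiscriminant D) {p : ℤ} (hp : Prime p)
    (hpD : p ∣ D) : ∃ u : ℤ, IsCoprime u D ∧ (∀ x, p ∣ x → D ∣ (u - 1) * x) ∧ chi D u = -1 := by
  obtain ⟨t, d, rfl, hd, hs, ht⟩ := hD.exists_eq_mul
  suffices h : ∃ u : ℤ, (∀ x, p ∣ x → t * d ∣ (u - 1) * x) ∧ chi (t * d) u = -1 by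
    obtain ⟨u, h1, h2⟩ := h
    refine ⟨u, by_contra fun h => ?_, h1, h2⟩
    rw [chi_of_not_coprime h] at h2
    omega
  have ho : Odd d.natAbs := by rw [Nat.odd_iff]; omega
  rcases hp.dvd_or_dvd hpD with h | h
  · have ht1 : t ≠ 1 := by
      rintro rfl
      exact hp.not_isUnit (isUnit_of_dvd_one h)
    have hp2 : p ∣ 2 := by
      have h8 : t ∣ 2 ^ 3 := by
        rcases ht with rfl | rfl | rfl | rfl <;> norm_num
      exact hp.dvd_of_dvd_pow (h.trans h8)
    have hpe : ∀ x, p ∣ x → (2 : ℤ) ∣ x := by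
      intro x hx
      have h2p : Associated p 2 := hp.irreducible.associated_of_dvd Int.prime_two.irreducible hp2
      exact h2p.symm.dvd.trans hx
    -- Here `p = ±2`, and `u = 1 + t d / 2` is `1` modulo `d`, while modulo `4` it is `3` if `t =
    -- -4` and modulo `8` it is `5` if `t = ±8`.
    refine ⟨1 + t / 2 * d, fun x hx => ?_, ?_⟩
    · obtain ⟨y, rfl⟩ := hpe x hx
      refine ⟨y, ?_⟩
      have : t / 2 * 2 = t := Int.ediv_mul_cancel (by omega)
      linear_combination d * y * this
    · rw [chi_eq_mul hd ht]
      have h1 : jacobiSym (1 + t / 2 * d) d.natAbs = 1 := by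
        refine (jacobiSym.mod_left' ?_).trans (jacobiSym.one_left _)
        refine Int.ModEq.symm (Int.modEq_iff_dvd.mpr (Int.natAbs_dvd.mpr ⟨t / 2, by ring⟩))
      have h4 : chiTwo t (1 + t / 2 * d) = -1 := by
        rcases ht with rfl | rfl | rfl | rfl
        · exact absurd rfl ht1
        · rw [chiTwo_congr (n := 3) (neg_dvd.mpr (by omega))]
          decide
        · rw [chiTwo_congr (n := 5) (by omega)]
          decide
        · rw [chiTwo_congr (n := 5) (neg_dvd.mpr (by omega))]
          decide
      rw [h1, h4]; rfl
  · obtain ⟨q, hq⟩ : ∃ q : ℕ, p.natAbs = q := ⟨_, rfl⟩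
    have hqp : q.Prime := hq ▸ Int.prime_iff_natAbs_prime.mp hp
    have : Fact q.Prime := ⟨hqp⟩
    obtain ⟨f, hf⟩ : q ∣ d.natAbs := hq ▸ Int.natAbs_dvd_natAbs.mpr h
    have hfo : Odd (q * f) := hf ▸ ho
    have hqo : Odd q := Nat.Odd.of_mul_left hfo
    have hf0 : f ≠ 0 := by rintro rfl; simp at hfo
    have hqf : Nat.Coprime q f := by
      have : Squarefree (q * f) := hf ▸ Int.squarefree_natAbs.mpr hs
      exact Nat.coprime_of_squarefree_mul this
    have hq2 : q ≠ 2 := by rintro rfl; exact absurd hqo (by decide)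
    obtain ⟨a, ha⟩ := quadraticChar_exists_neg_one' (F := ZMod q) (by rwa [ZMod.ringChar_zmod_n])
    -- Chinese remainder theorem with `|d| = q f`: the number `u = 1 + 8 f x (a' - 1)`, where `8 f x
    -- ≡ 1` modulo `q`, is `1` modulo `8 f` and a nonresidue modulo `q`.
    have hcop : IsCoprime ((8 * f : ℕ) : ℤ) (q : ℤ) := by
      rw [Nat.isCoprime_iff_coprime]
      refine Nat.Coprime.mul_left ?_ hqf.symm
      rw [show 8 = 2 ^ 3 by norm_num]
      exact Nat.Coprime.pow_left 3 ((Nat.coprime_primes Nat.prime_two hqp).mpr (Ne.symm hq2))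
    obtain ⟨x, y, hxy⟩ := hcop
    set a' : ℤ := (((a : ZMod q).val : ℕ) : ℤ) with ha'
    refine ⟨1 + 8 * f * x * (a' - 1), fun z hz => ?_, ?_⟩
    · have h8 : t ∣ 8 := by rcases ht with rfl | rfl | rfl | rfl <;> norm_num
      have hd' : d ∣ (q * f : ℕ) := hf ▸ Int.dvd_natAbs.mpr dvd_rfl
      have hz' : (q : ℤ) ∣ z := by rw [← hq]; exact Int.natAbs_dvd.mpr hz
      obtain ⟨w, rfl⟩ := hz'
      refine (mul_dvd_mul h8 hd').trans ⟨x * (a' - 1) * w, by push_cast; ring⟩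
    · rw [chi_eq_mul hd ht, hf, jacobiSym.mul_right' _ hqp.ne_zero hf0]
      have h1 : chiTwo t (1 + 8 * f * x * (a' - 1)) = 1 := by
        have h8 : t ∣ 8 := by rcases ht with rfl | rfl | rfl | rfl <;> norm_num
        rw [chiTwo_congr (n := 1) (h8.trans ⟨f * x * (a' - 1), by ring⟩), chiTwo]
        split_ifs <;> simp
      have h2 : jacobiSym (1 + 8 * f * x * (a' - 1)) f = 1 := by
        refine (jacobiSym.mod_left' ?_).trans (jacobiSym.one_left _)
        exact Int.ModEq.symm (Int.modEq_iff_dvd.mpr ⟨8 * x * (a' - 1), by ring⟩)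
      have h3 : jacobiSym (1 + 8 * f * x * (a' - 1)) q = -1 := by
        rw [jacobiSym.mod_left' (a₂ := a')
          (Int.ModEq.symm (Int.modEq_iff_dvd.mpr ⟨-y * (a' - 1), ?_⟩)),
          ← jacobiSym.legendreSym.to_jacobiSym, legendreSym]
        · rw [ha']
          simpa using ha
        · push_cast at hxy
          linear_combination (a' - 1) * hxy
      rw [h1, h2, h3]; rfl

/-- The values of a form of discriminant `D` with positive leading coefficient lie in the kernel
of the character. -/
lemma chi_form_value (hD : IsFundamentalDiscriminant D) {A B C : ℤ} (hA : 0 < A)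
    (hdisc : B ^ 2 - 4 * A * C = D) (x y : ℤ)
    (hcop : IsCoprime (A * x ^ 2 + B * x * y + C * y ^ 2) D) :
    chi D (A * x ^ 2 + B * x * y + C * y ^ 2) = 1 := by
  by_cases hD1 : D = 1
  · refine (chi_congr hD ?_).trans (chi_one hD)
    rw [hD1]
    exact one_dvd _
  set n := A * x ^ 2 + B * x * y + C * y ^ 2 with hn
  have hn0 : n ≠ 0 := by
    intro h
    rw [h, isCoprime_zero_left, Int.isUnit_iff] at hcop
    rcases hcop with h | h
    · exact hD1 h
    · rcases hD with ⟨h1, -⟩ | ⟨m, h1, -⟩ <;> omega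
  have hxy : x ≠ 0 ∨ y ≠ 0 := by
    by_contra h
    push Not at h
    apply hn0
    rw [hn, h.1, h.2]; ring
  -- Dividing by the greatest common divisor changes the value by the square `g²` and makes the
  -- representation primitive.
  obtain ⟨g, x', y', hg, hc', rfl, rfl⟩ : ∃ g x' y' : ℤ, g ≠ 0 ∧ IsCoprime x' y' ∧
      x = g * x' ∧ y = g * y' := by
    have hg0 : (Int.gcd x y : ℤ) ≠ 0 := by
      rw [Ne, Int.natCast_eq_zero, Int.gcd_eq_zero_iff]
      tauto
    refine ⟨Int.gcd x y, x / Int.gcd x y, y / Int.gcd x y, hg0, ?_,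
      (Int.mul_ediv_cancel' (Int.gcd_dvd_left ..)).symm,
      (Int.mul_ediv_cancel' (Int.gcd_dvd_right ..)).symm⟩
    rw [Int.isCoprime_iff_gcd_eq_one]
    exact Int.gcd_ediv_gcd_ediv_gcd (by omega)
  set m := A * x' ^ 2 + B * x' * y' + C * y' ^ 2 with hm
  have hnm : n = g * g * m := by rw [hn, hm]; ring
  rw [hnm] at hcop hn0 ⊢
  have hgD : IsCoprime g D := hcop.of_mul_left_left.of_mul_left_left
  have hmD : IsCoprime m D := hcop.of_mul_left_right
  have hm0 : m ≠ 0 := by rintro h; rw [h] at hn0; simp at hn0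
  rw [chi_mul hD, chi_mul hD, chi_mul_self hD hgD, one_mul, chi_of_coprime hmD]
  obtain ⟨w, u, huw⟩ := hc'
  -- Completing `(x', y')` to a matrix of determinant `1` gives an equivalent form with leading
  -- coefficient `m`; hence `D` is a square modulo `4 m`.
  obtain ⟨b', c', hb'⟩ : ∃ b' c' : ℤ, D = b' ^ 2 - 4 * m * c' := by
    refine ⟨2 * A * x' * (-u) + B * (x' * w + y' * (-u)) + 2 * C * y' * w,
      A * u ^ 2 - B * u * w + C * w ^ 2, ?_⟩
    rw [← hdisc, hm]
    linear_combination (-(B ^ 2 - 4 * A * C) * (w * x' + u * y' + 1)) * huw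
  -- A form of negative discriminant with positive leading coefficient has no negative values.
  have hsgn : ¬ (D < 0 ∧ m < 0) := by
    rintro ⟨h1, h2⟩
    have h3 : 4 * A * m = (2 * A * x' + B * y') ^ 2 - D * y' ^ 2 := by
      rw [hm, ← hdisc]; ring
    have h4 : 0 ≤ -D * y' ^ 2 := mul_nonneg (by omega) (sq_nonneg _)
    have h5 := sq_nonneg (2 * A * x' + B * y')
    have h6 : 4 * A * m < 0 := mul_neg_of_pos_of_neg (by omega) h2
    linarith
  rw [kronecker, if_neg hm0, if_neg hsgn, one_mul]
  set v := padicValNat 2 m.natAbs with hv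
  set o := m.natAbs / 2 ^ v with hodef
  have hno : m.natAbs = 2 ^ v * o := (Nat.mul_div_cancel' pow_padicValNat_dvd).symm
  have hom : (o : ℤ) ∣ m := by
    rw [← Int.dvd_natAbs, hno]
    exact ⟨2 ^ v, by push_cast; ring⟩
  -- If `m` is even, coprimality makes `D` odd, so `b'` is odd and `D ≡ b'² ≡ 1` modulo `8`.
  have h1 : (if D % 2 = 0 then 0 else if D % 8 = 1 ∨ D % 8 = 7 then 1 else -1 : ℤ) ^ v = 1 := by
    rcases Nat.eq_zero_or_pos v with h | h
    · rw [h, pow_zero]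
    · have hme : (2 : ℤ) ∣ m := by
        rw [← Int.dvd_natAbs, hno]
        have : 2 ∣ 2 ^ v * o := Dvd.dvd.mul_right (dvd_pow_self 2 (by omega)) o
        exact_mod_cast this
      have hDo : ¬ (2 : ℤ) ∣ D := fun h2 => absurd (hmD.isUnit_of_dvd' hme h2) (by decide)
      obtain ⟨m', hm'⟩ := hme
      have hbo : b' % 2 = 1 := by
        by_contra h2
        obtain ⟨b'', hb''⟩ : (2 : ℤ) ∣ b' := by omega
        apply hDo
        rw [hb', hb'']
        exact ⟨2 * b'' ^ 2 - 2 * m * c', by ring⟩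
      obtain ⟨b'', hb''⟩ : ∃ b'', b' = 2 * b'' + 1 := ⟨b' / 2, by omega⟩
      have h8 : D % 8 = 1 := by
        have h9 : D = 4 * (b'' * (b'' + 1)) + 1 - 8 * (m' * c') := by
          rw [hb', hb'', hm']; ring
        obtain ⟨s, hs⟩ := (Int.even_mul_succ_self b'')
        rw [hs] at h9
        omega
      rw [if_neg (by omega), if_pos (by omega), one_pow]
  -- Modulo the odd part `o` of `m`, the discriminant is the square of the unit `b'`.
  have h2 : jacobiSym D o = 1 := by
    have hgo : b'.gcd o = 1 := by
      rw [← Int.isCoprime_iff_gcd_eq_one]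
      have h3 : IsCoprime (o : ℤ) D := hmD.of_isCoprime_of_dvd_left hom
      have h4 : IsCoprime (o : ℤ) (b' ^ 2) := by
        obtain ⟨s, hs⟩ := hom
        have : b' ^ 2 = D + (o : ℤ) * (4 * s * c') := by rw [hb', hs]; ring
        rw [this]
        exact (IsCoprime.add_mul_left_right_iff).mpr h3
      exact (IsCoprime.pow_right_iff (by norm_num)).mp h4 |>.symm
    rw [← jacobiSym.sq_one' hgo]
    apply jacobiSym.mod_left'
    refine Int.ModEq.symm (Int.modEq_iff_dvd.mpr ?_)
    rw [hb']
    exact (hom.mul_right (-(4 * c'))).trans ⟨1, by ring⟩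
  rw [h1, h2, one_mul]

/-! ### Hermitian forms and the genus character -/

/-- The binary form `m h² + r h j + N j²`. -/
def binG {R : Type*} [CommRing R] (N r m h j : R) : R := m * h ^ 2 + r * h * j + N * j ^ 2

/-- The bilinear form belonging to `binG`. -/
def binB {R : Type*} [CommRing R] (N r m h j w y : R) : R :=
  2 * m * h * w + r * (h * y + j * w) + 2 * N * j * y

/-- The values of the binary Hermitian form with coefficients `c`, `(h, j)`, `a` over the quadratic
order of discriminant `r² - 4Nm`. -/
def hermVal (N r m a h j c x₁ x₂ w y : ℤ) : ℤ :=
  c * (x₁ ^ 2 + r * x₁ * x₂ + N * m * x₂ ^ 2) +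
    binB N r m (x₁ * h + x₂ * (N * j + r * h)) (x₁ * j - x₂ * m * h) w y + a * binG N r m w y

section

variable {D : ℤ}

lemma isCoprime_iff_prime (hD : D ≠ 0) (n : ℤ) :
    IsCoprime n D ↔ ∀ p : ℤ, Prime p → p ∣ D → ¬ p ∣ n := by
  refine ⟨fun h p hp h1 h2 => hp.not_isUnit (h.isUnit_of_dvd' h2 h1), fun h => ?_⟩
  exact isCoprime_of_prime_dvd (fun h' => hD h'.2) fun p hp h1 h2 => h p hp h2 h1

/-- A device for values prime to `D`. With `X` and `Y` the products of the primes of `D` that divide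
`a` and of those that do not, at each prime of `D` exactly one of the two is a unit, so that only
one square term of a form in `X`, `Y` survives there. -/
lemma exists_separating (hD : D ≠ 0) (a : ℤ) : ∃ X Y : ℤ, X ≠ 0 ∧ ∀ p : ℤ, Prime p → p ∣ D →
    (p ∣ a → p ∣ X ∧ ¬ p ∣ Y) ∧ (¬ p ∣ a → ¬ p ∣ X ∧ p ∣ Y) := by
  classical
  have key : ∀ s : Finset ℕ, (∀ q ∈ s, q.Prime) → ∀ p : ℤ, Prime p →
      (p ∣ ((∏ q ∈ s, q : ℕ) : ℤ) ↔ p.natAbs ∈ s) := by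
    intro s hs p hp
    have hp' := Int.prime_iff_natAbs_prime.mp hp
    rw [← Int.natAbs_dvd_natAbs, Int.natAbs_natCast, hp'.prime.dvd_finsetProd_iff]
    constructor
    · rintro ⟨q, hq, h⟩
      rwa [(Nat.prime_dvd_prime_iff_eq hp' (hs q hq)).mp h]
    · intro h
      exact ⟨_, h, dvd_rfl⟩
  set P := D.natAbs.primeFactors with hP
  have hPp : ∀ q ∈ P, q.Prime := fun q hq => Nat.prime_of_mem_primeFactors hq
  have hmem : ∀ p : ℤ, Prime p → p ∣ D → p.natAbs ∈ P := fun p hp h =>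
    Nat.mem_primeFactors.mpr ⟨Int.prime_iff_natAbs_prime.mp hp, Int.natAbs_dvd_natAbs.mpr h,
      by omega⟩
  refine ⟨((∏ q ∈ P.filter (fun q : ℕ => (q : ℤ) ∣ a), q : ℕ) : ℤ),
    ((∏ q ∈ P.filter (fun q : ℕ => ¬ (q : ℤ) ∣ a), q : ℕ) : ℤ), ?_, fun p hp hpD => ?_⟩
  · have : ∏ q ∈ P.filter (fun q : ℕ => (q : ℤ) ∣ a), q ≠ 0 :=
      Finset.prod_ne_zero_iff.mpr fun q hq => (hPp q (Finset.mem_filter.mp hq).1).ne_zero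
    exact_mod_cast this
  · rw [key _ (fun q hq => hPp q (Finset.mem_filter.mp hq).1) p hp,
      key _ (fun q hq => hPp q (Finset.mem_filter.mp hq).1) p hp, Finset.mem_filter,
      Finset.mem_filter, Int.natAbs_dvd]
    have := hmem p hp hpD
    tauto

/-- Otherwise `p ∣ r`, and `D / p² = (r / p)² - 4 s` is again `0` or `1` modulo `4`, which a
fundamental discriminant excludes. -/
lemma not_dvd_four_mul_form (hD : IsFundamentalDiscriminant D) {p : ℤ} (hp : Prime p) {r s : ℤ}
    (h : r ^ 2 - 4 * (p ^ 2 * s) = D) : ¬ p ∣ D := by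
  intro hpD
  have hpr : p ∣ r := by
    refine hp.dvd_of_dvd_pow (n := 2) ?_
    have : r ^ 2 = D + p * (4 * p * s) := by rw [← h]; ring
    rw [this]
    exact dvd_add hpD ⟨_, rfl⟩
  obtain ⟨k, rfl⟩ := hpr
  have hD2 : D = p * p * (k ^ 2 - 4 * s) := by rw [← h]; ring
  rcases hD with ⟨h4, hs⟩ | ⟨m, rfl, hm, hs⟩
  · exact hp.not_isUnit (hs p ⟨_, hD2⟩)
  · by_cases h2 : p ∣ 2
    · have h2a : Associated p 2 := hp.irreducible.associated_of_dvd Int.prime_two.irreducible h2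
      rcases Int.associated_iff.mp h2a with rfl | rfl
      · rcases Int.even_or_odd' k with ⟨i, rfl | rfl⟩ <;> ring_nf at hD2 <;> omega
      · rcases Int.even_or_odd' k with ⟨i, rfl | rfl⟩ <;> ring_nf at hD2 <;> omega
    · have hc : IsCoprime (p * p) ((2 : ℤ) * 2) := by
        have : IsCoprime p (2 : ℤ) := (hp.coprime_iff_not_dvd).mpr h2
        exact (this.mul_left this).mul_right (this.mul_left this)
      have : p * p ∣ m := by
        refine hc.dvd_of_dvd_mul_left ⟨k ^ 2 - 4 * s, ?_⟩
        rw [← hD2]; ring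
      exact hp.not_isUnit (hs p this)

variable {N : ℕ} {r m : ℤ}

/-- By `not_dvd_four_mul_form` no prime of `D` divides both outer coefficients `m` and `N`; the
separating pair isolates one that is a unit. -/
lemma exists_binG_coprime (hD : IsFundamentalDiscriminant D) (hr : r ^ 2 - 4 * N * m = D) :
    ∃ w y : ℤ, IsCoprime (binG (N : ℤ) r m w y) D := by
  obtain ⟨X, Y, -, h⟩ := exists_separating hD.ne_zero (N : ℤ)
  refine ⟨Y, X, (isCoprime_iff_prime hD.ne_zero _).mpr fun p hp hpD hdvd => ?_⟩
  obtain ⟨h1, h2⟩ := h p hp hpD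
  unfold binG at hdvd
  by_cases hN : p ∣ N
  · obtain ⟨hX, hY⟩ := h1 hN
    have hm : ¬ p ∣ m := by
      rintro ⟨k, rfl⟩
      obtain ⟨i, hi⟩ := hN
      exact not_dvd_four_mul_form hD hp (r := r) (s := i * k) (by rw [← hr, hi]; ring) hpD
    have h3 : p ∣ m * Y ^ 2 := by
      have : m * Y ^ 2 = (m * Y ^ 2 + r * Y * X + N * X ^ 2) - X * (r * Y + N * X) := by ring
      rw [this]
      exact dvd_sub hdvd (hX.mul_right _)
    rcases hp.dvd_or_dvd h3 with h4 | h4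
    · exact hm h4
    · exact hY (hp.dvd_of_dvd_pow h4)
  · obtain ⟨hX, hY⟩ := h2 hN
    have h3 : p ∣ N * X ^ 2 := by
      have : N * X ^ 2 = (m * Y ^ 2 + r * Y * X + N * X ^ 2) - Y * (m * Y + r * X) := by ring
      rw [this]
      exact dvd_sub hdvd (hY.mul_right _)
    rcases hp.dvd_or_dvd h3 with h4 | h4
    · exact hN h4
    · exact hX (hp.dvd_of_dvd_pow h4)

/-- Modulo a prime of `D` the form is degenerate and its zeros lie in the radical: completing the
square shows that `4 m binG` and `4 N binG` are squares up to multiples of `D`. -/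
lemma prime_dvd_gradient (hr : r ^ 2 - 4 * N * m = D) {p : ℤ} (hp : Prime p) (hpD : p ∣ D)
    {h j : ℤ} (hg : p ∣ binG (N : ℤ) r m h j) : p ∣ 2 * m * h + r * j ∧ p ∣ r * h + 2 * N * j := by
  unfold binG at hg
  constructor
  · refine hp.dvd_of_dvd_pow (n := 2) ?_
    have : (2 * m * h + r * j) ^ 2 = 4 * m * (m * h ^ 2 + r * h * j + N * j ^ 2) + D * j ^ 2 := by
      rw [← hr]; ring
    rw [this]
    exact dvd_add (hg.mul_left _) (hpD.mul_right _)
  · refine hp.dvd_of_dvd_pow (n := 2) ?_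
    have : (r * h + 2 * N * j) ^ 2 = 4 * N * (m * h ^ 2 + r * h * j + N * j ^ 2) + D * h ^ 2 := by
      rw [← hr]; ring
    rw [this]
    exact dvd_add (hg.mul_left _) (hpD.mul_right _)

lemma prime_dvd_binB (hr : r ^ 2 - 4 * N * m = D) {p : ℤ} (hp : Prime p) (hpD : p ∣ D)
    {h j : ℤ} (hg : p ∣ binG (N : ℤ) r m h j) (x₁ x₂ w y : ℤ) :
    p ∣ binB (N : ℤ) r m (x₁ * h + x₂ * (N * j + r * h)) (x₁ * j - x₂ * m * h) w y := by
  obtain ⟨h1, h2⟩ := prime_dvd_gradient hr hp hpD hg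
  have : binB (N : ℤ) r m (x₁ * h + x₂ * (N * j + r * h)) (x₁ * j - x₂ * m * h) w y =
      (2 * m * h + r * j) * (x₁ * w - x₂ * N * y) +
        (r * h + 2 * N * j) * (x₂ * m * w + x₁ * y + x₂ * r * y) := by
    unfold binB; ring
  rw [this]
  exact dvd_add (h1.mul_right _) (h2.mul_right _)

/-- With `(w, y)` scaled by the integer `Y` that belongs to `c`, the value is `c + Y B + Y² a G`.
Where `p ∤ c`, only `c` survives. Where `p ∣ c`, isotropy puts `(h, j)` in the radical modulo `p`,
so `B` vanishes as well and the unit `Y² a G` remains. -/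
lemma exists_hermVal_coprime (hD : IsFundamentalDiscriminant D) (hr : r ^ 2 - 4 * N * m = D)
    {a h j c : ℤ} (hq : D ∣ a * c - binG (N : ℤ) r m h j)
    (hac : ∀ p : ℤ, Prime p → p ∣ D → p ∣ a → ¬ p ∣ c) :
    ∃ w y : ℤ, IsCoprime (hermVal N r m a h j c 1 0 w y) D := by
  obtain ⟨w, y, hwy⟩ := exists_binG_coprime hD hr
  obtain ⟨X, Y, -, hXY⟩ := exists_separating hD.ne_zero c
  refine ⟨w * Y, y * Y, (isCoprime_iff_prime hD.ne_zero _).mpr fun p hp hpD hdvd => ?_⟩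
  obtain ⟨h1, h2⟩ := hXY p hp hpD
  have hv : hermVal N r m a h j c 1 0 (w * Y) (y * Y) =
      c + Y * binB (N : ℤ) r m h j w y + Y ^ 2 * (a * binG (N : ℤ) r m w y) := by
    unfold hermVal binB binG; ring
  rw [hv] at hdvd
  by_cases hc : p ∣ c
  · have ha : ¬ p ∣ a := fun ha => hac p hp hpD ha hc
    have hg : p ∣ binG (N : ℤ) r m h j := by
      have : binG (N : ℤ) r m h j = a * c - (a * c - binG (N : ℤ) r m h j) := by ring
      rw [this]
      exact dvd_sub (hc.mul_left _) (hpD.trans hq)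
    have hB : p ∣ binB (N : ℤ) r m h j w y := by
      simpa using prime_dvd_binB hr hp hpD hg 1 0 w y
    have h3 : p ∣ Y ^ 2 * (a * binG (N : ℤ) r m w y) := by
      rw [add_assoc] at hdvd
      exact (dvd_add_right (hB.mul_left Y)).mp ((dvd_add_right hc).mp hdvd)
    rcases hp.dvd_or_dvd h3 with h4 | h4
    · exact (h1 hc).2 (hp.dvd_of_dvd_pow h4)
    · rcases hp.dvd_or_dvd h4 with h5 | h5
      · exact ha h5
      · exact (isCoprime_iff_prime hD.ne_zero _).mp hwy p hp hpD h5
  · apply hc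
    have hY := (h2 hc).2
    have : c = (c + Y * binB (N : ℤ) r m h j w y + Y ^ 2 * (a * binG (N : ℤ) r m w y)) -
      Y * (binB (N : ℤ) r m h j w y + Y * (a * binG (N : ℤ) r m w y)) := by ring
    rw [this]
    exact dvd_sub hdvd (hY.mul_right _)

/-- The factorisation is `N₁ = gcd(N, X)`, `N₂ = N / N₁`, with `(X, Y)` separating for `a`. If `p ∤
a`, then `p ∤ X`, so `p ∤ N₁` and the term in `X²` is a unit. If `p ∣ a`, then `p ∣ X`, and `p ∣ N₂`
would give `p² ∣ N`; so the term in `Y²` is a unit. -/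
lemma exists_isRepresented [NeZero N] (hD : IsFundamentalDiscriminant D)
    (hr : r ^ 2 - 4 * N * m = D) {a b c : ℤ}
    (hac : ∀ p : ℤ, Prime p → p ∣ D → p ∣ a → ¬ p ∣ c) :
    ∃ n : ℤ, IsCoprime n D ∧ IsRepresented N a b c n := by
  obtain ⟨X, Y, hX0, hXY⟩ := exists_separating hD.ne_zero a
  set N₁ := Int.gcd N X with hN₁
  have hN₁d : N₁ ∣ N := by exact_mod_cast (Int.gcd_dvd_left (N : ℤ) X)
  obtain ⟨N₂, hN₂⟩ := hN₁d
  have hN0 : N ≠ 0 := NeZero.ne N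
  have hp1 : 0 < N₁ := Nat.pos_of_ne_zero fun h => hN0 (by rw [hN₂, h, zero_mul])
  have hp2 : 0 < N₂ := Nat.pos_of_ne_zero fun h => hN0 (by rw [hN₂, h, mul_zero])
  have hNz : (N : ℤ) = N₁ * N₂ := by exact_mod_cast hN₂
  refine ⟨_, ?_, N₁, N₂, hp1, hp2, hN₂.symm, X, Y, rfl⟩
  refine (isCoprime_iff_prime hD.ne_zero _).mpr fun p hp hpD hdvd => ?_
  obtain ⟨h1, h2⟩ := hXY p hp hpD
  by_cases ha : p ∣ a
  · obtain ⟨hX, hY⟩ := h1 ha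
    have h3 : p ∣ N₂ * c * Y ^ 2 := by
      have : N₂ * c * Y ^ 2 = (N₁ * a * X ^ 2 + b * X * Y + N₂ * c * Y ^ 2) -
        X * (N₁ * a * X + b * Y) := by ring
      rw [this]
      exact dvd_sub hdvd (hX.mul_right _)
    rcases hp.dvd_or_dvd h3 with h4 | h4
    · rcases hp.dvd_or_dvd h4 with h5 | h5
      · have hpN : p ∣ (N : ℤ) := hNz ▸ h5.mul_left _
        have hpN1 : p ∣ (N₁ : ℤ) := Int.dvd_coe_gcd hpN hX
        obtain ⟨i, hi⟩ := hpN1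
        obtain ⟨k, hk⟩ := h5
        exact not_dvd_four_mul_form hD hp (r := r) (s := i * k * m)
          (by rw [← hr, hNz, hi, hk]; ring) hpD
      · exact hac p hp hpD ha h5
    · exact hY (hp.dvd_of_dvd_pow h4)
  · obtain ⟨hX, hY⟩ := h2 ha
    have h3 : p ∣ N₁ * a * X ^ 2 := by
      have : N₁ * a * X ^ 2 = (N₁ * a * X ^ 2 + b * X * Y + N₂ * c * Y ^ 2) -
        Y * (b * X + N₂ * c * Y) := by ring
      rw [this]
      exact dvd_sub hdvd (hY.mul_right _)
    rcases hp.dvd_or_dvd h3 with h4 | h4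
    · rcases hp.dvd_or_dvd h4 with h5 | h5
      · exact hX (h5.trans (Int.gcd_dvd_right (N : ℤ) X))
      · exact ha h5
    · exact hX (hp.dvd_of_dvd_pow h4)

/-- On isotropic vectors modulo `D`, the genus character is given by any value of the Hermitian
form that is coprime to `D`. -/
theorem genusCharCoeff_eq_chi [NeZero N] (hD : IsFundamentalDiscriminant D)
    (hr : r ^ 2 - 4 * N * m = D) {a h j c : ℤ} (hq : D ∣ a * c - binG (N : ℤ) r m h j)
    {x₁ x₂ w y : ℤ} (hcop : IsCoprime (hermVal N r m a h j c x₁ x₂ w y) D) :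
    genusCharCoeff N D a (r * h + 2 * N * j) c = chi D (hermVal N r m a h j c x₁ x₂ w y) := by
  have hac : ∀ p : ℤ, Prime p → p ∣ D → p ∣ a → ¬ p ∣ c := by
    intro p hp hpD ha hc
    refine (isCoprime_iff_prime hD.ne_zero _).mp hcop p hp hpD ?_
    have hg : p ∣ binG (N : ℤ) r m h j := by
      have : binG (N : ℤ) r m h j = a * c - (a * c - binG (N : ℤ) r m h j) := by ring
      rw [this]
      exact dvd_sub (hc.mul_left _) (hpD.trans hq)
    unfold hermVal
    exact dvd_add (dvd_add (hc.mul_right _) (prime_dvd_binB hr hp hpD hg _ _ _ _)) (ha.mul_right _)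
  have hdisc : ∃ s m' : ℤ, (r * h + 2 * N * j) ^ 2 - 4 * N * a * c = D * (s ^ 2 + 4 * N * m') := by
    obtain ⟨k, hk⟩ := hq
    refine ⟨h, -k, ?_⟩
    unfold binG at hk
    linear_combination (-4 * (N : ℤ)) * hk + h ^ 2 * hr
  have hgcd : Int.gcd (Int.gcd a (r * h + 2 * N * j)) (Int.gcd c D) = 1 := by
    rw [← Int.isCoprime_iff_gcd_eq_one]
    refine isCoprime_of_prime_dvd (fun h' => ?_) fun p hp h1 h2 => ?_
    · have := h'.2
      rw [Int.natCast_eq_zero, Int.gcd_eq_zero_iff] at this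
      exact hD.ne_zero this.2
    · exact hac p hp (h2.trans (Int.gcd_dvd_right ..)) (h1.trans (Int.gcd_dvd_left ..))
        (h2.trans (Int.gcd_dvd_left ..))
  have hex := exists_isRepresented hD hr (b := r * h + 2 * N * j) hac
  have H : ((∃ s m' : ℤ, (r * h + 2 * N * j) ^ 2 - 4 * N * a * c = D * (s ^ 2 + 4 * N * m')) ∧
      Int.gcd (Int.gcd a (r * h + 2 * N * j)) (Int.gcd c D) = 1) ∧
      ∃ n : ℤ, IsCoprime n D ∧ IsRepresented N a (r * h + 2 * N * j) c n := ⟨⟨hdisc, hgcd⟩, hex⟩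
  rw [genusCharCoeff, dif_pos H]
  obtain ⟨hn, N₁, N₂, hp1, hp2, hN, X, Y, hnXY⟩ := H.2.choose_spec
  set n := H.2.choose
  rw [← chi_of_coprime hn]
  have hNz : (N : ℤ) = N₁ * N₂ := by exact_mod_cast hN.symm
  -- Modulo the isotropy relation, the product of a value of `[N₁a, b, N₂c]` and a value of the
  -- Hermitian form is the value at `(P, R)` of the form `[N₂, r, N₁ m]` of discriminant `D`. There
  -- the character is trivial by `chi_form_value`, so the two factors have the same character.
  set P := c * Y * x₁ + Y * (N * j * y + m * h * w + r * h * y) +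
    N₁ * X * (x₁ * j - x₂ * m * h + a * y)
  set R := N₂ * c * Y * x₂ + N₂ * Y * (j * w - h * y) + X * (x₁ * h + x₂ * (N * j + r * h) + a * w)
  have key : n * hermVal N r m a h j c x₁ x₂ w y -
      (N₂ * P ^ 2 + r * P * R + N₁ * m * R ^ 2) = (a * c - binG (N : ℤ) r m h j) *
      (N₁ * (N₂ * Y * y - X * x₁) ^ 2 + r * (N₂ * Y * y - X * x₁) * (Y * w - N₁ * X * x₂) +
        m * N₂ * (Y * w - N₁ * X * x₂) ^ 2) := by
    rw [hnXY]
    simp only [P, R, hermVal, binG, binB, hNz]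
    ring
  have hdvd : D ∣ n * hermVal N r m a h j c x₁ x₂ w y -
      (N₂ * P ^ 2 + r * P * R + N₁ * m * R ^ 2) := key ▸ hq.mul_right _
  have hcn : IsCoprime (n * hermVal N r m a h j c x₁ x₂ w y) D := hn.mul_left hcop
  have hcf : IsCoprime (N₂ * P ^ 2 + r * P * R + N₁ * m * R ^ 2) D := by
    obtain ⟨k, hk⟩ := hdvd
    have : (N₂ * P ^ 2 + r * P * R + N₁ * m * R ^ 2) =
      n * hermVal N r m a h j c x₁ x₂ w y + D * (-k) := by linear_combination -hk
    rw [this]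
    exact IsCoprime.add_mul_left_left_iff.mpr hcn
  have h1 := chi_form_value hD (A := N₂) (by exact_mod_cast hp2)
    (by rw [← hr, hNz]; ring) P R hcf
  rw [← chi_congr hD hdvd, chi_mul hD] at h1
  rcases chi_eq_one_or hD hn with e1 | e1 <;> rw [e1] at h1 ⊢ <;> omega

/-- If `p` divides `a` and `c`, isotropy and `prime_dvd_gradient` give `p ∣ b`, so the condition on
the greatest common divisor fails. -/
lemma genusCharCoeff_eq_zero (hr : r ^ 2 - 4 * N * m = D)
    {a h j c : ℤ} (hq : D ∣ a * c - binG (N : ℤ) r m h j)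
    {p : ℤ} (hp : Prime p) (hpD : p ∣ D) (ha : p ∣ a) (hc : p ∣ c) :
    genusCharCoeff N D a (r * h + 2 * N * j) c = 0 := by
  rw [genusCharCoeff, dif_neg]
  rintro ⟨⟨-, hgcd⟩, -⟩
  have hg : p ∣ binG (N : ℤ) r m h j := by
    have : binG (N : ℤ) r m h j = a * c - (a * c - binG (N : ℤ) r m h j) := by ring
    rw [this]
    exact dvd_sub (hc.mul_left _) (hpD.trans hq)
  have hb := (prime_dvd_gradient hr hp hpD hg).2
  rw [← Int.isCoprime_iff_gcd_eq_one] at hgcd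
  exact hp.not_isUnit (hgcd.isUnit_of_dvd' (Int.dvd_coe_gcd ha hb) (Int.dvd_coe_gcd hc hpD))

/-- The genus character restricted to isotropic vectors modulo `D`, in Hermitian coordinates. -/
def psi (N : ℕ) (D r m a h j c : ℤ) : ℤ :=
  open Classical in
  if D ∣ a * c - binG (N : ℤ) r m h j then genusCharCoeff N D a (r * h + 2 * N * j) c else 0

lemma psi_eq_chi [NeZero N] (hD : IsFundamentalDiscriminant D)
    (hr : r ^ 2 - 4 * N * m = D) {a h j c : ℤ} (hq : D ∣ a * c - binG (N : ℤ) r m h j)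
    {x₁ x₂ w y : ℤ} (hcop : IsCoprime (hermVal N r m a h j c x₁ x₂ w y) D) :
    psi N D r m a h j c = chi D (hermVal N r m a h j c x₁ x₂ w y) := by
  rw [psi, if_pos hq, genusCharCoeff_eq_chi hD hr hq hcop]

lemma psi_of_not_dvd {a h j c : ℤ} (hq : ¬ D ∣ a * c - binG (N : ℤ) r m h j) :
    psi N D r m a h j c = 0 := if_neg hq

lemma exists_coprime_of_psi_ne_zero (hD : IsFundamentalDiscriminant D)
    (hr : r ^ 2 - 4 * N * m = D) {a h j c : ℤ} (hne : psi N D r m a h j c ≠ 0) :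
    D ∣ a * c - binG (N : ℤ) r m h j ∧
      ∃ w y : ℤ, IsCoprime (hermVal N r m a h j c 1 0 w y) D := by
  by_cases hq : D ∣ a * c - binG (N : ℤ) r m h j
  · refine ⟨hq, exists_hermVal_coprime hD hr hq fun p hp hpD ha hc => hne ?_⟩
    rw [psi, if_pos hq, genusCharCoeff_eq_zero hr hq hp hpD ha hc]
  · exact absurd (psi_of_not_dvd hq) hne

/-- Equivariance of `psi` under similitudes of the Hermitian form. -/
lemma psi_eq_of_similitude [NeZero N] (hD : IsFundamentalDiscriminant D)
    (hr : r ^ 2 - 4 * N * m = D) {a h j c a' h' j' c' u : ℤ} (hu : IsCoprime u D)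
    (hq : D ∣ a * c - binG (N : ℤ) r m h j ↔ D ∣ a' * c' - binG (N : ℤ) r m h' j')
    (h1 : ∀ x₁ x₂ w y : ℤ, ∃ x₁' x₂' w' y' : ℤ, D ∣ hermVal N r m a' h' j' c' x₁' x₂' w' y' -
      u * hermVal N r m a h j c x₁ x₂ w y)
    (h2 : ∀ x₁' x₂' w' y' : ℤ, ∃ x₁ x₂ w y : ℤ, D ∣ hermVal N r m a' h' j' c' x₁' x₂' w' y' -
      u * hermVal N r m a h j c x₁ x₂ w y) :
    psi N D r m a' h' j' c' = chi D u * psi N D r m a h j c := by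
  have hcong : ∀ {A B : ℤ}, D ∣ A - u * B → (IsCoprime A D ↔ IsCoprime B D) := by
    rintro A B ⟨k, hk⟩
    have : A = u * B + D * k := by linear_combination hk
    rw [this, IsCoprime.add_mul_left_left_iff, IsCoprime.mul_left_iff]
    exact ⟨fun h => h.2, fun h => ⟨hu, h⟩⟩
  -- Vanishing has to be transferred too: a nonzero value for the primed vector would give, through
  -- `h2`, a value of the other form prime to `D`.
  by_cases hne : psi N D r m a h j c = 0
  · rw [hne, mul_zero]
    by_contra hne'
    obtain ⟨hq', w', y', hc'⟩ := exists_coprime_of_psi_ne_zero hD hr hne'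
    obtain ⟨x₁, x₂, w, y, hd⟩ := h2 1 0 w' y'
    have hc := (hcong hd).mp hc'
    have h3 := psi_eq_chi hD hr (hq.mpr hq') hc
    rw [hne] at h3
    have := chi_mul_self hD hc
    rw [← h3] at this
    omega
  · obtain ⟨hq', w, y, hc⟩ := exists_coprime_of_psi_ne_zero hD hr hne
    obtain ⟨x₁', x₂', w', y', hd⟩ := h1 1 0 w y
    rw [psi_eq_chi hD hr hq' hc, psi_eq_chi hD hr (hq.mp hq') ((hcong hd).mpr hc),
      chi_congr hD hd, chi_mul hD]

end

/-! ### Sums over residue classes -/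

/-- `f` depends only on the residue class modulo `M`. -/
def PeriodicMod (M : ℕ) (f : ℤ → ℂ) : Prop := ∀ x y : ℤ, (M : ℤ) ∣ x - y → f x = f y

namespace PeriodicMod

variable {M : ℕ} {f g : ℤ → ℂ}

lemma mul (hf : PeriodicMod M f) (hg : PeriodicMod M g) : PeriodicMod M fun x => f x * g x :=
  fun x y h => by simp only [hf x y h, hg x y h]

lemma sum {ι : Type*} {s : Finset ι} {F : ι → ℤ → ℂ} (h : ∀ i ∈ s, PeriodicMod M (F i)) :
    PeriodicMod M fun x => ∑ i ∈ s, F i x :=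
  fun x y hxy => Finset.sum_congr rfl fun i hi => h i hi x y hxy

lemma sum_range_eq [NeZero M] (f : ℤ → ℂ) :
    ∑ i ∈ Finset.range M, f i = ∑ z : ZMod M, f (z.val : ℤ) := by
  refine Finset.sum_bij' (fun i _ => (i : ZMod M)) (fun z _ => z.val) (fun _ _ => Finset.mem_univ _)
    (fun z _ => Finset.mem_range.mpr (ZMod.val_lt z))
    (fun i hi => ZMod.val_cast_of_lt (Finset.mem_range.mp hi)) (fun z _ => ZMod.natCast_zmod_val z)
    (fun i hi => ?_)
  rw [ZMod.val_cast_of_lt (Finset.mem_range.mp hi)]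

lemma eq_val [NeZero M] (hf : PeriodicMod M f) {x : ℤ} {z : ZMod M} (h : (x : ZMod M) = z) :
    f x = f (z.val : ℤ) := by
  refine hf _ _ ((ZMod.intCast_zmod_eq_zero_iff_dvd _ M).mp ?_)
  rw [Int.cast_sub, h]
  simp

lemma sum_add [NeZero M] (hf : PeriodicMod M f) (a : ℤ) :
    ∑ i ∈ Finset.range M, f (i + a) = ∑ i ∈ Finset.range M, f i := by
  rw [sum_range_eq fun x => f (x + a), sum_range_eq]
  conv_rhs => rw [← Equiv.sum_comp (Equiv.addRight (a : ZMod M))]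
  exact Finset.sum_congr rfl fun z _ => hf.eq_val (by simp)

lemma sum_mul [NeZero M] (hf : PeriodicMod M f) {u : ℤ} (hu : IsCoprime u M) :
    ∑ i ∈ Finset.range M, f (u * i) = ∑ i ∈ Finset.range M, f i := by
  obtain ⟨w, v, h⟩ := hu
  have h1 : (w : ZMod M) * u = 1 := by
    have := congrArg (Int.cast : ℤ → ZMod M) h
    simpa using this
  rw [sum_range_eq fun x => f (u * x), sum_range_eq]
  let E : ZMod M ≃ ZMod M := ⟨fun z => u * z, fun z => w * z,
    fun z => by linear_combination z * h1, fun z => by linear_combination z * h1⟩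
  conv_rhs => rw [← Equiv.sum_comp E]
  exact Finset.sum_congr rfl fun z _ => hf.eq_val (by simp [E])

lemma sum_range_mul (hf : PeriodicMod M f) (n : ℕ) :
    ∑ i ∈ Finset.range (n * M), f i = n * ∑ i ∈ Finset.range M, f i := by
  induction n with
  | zero => simp
  | succ n ih =>
    rw [add_mul, one_mul, Finset.sum_range_add, ih]
    push_cast
    rw [add_mul, one_mul]
    congr 1
    exact Finset.sum_congr rfl fun i _ => hf _ _ ⟨n, by ring⟩

lemma sum_range_mul_of_support {n D : ℕ} [NeZero n] [NeZero D] (hf : PeriodicMod (n * D) f) (s : ℤ)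
    (hs : ∀ x, ¬ (n : ℤ) ∣ x - s → f x = 0) :
    ∑ i ∈ Finset.range (n * D), f i = ∑ j ∈ Finset.range D, f (s + n * j) := by
  rw [← hf.sum_add s]
  have h0 : ∑ i ∈ Finset.range (n * D), f (i + s) =
      ∑ i ∈ (Finset.range (n * D)).filter (n ∣ ·), f (i + s) := by
    refine (Finset.sum_filter_of_ne fun i _ hi => ?_).symm
    by_contra h
    exact hi (hs _ fun h' => h (by exact_mod_cast (by simpa using h' : (n : ℤ) ∣ i)))
  rw [h0]
  have hn : 0 < n := NeZero.pos n
  refine Finset.sum_nbij' (fun i => i / n) (fun j => n * j) ?_ ?_ ?_ ?_ ?_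
  · intro i hi
    simp only [Finset.mem_filter, Finset.mem_range] at hi ⊢
    exact Nat.div_lt_of_lt_mul hi.1
  · intro j hj
    simp only [Finset.mem_filter, Finset.mem_range] at hj ⊢
    exact ⟨Nat.mul_lt_mul_of_pos_left hj hn, dvd_mul_right _ _⟩
  · intro i hi
    exact Nat.mul_div_cancel' (Finset.mem_filter.mp hi).2
  · intro j _
    exact Nat.mul_div_cancel_left j hn
  · intro i hi
    obtain ⟨j, rfl⟩ := (Finset.mem_filter.mp hi).2
    rw [Nat.mul_div_cancel_left j hn]
    push_cast
    rw [add_comm]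

end PeriodicMod

/-! ### Additive characters -/

lemma e_add (x y : ℂ) : e (x + y) = e x * e y := by
  rw [e, e, e, ← Complex.exp_add, mul_add]

lemma e_zero : e 0 = 1 := by simp [e]

lemma e_int (n : ℤ) : e n = 1 := by
  rw [e]
  exact Complex.exp_eq_one_iff.mpr ⟨n, by ring⟩

lemma e_ne_zero (x : ℂ) : e x ≠ 0 := Complex.exp_ne_zero _

lemma conj_e (x : ℂ) : (starRingEnd ℂ) (e x) = e (-(starRingEnd ℂ) x) := by
  rw [e, e, ← Complex.exp_conj]
  congr 1
  simp only [map_mul, map_ofNat, Complex.conj_ofReal, Complex.conj_I]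
  ring

/-- The additive character `n ↦ e(n/M)` of the integers modulo `M`. -/
def er (M : ℕ) (n : ℤ) : ℂ := e ((n : ℂ) / M)

lemma er_add (M : ℕ) (m n : ℤ) : er M (m + n) = er M m * er M n := by
  rw [er, er, er, ← e_add]
  push_cast
  rw [add_div]

lemma er_zero (M : ℕ) : er M 0 = 1 := by simp [er, e_zero]

lemma er_eq_stdAddChar (M : ℕ) [NeZero M] (n : ℤ) : er M n = ZMod.stdAddChar (n : ZMod M) := by
  rw [ZMod.stdAddChar_coe, er, e, mul_div_assoc]

lemma er_periodic (M : ℕ) [NeZero M] : PeriodicMod M (er M) := by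
  intro x y h
  rw [er_eq_stdAddChar, er_eq_stdAddChar]
  congr 1
  rw [← sub_eq_zero, ← Int.cast_sub]
  exact (ZMod.intCast_zmod_eq_zero_iff_dvd _ M).mpr h

lemma er_periodic_mul (M : ℕ) [NeZero M] (a : ℤ) : PeriodicMod M fun x => er M (x * a) :=
  fun x y h => er_periodic M _ _ (by rw [← sub_mul]; exact h.mul_right _)

lemma conj_er (M : ℕ) (n : ℤ) : (starRingEnd ℂ) (er M n) = er M (-n) := by
  rw [er, conj_e, er]
  simp [neg_div]

lemma er_mul_mul (M n : ℕ) [NeZero n] (a : ℤ) : er (n * M) (n * a) = er M a := by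
  have hn : (n : ℂ) ≠ 0 := Nat.cast_ne_zero.mpr (NeZero.ne n)
  rw [er, er]
  push_cast
  rw [mul_div_mul_left _ _ hn]

lemma sum_er (M : ℕ) [NeZero M] (a : ℤ) :
    ∑ i ∈ Finset.range M, er M (i * a) = if (M : ℤ) ∣ a then (M : ℂ) else 0 := by
  rw [PeriodicMod.sum_range_eq fun x => er M (x * a)]
  have : ∀ z : ZMod M, er M ((z.val : ℤ) * a) = ZMod.stdAddChar (z * (a : ZMod M)) := by
    intro z
    rw [er_eq_stdAddChar]
    simp
  simp only [this]
  rw [AddChar.sum_mulShift _ (ZMod.isPrimitive_stdAddChar M), ZMod.card]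
  simp only [ZMod.intCast_zmod_eq_zero_iff_dvd]
  split_ifs <;> simp

lemma sum_er_mul_conj (M : ℕ) [NeZero M] {s : ℤ} (hs : s * s = 1) {y y' : ℕ}
    (hy : y ∈ Finset.range M) (hy' : y' ∈ Finset.range M) :
    ∑ i ∈ Finset.range M, er M (s * i * y) * (starRingEnd ℂ) (er M (s * i * y')) =
      if y = y' then (M : ℂ) else 0 := by
  have : ∀ i : ℕ, er M (s * i * y) * (starRingEnd ℂ) (er M (s * i * y')) =
      er M (i * (s * (y - y'))) := by
    intro i
    rw [conj_er, ← er_add]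
    congr 1; ring
  simp only [this, sum_er]
  congr 1
  rw [eq_iff_iff]
  constructor
  · intro h
    have h1 : (M : ℤ) ∣ y - y' := by
      have := h.mul_left s
      rwa [← mul_assoc, hs, one_mul] at this
    have h2 := (Nat.modEq_iff_dvd (n := M) (a := y') (b := y)).mpr h1
    rw [Finset.mem_range] at hy hy'
    exact (Nat.ModEq.eq_of_lt_of_lt h2 hy' hy).symm
  · rintro rfl
    simp

/-! ### Rigidity of eigenfunctions of a finite Fourier transform -/

/-- If the Fourier transform of `f` is a multiple of `f` of the right size on the support of `f`,
then it is so everywhere. -/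
theorem fourier_eq_of_eq_on_support {ι : Type*} [DecidableEq ι] (s : Finset ι) (κ : ι → ι → ℂ)
    (n : ℝ)
    (hκ : ∀ y ∈ s, ∀ y' ∈ s,
      ∑ x ∈ s, κ x y * (starRingEnd ℂ) (κ x y') = if y = y' then (n : ℂ) else 0)
    (f : ι → ℂ) (C : ℂ) (hC : ‖C‖ ^ 2 = n)
    (h : ∀ x ∈ s, f x ≠ 0 → ∑ y ∈ s, κ x y * f y = C * f x) :
    ∀ x ∈ s, ∑ y ∈ s, κ x y * f y = C * f x := by
  set F : ι → ℂ := fun x => ∑ y ∈ s, κ x y * f y with hF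
  -- Parseval. The right side equals the sum of `‖C f‖²`, and `‖C f‖ ≤ ‖F‖` holds termwise,
  -- trivially where `f` vanishes. So equality holds in every term, and `F` vanishes where `f` does.
  have hpars : ∑ x ∈ s, ‖F x‖ ^ 2 = n * ∑ y ∈ s, ‖f y‖ ^ 2 := by
    have h1 : ∀ x, ((‖F x‖ ^ 2 : ℝ) : ℂ) =
        ∑ y ∈ s, ∑ y' ∈ s, (κ x y * (starRingEnd ℂ) (κ x y')) * (f y * (starRingEnd ℂ) (f y')) := by
      intro x
      rw [Complex.ofReal_pow, ← Complex.mul_conj']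
      simp only [hF, map_sum, map_mul, Finset.sum_mul_sum]
      refine Finset.sum_congr rfl fun y _ => Finset.sum_congr rfl fun y' _ => by ring
    have h2 : ((∑ x ∈ s, ‖F x‖ ^ 2 : ℝ) : ℂ) = ((n * ∑ y ∈ s, ‖f y‖ ^ 2 : ℝ) : ℂ) := by
      rw [Complex.ofReal_sum]
      simp only [h1]
      rw [Finset.sum_comm]
      push_cast
      rw [Finset.mul_sum]
      refine Finset.sum_congr rfl fun y hy => ?_
      rw [Finset.sum_comm]
      simp only [← Finset.sum_mul]
      rw [Finset.sum_congr rfl fun y' hy' => by rw [hκ y hy y' hy']]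
      simp only [ite_mul, zero_mul, Finset.sum_ite_eq, if_pos hy]
      rw [Complex.mul_conj']
    exact_mod_cast h2
  have hle : ∀ x ∈ s, ‖C * f x‖ ^ 2 ≤ ‖F x‖ ^ 2 := by
    intro x hx
    by_cases hfx : f x = 0
    · rw [hfx]; simp
    · rw [← h x hx hfx]
  have heq : ∑ x ∈ s, ‖C * f x‖ ^ 2 = ∑ x ∈ s, ‖F x‖ ^ 2 := by
    rw [hpars, ← hC, Finset.mul_sum]
    exact Finset.sum_congr rfl fun x _ => by rw [norm_mul, mul_pow]
  have hall := (Finset.sum_eq_sum_iff_of_le hle).mp heq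
  intro x hx
  by_cases hfx : f x = 0
  · have := hall x hx
    rw [hfx] at this ⊢
    have h0 : F x = 0 := by
      have : ‖F x‖ ^ 2 = 0 := by rw [← this]; simp
      exact norm_eq_zero.mp (pow_eq_zero_iff two_ne_zero |>.mp this)
    rw [mul_zero]
    exact h0
  · exact h x hx hfx

/-! ### The Gauss sum -/

section

variable {D : ℤ}

lemma isCoprime_natAbs_right {x : ℤ} (h : IsCoprime x D) : IsCoprime x (D.natAbs : ℤ) := by
  rcases Int.natAbs_eq D with h' | h'
  · rwa [h'] at h
  · rw [h'] at h
    exact (IsCoprime.neg_right_iff _ _).mp h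

lemma chi_periodic (hD : IsFundamentalDiscriminant D) :
    PeriodicMod D.natAbs fun x => (chi D x : ℂ) := by
  intro x y h
  rw [Int.natAbs_dvd] at h
  simp only [chi_congr hD h]

/-- The Gauss sum of the character `(Δ / ·)`. -/
def gauss (D : ℤ) : ℂ := ∑ a ∈ Finset.range D.natAbs, (chi D a : ℂ) * er D.natAbs a

lemma sum_chi_mul_er (hD : IsFundamentalDiscriminant D) (c : ℤ) :
    ∑ a ∈ Finset.range D.natAbs, (chi D a : ℂ) * er D.natAbs (a * c) = chi D c * gauss D := by
  have : NeZero D.natAbs := ⟨by simpa using hD.ne_zero⟩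
  have hper : ∀ c : ℤ, PeriodicMod D.natAbs fun x => (chi D x : ℂ) * er D.natAbs (x * c) :=
    fun c => (chi_periodic hD).mul (er_periodic_mul _ c)
  by_cases hc : IsCoprime c D
  · have h1 : chi D c * ∑ a ∈ Finset.range D.natAbs, (chi D a : ℂ) * er D.natAbs (a * c) =
        gauss D := by
      have hu := isCoprime_natAbs_right hc
      rw [gauss]
      have := (hper 1).sum_mul hu
      simp only [mul_one] at this
      rw [← this, Finset.mul_sum]
      refine Finset.sum_congr rfl fun a _ => ?_
      rw [chi_mul hD, mul_comm c (a : ℤ)]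
      push_cast
      ring
    have h2 : (chi D c : ℂ) * chi D c = 1 := by exact_mod_cast chi_mul_self hD hc
    rw [← h1, ← mul_assoc, h2, one_mul]
  · rw [chi_of_not_coprime hc]
    have : ∃ p : ℤ, Prime p ∧ p ∣ D ∧ p ∣ c := by
      rw [isCoprime_iff_prime hD.ne_zero] at hc
      push Not at hc
      exact hc
    obtain ⟨p, hp, hpD, hpc⟩ := this
    -- The substitution `a ↦ u a` fixes `e(a c / |D|)`, because `p ∣ c`, and reverses the sign of
    -- the character; so the sum equals its own negative.
    obtain ⟨u, hu, hux, hchi⟩ := exists_chi_eq_neg_one hD hp hpD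
    have hu' := isCoprime_natAbs_right hu
    have h1 := (hper c).sum_mul hu'
    have h2 : ∀ a : ℕ, (chi D (u * a) : ℂ) * er D.natAbs (u * a * c) =
        -((chi D a : ℂ) * er D.natAbs (a * c)) := by
      intro a
      rw [chi_mul hD, hchi, er_periodic D.natAbs (u * a * c) (a * c)]
      · push_cast; ring
      · rw [Int.natAbs_dvd]
        rw [show u * a * c - a * c = a * ((u - 1) * c) by ring]
        exact (hux c hpc).mul_left _
    simp only [h2, Finset.sum_neg_distrib] at h1
    push_cast
    rw [zero_mul]
    exact self_eq_neg.mp h1.symm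

/-- The sum of `‖χ(c) gauss‖²` over `c` is computed twice: directly, and through `sum_chi_mul_er` by
orthogonality of additive characters. -/
lemma norm_gauss_sq (hD : IsFundamentalDiscriminant D) : ‖gauss D‖ ^ 2 = D.natAbs := by
  have : NeZero D.natAbs := ⟨by simpa using hD.ne_zero⟩
  set s := Finset.range D.natAbs
  set S : ℂ := ∑ a ∈ s, (chi D a : ℂ) * (starRingEnd ℂ) (chi D a : ℂ) with hS
  have h1 : ∑ c ∈ s, (chi D c * gauss D : ℂ) * (starRingEnd ℂ) (chi D c * gauss D : ℂ) =
      gauss D * (starRingEnd ℂ) (gauss D) * S := by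
    rw [hS, Finset.mul_sum]
    refine Finset.sum_congr rfl fun c _ => ?_
    rw [map_mul]; ring
  have h2 : ∑ c ∈ s, (chi D c * gauss D : ℂ) * (starRingEnd ℂ) (chi D c * gauss D : ℂ) =
      D.natAbs * S := by
    have : ∀ c : ℕ, (chi D c * gauss D : ℂ) * (starRingEnd ℂ) (chi D c * gauss D : ℂ) =
        ∑ a ∈ s, ∑ a' ∈ s, (chi D a : ℂ) * (starRingEnd ℂ) (chi D a' : ℂ) *
          (er D.natAbs (1 * c * a) * (starRingEnd ℂ) (er D.natAbs (1 * c * a'))) := by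
      intro c
      rw [← sum_chi_mul_er hD, map_sum, Finset.sum_mul_sum]
      refine Finset.sum_congr rfl fun a _ => Finset.sum_congr rfl fun a' _ => ?_
      rw [map_mul, one_mul, mul_comm (c : ℤ), mul_comm (c : ℤ)]; ring
    simp only [this]
    rw [Finset.sum_comm, hS, Finset.mul_sum]
    refine Finset.sum_congr rfl fun a ha => ?_
    rw [Finset.sum_comm]
    simp only [← Finset.mul_sum]
    rw [Finset.sum_congr rfl fun a' ha' => by
      rw [sum_er_mul_conj D.natAbs (one_mul 1) ha ha']]
    simp only [mul_ite, mul_zero, Finset.sum_ite_eq, if_pos ha]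
    ring
  have hS0 : S ≠ 0 := by
    have hre : S = ((∑ a ∈ s, (chi D a : ℝ) ^ 2 : ℝ) : ℂ) := by
      rw [hS]
      push_cast
      refine Finset.sum_congr rfl fun a _ => ?_
      rw [map_intCast, pow_two]
    rw [hre]
    have hpos : 0 < ∑ a ∈ s, (chi D a : ℝ) ^ 2 := by
      refine Finset.sum_pos' (fun _ _ => sq_nonneg _) ⟨1 % D.natAbs, ?_, ?_⟩
      · exact Finset.mem_range.mpr (Nat.mod_lt _ (NeZero.pos _))
      · have : chi D ((1 % D.natAbs : ℕ) : ℤ) = 1 := by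
          rw [← chi_one hD]
          refine chi_congr hD ?_
          rw [← Int.natAbs_dvd]
          push_cast
          exact Int.modEq_iff_dvd.mp (Int.mod_modEq 1 _).symm
        rw [this]; norm_num
    exact_mod_cast hpos.ne'
  have h3 := mul_right_cancel₀ hS0 (h1.symm.trans h2)
  rw [Complex.mul_conj'] at h3
  exact_mod_cast h3

lemma gauss_ne_zero (hD : IsFundamentalDiscriminant D) : gauss D ≠ 0 := by
  intro h
  have := norm_gauss_sq hD
  rw [h] at this
  rw [norm_zero] at this
  have h0 : D.natAbs = 0 := by
    have h1 : ((D.natAbs : ℕ) : ℝ) = 0 := by rw [← this]; norm_num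
    exact_mod_cast h1
  exact hD.ne_zero (Int.natAbs_eq_zero.mp h0)

end

/-! ### Symmetries of the genus character modulo the discriminant -/

section

variable {N : ℕ} {D r m : ℤ}

lemma dvd_iff_cast {x y : ℤ} : D ∣ x - y ↔ (x : ZMod D.natAbs) = (y : ZMod D.natAbs) := by
  rw [← Int.natAbs_dvd, ← ZMod.intCast_zmod_eq_zero_iff_dvd, Int.cast_sub, sub_eq_zero]

lemma psi_congr [NeZero N] (hD : IsFundamentalDiscriminant D) (hr : r ^ 2 - 4 * N * m = D)
    {a h j c a' h' j' c' : ℤ} (ha : D ∣ a - a') (hh : D ∣ h - h') (hj : D ∣ j - j')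
    (hc : D ∣ c - c') : psi N D r m a h j c = psi N D r m a' h' j' c' := by
  rw [dvd_iff_cast] at ha hh hj hc
  have key := psi_eq_of_similitude hD hr (u := 1) (a := a') (h := h') (j := j') (c := c')
    (a' := a) (h' := h) (j' := j) (c' := c) isCoprime_one_left
    (by rw [dvd_iff_cast, dvd_iff_cast]; simp [binG, ha, hh, hj, hc])
    (fun x₁ x₂ w y => ⟨x₁, x₂, w, y, by
      rw [dvd_iff_cast]; simp [hermVal, binB, binG, ha, hh, hj, hc]⟩)
    (fun x₁ x₂ w y => ⟨x₁, x₂, w, y, by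
      rw [dvd_iff_cast]; simp [hermVal, binB, binG, ha, hh, hj, hc]⟩)
  rw [key, chi_one hD, one_mul]

/-- Shifting `(w', y')` by the product of `(x₁, x₂)` and `(w, y)` turns the values of one Hermitian
form into those of the other, and the determinant `a c - binG` is unchanged. -/
lemma psi_shear_right [NeZero N] (hD : IsFundamentalDiscriminant D) (hr : r ^ 2 - 4 * N * m = D)
    (a h j c w y : ℤ) : psi N D r m a (h + a * w) (j + a * y)
      (c + (binB (N : ℤ) r m h j w y + a * binG (N : ℤ) r m w y)) = psi N D r m a h j c := by
  have key := psi_eq_of_similitude hD hr (u := 1) (a := a) (h := h) (j := j) (c := c)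
    (a' := a) (h' := h + a * w) (j' := j + a * y)
    (c' := c + (binB (N : ℤ) r m h j w y + a * binG (N : ℤ) r m w y)) isCoprime_one_left
    (by
      rw [show a * (c + (binB (N : ℤ) r m h j w y + a * binG (N : ℤ) r m w y)) -
        binG (N : ℤ) r m (h + a * w) (j + a * y) = a * c - binG (N : ℤ) r m h j by
          unfold binB binG; ring])
    (fun x₁ x₂ w' y' => ⟨x₁, x₂, w' - (x₁ * w + x₂ * (N * y + r * w)),
      y' - (x₁ * y - x₂ * m * w), by
      rw [show hermVal N r m a (h + a * w) (j + a * y)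
        (c + (binB (N : ℤ) r m h j w y + a * binG (N : ℤ) r m w y)) x₁ x₂
        (w' - (x₁ * w + x₂ * (N * y + r * w))) (y' - (x₁ * y - x₂ * m * w)) -
        1 * hermVal N r m a h j c x₁ x₂ w' y' = 0 by unfold hermVal binB binG; ring]
      exact dvd_zero _⟩)
    (fun x₁ x₂ w' y' => ⟨x₁, x₂, w' + (x₁ * w + x₂ * (N * y + r * w)),
      y' + (x₁ * y - x₂ * m * w), by
      rw [show hermVal N r m a (h + a * w) (j + a * y)
        (c + (binB (N : ℤ) r m h j w y + a * binG (N : ℤ) r m w y)) x₁ x₂ w' y' -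
        1 * hermVal N r m a h j c x₁ x₂
        (w' + (x₁ * w + x₂ * (N * y + r * w))) (y' + (x₁ * y - x₂ * m * w)) = 0 by
        unfold hermVal binB binG; ring]
      exact dvd_zero _⟩)
  rw [key, chi_one hD, one_mul]

/-- The same argument, with `(x₁, x₂)` shifted by an amount bilinear in `(w, y)` and `(w', y')`. -/
lemma psi_shear_left [NeZero N] (hD : IsFundamentalDiscriminant D) (hr : r ^ 2 - 4 * N * m = D)
    (a h j c w y : ℤ) :
    psi N D r m (a + (binB (N : ℤ) r m h j w y + c * binG (N : ℤ) r m w y))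
      (h + c * w) (j + c * y) c = psi N D r m a h j c := by
  have key := psi_eq_of_similitude hD hr (u := 1) (a := a) (h := h) (j := j) (c := c)
    (a' := a + (binB (N : ℤ) r m h j w y + c * binG (N : ℤ) r m w y))
    (h' := h + c * w) (j' := j + c * y) (c' := c) isCoprime_one_left
    (by
      rw [show (a + (binB (N : ℤ) r m h j w y + c * binG (N : ℤ) r m w y)) * c -
        binG (N : ℤ) r m (h + c * w) (j + c * y) = a * c - binG (N : ℤ) r m h j by
          unfold binB binG; ring])
    (fun x₁ x₂ w' y' => ⟨x₁ - (N * y * y' + m * w * w' + r * w * y'), x₂ - (y * w' - w * y'),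
      w', y', by
      rw [show hermVal N r m (a + (binB (N : ℤ) r m h j w y + c * binG (N : ℤ) r m w y))
        (h + c * w) (j + c * y) c
        (x₁ - (N * y * y' + m * w * w' + r * w * y')) (x₂ - (y * w' - w * y')) w' y' -
        1 * hermVal N r m a h j c x₁ x₂ w' y' = 0 by unfold hermVal binB binG; ring]
      exact dvd_zero _⟩)
    (fun x₁ x₂ w' y' => ⟨x₁ + (N * y * y' + m * w * w' + r * w * y'), x₂ + (y * w' - w * y'),
      w', y', by
      rw [show hermVal N r m (a + (binB (N : ℤ) r m h j w y + c * binG (N : ℤ) r m w y))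
        (h + c * w) (j + c * y) c x₁ x₂ w' y' -
        1 * hermVal N r m a h j c (x₁ + (N * y * y' + m * w * w' + r * w * y'))
          (x₂ + (y * w' - w * y')) w' y' = 0 by unfold hermVal binB binG; ring]
      exact dvd_zero _⟩)
  rw [key, chi_one hD, one_mul]

/-- At `x₁ = x₂ = 0` the Hermitian form takes the value `a binG(w, y)`; as `binG` has discriminant
`D` and positive coefficient `N`, the character sees only `a`. -/
lemma psi_of_coprime [NeZero N] (hD : IsFundamentalDiscriminant D) (hr : r ^ 2 - 4 * N * m = D)
    {a h j c : ℤ} (ha : IsCoprime a D) (hq : D ∣ a * c - binG (N : ℤ) r m h j) :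
    psi N D r m a h j c = chi D a := by
  obtain ⟨w, y, hwy⟩ := exists_binG_coprime hD hr
  have h1 : hermVal N r m a h j c 0 0 w y = a * binG (N : ℤ) r m w y := by
    unfold hermVal binB; ring
  have h2 : chi D (binG (N : ℤ) r m w y) = 1 := by
    have h3 : binG (N : ℤ) r m w y = N * y ^ 2 + r * y * w + m * w ^ 2 := by unfold binG; ring
    rw [h3] at hwy ⊢
    exact chi_form_value hD (by exact_mod_cast NeZero.pos N) hr y w hwy
  rw [psi_eq_chi hD hr hq (x₁ := 0) (x₂ := 0) (w := w) (y := y) (h1 ▸ ha.mul_left hwy), h1,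
    chi_mul hD, h2, mul_one]

lemma psi_zero_zero_zero [NeZero N] (hD : IsFundamentalDiscriminant D)
    (hr : r ^ 2 - 4 * N * m = D) {c : ℤ} (hc : IsCoprime c D) :
    psi N D r m 0 0 0 c = chi D c := by
  have h1 : hermVal N r m 0 0 0 c 1 0 0 0 = c := by unfold hermVal binB; ring
  rw [psi_eq_chi hD hr (x₁ := 1) (x₂ := 0) (w := 0) (y := 0) (by simp [binG]) (by rwa [h1]), h1]

lemma psi_smul [NeZero N] (hD : IsFundamentalDiscriminant D) (hr : r ^ 2 - 4 * N * m = D)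
    {u : ℤ} (hu : IsCoprime u D) (a h j c : ℤ) :
    psi N D r m (u * a) (u * h) (u * j) (u * c) = chi D u * psi N D r m a h j c := by
  have hv : ∀ x₁ x₂ w y, hermVal N r m (u * a) (u * h) (u * j) (u * c) x₁ x₂ w y -
      u * hermVal N r m a h j c x₁ x₂ w y = 0 := by
    intros; unfold hermVal binB binG; ring
  refine psi_eq_of_similitude hD hr hu ?_
    (fun x₁ x₂ w y => ⟨x₁, x₂, w, y, by rw [hv]; exact dvd_zero _⟩)
    (fun x₁ x₂ w y => ⟨x₁, x₂, w, y, by rw [hv]; exact dvd_zero _⟩)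
  rw [show u * a * (u * c) - binG (N : ℤ) r m (u * h) (u * j) =
    u * (u * (a * c - binG (N : ℤ) r m h j)) by unfold binG; ring]
  exact ⟨fun h => (h.mul_left _).mul_left _, fun h =>
    hu.symm.dvd_of_dvd_mul_left (hu.symm.dvd_of_dvd_mul_left h)⟩

/-- Neither `b = r h + 2 N j` nor the isotropy modulo `D` changes. In this sense only the class of
`h` modulo `2 N` matters. -/
lemma psi_add_translate [NeZero N] (hr : r ^ 2 - 4 * N * m = D) (a h j c q : ℤ) :
    psi N D r m a (h + 2 * N * q) (j - r * q) c = psi N D r m a h j c := by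
  unfold psi
  rw [show r * (h + 2 * N * q) + 2 * N * (j - r * q) = r * h + 2 * N * j by ring]
  congr 1
  rw [eq_iff_iff, show a * c - binG (N : ℤ) r m (h + 2 * N * q) (j - r * q) =
    a * c - binG (N : ℤ) r m h j + D * (q * h + N * q ^ 2) by rw [← hr]; unfold binG; ring]
  exact (Int.dvd_add_left (dvd_mul_right _ _))

lemma psi_periodic [NeZero N] (hD : IsFundamentalDiscriminant D) (hr : r ^ 2 - 4 * N * m = D) :
    (∀ h j c, PeriodicMod D.natAbs fun a => (psi N D r m a h j c : ℂ)) ∧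
    (∀ a j c, PeriodicMod D.natAbs fun h => (psi N D r m a h j c : ℂ)) ∧
    (∀ a h c, PeriodicMod D.natAbs fun j => (psi N D r m a h j c : ℂ)) ∧
    (∀ a h j, PeriodicMod D.natAbs fun c => (psi N D r m a h j c : ℂ)) := by
  refine ⟨fun h j c x y hxy => ?_, fun a j c x y hxy => ?_, fun a h c x y hxy => ?_,
    fun a h j x y hxy => ?_⟩ <;> rw [Int.natAbs_dvd] at hxy <;> simp only [Int.cast_inj]
  · exact psi_congr hD hr hxy (by simp) (by simp) (by simp)
  · exact psi_congr hD hr (by simp) hxy (by simp) (by simp)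
  · exact psi_congr hD hr (by simp) (by simp) hxy (by simp)
  · exact psi_congr hD hr (by simp) (by simp) (by simp) hxy

/-- For `a` prime to `D`, each `(h, j)` admits exactly one isotropic `c`, which contributes `χ(a)`.
Otherwise, scaling `(h, j, c)` by the unit of `exists_chi_eq_neg_one` changes the sign while `a`
stays fixed modulo `D`, so the sum vanishes. -/
lemma sum_psi [NeZero N] (hD : IsFundamentalDiscriminant D) (hr : r ^ 2 - 4 * N * m = D) (a : ℤ) :
    ∑ h ∈ Finset.range D.natAbs, ∑ j ∈ Finset.range D.natAbs, ∑ c ∈ Finset.range D.natAbs,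
      (psi N D r m a h j c : ℂ) = D.natAbs ^ 2 * chi D a := by
  have : NeZero D.natAbs := ⟨by simpa using hD.ne_zero⟩
  obtain ⟨-, p2, p3, p4⟩ := psi_periodic hD hr (N := N)
  by_cases ha : IsCoprime a D
  · obtain ⟨u, v, huv⟩ := ha
    have hu : IsCoprime u D := ⟨a, v, by rw [mul_comm a u]; exact huv⟩
    have h1 : ∀ h j : ℤ, ∑ c ∈ Finset.range D.natAbs, (psi N D r m a h j c : ℂ) = chi D a := by
      intro h j
      -- As `u a ≡ 1`, the substitution of `u (c + binG)` for `c` moves the isotropic solution to `c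
      -- = 0`.
      rw [← (p4 a h j).sum_mul (isCoprime_natAbs_right hu)]
      have hp : PeriodicMod D.natAbs fun c => (psi N D r m a h j (u * c) : ℂ) :=
        fun x y hxy => p4 a h j _ _ (by rw [← mul_sub]; exact hxy.mul_left _)
      rw [← hp.sum_add (binG (N : ℤ) r m h j), Finset.sum_eq_single 0]
      · rw [psi_of_coprime hD hr ⟨u, v, huv⟩]
        refine ⟨-v * binG (N : ℤ) r m h j, ?_⟩
        push_cast
        linear_combination (binG (N : ℤ) r m h j) * huv
      · intro c hc hc0
        rw [psi_of_not_dvd, Int.cast_zero]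
        intro hd
        have hd' : D ∣ (c : ℤ) := by
          obtain ⟨k, hk⟩ := hd
          refine ⟨k + v * (c + binG (N : ℤ) r m h j), ?_⟩
          linear_combination hk - (c + binG (N : ℤ) r m h j) * huv
        have hd2 : D.natAbs ∣ c := by exact_mod_cast Int.natAbs_dvd.mpr hd'
        exact hc0 (Nat.eq_zero_of_dvd_of_lt hd2 (Finset.mem_range.mp hc))
      · intro h
        exact absurd (Finset.mem_range.mpr (NeZero.pos _)) h
    simp only [h1, Finset.sum_const, Finset.card_range, nsmul_eq_mul]
    ring
  · rw [chi_of_not_coprime ha]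
    have : ∃ p : ℤ, Prime p ∧ p ∣ D ∧ p ∣ a := by
      rw [isCoprime_iff_prime hD.ne_zero] at ha
      push Not at ha
      exact ha
    obtain ⟨p, hp, hpD, hpa⟩ := this
    obtain ⟨u, hu, hux, hchi⟩ := exists_chi_eq_neg_one hD hp hpD
    have key : ∀ h j c : ℤ, (psi N D r m a (u * h) (u * j) (u * c) : ℂ) = -psi N D r m a h j c := by
      intro h j c
      have := psi_smul hD hr hu a h j c (N := N)
      rw [hchi] at this
      rw [psi_congr hD hr (a' := u * a) (h' := u * h) (j' := u * j) (c' := u * c) ?_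
        (by simp) (by simp) (by simp), this]
      · push_cast; ring
      · have := hux a hpa
        rw [show a - u * a = -((u - 1) * a) by ring, dvd_neg]
        exact this
    push_cast
    rw [mul_zero]
    refine self_eq_neg.mp ?_
    have q3 : ∀ h : ℤ, PeriodicMod D.natAbs fun j => ∑ c ∈ Finset.range D.natAbs,
        (psi N D r m a h j c : ℂ) := fun h => PeriodicMod.sum fun c _ => p3 a h c
    have q2 : PeriodicMod D.natAbs fun h => ∑ j ∈ Finset.range D.natAbs,
        ∑ c ∈ Finset.range D.natAbs, (psi N D r m a h j c : ℂ) :=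
      PeriodicMod.sum fun j _ => PeriodicMod.sum fun c _ => p2 a j c
    conv_lhs =>
      rw [← q2.sum_mul (isCoprime_natAbs_right hu)]
      enter [2, h]
      rw [← (q3 (u * h)).sum_mul (isCoprime_natAbs_right hu)]
      enter [2, j]
      rw [← (p4 a (u * h) (u * j)).sum_mul (isCoprime_natAbs_right hu)]
    simp only [key, Finset.sum_neg_distrib]

end

/-! ### The finite Fourier transform of the genus character -/

section

variable {N : ℕ} {D r m : ℤ}

/-- The bilinear form on the coordinates `(a, h, j, c)`. -/
def quadPair (N r m a h j c a' h' j' c' : ℤ) : ℤ := a * c' + a' * c - binB N r m h j h' j'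

/-- The Fourier transform of `psi` over the residue classes modulo the discriminant. -/
def psiHat (N : ℕ) (D r m a' h' j' c' : ℤ) : ℂ :=
  ∑ a ∈ Finset.range D.natAbs, ∑ h ∈ Finset.range D.natAbs, ∑ j ∈ Finset.range D.natAbs,
    ∑ c ∈ Finset.range D.natAbs,
      (psi N D r m a h j c : ℂ) * er D.natAbs (quadPair N r m a h j c a' h' j' c')

lemma sum_shear {M : ℕ} [NeZero M] {F : ℤ → ℤ → ℤ → ℤ → ℂ}
    (h2 : ∀ a j c, PeriodicMod M fun h => F a h j c)
    (h3 : ∀ a h c, PeriodicMod M fun j => F a h j c)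
    (h4 : ∀ a h j, PeriodicMod M fun c => F a h j c) (w y : ℤ) (φ : ℤ → ℤ → ℤ → ℤ) :
    ∑ a ∈ Finset.range M, ∑ h ∈ Finset.range M, ∑ j ∈ Finset.range M, ∑ c ∈ Finset.range M,
      F a (h + a * w) (j + a * y) (c + φ a h j) =
    ∑ a ∈ Finset.range M, ∑ h ∈ Finset.range M, ∑ j ∈ Finset.range M, ∑ c ∈ Finset.range M,
      F a h j c := by
  refine Finset.sum_congr rfl fun a _ => ?_
  have e1 : ∀ h j : ℤ, ∑ c ∈ Finset.range M, F a (h + a * w) (j + a * y) (c + φ a h j) =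
      ∑ c ∈ Finset.range M, F a (h + a * w) (j + a * y) c := fun h j => (h4 _ _ _).sum_add _
  simp only [e1]
  have e2 : ∀ h : ℤ, ∑ j ∈ Finset.range M, ∑ c ∈ Finset.range M,
      F a (h + a * w) (j + a * y) c = ∑ j ∈ Finset.range M, ∑ c ∈ Finset.range M,
      F a (h + a * w) j c := fun h => by
    have : PeriodicMod M fun j => ∑ c ∈ Finset.range M, F a (h + a * w) j c :=
      PeriodicMod.sum fun c _ => h3 _ _ _
    exact this.sum_add _
  simp only [e2]
  have : PeriodicMod M fun h => ∑ j ∈ Finset.range M, ∑ c ∈ Finset.range M, F a h j c :=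
    PeriodicMod.sum fun j _ => PeriodicMod.sum fun c _ => h2 _ _ _
  exact this.sum_add _

lemma sum_comm_outer {M : ℕ} (F : ℤ → ℤ → ℤ → ℤ → ℂ) :
    ∑ a ∈ Finset.range M, ∑ h ∈ Finset.range M, ∑ j ∈ Finset.range M, ∑ c ∈ Finset.range M,
      F a h j c =
    ∑ c ∈ Finset.range M, ∑ h ∈ Finset.range M, ∑ j ∈ Finset.range M, ∑ a ∈ Finset.range M,
      F a h j c := by
  rw [Finset.sum_comm]
  simp only [Finset.sum_comm (s := Finset.range M) (t := Finset.range M)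
    (f := fun (j c : ℕ) => F _ _ j c)]
  rw [Finset.sum_congr rfl fun h _ => Finset.sum_comm, Finset.sum_comm]
  refine Finset.sum_congr rfl fun c _ => Finset.sum_congr rfl fun h _ => Finset.sum_comm

variable (N) in
lemma psi_mul_er_periodic [NeZero N] (hD : IsFundamentalDiscriminant D)
    (hr : r ^ 2 - 4 * N * m = D) (a' h' j' c' : ℤ) :
    (∀ h j c, PeriodicMod D.natAbs fun a =>
      (psi N D r m a h j c : ℂ) * er D.natAbs (quadPair N r m a h j c a' h' j' c')) ∧
    (∀ a j c, PeriodicMod D.natAbs fun h =>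
      (psi N D r m a h j c : ℂ) * er D.natAbs (quadPair N r m a h j c a' h' j' c')) ∧
    (∀ a h c, PeriodicMod D.natAbs fun j =>
      (psi N D r m a h j c : ℂ) * er D.natAbs (quadPair N r m a h j c a' h' j' c')) ∧
    (∀ a h j, PeriodicMod D.natAbs fun c =>
      (psi N D r m a h j c : ℂ) * er D.natAbs (quadPair N r m a h j c a' h' j' c')) := by
  have : NeZero D.natAbs := ⟨by simpa using hD.ne_zero⟩
  obtain ⟨p1, p2, p3, p4⟩ := psi_periodic hD hr (N := N)
  refine ⟨fun h j c => (p1 h j c).mul ?_, fun a j c => (p2 a j c).mul ?_,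
    fun a h c => (p3 a h c).mul ?_, fun a h j => (p4 a h j).mul ?_⟩ <;>
  · intro x y hxy
    refine er_periodic _ _ _ ?_
    rw [Int.natAbs_dvd, dvd_iff_cast] at hxy ⊢
    simp [quadPair, binB, hxy]

lemma psiHat_congr [NeZero N] (hD : D ≠ 0) {a h j c a' h' j' c' : ℤ} (ha : D ∣ a - a')
    (hh : D ∣ h - h') (hj : D ∣ j - j') (hc : D ∣ c - c') :
    psiHat N D r m a h j c = psiHat N D r m a' h' j' c' := by
  have : NeZero D.natAbs := ⟨by simpa using hD⟩
  unfold psiHat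
  refine Finset.sum_congr rfl fun _ _ => Finset.sum_congr rfl fun _ _ =>
    Finset.sum_congr rfl fun _ _ => Finset.sum_congr rfl fun _ _ => ?_
  congr 1
  refine er_periodic _ _ _ ?_
  rw [dvd_iff_cast] at ha hh hj hc
  rw [Int.natAbs_dvd, dvd_iff_cast]
  simp [quadPair, binB, ha, hh, hj, hc]

/-- The shear is an isometry of `quadPair`, permutes the residue classes and preserves `psi`; the
Fourier transform inherits the invariance. -/
lemma psiHat_shear_right [NeZero N] (hD : IsFundamentalDiscriminant D)
    (hr : r ^ 2 - 4 * N * m = D) (a h j c w y : ℤ) :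
    psiHat N D r m a (h + a * w) (j + a * y)
      (c + (binB (N : ℤ) r m h j w y + a * binG (N : ℤ) r m w y)) = psiHat N D r m a h j c := by
  have : NeZero D.natAbs := ⟨by simpa using hD.ne_zero⟩
  obtain ⟨-, p2, p3, p4⟩ := psi_mul_er_periodic N hD hr a (h + a * w) (j + a * y)
      (c + (binB (N : ℤ) r m h j w y + a * binG (N : ℤ) r m w y))
  rw [psiHat, psiHat, ← sum_shear p2 p3 p4 w y
    (fun a h j => binB (N : ℤ) r m h j w y + a * binG (N : ℤ) r m w y)]
  refine Finset.sum_congr rfl fun _ _ => Finset.sum_congr rfl fun _ _ =>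
    Finset.sum_congr rfl fun _ _ => Finset.sum_congr rfl fun _ _ => ?_
  rw [psi_shear_right hD hr]
  congr 2
  unfold quadPair binB binG; ring

lemma psiHat_shear_left [NeZero N] (hD : IsFundamentalDiscriminant D)
    (hr : r ^ 2 - 4 * N * m = D) (a h j c w y : ℤ) :
    psiHat N D r m (a + (binB (N : ℤ) r m h j w y + c * binG (N : ℤ) r m w y))
      (h + c * w) (j + c * y) c = psiHat N D r m a h j c := by
  have : NeZero D.natAbs := ⟨by simpa using hD.ne_zero⟩
  obtain ⟨p1, p2, p3, -⟩ := psi_mul_er_periodic N hD hr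
    (a + (binB (N : ℤ) r m h j w y + c * binG (N : ℤ) r m w y)) (h + c * w) (j + c * y) c
  -- `sum_shear` is used with the roles of `a` and `c` interchanged, hence the reordering by
  -- `sum_comm_outer`.
  have key := sum_shear (M := D.natAbs) (F := fun c' h' j' a' => (psi N D r m a' h' j' c' : ℂ) *
    er D.natAbs (quadPair N r m a' h' j' c'
      (a + (binB (N : ℤ) r m h j w y + c * binG (N : ℤ) r m w y)) (h + c * w) (j + c * y) c))
    (fun c' j' a' => p2 a' j' c') (fun c' h' a' => p3 a' h' c') (fun c' h' j' => p1 h' j' c') w y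
    (fun c h j => binB (N : ℤ) r m h j w y + c * binG (N : ℤ) r m w y)
  rw [psiHat, psiHat,
    sum_comm_outer fun a' h' j' c' => (psi N D r m a' h' j' c' : ℂ) *
      er D.natAbs (quadPair N r m a' h' j' c'
      (a + (binB (N : ℤ) r m h j w y + c * binG (N : ℤ) r m w y)) (h + c * w) (j + c * y) c),
    sum_comm_outer fun a' h' j' c' => (psi N D r m a' h' j' c' : ℂ) *
      er D.natAbs (quadPair N r m a' h' j' c' a h j c), ← key]
  refine Finset.sum_congr rfl fun _ _ => Finset.sum_congr rfl fun _ _ =>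
    Finset.sum_congr rfl fun _ _ => Finset.sum_congr rfl fun _ _ => ?_
  rw [psi_shear_left hD hr]
  congr 2
  unfold quadPair binB binG; ring

/-- The pairing with `(0, 0, 0, c)` involves only `a`. The three inner sums are evaluated by
`sum_psi`, and the outer one is a Gauss sum. -/
lemma psiHat_zero_zero_zero [NeZero N] (hD : IsFundamentalDiscriminant D)
    (hr : r ^ 2 - 4 * N * m = D) (c : ℤ) :
    psiHat N D r m 0 0 0 c = D.natAbs ^ 2 * (chi D c * gauss D) := by
  have h1 : ∀ a h j c', quadPair N r m a h j c' 0 0 0 c = a * c := by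
    intros; unfold quadPair binB; ring
  simp only [psiHat, h1, ← Finset.sum_mul, sum_psi hD hr]
  rw [← sum_chi_mul_er hD, Finset.mul_sum]
  exact Finset.sum_congr rfl fun _ _ => by ring

/-- On its support, the genus character is an eigenfunction of the Fourier transform. -/
theorem psiHat_eq [NeZero N] (hD : IsFundamentalDiscriminant D)
    (hr : r ^ 2 - 4 * N * m = D) {a h j c : ℤ} (hne : psi N D r m a h j c ≠ 0) :
    psiHat N D r m a h j c = D.natAbs ^ 2 * gauss D * psi N D r m a h j c := by
  -- A right shear replaces `c` by a value prime to `D`. A left shear then removes `h` and `j`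
  -- modulo `D`, and by isotropy also `a`. At `(0, 0, 0, γ)` both sides are known.
  obtain ⟨hq, w, y, hc⟩ := exists_coprime_of_psi_ne_zero hD hr hne
  rw [← psiHat_shear_right hD hr a h j c w y, ← psi_shear_right hD hr a h j c w y]
  have hq' : D ∣ a * (c + (binB (N : ℤ) r m h j w y + a * binG (N : ℤ) r m w y)) -
      binG (N : ℤ) r m (h + a * w) (j + a * y) := by
    rw [show a * (c + (binB (N : ℤ) r m h j w y + a * binG (N : ℤ) r m w y)) -
        binG (N : ℤ) r m (h + a * w) (j + a * y) = a * c - binG (N : ℤ) r m h j by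
          unfold binB binG; ring]
    exact hq
  have hc' : IsCoprime (c + (binB (N : ℤ) r m h j w y + a * binG (N : ℤ) r m w y)) D := by
    convert hc using 1
    unfold hermVal binB; ring
  generalize c + (binB (N : ℤ) r m h j w y + a * binG (N : ℤ) r m w y) = γ at *
  generalize h + a * w = h₁ at *
  generalize j + a * y = j₁ at *
  obtain ⟨u, v, huv⟩ := hc'
  rw [← psiHat_shear_left hD hr a h₁ j₁ γ (-(u * h₁)) (-(u * j₁)),
    ← psi_shear_left hD hr a h₁ j₁ γ (-(u * h₁)) (-(u * j₁))]
  have d1 : D ∣ h₁ + γ * -(u * h₁) - 0 := ⟨v * h₁, by linear_combination (-h₁) * huv⟩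
  have d2 : D ∣ j₁ + γ * -(u * j₁) - 0 := ⟨v * j₁, by linear_combination (-j₁) * huv⟩
  have d0 : D ∣ a + (binB (N : ℤ) r m h₁ j₁ (-(u * h₁)) (-(u * j₁)) +
      γ * binG (N : ℤ) r m (-(u * h₁)) (-(u * j₁))) - 0 := by
    obtain ⟨k, hk⟩ := hq'
    refine ⟨u * k + v * a - u * v * binG (N : ℤ) r m h₁ j₁, ?_⟩
    unfold binG binB at *
    linear_combination u * hk - a * huv +
      (u * (m * h₁ ^ 2 + r * h₁ * j₁ + N * j₁ ^ 2)) * huv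
  rw [psiHat_congr hD.ne_zero d0 d1 d2 (c' := γ) (by simp),
    psi_congr hD hr d0 d1 d2 (c' := γ) (by simp), psiHat_zero_zero_zero hD hr,
    psi_zero_zero_zero hD hr ⟨u, v, huv⟩]
  ring

end

/-! ### The Schwartz function `φ_h` on the finite quadratic space -/

section

variable {N : ℕ} {D r m : ℤ}

/-- The genus character restricted to `λ ≡ r h` modulo `L` with `Q(λ) ≡ Δ Q(h)` modulo `Δ`, in
terms of the coefficients `a, b, c` of `λ`. -/
def phi (N : ℕ) (D r h a b c : ℤ) : ℤ :=
  open Classical in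
  if (2 * N : ℤ) ∣ b - r * h ∧ 4 * N * D ∣ b ^ 2 - 4 * N * a * c - D * h ^ 2
  then genusCharCoeff N D a b c else 0

/-- By `r² - 4 N m = D`, the number `b² - 4 N a c - D h²` is `-4 N` times the determinant `a c -
binG`. -/
lemma phi_eq_psi [NeZero N] (hr : r ^ 2 - 4 * N * m = D) (h a j c : ℤ) :
    phi N D r h a (r * h + 2 * N * j) c = psi N D r m a h j c := by
  have hN : (N : ℤ) ≠ 0 := by exact_mod_cast NeZero.ne N
  unfold phi psi
  congr 1
  rw [eq_iff_iff]
  have h1 : (r * h + 2 * N * j) ^ 2 - 4 * N * a * c - D * h ^ 2 =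
      4 * N * -(a * c - binG (N : ℤ) r m h j) := by rw [← hr]; unfold binG; ring
  rw [h1, mul_dvd_mul_iff_left (by positivity), dvd_neg]
  exact ⟨fun h => h.2, fun h => ⟨⟨j, by ring⟩, h⟩⟩

lemma phi_of_not_dvd {h a b c : ℤ} (hb : ¬ (2 * N : ℤ) ∣ b - r * h) : phi N D r h a b c = 0 :=
  if_neg fun h => hb h.1

lemma phi_periodic [NeZero N] (hD : IsFundamentalDiscriminant D) (hr : r ^ 2 - 4 * N * m = D) :
    (∀ a b c, PeriodicMod (2 * N) fun h => (phi N D r h a b c : ℂ)) ∧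
    (∀ h b c, PeriodicMod D.natAbs fun a => (phi N D r h a b c : ℂ)) ∧
    (∀ h a c, PeriodicMod (2 * N * D.natAbs) fun b => (phi N D r h a b c : ℂ)) ∧
    (∀ h a b, PeriodicMod D.natAbs fun c => (phi N D r h a b c : ℂ)) := by
  have key : ∀ h h' a a' b b' c c' : ℤ, (2 * N : ℤ) ∣ h - h' → D ∣ a - a' → 2 * N * D ∣ b - b' →
      D ∣ c - c' → phi N D r h a b c = phi N D r h' a' b' c' := by
    intro h h' a a' b b' c c' hh ha hb hc
    obtain ⟨q, hq⟩ := hh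
    obtain ⟨t, ht⟩ := hb
    have hiff : (2 * N : ℤ) ∣ b - r * h ↔ (2 * N : ℤ) ∣ b' - r * h' := by
      rw [show b - r * h = b' - r * h' + 2 * N * (D * t - r * q) by
        linear_combination ht - r * hq]
      exact Int.dvd_add_left (dvd_mul_right _ _)
    by_cases hb' : (2 * N : ℤ) ∣ b' - r * h'
    · obtain ⟨j, hj⟩ := hb'
      have e1 : b' = r * h' + 2 * N * j := by linear_combination hj
      have e2 : b = r * h + 2 * N * (j - r * q + D * t) := by linear_combination ht - r * hq + hj
      rw [e1, e2, phi_eq_psi hr, phi_eq_psi hr, show h = h' + 2 * N * q by linear_combination hq,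
        ← psi_add_translate hr a' h' j c' q]
      exact psi_congr hD hr ha (by simp) ⟨t, by ring⟩ hc
    · rw [phi_of_not_dvd hb', phi_of_not_dvd (mt hiff.mp hb')]
  refine ⟨fun a b c x y hxy => ?_, fun h b c x y hxy => ?_, fun h a c x y hxy => ?_,
    fun h a b x y hxy => ?_⟩ <;> simp only [Int.cast_inj]
  · exact key _ _ _ _ _ _ _ _ (by exact_mod_cast hxy) (by simp) (by simp) (by simp)
  · exact key _ _ _ _ _ _ _ _ (by simp) (Int.natAbs_dvd.mp hxy) (by simp) (by simp)
  · refine key _ _ _ _ _ _ _ _ (by simp) (by simp) ?_ (by simp)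
    push_cast at hxy
    exact (mul_dvd_mul_left _ (dvd_abs _ _ |>.mpr dvd_rfl)).trans hxy
  · exact key _ _ _ _ _ _ _ _ (by simp) (by simp) (by simp) (Int.natAbs_dvd.mp hxy)

/-- The kernel of the Fourier transform on `ℤ/2N × L'/ΔL`. -/
def discKernel (N : ℕ) (D h a b c h' a' b' c' : ℤ) : ℂ :=
  er (2 * N) (D.sign * h' * h) * er (2 * N * D.natAbs) (-1 * b' * b) *
    (er D.natAbs (1 * a' * c) * er D.natAbs (1 * c' * a))

lemma discKernel_periodic [NeZero N] (hD : D ≠ 0) :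
    (∀ a b c h' a' b' c', PeriodicMod (2 * N) fun h => discKernel N D h a b c h' a' b' c') ∧
    (∀ h b c h' a' b' c', PeriodicMod D.natAbs fun a => discKernel N D h a b c h' a' b' c') ∧
    (∀ h a c h' a' b' c', PeriodicMod (2 * N * D.natAbs)
      fun b => discKernel N D h a b c h' a' b' c') ∧
    (∀ h a b h' a' b' c', PeriodicMod D.natAbs fun c => discKernel N D h a b c h' a' b' c') := by
  have : NeZero D.natAbs := ⟨by simpa using hD⟩
  have key : ∀ (M : ℕ) [NeZero M] (u x y : ℤ), (M : ℤ) ∣ x - y → er M (u * x) = er M (u * y) :=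
    fun M _ u x y h => er_periodic M _ _ (by rw [← mul_sub]; exact h.mul_left _)
  refine ⟨fun a b c h' a' b' c' x y hxy => ?_, fun h b c h' a' b' c' x y hxy => ?_,
    fun h a c h' a' b' c' x y hxy => ?_, fun h a b h' a' b' c' x y hxy => ?_⟩ <;>
  · simp only [discKernel]
    rw [key _ _ x y hxy]

lemma discKernel_swap (h a b c h' a' b' c' : ℤ) :
    discKernel N D h a b c h' a' b' c' = discKernel N D h' a' b' c' h a b c := by
  unfold discKernel
  rw [show D.sign * h' * h = D.sign * h * h' by ring, show -1 * b' * b = -1 * b * b' by ring,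
    show 1 * a' * c = 1 * c * a' by ring, show 1 * c' * a = 1 * a * c' by ring,
    mul_comm (er D.natAbs (1 * c * a'))]

/-- On the support `b = r h + 2 N j`, and `r² - 4 N m = D` merges the characters in `h` and in `b`
into the bilinear form `binB`. The sign of `D` in the kernel is there because `|D| sign(D) = D`. -/
lemma discKernel_of_support [NeZero N] (hD : D ≠ 0) (hr : r ^ 2 - 4 * N * m = D)
    (h a j c h' a' j' c' : ℤ) :
    discKernel N D h a (r * h + 2 * N * j) c h' a' (r * h' + 2 * N * j') c' =
      er D.natAbs (quadPair N r m a h j c a' h' j' c') := by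
  have : NeZero D.natAbs := ⟨by simpa using hD⟩
  unfold discKernel
  have hs : |D| * D.sign = D := by
    rw [mul_comm, ← Int.natCast_natAbs]
    exact Int.sign_mul_natAbs D
  rw [mul_comm (2 * N) D.natAbs, ← er_mul_mul (2 * N) D.natAbs (D.sign * h' * h), ← er_add,
    show (D.natAbs : ℤ) * (D.sign * h' * h) + -1 * (r * h' + 2 * N * j') * (r * h + 2 * N * j) =
      ((2 * N : ℕ) : ℤ) * -binB (N : ℤ) r m h j h' j' by
        push_cast
        unfold binB
        linear_combination h' * h * hs - h * h' * hr, mul_comm D.natAbs (2 * N), er_mul_mul,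
    ← er_add, ← er_add]
  congr 1
  unfold quadPair
  ring

/-- The index set of the Fourier transform on `ℤ/2N × L'/ΔL`. -/
def discIndex (N : ℕ) (D : ℤ) : Finset (ℕ × ℕ × ℕ × ℕ) :=
  Finset.range (2 * N) ×ˢ Finset.range D.natAbs ×ˢ Finset.range (2 * N * D.natAbs) ×ˢ
    Finset.range D.natAbs

lemma discKernel_orthogonal [NeZero N] (hD : D ≠ 0) (y y' : ℕ × ℕ × ℕ × ℕ) (hy : y ∈ discIndex N D)
    (hy' : y' ∈ discIndex N D) :
    ∑ x ∈ discIndex N D,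
      discKernel N D y.1 y.2.1 y.2.2.1 y.2.2.2 x.1 x.2.1 x.2.2.1 x.2.2.2 *
      (starRingEnd ℂ) (discKernel N D y'.1 y'.2.1 y'.2.2.1 y'.2.2.2 x.1 x.2.1 x.2.2.1 x.2.2.2) =
    if y = y' then ((((2 * N * D.natAbs : ℕ) : ℝ) ^ 2 * D.natAbs : ℝ) : ℂ) else 0 := by
  have : NeZero D.natAbs := ⟨by simpa using hD⟩
  have hs : D.sign * D.sign = 1 := by
    rcases lt_or_gt_of_ne hD with h | h
    · rw [Int.sign_eq_neg_one_of_neg h]; rfl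
    · rw [Int.sign_eq_one_of_pos h]; rfl
  obtain ⟨h, a, b, c⟩ := y
  obtain ⟨h', a', b', c'⟩ := y'
  simp only [discIndex, Finset.mem_product] at hy hy'
  simp only [discIndex, Finset.sum_product, discKernel, map_mul]
  have e : ∀ p q s t : ℕ,
      er (2 * N) (D.sign * p * h) * er (2 * N * D.natAbs) (-1 * s * b) *
        (er D.natAbs (1 * q * c) * er D.natAbs (1 * t * a)) *
        ((starRingEnd ℂ) (er (2 * N) (D.sign * p * h')) *
        (starRingEnd ℂ) (er (2 * N * D.natAbs) (-1 * s * b')) *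
        ((starRingEnd ℂ) (er D.natAbs (1 * q * c')) *
        (starRingEnd ℂ) (er D.natAbs (1 * t * a')))) =
      (er (2 * N) (D.sign * p * h) * (starRingEnd ℂ) (er (2 * N) (D.sign * p * h'))) *
      ((er D.natAbs (1 * q * c) * (starRingEnd ℂ) (er D.natAbs (1 * q * c'))) *
      ((er (2 * N * D.natAbs) (-1 * s * b) *
        (starRingEnd ℂ) (er (2 * N * D.natAbs) (-1 * s * b'))) *
      (er D.natAbs (1 * t * a) * (starRingEnd ℂ) (er D.natAbs (1 * t * a'))))) := by
    intros; ring
  simp only [e, ← Finset.mul_sum, ← Finset.sum_mul]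
  rw [sum_er_mul_conj _ hs hy.1 hy'.1, sum_er_mul_conj _ (one_mul 1) hy.2.2.2 hy'.2.2.2,
    sum_er_mul_conj _ (by norm_num) hy.2.2.1 hy'.2.2.1,
    sum_er_mul_conj _ (one_mul 1) hy.2.1 hy'.2.1]
  simp only [Prod.mk.injEq]
  generalize D.natAbs = d
  by_cases h1 : h = h' <;> by_cases h2 : a = a' <;> by_cases h3 : b = b' <;>
    by_cases h4 : c = c' <;> simp [h1, h2, h3, h4]
  ring

/-- As a function of `h` the inner sum has the periods `2 N` and `|D|`; summing over `2 N |D|`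
consecutive values in two ways compares the sums over the two kinds of classes. -/
lemma sum_psi_eq_psiHat [NeZero N] (hD : IsFundamentalDiscriminant D)
    (hr : r ^ 2 - 4 * N * m = D) (a' h' j' c' : ℤ) :
    D.natAbs * ∑ h ∈ Finset.range (2 * N), ∑ a ∈ Finset.range D.natAbs,
      ∑ j ∈ Finset.range D.natAbs, ∑ c ∈ Finset.range D.natAbs,
      (psi N D r m a h j c : ℂ) * er D.natAbs (quadPair N r m a h j c a' h' j' c') =
    2 * N * psiHat N D r m a' h' j' c' := by
  have : NeZero D.natAbs := ⟨by simpa using hD.ne_zero⟩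
  obtain ⟨-, p2, p3, -⟩ := psi_mul_er_periodic N hD hr a' h' j' c'
  set t : ℤ → ℂ := fun h => ∑ a ∈ Finset.range D.natAbs,
      ∑ j ∈ Finset.range D.natAbs, ∑ c ∈ Finset.range D.natAbs,
      (psi N D r m a h j c : ℂ) * er D.natAbs (quadPair N r m a h j c a' h' j' c') with ht
  have t1 : PeriodicMod D.natAbs t := PeriodicMod.sum fun a _ => PeriodicMod.sum fun j _ =>
    PeriodicMod.sum fun c _ => p2 a j c
  have t2 : PeriodicMod (2 * N) t := by
    intro x y hxy
    obtain ⟨q, hq⟩ := hxy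
    obtain rfl : x = y + 2 * N * q := by push_cast at hq; linear_combination hq
    simp only [ht]
    refine Finset.sum_congr rfl fun a _ => ?_
    have hp : PeriodicMod D.natAbs fun j => ∑ c ∈ Finset.range D.natAbs,
        (psi N D r m a (y + 2 * N * q) j c : ℂ) *
          er D.natAbs (quadPair N r m a (y + 2 * N * q) j c a' h' j' c') :=
      PeriodicMod.sum fun c _ => p3 a (y + 2 * N * q) c
    rw [← hp.sum_add (-(r * q))]
    refine Finset.sum_congr rfl fun j _ => Finset.sum_congr rfl fun c _ => ?_
    rw [← sub_eq_add_neg, psi_add_translate hr]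
    congr 1
    refine er_periodic _ _ _ (Int.natAbs_dvd.mpr ⟨q * h', ?_⟩)
    rw [← hr]
    unfold quadPair binB
    ring
  have e1 := t2.sum_range_mul D.natAbs
  have e2 := t1.sum_range_mul (2 * N)
  rw [mul_comm D.natAbs] at e1
  rw [e1] at e2
  rw [e2]
  push_cast
  congr 1
  rw [psiHat, Finset.sum_comm]

variable (N) in
lemma sum_phi_mul_discKernel [NeZero N] (hD : IsFundamentalDiscriminant D)
    (hr : r ^ 2 - 4 * N * m = D) {h' a' b' c' : ℤ} (hne : phi N D r h' a' b' c' ≠ 0) :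
    ∑ h ∈ Finset.range (2 * N), ∑ a ∈ Finset.range D.natAbs,
      ∑ b ∈ Finset.range (2 * N * D.natAbs), ∑ c ∈ Finset.range D.natAbs,
        discKernel N D h a b c h' a' b' c' * (phi N D r h a b c : ℂ) =
    2 * N * D.natAbs * gauss D * phi N D r h' a' b' c' := by
  have : NeZero D.natAbs := ⟨by simpa using hD.ne_zero⟩
  have hD0 : (D.natAbs : ℂ) ≠ 0 := Nat.cast_ne_zero.mpr (NeZero.ne _)
  obtain ⟨-, -, p3, -⟩ := phi_periodic hD hr (N := N)
  obtain ⟨-, -, q3, -⟩ := discKernel_periodic hD.ne_zero (N := N)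
  have hb : (2 * N : ℤ) ∣ b' - r * h' := by
    by_contra hb
    exact hne (phi_of_not_dvd hb)
  obtain ⟨j', hj'⟩ := hb
  obtain rfl : b' = r * h' + 2 * N * j' := by linear_combination hj'
  rw [phi_eq_psi hr] at hne ⊢
  have e1 : ∀ h a : ℤ, ∑ b ∈ Finset.range (2 * N * D.natAbs), ∑ c ∈ Finset.range D.natAbs,
        discKernel N D h a b c h' a' (r * h' + 2 * N * j') c' * (phi N D r h a b c : ℂ) =
      ∑ j ∈ Finset.range D.natAbs, ∑ c ∈ Finset.range D.natAbs,
        (psi N D r m a h j c : ℂ) * er D.natAbs (quadPair N r m a h j c a' h' j' c') := by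
    intro h a
    have hp : PeriodicMod (2 * N * D.natAbs) fun b => ∑ c ∈ Finset.range D.natAbs,
        discKernel N D h a b c h' a' (r * h' + 2 * N * j') c' * (phi N D r h a b c : ℂ) :=
      PeriodicMod.sum fun c _ => (q3 _ _ _ _ _ _ _).mul (p3 _ _ _)
    rw [hp.sum_range_mul_of_support (r * h)]
    · refine Finset.sum_congr rfl fun j _ => Finset.sum_congr rfl fun c _ => ?_
      push_cast
      rw [discKernel_of_support hD.ne_zero hr, phi_eq_psi hr, mul_comm]
    · intro x hx
      refine Finset.sum_eq_zero fun c _ => ?_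
      rw [phi_of_not_dvd (by exact_mod_cast hx)]
      simp
  simp only [e1]
  refine mul_left_cancel₀ hD0 ?_
  rw [sum_psi_eq_psiHat hD hr, psiHat_eq hD hr hne]
  ring

variable (N) in
/-- The functions `φ_h` form an eigenvector of the Fourier transform on `ℤ/2N × L'/ΔL`. -/
theorem sum_phi_mul_discKernel_eq [NeZero N] (hD : IsFundamentalDiscriminant D)
    (hr : r ^ 2 - 4 * N * m = D) (h' a' b' c' : ℤ) :
    ∑ h ∈ Finset.range (2 * N), ∑ a ∈ Finset.range D.natAbs,
      ∑ b ∈ Finset.range (2 * N * D.natAbs), ∑ c ∈ Finset.range D.natAbs,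
        discKernel N D h a b c h' a' b' c' * (phi N D r h a b c : ℂ) =
    2 * N * D.natAbs * gauss D * phi N D r h' a' b' c' := by
  have : NeZero D.natAbs := ⟨by simpa using hD.ne_zero⟩
  obtain ⟨p1, p2, p3, p4⟩ := phi_periodic hD hr (N := N)
  obtain ⟨q1, q2, q3, q4⟩ := discKernel_periodic hD.ne_zero (N := N)
  -- On the support the equation is `sum_phi_mul_discKernel`, and by `norm_gauss_sq` the eigenvalue
  -- has the size that Parseval requires. The class `h` is treated as one more variable because the
  -- transform of a single `φ_h` mixes all of them.
  have key := fourier_eq_of_eq_on_support (discIndex N D)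
    (fun x y => discKernel N D y.1 y.2.1 y.2.2.1 y.2.2.2 x.1 x.2.1 x.2.2.1 x.2.2.2)
    (((2 * N * D.natAbs : ℕ) : ℝ) ^ 2 * D.natAbs)
    (fun y hy y' hy' => discKernel_orthogonal hD.ne_zero y y' hy hy')
    (fun x => (phi N D r x.1 x.2.1 x.2.2.1 x.2.2.2 : ℂ)) (2 * N * D.natAbs * gauss D) (by
      rw [norm_mul, mul_pow, norm_gauss_sq hD]
      congr 2
      exact_mod_cast Complex.norm_natCast (2 * N * D.natAbs))
    (fun x hx hne => by
      simp only [discIndex, Finset.sum_product]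
      exact sum_phi_mul_discKernel N hD hr (by exact_mod_cast hne))
  have red : ∀ (M : ℕ) [NeZero M] (x : ℤ), ∃ x₀ ∈ Finset.range M, (M : ℤ) ∣ x - (x₀ : ℕ) := by
    intro M _ x
    have hM : (M : ℤ) ≠ 0 := by exact_mod_cast NeZero.ne M
    have h0 := Int.emod_nonneg x hM
    have h1 := Int.emod_lt_of_pos x (by exact_mod_cast NeZero.pos M : (0 : ℤ) < M)
    refine ⟨(x % M).toNat, Finset.mem_range.mpr (by omega), ?_⟩
    rw [Int.toNat_of_nonneg h0]
    exact Int.dvd_self_sub_emod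
  obtain ⟨h₀, hh, dh⟩ := red (2 * N) h'
  obtain ⟨a₀, ha, da⟩ := red D.natAbs a'
  obtain ⟨b₀, hb, db⟩ := red (2 * N * D.natAbs) b'
  obtain ⟨c₀, hc, dc⟩ := red D.natAbs c'
  have h1 := key (h₀, a₀, b₀, c₀) (by
    simp only [discIndex, Finset.mem_product]; exact ⟨hh, ha, hb, hc⟩)
  simp only [discIndex, Finset.sum_product] at h1
  have hphi : (phi N D r h' a' b' c' : ℂ) = phi N D r h₀ a₀ b₀ c₀ := by
    exact (p1 _ _ _ _ _ dh).trans ((p2 _ _ _ _ _ da).trans ((p3 _ _ _ _ _ db).trans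
      (p4 _ _ _ _ _ dc)))
  rw [hphi, ← h1]
  refine Finset.sum_congr rfl fun h _ => Finset.sum_congr rfl fun a _ =>
    Finset.sum_congr rfl fun b _ => Finset.sum_congr rfl fun c _ => ?_
  congr 1
  rw [discKernel_swap, discKernel_swap h a b c]
  exact (q1 _ _ _ _ _ _ _ _ _ dh).trans ((q2 _ _ _ _ _ _ _ _ _ da).trans
    ((q3 _ _ _ _ _ _ _ _ _ db).trans (q4 _ _ _ _ _ _ _ _ _ dc)))

variable (N) in
/-- The Fourier transform of `φ_h` over `L'/ΔL`. -/
theorem fourier_phi [NeZero N] (hD : IsFundamentalDiscriminant D)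
    (hr : r ^ 2 - 4 * N * m = D) {h : ℕ} (hh : h ∈ Finset.range (2 * N)) (a' b' c' : ℤ) :
    ∑ a ∈ Finset.range D.natAbs, ∑ b ∈ Finset.range (2 * N * D.natAbs),
      ∑ c ∈ Finset.range D.natAbs, (phi N D r h a b c : ℂ) *
        (er (2 * N * D.natAbs) (-(b' * b)) * er D.natAbs (a' * c + c' * a)) =
    D.natAbs * gauss D * ∑ h' ∈ Finset.range (2 * N),
      er (2 * N) (-(D.sign * h * h')) * phi N D r h' a' b' c' := by
  have hs : D.sign * D.sign = 1 := by
    rcases lt_or_gt_of_ne hD.ne_zero with h | h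
    · rw [Int.sign_eq_neg_one_of_neg h]; rfl
    · rw [Int.sign_eq_one_of_pos h]; rfl
  have hN0 : ((2 * N : ℕ) : ℂ) ≠ 0 := Nat.cast_ne_zero.mpr (NeZero.ne _)
  refine mul_left_cancel₀ hN0 ?_
  set F : ℕ → ℂ := fun h => ∑ a ∈ Finset.range D.natAbs, ∑ b ∈ Finset.range (2 * N * D.natAbs),
      ∑ c ∈ Finset.range D.natAbs, (phi N D r h a b c : ℂ) *
        (er (2 * N * D.natAbs) (-(b' * b)) * er D.natAbs (a' * c + c' * a)) with hF
  have h1 : ∀ h' : ℕ, ∑ h ∈ Finset.range (2 * N), er (2 * N) (D.sign * h' * h) * F h =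
      2 * N * D.natAbs * gauss D * phi N D r h' a' b' c' := by
    intro h'
    rw [← sum_phi_mul_discKernel_eq N hD hr]
    refine Finset.sum_congr rfl fun h _ => ?_
    simp only [hF, Finset.mul_sum]
    refine Finset.sum_congr rfl fun a _ =>
      Finset.sum_congr rfl fun b _ => Finset.sum_congr rfl fun c _ => ?_
    rw [discKernel, er_add]
    simp only [one_mul, neg_mul]
    ring
  -- Fourier inversion in `h` alone isolates the transform of a single `φ_h`.
  have h2 : ∑ h' ∈ Finset.range (2 * N), er (2 * N) (-(D.sign * h * h')) *
      ∑ h₁ ∈ Finset.range (2 * N), er (2 * N) (D.sign * h' * h₁) * F h₁ = (2 * N : ℕ) * F h := by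
    simp only [Finset.mul_sum]
    rw [Finset.sum_comm]
    have : ∀ h₁ ∈ Finset.range (2 * N), ∑ h' ∈ Finset.range (2 * N),
        er (2 * N) (-(D.sign * h * h')) * (er (2 * N) (D.sign * h' * h₁) * F h₁) =
        if h₁ = h then (2 * N : ℕ) * F h₁ else 0 := by
      intro h₁ hh₁
      have := sum_er_mul_conj (2 * N) hs hh₁ hh
      rw [← ite_zero_mul, ← this, Finset.sum_mul]
      refine Finset.sum_congr rfl fun h' _ => ?_
      rw [conj_er, show D.sign * h * h' = D.sign * h' * h by ring]
      ring
    rw [Finset.sum_congr rfl this, Finset.sum_ite_eq' , if_pos hh]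
  rw [← h2]
  simp only [h1]
  push_cast
  simp only [Finset.mul_sum]
  exact Finset.sum_congr rfl fun _ _ => by ring

end

/-! ### Adapted coordinates -/

/-- The coefficients of two isotropic vectors `l`, `l'` of `L` with `(l, l') = 1`. -/
structure HypPair (N : ℕ) where
  (a₀ b₀ c₀ a₁ b₁ c₁ : ℤ)
  iso₀ : N * b₀ ^ 2 = a₀ * c₀
  iso₁ : N * b₁ ^ 2 = a₁ * c₁
  pair : 2 * N * b₀ * b₁ - a₀ * c₁ - a₁ * c₀ = 1

namespace HypPair

variable {N : ℕ} (P : HypPair N)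

/-- The coefficients of a generator of the orthogonal complement of `l`, `l'` in `L'`. -/
def kA : ℤ := P.a₀ * P.b₁ - P.a₁ * P.b₀
/-- Second coefficient of the generator of `K'`. -/
def kB : ℤ := P.a₀ * P.c₁ - P.a₁ * P.c₀
/-- Third coefficient of the generator of `K'`. -/
def kC : ℤ := P.b₀ * P.c₁ - P.c₀ * P.b₁

/-- The coefficients of `x k + m l + n l'`, where `k` generates `K'`. -/
def toA (x m n : ℤ) : ℤ := x * P.kA + m * P.a₀ + n * P.a₁
/-- The second coefficient in terms of adapted coordinates. -/
def toB (x m n : ℤ) : ℤ := x * P.kB + 2 * N * (m * P.b₀ + n * P.b₁)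
/-- The third coefficient in terms of adapted coordinates. -/
def toC (x m n : ℤ) : ℤ := x * P.kC + m * P.c₀ + n * P.c₁

/-- The coordinates of the vector with coefficients `a, b, c`. -/
def ofX (a b c : ℤ) : ℤ := b * P.kB - 2 * N * (a * P.kC + P.kA * c)
/-- The second adapted coordinate. -/
def ofM (a b c : ℤ) : ℤ := b * P.b₁ - a * P.c₁ - P.a₁ * c
/-- The third adapted coordinate. -/
def ofN (a b c : ℤ) : ℤ := b * P.b₀ - a * P.c₀ - P.a₀ * c

/-- The generator `k` of `K'` has `Q(k) = 1 / (4 N)`. In particular `kB` is its own inverse modulo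
`4 N`. -/
lemma kB_sq : P.kB ^ 2 - 4 * N * P.kA * P.kC = 1 := by
  have h0 := P.iso₀
  have h1 := P.iso₁
  have h2 := P.pair
  unfold kA kB kC; grind

lemma pairing (x m n x' m' n' : ℤ) : P.toB x m n * P.toB x' m' n' -
    2 * N * (P.toA x m n * P.toC x' m' n' + P.toA x' m' n' * P.toC x m n) =
    x * x' + 2 * N * (m * n' + m' * n) := by
  have h0 := P.iso₀
  have h1 := P.iso₁
  have h2 := P.pair
  unfold toA toB toC kA kB kC; grind

lemma disc (x m n : ℤ) : P.toB x m n ^ 2 - 4 * N * P.toA x m n * P.toC x m n =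
    x ^ 2 + 4 * N * m * n := by
  linear_combination P.pairing x m n x m n

lemma toA_of (a b c : ℤ) : P.toA (P.ofX a b c) (P.ofM a b c) (P.ofN a b c) = a := by
  have h0 := P.iso₀
  have h1 := P.iso₁
  have h2 := P.pair
  unfold toA ofX ofM ofN kA kB kC; grind

lemma toB_of (a b c : ℤ) : P.toB (P.ofX a b c) (P.ofM a b c) (P.ofN a b c) = b := by
  have h0 := P.iso₀
  have h1 := P.iso₁
  have h2 := P.pair
  unfold toB ofX ofM ofN kA kB kC; grind

lemma toC_of (a b c : ℤ) : P.toC (P.ofX a b c) (P.ofM a b c) (P.ofN a b c) = c := by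
  have h0 := P.iso₀
  have h1 := P.iso₁
  have h2 := P.pair
  unfold toC ofX ofM ofN kA kB kC; grind

lemma ofX_to (x m n : ℤ) : P.ofX (P.toA x m n) (P.toB x m n) (P.toC x m n) = x := by
  have h0 := P.iso₀
  have h1 := P.iso₁
  have h2 := P.pair
  unfold ofX toA toB toC kA kB kC; grind

lemma ofM_to (x m n : ℤ) : P.ofM (P.toA x m n) (P.toB x m n) (P.toC x m n) = m := by
  have h0 := P.iso₀
  have h1 := P.iso₁
  have h2 := P.pair
  unfold ofM toA toB toC kA kB kC; grind

lemma ofN_to (x m n : ℤ) : P.ofN (P.toA x m n) (P.toB x m n) (P.toC x m n) = n := by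
  have h0 := P.iso₀
  have h1 := P.iso₁
  have h2 := P.pair
  unfold ofN toA toB toC kA kB kC; grind

lemma isCoprime_kB : IsCoprime P.kB ((2 * N : ℕ) : ℤ) :=
  ⟨P.kB, -(2 * P.kA * P.kC), by push_cast; linear_combination P.kB_sq⟩

lemma dvd_kB_mul {x : ℤ} : (2 * N : ℤ) ∣ P.kB * x ↔ (2 * N : ℤ) ∣ x :=
  ⟨fun h => (by exact_mod_cast P.isCoprime_kB.symm : IsCoprime (2 * N : ℤ) P.kB).dvd_of_dvd_mul_left
    h, fun h => h.mul_left _⟩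

/-- The change of coordinates is invertible over the integers, so it permutes triples of residue
classes for every modulus. -/
lemma sum_change [NeZero N] {M : ℕ} [NeZero M] {F : ℤ → ℤ → ℤ → ℂ}
    (h1 : ∀ b c, PeriodicMod M fun a => F a b c) (h2 : ∀ a c, PeriodicMod M fun b => F a b c)
    (h3 : ∀ a b, PeriodicMod M fun c => F a b c) :
    ∑ x ∈ Finset.range M, ∑ m ∈ Finset.range M, ∑ n ∈ Finset.range M,
      F (P.toA x m n) (P.toB x m n) (P.toC x m n) =
    ∑ a ∈ Finset.range M, ∑ b ∈ Finset.range M, ∑ c ∈ Finset.range M, F a b c := by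
  have hF : ∀ a b c a' b' c' : ℤ, (a : ZMod M) = a' → (b : ZMod M) = b' → (c : ZMod M) = c' →
      F a b c = F a' b' c' := by
    intro a b c a' b' c' ha hb hc
    rw [← sub_eq_zero, ← Int.cast_sub, ZMod.intCast_zmod_eq_zero_iff_dvd] at ha hb hc
    exact (h1 _ _ _ _ ha).trans ((h2 _ _ _ _ hb).trans (h3 _ _ _ _ hc))
  have tr : ∀ G : ℤ → ℤ → ℤ → ℂ, ∑ a ∈ Finset.range M, ∑ b ∈ Finset.range M,
      ∑ c ∈ Finset.range M, G a b c =
      ∑ z : ZMod M × ZMod M × ZMod M, G z.1.val z.2.1.val z.2.2.val := by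
    intro G
    rw [PeriodicMod.sum_range_eq fun a => ∑ b ∈ Finset.range M, ∑ c ∈ Finset.range M, G a b c,
      Fintype.sum_prod_type]
    refine Finset.sum_congr rfl fun a _ => ?_
    rw [PeriodicMod.sum_range_eq fun b => ∑ c ∈ Finset.range M, G _ b c, Fintype.sum_prod_type]
    refine Finset.sum_congr rfl fun b _ => ?_
    rw [PeriodicMod.sum_range_eq fun c => G _ _ c]
  rw [tr F, tr fun x m n => F (P.toA x m n) (P.toB x m n) (P.toC x m n)]
  let T : ZMod M × ZMod M × ZMod M → ZMod M × ZMod M × ZMod M := fun z =>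
    (P.toA z.1.val z.2.1.val z.2.2.val, P.toB z.1.val z.2.1.val z.2.2.val,
      P.toC z.1.val z.2.1.val z.2.2.val)
  let U : ZMod M × ZMod M × ZMod M → ZMod M × ZMod M × ZMod M := fun z =>
    (P.ofX z.1.val z.2.1.val z.2.2.val, P.ofM z.1.val z.2.1.val z.2.2.val,
      P.ofN z.1.val z.2.1.val z.2.2.val)
  let E : (ZMod M × ZMod M × ZMod M) ≃ (ZMod M × ZMod M × ZMod M) := ⟨T, U, fun z => by
      obtain ⟨x, m, n⟩ := z
      have e1 := congrArg (Int.cast : ℤ → ZMod M) (P.ofX_to x.val m.val n.val)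
      have e2 := congrArg (Int.cast : ℤ → ZMod M) (P.ofM_to x.val m.val n.val)
      have e3 := congrArg (Int.cast : ℤ → ZMod M) (P.ofN_to x.val m.val n.val)
      simp [T, U, ofX, ofM, ofN] at e1 e2 e3 ⊢
      exact ⟨e1, e2, e3⟩, fun z => by
      obtain ⟨x, m, n⟩ := z
      have e1 := congrArg (Int.cast : ℤ → ZMod M) (P.toA_of x.val m.val n.val)
      have e2 := congrArg (Int.cast : ℤ → ZMod M) (P.toB_of x.val m.val n.val)
      have e3 := congrArg (Int.cast : ℤ → ZMod M) (P.toC_of x.val m.val n.val)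
      simp [T, U, toA, toB, toC] at e1 e2 e3 ⊢
      exact ⟨e1, e2, e3⟩⟩
  conv_rhs => rw [← Equiv.sum_comp E]
  refine Finset.sum_congr rfl fun z _ => hF _ _ _ _ _ _ ?_ ?_ ?_ <;> simp [E, T]

end HypPair

/-! ### The Fourier transform in adapted coordinates -/

section

variable {N : ℕ} {D r m₀ : ℤ} (P : HypPair N)

/-- `φ_h` at the vector `x k + m l + n l'`, where `h` is the class of `h k`. -/
def wgt (P : HypPair N) (D r h x m n : ℤ) : ℤ :=
  phi N D r (P.kB * h) (P.toA x m n) (P.toB x m n) (P.toC x m n)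

/-- The class of `h k` has second coefficient `kB h`. Since `kB` is invertible modulo `2 N` with
`kB² ≡ 1` modulo `4 N`, it drops out of both conditions. -/
lemma wgt_eq_ite (h x m n : ℤ) : wgt P D r h x m n =
    open Classical in
    if (2 * N : ℤ) ∣ x - r * h ∧ 4 * N * D ∣ x ^ 2 + 4 * N * m * n - D * h ^ 2
    then genusCharCoeff N D (P.toA x m n) (P.toB x m n) (P.toC x m n) else 0 := by
  unfold wgt phi
  congr 1
  rw [eq_iff_iff]
  refine and_congr ?_ ?_
  · rw [show P.toB x m n - r * (P.kB * h) =
      P.kB * (x - r * h) + 2 * N * (m * P.b₀ + n * P.b₁) by unfold HypPair.toB; ring,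
      Int.dvd_add_left (dvd_mul_right _ _), P.dvd_kB_mul]
  · rw [P.disc, show x ^ 2 + 4 * N * m * n - D * (P.kB * h) ^ 2 =
      x ^ 2 + 4 * N * m * n - D * h ^ 2 + 4 * N * D * -(P.kA * P.kC * h ^ 2) by
        linear_combination (-D * h ^ 2) * P.kB_sq]
    exact Int.dvd_add_left (dvd_mul_right _ _)

lemma wgt_of_not_dvd {h x m n : ℤ} (hx : ¬ (2 * N : ℤ) ∣ x - r * h) : wgt P D r h x m n = 0 := by
  rw [wgt_eq_ite, if_neg fun h => hx h.1]

lemma wgt_of_not_dvd' {h x m n : ℤ} (hx : ¬ 4 * N * D ∣ x ^ 2 + 4 * N * m * n - D * h ^ 2) :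
    wgt P D r h x m n = 0 := by
  rw [wgt_eq_ite, if_neg fun h => hx h.2]

lemma phi_congr [NeZero N] (hD : IsFundamentalDiscriminant D) (hr : r ^ 2 - 4 * N * m₀ = D)
    {h h' a a' b b' c c' : ℤ} (hh : ((2 * N : ℕ) : ℤ) ∣ h - h') (ha : (D.natAbs : ℤ) ∣ a - a')
    (hb : ((2 * N * D.natAbs : ℕ) : ℤ) ∣ b - b') (hc : (D.natAbs : ℤ) ∣ c - c') :
    (phi N D r h a b c : ℂ) = phi N D r h' a' b' c' := by
  obtain ⟨p1, p2, p3, p4⟩ := phi_periodic hD hr (N := N)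
  exact (p1 _ _ _ _ _ hh).trans ((p2 _ _ _ _ _ ha).trans ((p3 _ _ _ _ _ hb).trans
    (p4 _ _ _ _ _ hc)))

lemma wgt_congr [NeZero N] (hD : IsFundamentalDiscriminant D) (hr : r ^ 2 - 4 * N * m₀ = D)
    {h h' x x' m m' n n' : ℤ} (hh : ((2 * N : ℕ) : ℤ) ∣ h - h')
    (hx : ((2 * N * D.natAbs : ℕ) : ℤ) ∣ x - x') (hm : (D.natAbs : ℤ) ∣ m - m')
    (hn : (D.natAbs : ℤ) ∣ n - n') :
    (wgt P D r h x m n : ℂ) = wgt P D r h' x' m' n' := by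
  obtain ⟨q, hq⟩ := hh
  obtain ⟨i, hi⟩ := hx
  obtain ⟨j, hj⟩ := hm
  obtain ⟨k, hk⟩ := hn
  push_cast at hq hi
  rw [← Int.natCast_natAbs] at hi
  refine phi_congr hD hr ⟨P.kB * q, ?_⟩ ⟨2 * N * i * P.kA + j * P.a₀ + k * P.a₁, ?_⟩
    ⟨i * P.kB + (j * P.b₀ + k * P.b₁), ?_⟩ ⟨2 * N * i * P.kC + j * P.c₀ + k * P.c₁, ?_⟩
  · push_cast; linear_combination P.kB * hq
  · unfold HypPair.toA
    linear_combination P.kA * hi + P.a₀ * hj + P.a₁ * hk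
  · unfold HypPair.toB
    rw [Nat.cast_mul]
    push_cast [-Int.natCast_natAbs]
    linear_combination P.kB * hi + 2 * N * P.b₀ * hj + 2 * N * P.b₁ * hk
  · unfold HypPair.toC
    linear_combination P.kC * hi + P.c₀ * hj + P.c₁ * hk

lemma wgt_periodic [NeZero N] (hD : IsFundamentalDiscriminant D) (hr : r ^ 2 - 4 * N * m₀ = D) :
    (∀ x m n, PeriodicMod (2 * N) fun h => (wgt P D r h x m n : ℂ)) ∧
    (∀ h m n, PeriodicMod (2 * N * D.natAbs) fun x => (wgt P D r h x m n : ℂ)) ∧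
    (∀ h x n, PeriodicMod D.natAbs fun m => (wgt P D r h x m n : ℂ)) ∧
    (∀ h x m, PeriodicMod D.natAbs fun n => (wgt P D r h x m n : ℂ)) :=
  ⟨fun _ _ _ _ _ hxy => wgt_congr P hD hr hxy (by simp) (by simp) (by simp),
    fun _ _ _ _ _ hxy => wgt_congr P hD hr (by simp) hxy (by simp) (by simp),
    fun _ _ _ _ _ hxy => wgt_congr P hD hr (by simp) (by simp) hxy (by simp),
    fun _ _ _ _ _ hxy => wgt_congr P hD hr (by simp) (by simp) (by simp) hxy⟩

lemma er_comp_periodic {M : ℕ} [NeZero M] {g : ℤ → ℤ} (hg : ∀ x y, (M : ℤ) ∣ x - y →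
    (M : ℤ) ∣ g x - g y) : PeriodicMod M fun x => er M (g x) :=
  fun x y h => er_periodic M _ _ (hg x y h)

lemma PeriodicMod.of_dvd {M M' : ℕ} {f : ℤ → ℂ} (hf : PeriodicMod M f) (h : M ∣ M') :
    PeriodicMod M' f := fun x y hxy => hf x y ((Int.natCast_dvd_natCast.mpr h).trans hxy)

/-- The Fourier transform of `φ_h` over `L'/ΔL` in adapted coordinates. -/
theorem fourier_wgt_full [NeZero N] (hD : IsFundamentalDiscriminant D)
    (hr : r ^ 2 - 4 * N * m₀ = D) (h x' m' n' : ℤ) :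
    ∑ x ∈ Finset.range (2 * N * D.natAbs), ∑ m ∈ Finset.range D.natAbs,
      ∑ n ∈ Finset.range D.natAbs, (wgt P D r h x m n : ℂ) *
        (er (2 * N * D.natAbs) (-(x' * x)) * er D.natAbs (-(m * n' + n * m'))) =
    D.natAbs * gauss D * ∑ h' ∈ Finset.range (2 * N),
      er (2 * N) (-(D.sign * h * h')) * wgt P D r h' x' m' n' := by
  have : NeZero D.natAbs := ⟨by simpa using hD.ne_zero⟩
  have hz : ∀ k x : ℤ, k ∣ x - x := fun k x => by simp
  set M := 2 * N * D.natAbs with hM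
  have hdM : D.natAbs ∣ M := dvd_mul_left _ _
  have hNC : ((2 * N : ℕ) : ℂ) ≠ 0 := Nat.cast_ne_zero.mpr (NeZero.ne _)
  -- the transform for an arbitrary integer `h`
  have step1 : ∀ h a' b' c' : ℤ, ∑ a ∈ Finset.range D.natAbs, ∑ b ∈ Finset.range M,
      ∑ c ∈ Finset.range D.natAbs, (phi N D r h a b c : ℂ) *
        (er M (-(b' * b)) * er D.natAbs (a' * c + c' * a)) =
    D.natAbs * gauss D * ∑ h' ∈ Finset.range (2 * N),
      er (2 * N) (-(D.sign * h * h')) * phi N D r h' a' b' c' := by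
    intro h a' b' c'
    have hpos : (0 : ℤ) < (2 * N : ℕ) := by exact_mod_cast NeZero.pos (2 * N)
    have h0 := Int.emod_nonneg h hpos.ne'
    have h1 := Int.emod_lt_of_pos h hpos
    obtain ⟨h₀, hh₀⟩ := Int.eq_ofNat_of_zero_le h0
    have hd : ((2 * N : ℕ) : ℤ) ∣ h - h₀ := hh₀ ▸ Int.dvd_self_sub_emod
    have key := fourier_phi N hD hr (Finset.mem_range.mpr (by omega : h₀ < 2 * N)) a' b' c'
    rw [← hM] at key
    convert key using 2
    · refine Finset.sum_congr rfl fun b _ => Finset.sum_congr rfl fun c _ => ?_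
      rw [phi_congr hD hr hd (hz _ _) (hz _ _) (hz _ _)]
    · refine Finset.sum_congr rfl fun h' _ => ?_
      congr 1
      refine er_periodic _ _ _ ?_
      obtain ⟨q, hq⟩ := hd
      exact ⟨-(D.sign * q * h'), by linear_combination (-D.sign * h') * hq⟩
  -- the summand as a function of `a, b, c`
  set F : ℤ → ℤ → ℤ → ℂ := fun a b c => (phi N D r (P.kB * h) a b c : ℂ) *
    (er M (-(P.toB x' m' n' * b)) * er D.natAbs (P.toA x' m' n' * c + P.toC x' m' n' * a)) with hF
  have F1 : ∀ b c, PeriodicMod D.natAbs fun a => F a b c := fun b c x y hxy => by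
    simp only [hF]
    rw [phi_congr hD hr (hz _ _) hxy (hz _ _) (hz _ _)]
    congr 2
    refine er_periodic _ _ _ ?_
    obtain ⟨q, hq⟩ := hxy
    exact ⟨P.toC x' m' n' * q, by linear_combination P.toC x' m' n' * hq⟩
  have F2 : ∀ a c, PeriodicMod M fun b => F a b c := fun a c x y hxy => by
    simp only [hF]
    rw [phi_congr hD hr (hz _ _) (hz _ _) hxy (hz _ _)]
    congr 2
    refine er_periodic _ _ _ ?_
    obtain ⟨q, hq⟩ := hxy
    exact ⟨-P.toB x' m' n' * q, by linear_combination -P.toB x' m' n' * hq⟩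
  have F3 : ∀ a b, PeriodicMod D.natAbs fun c => F a b c := fun a b x y hxy => by
    simp only [hF]
    rw [phi_congr hD hr (hz _ _) (hz _ _) (hz _ _) hxy]
    congr 2
    refine er_periodic _ _ _ ?_
    obtain ⟨q, hq⟩ := hxy
    exact ⟨P.toA x' m' n' * q, by linear_combination P.toA x' m' n' * hq⟩
  have hval : ∀ x m n : ℤ, F (P.toA x m n) (P.toB x m n) (P.toC x m n) =
      (wgt P D r h x m n : ℂ) * (er M (-(x' * x)) * er D.natAbs (-(m * n' + n * m'))) := by
    intro x m n
    simp only [hF, wgt]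
    congr 1
    rw [← er_mul_mul D.natAbs (2 * N), ← er_mul_mul D.natAbs (2 * N), ← hM, ← er_add, ← er_add]
    congr 1
    push_cast
    linear_combination -P.pairing x m n x' m' n'
  -- change of variables
  have hchange := P.sum_change (M := M) (fun b c => (F1 b c).of_dvd hdM) F2
    (fun a b => (F3 a b).of_dvd hdM)
  simp only [hval] at hchange
  -- The change of variables needs one common modulus, so all variables were summed over `M = 2 N
  -- |D|` classes. On either side two of them have period `|D|`, and each contributes a factor `2
  -- N`.
  have hl : ∑ a ∈ Finset.range M, ∑ b ∈ Finset.range M, ∑ c ∈ Finset.range M, F a b c =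
      (2 * N : ℕ) * ((2 * N : ℕ) * ∑ a ∈ Finset.range D.natAbs, ∑ b ∈ Finset.range M,
      ∑ c ∈ Finset.range D.natAbs, F a b c) := by
    have e1 : ∀ a b : ℤ, ∑ c ∈ Finset.range M, F a b c =
        (2 * N : ℕ) * ∑ c ∈ Finset.range D.natAbs, F a b c :=
      fun a b => (F3 a b).sum_range_mul (2 * N)
    simp only [e1, ← Finset.mul_sum]
    congr 1
    have hp : PeriodicMod D.natAbs fun a => ∑ b ∈ Finset.range M, ∑ c ∈ Finset.range D.natAbs,
        F a b c := PeriodicMod.sum fun b _ => PeriodicMod.sum fun c _ => F1 b c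
    exact hp.sum_range_mul (2 * N)
  have hrr : ∑ x ∈ Finset.range M, ∑ m ∈ Finset.range M, ∑ n ∈ Finset.range M,
      (wgt P D r h x m n : ℂ) * (er M (-(x' * x)) * er D.natAbs (-(m * n' + n * m'))) =
      (2 * N : ℕ) * ((2 * N : ℕ) * ∑ x ∈ Finset.range M, ∑ m ∈ Finset.range D.natAbs,
      ∑ n ∈ Finset.range D.natAbs,
      (wgt P D r h x m n : ℂ) * (er M (-(x' * x)) * er D.natAbs (-(m * n' + n * m')))) := by
    obtain ⟨-, -, w3, w4⟩ := wgt_periodic P hD hr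
    have g3 : ∀ (x n : ℤ), PeriodicMod D.natAbs fun m => (wgt P D r h x m n : ℂ) *
        (er M (-(x' * x)) * er D.natAbs (-(m * n' + n * m'))) := fun x n u v huv => by
      simp only [w3 h x n u v huv]
      congr 2
      refine er_periodic _ _ _ ?_
      obtain ⟨q, hq⟩ := huv
      exact ⟨-q * n', by linear_combination -n' * hq⟩
    have g4 : ∀ (x m : ℤ), PeriodicMod D.natAbs fun n => (wgt P D r h x m n : ℂ) *
        (er M (-(x' * x)) * er D.natAbs (-(m * n' + n * m'))) := fun x m u v huv => by
      simp only [w4 h x m u v huv]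
      congr 2
      refine er_periodic _ _ _ ?_
      obtain ⟨q, hq⟩ := huv
      exact ⟨-q * m', by linear_combination -m' * hq⟩
    have e1 : ∀ x m : ℤ, ∑ n ∈ Finset.range M, (wgt P D r h x m n : ℂ) *
        (er M (-(x' * x)) * er D.natAbs (-(m * n' + n * m'))) =
        (2 * N : ℕ) * ∑ n ∈ Finset.range D.natAbs, (wgt P D r h x m n : ℂ) *
        (er M (-(x' * x)) * er D.natAbs (-(m * n' + n * m'))) :=
      fun x m => (g4 x m).sum_range_mul (2 * N)
    have e2 : ∀ x : ℤ, ∑ m ∈ Finset.range M, ∑ n ∈ Finset.range D.natAbs,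
        (wgt P D r h x m n : ℂ) * (er M (-(x' * x)) * er D.natAbs (-(m * n' + n * m'))) =
        (2 * N : ℕ) * ∑ m ∈ Finset.range D.natAbs, ∑ n ∈ Finset.range D.natAbs,
        (wgt P D r h x m n : ℂ) * (er M (-(x' * x)) * er D.natAbs (-(m * n' + n * m'))) :=
      fun x => by
        have hp : PeriodicMod D.natAbs fun m => ∑ n ∈ Finset.range D.natAbs,
            (wgt P D r h x m n : ℂ) * (er M (-(x' * x)) * er D.natAbs (-(m * n' + n * m'))) :=
          PeriodicMod.sum fun n _ => g3 x n
        exact hp.sum_range_mul (2 * N)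
    simp only [e1, ← Finset.mul_sum, e2]
  rw [hrr, hl] at hchange
  rw [mul_left_cancel₀ hNC (mul_left_cancel₀ hNC hchange), step1]
  congr 1
  -- reindex the classes
  have hp : PeriodicMod (2 * N) fun h' => er (2 * N) (-(D.sign * (P.kB * h) * h')) *
      phi N D r h' (P.toA x' m' n') (P.toB x' m' n') (P.toC x' m' n') := by
    refine PeriodicMod.mul (er_comp_periodic fun x y hxy => ?_)
      ((phi_periodic hD hr (N := N)).1 _ _ _)
    obtain ⟨q, hq⟩ := hxy
    exact ⟨-(D.sign * (P.kB * h) * q), by linear_combination (-D.sign * (P.kB * h)) * hq⟩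
  rw [← hp.sum_mul P.isCoprime_kB]
  refine Finset.sum_congr rfl fun h' _ => ?_
  rw [wgt]
  congr 1
  refine er_periodic _ _ _ ⟨-(D.sign * h * h' * (2 * P.kA * P.kC)), ?_⟩
  push_cast
  linear_combination (-D.sign * h * h') * P.kB_sq

/-- The partial Fourier transform of `φ_h` in the direction of `l`. -/
def wgtF (P : HypPair N) (D r h x α n : ℤ) : ℂ :=
  ∑ t ∈ Finset.range D.natAbs, (wgt P D r h x t n : ℂ) * er D.natAbs (α * t)

lemma wgtF_periodic [NeZero N] (hD : IsFundamentalDiscriminant D) (hr : r ^ 2 - 4 * N * m₀ = D) :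
    (∀ x α n, PeriodicMod (2 * N) fun h => wgtF P D r h x α n) ∧
    (∀ h α n, PeriodicMod (2 * N * D.natAbs) fun x => wgtF P D r h x α n) ∧
    (∀ h x n, PeriodicMod D.natAbs fun α => wgtF P D r h x α n) ∧
    (∀ h x α, PeriodicMod D.natAbs fun n => wgtF P D r h x α n) := by
  have : NeZero D.natAbs := ⟨by simpa using hD.ne_zero⟩
  obtain ⟨w1, w2, -, w4⟩ := wgt_periodic P hD hr
  refine ⟨fun x α n u v huv => ?_, fun h α n u v huv => ?_, fun h x n u v huv => ?_,
    fun h x α u v huv => ?_⟩ <;> refine Finset.sum_congr rfl fun t _ => ?_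
  · simp only [w1 _ _ _ _ _ huv]
  · simp only [w2 _ _ _ _ _ huv]
  · exact congrArg _ (er_periodic_mul D.natAbs t u v huv)
  · simp only [w4 _ _ _ _ _ huv]

/-- The Fourier transform of `φ_h` along `K'` exchanges the two coordinates of the hyperbolic
plane. -/
theorem fourier_wgtF [NeZero N] (hD : IsFundamentalDiscriminant D)
    (hr : r ^ 2 - 4 * N * m₀ = D) (h x' α n : ℤ) :
    ∑ x ∈ Finset.range (2 * N * D.natAbs), wgtF P D r h x α n * er (2 * N * D.natAbs) (-(x' * x)) =
    gauss D * ∑ h' ∈ Finset.range (2 * N),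
      er (2 * N) (-(D.sign * h * h')) * wgtF P D r h' x' n (-α) := by
  have : NeZero D.natAbs := ⟨by simpa using hD.ne_zero⟩
  have hD0 : (D.natAbs : ℂ) ≠ 0 := Nat.cast_ne_zero.mpr (NeZero.ne _)
  refine mul_left_cancel₀ hD0 ?_
  set M := 2 * N * D.natAbs
  -- `B` is the left side as a function of `n`. Its finite Fourier transform in `n` is known from
  -- `fourier_wgt_full` (`h1`) and is inverted in `h2`.
  set B : ℤ → ℂ := fun n => ∑ x ∈ Finset.range M, wgtF P D r h x α n * er M (-(x' * x)) with hB
  have hBp : PeriodicMod D.natAbs B := fun u v huv => by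
    simp only [hB, (wgtF_periodic P hD hr).2.2.2 _ _ _ _ _ huv]
  have h1 : ∀ m' : ℤ, ∑ n₁ ∈ Finset.range D.natAbs, B n₁ * er D.natAbs (-(n₁ * m')) =
      D.natAbs * gauss D * ∑ h' ∈ Finset.range (2 * N),
      er (2 * N) (-(D.sign * h * h')) * wgt P D r h' x' m' (-α) := by
    intro m'
    rw [← fourier_wgt_full P hD hr]
    simp only [hB, wgtF, Finset.sum_mul]
    rw [Finset.sum_comm]
    refine Finset.sum_congr rfl fun x _ => ?_
    rw [Finset.sum_comm]
    refine Finset.sum_congr rfl fun m _ => Finset.sum_congr rfl fun n₁ _ => ?_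
    rw [show -((m : ℤ) * -α + n₁ * m') = α * m + -(n₁ * m') by ring, er_add]
    ring
  have h2 : ∑ m' ∈ Finset.range D.natAbs, er D.natAbs (n * m') *
      ∑ n₁ ∈ Finset.range D.natAbs, B n₁ * er D.natAbs (-(n₁ * m')) = D.natAbs * B n := by
    have : ∀ m' : ℤ, ∑ n₁ ∈ Finset.range D.natAbs, B n₁ * er D.natAbs (-(n₁ * m')) =
        ∑ n₁ ∈ Finset.range D.natAbs, B (n₁ + n) * er D.natAbs (-((n₁ + n) * m')) := by
      intro m'
      have hp : PeriodicMod D.natAbs fun n₁ => B n₁ * er D.natAbs (-(n₁ * m')) :=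
        hBp.mul (er_comp_periodic fun x y hxy => by
          obtain ⟨q, hq⟩ := hxy
          exact ⟨-(q * m'), by linear_combination -m' * hq⟩)
      exact (hp.sum_add n).symm
    simp only [this, Finset.mul_sum]
    rw [Finset.sum_comm]
    have e : ∀ n₁ m' : ℕ, er D.natAbs (n * m') *
        (B (n₁ + n) * er D.natAbs (-((n₁ + n) * m'))) = B (n₁ + n) * er D.natAbs (m' * -n₁) := by
      intro n₁ m'
      rw [show er D.natAbs ((m' : ℤ) * -n₁) = er D.natAbs (n * m') *
        er D.natAbs (-((n₁ + n) * m')) by rw [← er_add]; congr 1; ring]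
      ring
    simp only [e, ← Finset.mul_sum, sum_er]
    rw [Finset.sum_eq_single 0]
    · simp [mul_comm]
    · intro b hb hb0
      rw [if_neg, mul_zero]
      rw [dvd_neg, Int.natCast_dvd_natCast]
      exact fun h => hb0 (Nat.eq_zero_of_dvd_of_lt h (Finset.mem_range.mp hb))
    · intro h
      exact absurd (Finset.mem_range.mpr (NeZero.pos _)) h
  rw [← h2]
  simp only [h1, wgtF, Finset.mul_sum]
  rw [Finset.sum_comm]
  refine Finset.sum_congr rfl fun h' _ => Finset.sum_congr rfl fun m' _ => ?_
  ring

end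

/-! ### The theta functions of `K'` and their transformation laws -/

/-- The real parameters of a point of the upper half plane in adapted coordinates. -/
structure Geom (N : ℕ) where
  (A ρ σ : ℝ)
  A_pos : 0 < A
  sq : 2 * N * A * σ ^ 2 = 1

section

variable {N : ℕ} {D r m₀ : ℤ} (P : HypPair N) (G : Geom N)

/-- The summand of `jFun`. -/
def jTerm (D r : ℤ) (κ : ℕ) (τ : ℍ) (n α h x : ℤ) : ℂ :=
  wgtF P D r h x α n *
    (heatPoly (-(D.natAbs / (8 * Real.pi * τ.im * G.A))) κ
      (G.σ * (x - 2 * N * G.ρ * n) + (n * (starRingEnd ℂ) (τ : ℂ) - α) / (2 * τ.im * G.A)) *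
    e ((τ * (x - 2 * N * G.ρ * n) ^ 2 / (4 * N) + α * G.ρ * (x - 2 * N * G.ρ * n) +
      N * G.ρ ^ 2 * n * α + Complex.I * (n * τ - α) * (n * (starRingEnd ℂ) (τ : ℂ) - α) /
        (4 * τ.im * G.A)) / D.natAbs))

/-- The theta functions of `K'` attached to the pairs `(n, α)`. -/
def jFun (D r : ℤ) (κ : ℕ) (τ : ℍ) (n α h : ℤ) : ℂ := ∑' x : ℤ, jTerm P G D r κ τ n α h x

lemma jTerm_eq [NeZero N] (hD : D ≠ 0) (κ : ℕ) (τ : ℍ) (n α h x : ℤ) :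
    jTerm P G D r κ τ n α h x =
      e ((N * G.ρ ^ 2 * n * (n * τ - α) + Complex.I * (n * τ - α) *
        (n * (starRingEnd ℂ) (τ : ℂ) - α) / (4 * τ.im * G.A)) / D.natAbs) *
      (wgtF P D r h x α n * (heatPoly (-(D.natAbs / (8 * Real.pi * τ.im * G.A))) κ
        (G.σ * x + (-(2 * N * G.ρ * G.σ * n) +
          (n * (starRingEnd ℂ) (τ : ℂ) - α) / (2 * τ.im * G.A))) *
      Complex.exp (-Real.pi * (-(Complex.I * τ) / (2 * N * D.natAbs)) * x ^ 2 +
        2 * Real.pi * Complex.I * G.ρ / D.natAbs * (α - n * τ) * x))) := by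
  have hN : (N : ℂ) ≠ 0 := Nat.cast_ne_zero.mpr (NeZero.ne N)
  have hd : (D.natAbs : ℂ) ≠ 0 := Nat.cast_ne_zero.mpr (by simpa using hD)
  rw [jTerm]
  have h1 : ∀ s t : ℂ, G.σ * (x - 2 * N * G.ρ * n) + s = G.σ * x + (-(2 * N * G.ρ * G.σ * n) + s) :=
    fun s t => by ring
  rw [h1 _ 0]
  have h2 : e ((τ * (x - 2 * N * G.ρ * n) ^ 2 / (4 * N) + α * G.ρ * (x - 2 * N * G.ρ * n) +
      N * G.ρ ^ 2 * n * α + Complex.I * (n * τ - α) * (n * (starRingEnd ℂ) (τ : ℂ) - α) /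
        (4 * τ.im * G.A)) / D.natAbs) =
      e ((N * G.ρ ^ 2 * n * (n * τ - α) + Complex.I * (n * τ - α) *
        (n * (starRingEnd ℂ) (τ : ℂ) - α) / (4 * τ.im * G.A)) / D.natAbs) *
      Complex.exp (-Real.pi * (-(Complex.I * τ) / (2 * N * D.natAbs)) * x ^ 2 +
        2 * Real.pi * Complex.I * G.ρ / D.natAbs * (α - n * τ) * x) := by
    rw [e, e, ← Complex.exp_add]
    congr 1
    generalize Complex.I * (n * τ - α) * (n * (starRingEnd ℂ) (τ : ℂ) - α) /
        (4 * τ.im * G.A) = s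
    field_simp
    ring
  rw [h2]
  ring

lemma gauss_re_pos [NeZero N] (hD : D ≠ 0) (τ : ℍ) :
    0 < (-(Complex.I * τ) / (2 * N * D.natAbs) : ℂ).re := by
  have hN : (0 : ℝ) < N := Nat.cast_pos.mpr (NeZero.pos N)
  have hd : (0 : ℝ) < D.natAbs := Nat.cast_pos.mpr (by simpa using hD)
  have h : (-(Complex.I * τ) / (2 * N * D.natAbs) : ℂ) =
      -(Complex.I * τ) / ((2 * N * D.natAbs : ℝ) : ℂ) := by push_cast; rfl
  rw [h, Complex.div_ofReal_re]
  have : (-(Complex.I * (τ : ℂ))).re = τ.im := by simp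
  rw [this]
  exact div_pos τ.im_pos (by positivity)

lemma summable_jTerm [NeZero N] (hD : IsFundamentalDiscriminant D) (hr : r ^ 2 - 4 * N * m₀ = D)
    (κ : ℕ) (τ : ℍ) (n α h : ℤ) : Summable fun x => jTerm P G D r κ τ n α h x := by
  have : NeZero D.natAbs := ⟨by simpa using hD.ne_zero⟩
  obtain ⟨C, hC⟩ := exists_norm_le_of_periodic (c := fun x => wgtF P D r h x α n)
    (M := 2 * N * D.natAbs) fun m => (wgtF_periodic P hD hr).2.1 h α n _ _ (by simp)
  simp only [jTerm_eq P G hD.ne_zero]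
  refine Summable.mul_left _ ?_
  refine Summable.of_norm_bounded (((summable_heatPoly_gauss (gauss_re_pos (N := N) hD.ne_zero τ)
    (-(D.natAbs / (8 * Real.pi * τ.im * G.A))) G.σ (-(2 * N * G.ρ * G.σ * n) +
          (n * (starRingEnd ℂ) (τ : ℂ) - α) / (2 * τ.im * G.A))
    (2 * Real.pi * Complex.I * G.ρ / D.natAbs * (α - n * τ)) κ).norm).mul_left C) fun x => ?_
  rw [norm_mul]
  exact mul_le_mul_of_nonneg_right (hC x) (norm_nonneg _)

/-- The behaviour of the weights under translation. -/
lemma wgtF_mul_e [NeZero N] (hD : D ≠ 0) (h x α n : ℤ) :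
    wgtF P D r h x α n * e ((x : ℂ) ^ 2 / (4 * N) / D.natAbs) =
      e (D.sign * (h : ℂ) ^ 2 / (4 * N)) * wgtF P D r h x (α - n) n := by
  have hN : (N : ℂ) ≠ 0 := Nat.cast_ne_zero.mpr (NeZero.ne N)
  have hd : (D.natAbs : ℂ) ≠ 0 := Nat.cast_ne_zero.mpr (by simpa using hD)
  rw [wgtF, wgtF, Finset.sum_mul, Finset.mul_sum]
  refine Finset.sum_congr rfl fun t _ => ?_
  -- On the support `x² + 4 N t n ≡ D h²` modulo `4 N D`, so the phase in `x²` splits into a phase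
  -- in `h` and `e(-t n / |D|)`; the latter shifts `α` by `n`.
  by_cases hx : 4 * N * D ∣ x ^ 2 + 4 * N * t * n - D * h ^ 2
  · obtain ⟨q, hq⟩ := hx
    have hs : (D : ℂ) = D.sign * D.natAbs := by
      have : ((D.sign * D.natAbs : ℤ) : ℂ) = D := by rw [Int.sign_mul_natAbs]
      rw [Int.cast_mul, Int.cast_natCast] at this
      exact this.symm
    have hq' : (x : ℂ) ^ 2 + 4 * N * t * n - D * h ^ 2 = 4 * N * D * q := by exact_mod_cast hq
    have h1 : er D.natAbs (α * t) * e ((x : ℂ) ^ 2 / (4 * N) / D.natAbs) =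
        e (D.sign * (h : ℂ) ^ 2 / (4 * N)) * er D.natAbs ((α - n) * t) := by
      have h2 : (x : ℂ) ^ 2 / (4 * N) / D.natAbs =
          D.sign * (h : ℂ) ^ 2 / (4 * N) - t * n / D.natAbs + ((D.sign * q : ℤ) : ℂ) := by
        rw [hs] at hq'
        push_cast
        field_simp
        linear_combination hq'
      rw [h2, er, er, ← e_add, ← e_add, ← add_assoc, e_add _ (((D.sign * q : ℤ) : ℂ)), e_int,
        mul_one]
      congr 1
      push_cast
      ring
    linear_combination (wgt P D r h x t n : ℂ) * h1
  · rw [wgt_of_not_dvd' P hx]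
    simp

/-- The transformation law under `τ ↦ τ + 1`. -/
theorem jFun_add_one [NeZero N] (hD : D ≠ 0) (κ : ℕ) {τ τ' : ℍ} (hτ : (τ' : ℂ) = τ + 1)
    (n α h : ℤ) :
    jFun P G D r κ τ' n α h =
      e (D.sign * (h : ℂ) ^ 2 / (4 * N)) * jFun P G D r κ τ n (α - n) h := by
  have hN : (N : ℂ) ≠ 0 := Nat.cast_ne_zero.mpr (NeZero.ne N)
  have hd : (D.natAbs : ℂ) ≠ 0 := Nat.cast_ne_zero.mpr (by simpa using hD)
  have him : τ'.im = τ.im := by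
    have := congrArg Complex.im hτ
    simpa using this
  rw [jFun, jFun, ← tsum_mul_left]
  refine tsum_congr fun x => ?_
  rw [jTerm, jTerm, hτ, him]
  have hc : (n : ℂ) * (starRingEnd ℂ) ((τ : ℂ) + 1) - α =
      n * (starRingEnd ℂ) (τ : ℂ) - ((α - n : ℤ) : ℂ) := by
    rw [map_add, map_one]; push_cast; ring
  rw [hc]
  have h1 : e ((((τ : ℂ) + 1) * (x - 2 * N * G.ρ * n) ^ 2 / (4 * N) +
      α * G.ρ * (x - 2 * N * G.ρ * n) + N * G.ρ ^ 2 * n * α + Complex.I * (n * ((τ : ℂ) + 1) - α) *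
        (n * (starRingEnd ℂ) (τ : ℂ) - ((α - n : ℤ) : ℂ)) / (4 * τ.im * G.A)) / D.natAbs) =
      e ((x : ℂ) ^ 2 / (4 * N) / D.natAbs) * e ((τ * (x - 2 * N * G.ρ * n) ^ 2 / (4 * N) +
      ((α - n : ℤ) : ℂ) * G.ρ * (x - 2 * N * G.ρ * n) + N * G.ρ ^ 2 * n * ((α - n : ℤ) : ℂ) +
      Complex.I * (n * τ - ((α - n : ℤ) : ℂ)) * (n * (starRingEnd ℂ) (τ : ℂ) - ((α - n : ℤ) : ℂ)) /
        (4 * τ.im * G.A)) / D.natAbs) := by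
    rw [← e_add]
    congr 1
    have : (n : ℂ) * ((τ : ℂ) + 1) - α = n * τ - ((α - n : ℤ) : ℂ) := by push_cast; ring
    rw [this]
    generalize Complex.I * (n * τ - ((α - n : ℤ) : ℂ)) *
      (n * (starRingEnd ℂ) (τ : ℂ) - ((α - n : ℤ) : ℂ)) / (4 * τ.im * G.A) = s
    push_cast
    field_simp
    ring
  rw [h1]
  have h2 := wgtF_mul_e P (r := r) hD h x α n
  linear_combination (heatPoly (-(D.natAbs / (8 * Real.pi * τ.im * G.A))) κ
      (G.σ * (x - 2 * N * G.ρ * n) +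
        (n * (starRingEnd ℂ) (τ : ℂ) - ((α - n : ℤ) : ℂ)) / (2 * τ.im * G.A)) *
    e ((τ * (x - 2 * N * G.ρ * n) ^ 2 / (4 * N) +
      ((α - n : ℤ) : ℂ) * G.ρ * (x - 2 * N * G.ρ * n) + N * G.ρ ^ 2 * n * ((α - n : ℤ) : ℂ) +
      Complex.I * (n * τ - ((α - n : ℤ) : ℂ)) * (n * (starRingEnd ℂ) (τ : ℂ) - ((α - n : ℤ) : ℂ)) /
        (4 * τ.im * G.A)) / D.natAbs)) * h2

/-- The principal branches are compatible because `-i τ` has positive real part; `e(-1/8)` is the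
square root of `-i`. -/
lemma one_div_cpow_half {b : ℝ} (hb : 0 < b) (τ τ' : ℍ) (hτ : (τ' : ℂ) = -1 / τ) :
    1 / (-(Complex.I * τ') / b : ℂ) ^ (1 / 2 : ℂ) = √b * (e (-1 / 8) * (τ : ℂ) ^ (1 / 2 : ℂ)) := by
  have h0 : (τ : ℂ) ≠ 0 := τ.ne_zero
  have hbc : (b : ℂ) ≠ 0 := by exact_mod_cast hb.ne'
  have h1 : (-(Complex.I * τ') / b : ℂ) = ((b : ℂ) * (-Complex.I * τ))⁻¹ := by
    rw [hτ]
    field_simp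
    rw [Complex.I_sq]
  have hI : -Complex.I * (τ : ℂ) ≠ 0 := mul_ne_zero (neg_ne_zero.mpr Complex.I_ne_zero) h0
  have harg0 : 0 < (τ : ℂ).arg ∧ (τ : ℂ).arg < Real.pi := by
    constructor
    · rcases (Complex.arg_nonneg_iff.mpr τ.im_pos.le).lt_or_eq with h | h
      · exact h
      · have := (Complex.arg_eq_zero_iff.mp h.symm).2
        exact absurd this τ.im_pos.ne'
    · exact Complex.arg_lt_pi_iff.mpr (Or.inr τ.im_pos.ne')
  have h2 : (-Complex.I * (τ : ℂ)) ^ (1 / 2 : ℂ) = e (-1 / 8) * (τ : ℂ) ^ (1 / 2 : ℂ) := by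
    have hlog : Complex.log (-Complex.I * (τ : ℂ)) =
        -(Real.pi / 2 : ℝ) * Complex.I + Complex.log τ := by
      rw [Complex.log_mul (by simp) h0]
      · rw [Complex.log_neg_I]
        push_cast; ring
      · rw [Complex.arg_neg_I]
        constructor <;> linarith [Real.pi_pos, harg0.1, harg0.2]
    rw [Complex.cpow_def_of_ne_zero hI, Complex.cpow_def_of_ne_zero h0, hlog, e, ← Complex.exp_add]
    congr 1
    push_cast
    ring
  have hre : 0 < (-Complex.I * (τ : ℂ)).re := by
    simpa using τ.im_pos
  have h3 : ((b : ℂ) * (-Complex.I * τ)).arg ≠ Real.pi := by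
    rw [Complex.arg_real_mul _ hb]
    intro h
    have := Complex.arg_eq_pi_iff.mp h
    linarith [this.1]
  rw [h1, Complex.inv_cpow _ _ h3, one_div, inv_inv, ofReal_mul_cpow_half hb hI, h2]

/-- The transformation law under `τ ↦ -1/τ`, up to the evaluation of the Gauss sum. -/
theorem jFun_inv [NeZero N] (hD : IsFundamentalDiscriminant D) (hr : r ^ 2 - 4 * N * m₀ = D)
    (κ : ℕ) {τ τ' : ℍ} (hτ : (τ' : ℂ) = -1 / τ) (n α h : ℤ) :
    jFun P G D r κ τ' n α h =
      (gauss D / ((√(2 * N * D.natAbs : ℝ) : ℝ) : ℂ)) * (e (-1 / 8) * (τ : ℂ) ^ (1 / 2 : ℂ)) *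
        (τ : ℂ) ^ κ * ∑ h' ∈ Finset.range (2 * N),
          er (2 * N) (-(D.sign * h * h')) * jFun P G D r κ τ (-α) n h' := by
  have : NeZero D.natAbs := ⟨by simpa using hD.ne_zero⟩
  have hN : (N : ℂ) ≠ 0 := Nat.cast_ne_zero.mpr (NeZero.ne N)
  have hd : (D.natAbs : ℂ) ≠ 0 := Nat.cast_ne_zero.mpr (NeZero.ne _)
  have hpi : (Real.pi : ℂ) ≠ 0 := by exact_mod_cast Real.pi_ne_zero
  have hA : (G.A : ℂ) ≠ 0 := by exact_mod_cast G.A_pos.ne'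
  have hT : (τ : ℂ) ≠ 0 := τ.ne_zero
  have hTb : (starRingEnd ℂ) (τ : ℂ) ≠ 0 := (map_ne_zero _).mpr hT
  have hv : (τ.im : ℂ) ≠ 0 := by exact_mod_cast τ.im_pos.ne'
  have hv' : (τ'.im : ℂ) ≠ 0 := by exact_mod_cast τ'.im_pos.ne'
  have hI := Complex.I_sq
  have hTv : (τ : ℂ) - (starRingEnd ℂ) (τ : ℂ) = 2 * Complex.I * τ.im := by
    rw [Complex.sub_conj]; push_cast; simp; ring
  have hTb' : (starRingEnd ℂ) (τ' : ℂ) = -1 / (starRingEnd ℂ) (τ : ℂ) := by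
    rw [hτ]; simp
  have hvv : (τ'.im : ℂ) = τ.im / (τ * (starRingEnd ℂ) (τ : ℂ)) := by
    have h1 : (τ' : ℂ) - (starRingEnd ℂ) (τ' : ℂ) = 2 * Complex.I * τ'.im := by
      rw [Complex.sub_conj]; push_cast; simp; ring
    rw [hTb', hτ] at h1
    have h2 : (2 * Complex.I) ≠ 0 := by simp
    apply mul_left_cancel₀ h2
    rw [← h1, mul_div_assoc', ← hTv]
    field_simp
    ring
  set M := 2 * N * D.natAbs with hM
  have hMr : (0 : ℝ) < (M : ℝ) := by exact_mod_cast NeZero.pos M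
  have hMc : (2 * N * D.natAbs : ℂ) = (M : ℂ) := by rw [hM]; push_cast; ring
  have hMc' : (2 * N * D.natAbs : ℝ) = (M : ℝ) := by rw [hM]; push_cast; ring
  have hM0 : (M : ℂ) ≠ 0 := Nat.cast_ne_zero.mpr (NeZero.ne M)
  set a : ℂ := -(Complex.I * τ') / (2 * N * D.natAbs) with ha
  have hre : 0 < a.re := gauss_re_pos hD.ne_zero τ'
  have ha0 : a ≠ 0 := fun h => by simp [h] at hre
  have haT : a = Complex.I / (2 * N * D.natAbs * τ) := by
    rw [ha, hτ]; field_simp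
  have hroot : 1 / a ^ (1 / 2 : ℂ) = √(M : ℝ) * (e (-1 / 8) * (τ : ℂ) ^ (1 / 2 : ℂ)) := by
    rw [← one_div_cpow_half hMr τ τ' hτ, ha, hMc]
    simp
  -- Poisson summation with the periodic weight `wgtF`. The dual variable is negated so that the two
  -- sides can be compared term by term.
  simp only [jFun, jTerm_eq P G hD.ne_zero]
  rw [tsum_mul_left, tsum_periodic_heatPoly_gauss hre _ _ _ _ _ M _
    (fun m => (wgtF_periodic P hD hr).2.1 h α n _ _ (by simp [hM])), ← tsum_mul_left,
    ← (Equiv.neg ℤ).tsum_eq]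
  simp only [← tsum_mul_left]
  simp only [← jTerm_eq P G hD.ne_zero]
  rw [← Summable.tsum_finsetSum, ← tsum_mul_left]
  swap
  · exact fun h' _ => (summable_jTerm P G hD hr κ τ (-α) n h').mul_left _
  refine tsum_congr fun x => ?_
  have hw : ∑ s ∈ Finset.range M, wgtF P D r h s α n * e (((-x : ℤ) : ℂ) * s / M) =
      gauss D * ∑ h' ∈ Finset.range (2 * N), er (2 * N) (-(D.sign * h * h')) *
        wgtF P D r h' x n (-α) := by
    rw [← fourier_wgtF P hD hr]
    refine Finset.sum_congr rfl fun s _ => ?_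
    rw [er, ← hM]
    congr 2
    push_cast
    ring
  simp only [Equiv.neg_apply]
  rw [hw, hroot]
  -- The new time parameter is `τ²` times the one belonging to `τ`; this is where `2 N A σ² = 1`
  -- enters. Together with `hX` it lets `heatPoly_mul` extract `τ ^ κ`.
  have ht : (-(D.natAbs / (8 * Real.pi * τ'.im * G.A)) + (G.σ : ℂ) ^ 2 / (4 * Real.pi * a) : ℂ) =
      (τ : ℂ) ^ 2 * -(D.natAbs / (8 * Real.pi * τ.im * G.A)) := by
    have hσ : 2 * (N : ℂ) * G.A * G.σ ^ 2 = 1 := by exact_mod_cast G.sq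
    have hσ' : (G.σ : ℂ) ^ 2 = 1 / (2 * N * G.A) := by field_simp; linear_combination hσ
    rw [hvv, haT, hσ']
    have hI0 : Complex.I ≠ 0 := Complex.I_ne_zero
    field_simp
    linear_combination (4 * Complex.I) * hTv + (8 * (τ.im : ℂ)) * hI
  have hX : (-(2 * N * G.ρ * G.σ * n) + (n * (starRingEnd ℂ) (τ' : ℂ) - α) / (2 * τ'.im * G.A) +
        G.σ * (2 * Real.pi * Complex.I * G.ρ / D.natAbs * (α - n * τ') -
          2 * Real.pi * Complex.I * (((-x : ℤ) : ℂ) / M)) / (2 * Real.pi * a) : ℂ) =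
      τ * (G.σ * (x - 2 * N * G.ρ * ((-α : ℤ) : ℂ)) +
        (((-α : ℤ) : ℂ) * (starRingEnd ℂ) (τ : ℂ) - n) / (2 * τ.im * G.A)) := by
    rw [hvv, haT, hTb', hτ, ← hMc]
    have hI0 : Complex.I ≠ 0 := Complex.I_ne_zero
    push_cast
    field_simp
    ring
  have hE : e ((N * G.ρ ^ 2 * n * (n * τ' - α) + Complex.I * (n * τ' - α) *
        (n * (starRingEnd ℂ) (τ' : ℂ) - α) / (4 * τ'.im * G.A)) / D.natAbs) *
      Complex.exp ((2 * Real.pi * Complex.I * G.ρ / D.natAbs * (α - n * τ') -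
          2 * Real.pi * Complex.I * (((-x : ℤ) : ℂ) / M)) ^ 2 / (4 * Real.pi * a)) =
      e ((τ * (x - 2 * N * G.ρ * ((-α : ℤ) : ℂ)) ^ 2 / (4 * N) +
      n * G.ρ * (x - 2 * N * G.ρ * ((-α : ℤ) : ℂ)) +
      N * G.ρ ^ 2 * ((-α : ℤ) : ℂ) * n + Complex.I * (((-α : ℤ) : ℂ) * τ - n) *
        (((-α : ℤ) : ℂ) * (starRingEnd ℂ) (τ : ℂ) - n) / (4 * τ.im * G.A)) / D.natAbs) := by
    rw [e, e, ← Complex.exp_add]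
    congr 1
    rw [hvv, haT, hTb', hτ, ← hMc]
    have hI0 : Complex.I ≠ 0 := Complex.I_ne_zero
    push_cast
    field_simp
    ring
  have hsq : (1 / (M : ℂ)) * √(M : ℝ) = 1 / ((√(2 * N * D.natAbs : ℝ) : ℝ) : ℂ) := by
    rw [hMc']
    have h1 : ((√(M : ℝ) : ℝ) : ℂ) * ((√(M : ℝ) : ℝ) : ℂ) = M := by
      exact_mod_cast Real.mul_self_sqrt hMr.le
    have h2 : ((√(M : ℝ) : ℝ) : ℂ) ≠ 0 := by
      exact_mod_cast (Real.sqrt_pos.mpr hMr).ne'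
    field_simp
    linear_combination h1
  rw [ht, hX, heatPoly_mul]
  simp only [jTerm]
  have hsum : ∀ z : ℂ, ∑ h' ∈ Finset.range (2 * N), er (2 * N) (-(D.sign * h * h')) *
      (wgtF P D r h' x n (-α) * z) = (∑ h' ∈ Finset.range (2 * N),
        er (2 * N) (-(D.sign * h * h')) * wgtF P D r h' x n (-α)) * z := by
    intro z
    rw [Finset.sum_mul]
    exact Finset.sum_congr rfl fun _ _ => by ring
  rw [hsum, ← hE]
  generalize ∑ h' ∈ Finset.range (2 * N), er (2 * N) (-(D.sign * h * h')) *
    wgtF P D r h' x n (-α) = S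
  generalize heatPoly (-(D.natAbs / (8 * Real.pi * τ.im * G.A))) κ
    (G.σ * (x - 2 * N * G.ρ * ((-α : ℤ) : ℂ)) +
        (((-α : ℤ) : ℂ) * (starRingEnd ℂ) (τ : ℂ) - n) / (2 * τ.im * G.A)) = H
  generalize Complex.exp ((2 * Real.pi * Complex.I * G.ρ / D.natAbs * (α - n * τ') -
          2 * Real.pi * Complex.I * (((-x : ℤ) : ℂ) / M)) ^ 2 / (4 * Real.pi * a)) = E₁
  generalize e ((N * G.ρ ^ 2 * n * (n * τ' - α) + Complex.I * (n * τ' - α) *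
        (n * (starRingEnd ℂ) (τ' : ℂ) - α) / (4 * τ'.im * G.A)) / D.natAbs) = E₂
  rw [div_eq_mul_one_div (gauss D), ← hsq]
  ring

end

/-! ### The sign of the Gauss sum -/

lemma cpow_half_pos (τ : ℍ) :
    0 < ((τ : ℂ) ^ (1 / 2 : ℂ)).re ∧ 0 < ((τ : ℂ) ^ (1 / 2 : ℂ)).im := by
  have harg0 : 0 < (τ : ℂ).arg := by
    rcases (Complex.arg_nonneg_iff.mpr τ.im_pos.le).lt_or_eq with h | h
    · exact h
    · exact absurd (Complex.arg_eq_zero_iff.mp h.symm).2 τ.im_pos.ne'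
  have harg1 : (τ : ℂ).arg < Real.pi := Complex.arg_lt_pi_iff.mpr (Or.inr τ.im_pos.ne')
  have him : (Complex.log (τ : ℂ) * (1 / 2)).im = (τ : ℂ).arg / 2 := by
    simp [Complex.log_im]; ring
  rw [Complex.cpow_def_of_ne_zero τ.ne_zero, Complex.exp_re, Complex.exp_im, him]
  exact ⟨mul_pos (Real.exp_pos _) (Real.cos_pos_of_mem_Ioo ⟨by linarith, by linarith⟩),
    mul_pos (Real.exp_pos _) (Real.sin_pos_of_pos_of_lt_pi (by linarith) (by linarith))⟩

lemma cpow_half_sq (z : ℂ) : (z ^ (1 / 2 : ℂ)) ^ 2 = z := by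
  rw [← Complex.cpow_nat_mul]; simp

/-- Both sides agree up to sign. All three roots lie in the open first quadrant, so the product on
the left has positive imaginary part and the sign is `+`. -/
lemma cpow_half_mul {τ τ' τ'' : ℍ} (h : (τ'' : ℂ) = τ * τ') :
    (τ : ℂ) ^ (1 / 2 : ℂ) * (τ' : ℂ) ^ (1 / 2 : ℂ) = (τ'' : ℂ) ^ (1 / 2 : ℂ) := by
  have hsq : ((τ : ℂ) ^ (1 / 2 : ℂ) * (τ' : ℂ) ^ (1 / 2 : ℂ)) ^ 2 =
      ((τ'' : ℂ) ^ (1 / 2 : ℂ)) ^ 2 := by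
    rw [mul_pow, cpow_half_sq, cpow_half_sq, cpow_half_sq, h]
  rcases sq_eq_sq_iff_eq_or_eq_neg.mp hsq with h1 | h1
  · exact h1
  · have h2 := congrArg Complex.im h1
    obtain ⟨a1, a2⟩ := cpow_half_pos τ
    obtain ⟨b1, b2⟩ := cpow_half_pos τ'
    obtain ⟨c1, c2⟩ := cpow_half_pos τ''
    rw [Complex.mul_im, Complex.neg_im] at h2
    nlinarith [mul_pos a1 b2, mul_pos a2 b1]

lemma cpow_half_inv {τ τ' : ℍ} (h : (τ' : ℂ) = -1 / τ) :
    (τ' : ℂ) ^ (1 / 2 : ℂ) * (τ : ℂ) ^ (1 / 2 : ℂ) = Complex.I := by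
  have hsq : ((τ' : ℂ) ^ (1 / 2 : ℂ) * (τ : ℂ) ^ (1 / 2 : ℂ)) ^ 2 = Complex.I ^ 2 := by
    rw [mul_pow, cpow_half_sq, cpow_half_sq, h, Complex.I_sq]
    field_simp [τ.ne_zero]
  rcases sq_eq_sq_iff_eq_or_eq_neg.mp hsq with h1 | h1
  · exact h1
  · have h2 := congrArg Complex.im h1
    obtain ⟨a1, a2⟩ := cpow_half_pos τ
    obtain ⟨b1, b2⟩ := cpow_half_pos τ'
    rw [Complex.mul_im, Complex.neg_im, Complex.I_im] at h2
    nlinarith [mul_pos a1 b2, mul_pos a2 b1]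

section

variable {D : ℤ}

/-- The standard hyperbolic pair for level one. -/
def stdPair : HypPair 1 where
  a₀ := 1
  b₀ := 0
  c₀ := 0
  a₁ := 0
  b₁ := 0
  c₁ := -1
  iso₀ := by norm_num
  iso₁ := by norm_num
  pair := by norm_num

/-- A standard choice of real parameters for level one. -/
def stdGeom : Geom 1 where
  A := 1 / 2
  ρ := 0
  σ := 1
  A_pos := by norm_num
  sq := by norm_num

lemma psi_zero_zero_right {r m : ℤ} (hD : IsFundamentalDiscriminant D)
    (hr : r ^ 2 - 4 * (1 : ℕ) * m = D) (t : ℤ) : psi 1 D r m t 0 0 0 = chi D t := by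
  by_cases ht : IsCoprime t D
  · exact psi_of_coprime hD hr ht (by simp [binG])
  · rw [chi_of_not_coprime ht]
    have : ∃ p : ℤ, Prime p ∧ p ∣ D ∧ p ∣ t := by
      rw [isCoprime_iff_prime hD.ne_zero] at ht
      push Not at ht
      exact ht
    obtain ⟨p, hp, hpD, hpt⟩ := this
    have hq : D ∣ t * 0 - binG ((1 : ℕ) : ℤ) r m 0 0 := by simp [binG]
    rw [psi, if_pos hq, genusCharCoeff_eq_zero hr hq hp hpD hpt (dvd_zero p)]

lemma wgtF_stdPair {r m : ℤ} (hD : IsFundamentalDiscriminant D)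
    (hr : r ^ 2 - 4 * (1 : ℕ) * m = D) : wgtF stdPair D r 0 0 1 0 = gauss D := by
  rw [wgtF, gauss]
  refine Finset.sum_congr rfl fun t _ => ?_
  have h1 : wgt stdPair D r 0 0 t 0 = chi D t := by
    have := phi_eq_psi hr 0 t 0 0
    rw [psi_zero_zero_right hD hr] at this
    rw [← this, wgt]
    simp [HypPair.toA, HypPair.toB, HypPair.toC, HypPair.kA, HypPair.kB, HypPair.kC, stdPair]
  rw [h1, one_mul]

/-- As `τ = i (v + 1)` tends to infinity, up to a common nonzero factor every term except `x = 0`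
tends to zero, and the weight at `x = 0` is the nonzero Gauss sum. -/
lemma exists_jFun_ne_zero {r m : ℤ} (hD : IsFundamentalDiscriminant D)
    (hr : r ^ 2 - 4 * (1 : ℕ) * m = D) : ∃ τ : ℍ, jFun stdPair stdGeom D r 0 τ 0 1 0 ≠ 0 := by
  by_contra! hall
  have : NeZero D.natAbs := ⟨by simpa using hD.ne_zero⟩
  have hd : (0 : ℝ) < D.natAbs := Nat.cast_pos.mpr (NeZero.pos _)
  set c : ℤ → ℂ := fun x => wgtF stdPair D r 0 x 1 0 with hc
  obtain ⟨C, hC⟩ := exists_norm_le_of_periodic (c := c) (M := 2 * 1 * D.natAbs)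
    fun m => (wgtF_periodic stdPair hD hr).2.1 0 1 0 _ _ (by simp)
  let b : ℝ := Real.pi / (2 * D.natAbs)
  have hb : 0 < b := by positivity
  set f : ℕ → ℤ → ℂ := fun v x => c x * Complex.exp ((-(b * (v + 1) * (x : ℝ) ^ 2) : ℝ)) with hf
  have hsum0 : ∀ v : ℕ, ∑' x, f v x = 0 := by
    intro v
    let τ : ℍ := ⟨Complex.I * (v + 1 : ℝ), by
      rw [Complex.I_mul_im, Complex.ofReal_re]; positivity⟩
    have h1 := hall τ
    have h2 : ∀ x : ℤ, jTerm stdPair stdGeom D r 0 τ 0 1 0 x =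
        e (Complex.I / (2 * τ.im) / D.natAbs) * f v x := by
      intro x
      have hτ : (τ : ℂ) = Complex.I * (v + 1) := by
        change Complex.I * ((v + 1 : ℝ) : ℂ) = _
        push_cast; rfl
      have hv : (τ.im : ℂ) ≠ 0 := by exact_mod_cast τ.im_pos.ne'
      have hdc : (D.natAbs : ℂ) ≠ 0 := by exact_mod_cast hd.ne'
      rw [jTerm, heatPoly_zero, one_mul, hf, hc]
      simp only
      refine Eq.trans (congrArg _ ?_) (mul_left_comm _ _ _)
      simp only [e]
      rw [← Complex.exp_add, hτ]
      congr 1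
      simp only [stdGeom, b]
      push_cast
      field_simp
      ring_nf
      rw [Complex.I_sq]
      ring
    rw [jFun] at h1
    simp only [h2, tsum_mul_left] at h1
    exact (mul_eq_zero.mp h1).resolve_left (e_ne_zero _)
  have hbound : Summable fun x : ℤ => C * Real.exp (-(b * (x : ℝ) ^ 2)) := by
    refine Summable.mul_left _ ?_
    have ha : 0 < (((1 / (2 * D.natAbs) : ℝ) : ℂ)).re := by
      rw [Complex.ofReal_re]; positivity
    refine (summable_heatPoly_gauss ha 0 0 0 0 0).norm.congr fun x => ?_
    rw [heatPoly_zero, one_mul, Complex.norm_exp]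
    congr 1
    have : (-Real.pi * ((1 / (2 * D.natAbs) : ℝ) : ℂ) * x ^ 2 + 0 * x : ℂ) =
      ((-(b * (x : ℝ) ^ 2) : ℝ) : ℂ) := by
      simp only [b]; push_cast; ring
    rw [this, Complex.ofReal_re]
  have hlim := tendsto_tsum_of_dominated_convergence (𝓕 := Filter.atTop) (f := f)
    (g := fun x => if x = 0 then c 0 else 0) hbound (fun x => ?_) ?_
  · simp only [hsum0, tsum_ite_eq] at hlim
    have h0 : c 0 = 0 := (tendsto_nhds_unique hlim tendsto_const_nhds)
    rw [hc] at h0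
    simp only at h0
    rw [wgtF_stdPair hD hr] at h0
    exact gauss_ne_zero hD h0
  · by_cases hx : x = 0
    · subst hx
      simp only [hf, if_true]
      refine Filter.Tendsto.congr (fun v => ?_) tendsto_const_nhds
      simp
    · simp only [hf, if_neg hx]
      rw [← mul_zero (c x)]
      refine Filter.Tendsto.const_mul _ ?_
      have hx2 : 0 < b * (x : ℝ) ^ 2 := by positivity
      have h1 : Filter.Tendsto (fun v : ℕ => -(b * (v + 1) * (x : ℝ) ^ 2)) Filter.atTop
          Filter.atBot := by
        have h2 : Filter.Tendsto (fun v : ℕ => (v : ℝ) + 1) Filter.atTop Filter.atTop :=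
          Filter.tendsto_atTop_add_const_right _ _ tendsto_natCast_atTop_atTop
        have h3 := (h2.const_mul_atTop hx2)
        refine (Filter.tendsto_neg_atTop_atBot.comp h3).congr fun v => ?_
        simp only [Function.comp]
        ring
      have h2 := (Real.tendsto_exp_atBot.comp h1)
      have h3 := (Complex.continuous_ofReal.tendsto 0).comp h2
      rw [Complex.ofReal_zero] at h3
      refine h3.congr fun v => ?_
      simp only [Function.comp, Complex.ofReal_exp]
  · refine Filter.Eventually.of_forall fun v x => ?_
    rw [hf]
    simp only
    rw [norm_mul, Complex.norm_exp, Complex.ofReal_re]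
    have hC0 : 0 ≤ C := (norm_nonneg _).trans (hC 0)
    refine mul_le_mul (hC x) (Real.exp_le_exp.mpr ?_) (Real.exp_pos _).le hC0
    have : 0 ≤ b * v * (x : ℝ) ^ 2 := by positivity
    nlinarith

/-- The evaluation of the Gauss sum. -/
theorem gauss_eq (hD : IsFundamentalDiscriminant D) :
    gauss D = ((√(D.natAbs : ℝ) : ℝ) : ℂ) * e ((1 - D.sign) / 8) := by
  -- At level one every fundamental discriminant has the form `r² - 4 m`. So the laws `jFun_add_one`
  -- and `jFun_inv`, which contain the Gauss sum as an unknown constant, are available to determine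
  -- it.
  obtain ⟨r, m, hr⟩ : ∃ r m : ℤ, r ^ 2 - 4 * (1 : ℕ) * m = D := by
    rcases hD with ⟨h, -⟩ | ⟨q, rfl, -⟩
    · exact ⟨1, (1 - D) / 4, by push_cast; omega⟩
    · exact ⟨0, -q, by push_cast; ring⟩
  have : NeZero D.natAbs := ⟨by simpa using hD.ne_zero⟩
  have hd : (0 : ℝ) < D.natAbs := Nat.cast_pos.mpr (NeZero.pos _)
  obtain ⟨τ, hτ⟩ := exists_jFun_ne_zero hD hr
  set C : ℂ := gauss D / ((√(2 * (1 : ℕ) * D.natAbs : ℝ) : ℝ) : ℂ) * e (-1 / 8) with hC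
  have hC0 : C ≠ 0 := by
    refine mul_ne_zero (div_ne_zero (gauss_ne_zero hD) ?_) (e_ne_zero _)
    exact_mod_cast (Real.sqrt_pos.mpr (by push_cast; linarith)).ne'
  set s := D.sign with hs
  have hs1 : s = 1 ∨ s = -1 := by
    rcases lt_or_gt_of_ne hD.ne_zero with h | h
    · exact Or.inr (Int.sign_eq_neg_one_of_neg h)
    · exact Or.inl (Int.sign_eq_one_of_pos h)
  set j : ℂ := e ((s : ℂ) / 4) with hj
  have hj2 : j ^ 2 = -1 := by
    rw [hj, pow_two, ← e_add, e]
    rcases hs1 with h | h <;> rw [h]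
    · rw [show (2 * Real.pi * Complex.I * (((1 : ℤ) : ℂ) / 4 + ((1 : ℤ) : ℂ) / 4) : ℂ) =
        Real.pi * Complex.I by push_cast; ring, Complex.exp_pi_mul_I]
    · rw [show (2 * Real.pi * Complex.I * (((-1 : ℤ) : ℂ) / 4 + ((-1 : ℤ) : ℂ) / 4) : ℂ) =
        -(Real.pi * Complex.I) by push_cast; ring, Complex.exp_neg, Complex.exp_pi_mul_I]
      norm_num
  set f : ℤ → ℍ → ℤ → ℤ → ℂ := fun h τ n α => jFun stdPair stdGeom D r 0 τ n α h with hf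
  have hm1 : er 2 (-(s * 1 * 1)) = -1 := by
    rw [er, e]
    rcases hs1 with h | h <;> rw [h]
    · rw [show (2 * Real.pi * Complex.I * (((-(1 * 1 * 1) : ℤ) : ℂ) / ((2 : ℕ) : ℂ)) : ℂ) =
        -(Real.pi * Complex.I) by push_cast; ring, Complex.exp_neg, Complex.exp_pi_mul_I]
      norm_num
    · rw [show (2 * Real.pi * Complex.I * (((-(-1 * 1 * 1) : ℤ) : ℂ) / ((2 : ℕ) : ℂ)) : ℂ) =
        Real.pi * Complex.I by push_cast; ring, Complex.exp_pi_mul_I]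
  have S0 : ∀ {τ τ' : ℍ}, (τ' : ℂ) = -1 / τ → ∀ n α, f 0 τ' n α =
      C * (τ : ℂ) ^ (1 / 2 : ℂ) * (f 0 τ (-α) n + f 1 τ (-α) n) := by
    intro τ τ' h n α
    have := jFun_inv stdPair stdGeom hD hr 0 h n α 0
    simp only [hf]
    rw [this, hC]
    simp only [mul_one, Finset.sum_range_succ, Finset.sum_range_zero, zero_add, pow_zero]
    simp only [mul_zero, zero_mul, neg_zero, er_zero, one_mul, Nat.cast_zero, Nat.cast_one]
    ring
  have S1 : ∀ {τ τ' : ℍ}, (τ' : ℂ) = -1 / τ → ∀ n α, f 1 τ' n α =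
      C * (τ : ℂ) ^ (1 / 2 : ℂ) * (f 0 τ (-α) n - f 1 τ (-α) n) := by
    intro τ τ' h n α
    have := jFun_inv stdPair stdGeom hD hr 0 h n α 1
    simp only [hf]
    rw [this, hC]
    simp only [mul_one 2, Finset.sum_range_succ, Finset.sum_range_zero, zero_add, pow_zero]
    simp only [mul_zero, neg_zero, er_zero, one_mul, Nat.cast_zero, Nat.cast_one]
    rw [hm1]
    ring
  have T0 : ∀ {τ τ' : ℍ}, (τ' : ℂ) = τ + 1 → ∀ n α, f 0 τ' n α = f 0 τ n (α - n) := by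
    intro τ τ' h n α
    have := jFun_add_one stdPair stdGeom (r := r) hD.ne_zero 0 h n α 0
    simpa [e_zero] using this
  have T1 : ∀ {τ τ' : ℍ}, (τ' : ℂ) = τ + 1 → ∀ n α, f 1 τ' n α = j * f 1 τ n (α - n) := by
    intro τ τ' h n α
    have := jFun_add_one stdPair stdGeom (r := r) hD.ne_zero 0 h n α 1
    simpa using this
  have h0 : (τ : ℂ) ≠ 0 := τ.ne_zero
  -- The points satisfy `τ = S t1`, `t1 = T t2`, `t2 = S t3`, `t3 = T t4`, `t4 = S t5`, `t5 = T τ`: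
  -- the relation that `(S T)³` acts trivially.
  let t1 : ℍ := ModularGroup.S • τ
  have e1 : (t1 : ℂ) = -1 / τ := by
    simp only [t1]
    rw [modular_S_smul]
    change (-(τ : ℂ))⁻¹ = _
    rw [inv_neg, neg_div, one_div]
  let t5 : ℍ := ModularGroup.T • τ
  have e5 : (t5 : ℂ) = τ + 1 := by
    simp only [t5]
    rw [modular_T_smul]
    simp [add_comm]
  let t4 : ℍ := ModularGroup.S • t5
  have e4 : (t4 : ℂ) = -1 / t5 := by
    simp only [t4]
    rw [modular_S_smul]
    change (-(t5 : ℂ))⁻¹ = _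
    rw [inv_neg, neg_div, one_div]
  let t3 : ℍ := ModularGroup.T • t4
  have e3 : (t3 : ℂ) = t4 + 1 := by
    simp only [t3]
    rw [modular_T_smul]
    simp [add_comm]
  let t2 : ℍ := ModularGroup.S • t3
  have e2 : (t2 : ℂ) = -1 / t3 := by
    simp only [t2]
    rw [modular_S_smul]
    change (-(t3 : ℂ))⁻¹ = _
    rw [inv_neg, neg_div, one_div]
  have h5 : (τ : ℂ) + 1 ≠ 0 := e5 ▸ t5.ne_zero
  have h3 : (t3 : ℂ) = τ / (τ + 1) := by
    rw [e3, e4, e5]; field_simp; ring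
  have e12 : (t1 : ℂ) = t2 + 1 := by
    rw [e1, e2, h3]; field_simp; ring
  have e0 : (τ : ℂ) = -1 / t1 := by
    rw [e1]; field_simp
  have r1 := cpow_half_inv e1
  have r2 : (t3 : ℂ) ^ (1 / 2 : ℂ) * (t5 : ℂ) ^ (1 / 2 : ℂ) = (τ : ℂ) ^ (1 / 2 : ℂ) :=
    cpow_half_mul (by rw [h3, e5]; field_simp)
  -- the relation from the square of the inversion
  have A1 : f 0 τ 0 (-1) = 2 * Complex.I * C ^ 2 * f 0 τ 0 1 := by
    rw [S0 e0, S0 e1, S1 e1]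
    simp only [neg_neg, neg_zero]
    linear_combination (2 * C ^ 2 * f 0 τ 0 1) * r1
  -- the relation from the cube of the product of the generators
  have A2 : f 0 τ 0 (-1) = 2 * Complex.I * C ^ 3 * (1 + j) * f 0 τ 0 1 := by
    rw [S0 e0, T0 e12, T1 e12, S0 e2, S1 e2, T0 e3, T1 e3, S0 e4, S1 e4, T0 e5, T1 e5]
    simp only [neg_neg, neg_zero, zero_sub, sub_self, sub_zero, Int.reduceNeg]
    rw [← r1, ← r2]
    linear_combination (C ^ 3 * (t1 : ℂ) ^ (1 / 2 : ℂ) * (t3 : ℂ) ^ (1 / 2 : ℂ) *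
      (t5 : ℂ) ^ (1 / 2 : ℂ)) * (-f 0 τ 0 1 + j * f 1 τ 0 1) * hj2
  -- The two relations evaluate the same quantity; as `C` and `f 0 τ 0 1` are nonzero, their
  -- comparison fixes `C`. Here `j` is `i` or `-i` according to the sign of `D`.
  have hCj : C * (1 + j) = 1 := by
    have h1 : (2 * Complex.I * C ^ 2 * f 0 τ 0 1) * (C * (1 + j) - 1) = 0 := by
      linear_combination A1 - A2
    have h2 : (2 * Complex.I * C ^ 2 * f 0 τ 0 1) ≠ 0 := by
      refine mul_ne_zero (mul_ne_zero (by simp) (pow_ne_zero 2 hC0)) hτ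
    linear_combination (mul_eq_zero.mp h1).resolve_left h2
  have hI8 : e (1 / 4) = Complex.I := by
    rw [e, show (2 * Real.pi * Complex.I * (1 / 4) : ℂ) = Real.pi / 2 * Complex.I by ring,
      Complex.exp_pi_div_two_mul_I]
  have h8 : e (1 / 8) ^ 2 = Complex.I := by
    rw [pow_two, ← e_add, ← hI8]; norm_num
  have h8' : e (-1 / 8) * e (1 / 8) = 1 := by
    rw [← e_add, show (-1 / 8 + 1 / 8 : ℂ) = 0 by norm_num, e_zero]
  have hsq2 : ((√2 : ℝ) : ℂ) * ((√2 : ℝ) : ℂ) = 2 := by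
    exact_mod_cast Real.mul_self_sqrt (by norm_num : (0 : ℝ) ≤ 2)
  have hsqrt2 : ((√2 : ℝ) : ℂ) * e (1 / 8) = 1 + Complex.I := by
    have : e (1 / 8) = ((√2 : ℝ) : ℂ) / 2 + ((√2 : ℝ) : ℂ) / 2 * Complex.I := by
      rw [e, show (2 * Real.pi * Complex.I * (1 / 8) : ℂ) = ((Real.pi / 4 : ℝ) : ℂ) * Complex.I by
        push_cast; ring, Complex.exp_mul_I, ← Complex.ofReal_cos, ← Complex.ofReal_sin,
        Real.cos_pi_div_four, Real.sin_pi_div_four]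
      push_cast; ring
    rw [this]
    linear_combination (1 / 2 + Complex.I / 2) * hsq2
  have hroot : ((√(2 * (1 : ℕ) * D.natAbs : ℝ) : ℝ) : ℂ) =
      ((√2 : ℝ) : ℂ) * ((√(D.natAbs : ℝ) : ℝ) : ℂ) := by
    rw [Nat.cast_one, mul_one, Real.sqrt_mul (by norm_num)]
    push_cast; rfl
  have hr0 : ((√(2 * (1 : ℕ) * D.natAbs : ℝ) : ℝ) : ℂ) ≠ 0 := by
    exact_mod_cast (Real.sqrt_pos.mpr (by push_cast; linarith)).ne'
  have hG : gauss D * e (-1 / 8) * (1 + j) =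
      ((√2 : ℝ) : ℂ) * ((√(D.natAbs : ℝ) : ℝ) : ℂ) := by
    rw [hC] at hCj
    rw [← hroot]
    generalize e (-1 / 8) = E at hCj ⊢
    field_simp at hCj
    linear_combination hCj
  rcases hs1 with h | h
  · have hjI : j = Complex.I := by rw [hj, h, ← hI8]; norm_num
    rw [h, show ((1 - ((1 : ℤ) : ℂ)) / 8) = 0 by norm_num, e_zero, mul_one]
    have h2 : ((√2 : ℝ) : ℂ) ≠ 0 := by
      exact_mod_cast (Real.sqrt_pos.mpr (by norm_num : (0 : ℝ) < 2)).ne'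
    rw [hjI, ← hsqrt2] at hG
    apply mul_left_cancel₀ h2
    linear_combination hG - (gauss D * ((√2 : ℝ) : ℂ)) * h8'
  · have hjI : j = -Complex.I := by
      have : j * Complex.I = 1 := by
        rw [hj, h, ← hI8, ← e_add, show (((-1 : ℤ) : ℂ) / 4 + 1 / 4 : ℂ) = 0 by norm_num, e_zero]
      linear_combination (-Complex.I) * this + j * Complex.I_sq
    rw [h, show ((1 - ((-1 : ℤ) : ℂ)) / 8) = 1 / 4 by norm_num, hI8]
    have h2 : ((√2 : ℝ) : ℂ) ≠ 0 := by
      exact_mod_cast (Real.sqrt_pos.mpr (by norm_num : (0 : ℝ) < 2)).ne'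
    rw [hjI] at hG
    have h3 : (1 + -Complex.I) * Complex.I = ((√2 : ℝ) : ℂ) * e (1 / 8) := by
      rw [hsqrt2]; linear_combination -Complex.I_sq
    apply mul_left_cancel₀ h2
    linear_combination Complex.I * hG - (gauss D * e (-1 / 8)) * h3 -
      (gauss D * ((√2 : ℝ) : ℂ)) * h8'

end

/-! ### Summability of Gaussians on `ℤ³` -/

/-- A positive definite quadratic form on `ℝ³` in the variables `x`, `n`, `m`. -/
def radSq (s p q : ℝ) (x n m : ℝ) : ℝ :=
  (m - p * (x - s * n) - q * n) ^ 2 + n ^ 2 + (x - s * n) ^ 2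

lemma radSq_nonneg (s p q x n m : ℝ) : 0 ≤ radSq s p q x n m := by
  unfold radSq; positivity

lemma exists_mul_le_radSq (s p q : ℝ) :
    ∃ η : ℝ, 0 < η ∧ ∀ x n m : ℝ, η * (x ^ 2 + n ^ 2 + m ^ 2) ≤ radSq s p q x n m := by
  have hpos : 0 < 6 + 2 * s ^ 2 + 3 * p ^ 2 + 3 * q ^ 2 := by positivity
  refine ⟨1 / (6 + 2 * s ^ 2 + 3 * p ^ 2 + 3 * q ^ 2), by positivity, fun x n m => ?_⟩
  rw [one_div_mul_eq_div, div_le_iff₀ hpos]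
  obtain ⟨y, hy⟩ : ∃ y, y = x - s * n := ⟨_, rfl⟩
  obtain ⟨w, hw⟩ : ∃ w, w = m - p * y - q * n := ⟨_, rfl⟩
  have hx : x = y + s * n := by rw [hy]; ring
  have hm : m = w + p * y + q * n := by rw [hw]; ring
  have hR : radSq s p q x n m = w ^ 2 + n ^ 2 + y ^ 2 := by rw [radSq, ← hy, ← hw]
  rw [hR, hx, hm]
  have h1 : (y + s * n) ^ 2 ≤ 2 * y ^ 2 + 2 * s ^ 2 * n ^ 2 := by nlinarith [sq_nonneg (y - s * n)]
  have h2 : (w + p * y + q * n) ^ 2 ≤ 3 * w ^ 2 + 3 * p ^ 2 * y ^ 2 + 3 * q ^ 2 * n ^ 2 := by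
    nlinarith [sq_nonneg (w - p * y), sq_nonneg (w - q * n), sq_nonneg (p * y - q * n)]
  have h3 : 0 ≤ (2 * s ^ 2 + 3 * q ^ 2) * (w ^ 2 + y ^ 2) + 3 * p ^ 2 * (w ^ 2 + n ^ 2) +
      3 * w ^ 2 + 4 * y ^ 2 + 5 * n ^ 2 := by positivity
  nlinarith

lemma summable_exp_neg_mul_sq {c : ℝ} (hc : 0 < c) :
    Summable fun x : ℤ => Real.exp (-(c * (x : ℝ) ^ 2)) := by
  have ha : 0 < (((c / Real.pi : ℝ) : ℂ)).re := by
    rw [Complex.ofReal_re]; positivity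
  refine (summable_heatPoly_gauss ha 0 0 0 0 0).norm.congr fun x => ?_
  rw [heatPoly_zero, one_mul, Complex.norm_exp]
  congr 1
  have : (-Real.pi * ((c / Real.pi : ℝ) : ℂ) * x ^ 2 + 0 * x : ℂ) =
      ((-(c * (x : ℝ) ^ 2) : ℝ) : ℂ) := by
    have : (Real.pi : ℂ) ≠ 0 := by exact_mod_cast Real.pi_ne_zero
    push_cast; field_simp; ring
  rw [this, Complex.ofReal_re]

lemma one_add_pow_mul_exp_le {b R : ℝ} (hb : 0 < b) (hR : 0 ≤ R) (K : ℕ) :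
    (1 + R) ^ K ≤ K.factorial / b ^ K * Real.exp b * Real.exp (b * R) := by
  have h := Real.pow_div_factorial_le_exp (b * (1 + R)) (by positivity) K
  rw [div_le_iff₀ (by positivity), mul_pow, mul_add, mul_one, Real.exp_add] at h
  rw [div_mul_eq_mul_div, div_mul_eq_mul_div, le_div_iff₀ (by positivity)]
  linarith

/-- Half of the exponent absorbs the polynomial factor; the other half is dominated by a product of
three one-dimensional Gaussians. -/
lemma summable_of_radSq_bound (s p q : ℝ) {a C : ℝ} (ha : 0 < a) (hC : 0 ≤ C) (K : ℕ)
    {f : (ℤ × ℤ) × ℤ → ℂ}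
    (hf : ∀ x n m : ℤ, ‖f ((x, n), m)‖ ≤ C * (1 + radSq s p q x n m) ^ K *
      Real.exp (-(a * radSq s p q x n m))) : Summable f := by
  obtain ⟨η, hη, hle⟩ := exists_mul_le_radSq s p q
  have hc : 0 < a / 2 * η := by positivity
  have h1 := summable_exp_neg_mul_sq hc
  have h0 : ∀ x : ℤ, 0 ≤ Real.exp (-(a / 2 * η * (x : ℝ) ^ 2)) := fun x => (Real.exp_pos _).le
  have h3 := (h1.mul_of_nonneg h1 h0 h0).mul_of_nonneg h1
    (fun p => mul_nonneg (h0 p.1) (h0 p.2)) h0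
  refine Summable.of_norm_bounded
    (h3.mul_left (C * (K.factorial / (a / 2) ^ K * Real.exp (a / 2)))) ?_
  rintro ⟨⟨x, n⟩, m⟩
  refine (hf x n m).trans ?_
  set R := radSq s p q x n m with hR
  have hR0 : 0 ≤ R := radSq_nonneg _ _ _ _ _ _
  have h4 := one_add_pow_mul_exp_le (half_pos ha) hR0 K
  have h5 : Real.exp (-(a / 2 * R)) ≤ Real.exp (-(a / 2 * η * (x : ℝ) ^ 2)) *
      Real.exp (-(a / 2 * η * (n : ℝ) ^ 2)) * Real.exp (-(a / 2 * η * (m : ℝ) ^ 2)) := by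
    rw [← Real.exp_add, ← Real.exp_add, Real.exp_le_exp]
    have := hle x n m
    nlinarith
  have h6 : Real.exp (-(a * R)) = Real.exp (-(a / 2 * R)) * Real.exp (-(a / 2 * R)) := by
    rw [← Real.exp_add]; congr 1; ring
  have h7 : Real.exp (a / 2 * R) * Real.exp (-(a / 2 * R)) = 1 := by
    rw [← Real.exp_add, add_neg_cancel, Real.exp_zero]
  calc C * (1 + R) ^ K * Real.exp (-(a * R))
      ≤ C * (K.factorial / (a / 2) ^ K * Real.exp (a / 2) * Real.exp (a / 2 * R)) *
        Real.exp (-(a * R)) := by gcongr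
    _ = C * (K.factorial / (a / 2) ^ K * Real.exp (a / 2)) * Real.exp (-(a / 2 * R)) := by
      rw [h6]
      linear_combination (C * (K.factorial / (a / 2) ^ K * Real.exp (a / 2)) *
        Real.exp (-(a / 2 * R))) * h7
    _ ≤ _ := by gcongr

lemma abs_le_one_add_radSq (s p q x n m : ℝ) :
    |m - p * (x - s * n) - q * n| ≤ 1 + radSq s p q x n m ∧ |n| ≤ 1 + radSq s p q x n m ∧
      |x - s * n| ≤ 1 + radSq s p q x n m := by
  have key : ∀ y z : ℝ, 0 ≤ z → |y| ≤ 1 + (y ^ 2 + z) := fun y z hz => by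
    rw [abs_le]
    constructor <;> nlinarith [sq_nonneg (y - 1 / 2), sq_nonneg (y + 1 / 2)]
  unfold radSq
  refine ⟨?_, ?_, ?_⟩
  · refine (key _ (n ^ 2 + (x - s * n) ^ 2) (by positivity)).trans_eq (by ring)
  · refine (key _ ((m - p * (x - s * n) - q * n) ^ 2 + (x - s * n) ^ 2)
      (by positivity)).trans_eq (by ring)
  · refine (key _ ((m - p * (x - s * n) - q * n) ^ 2 + n ^ 2) (by positivity)).trans_eq (by ring)

lemma norm_linear_le (s p q x n m : ℝ) (α β γ : ℂ) :
    ‖α * ((m - p * (x - s * n) - q * n : ℝ) : ℂ) + β * (n : ℂ) + γ * ((x - s * n : ℝ) : ℂ)‖ ≤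
      (‖α‖ + ‖β‖ + ‖γ‖) * (1 + radSq s p q x n m) := by
  obtain ⟨h1, h2, h3⟩ := abs_le_one_add_radSq s p q x n m
  refine (norm_add₃_le).trans ?_
  rw [norm_mul, norm_mul, norm_mul, Complex.norm_real, Complex.norm_real, Complex.norm_real,
    Real.norm_eq_abs, Real.norm_eq_abs, Real.norm_eq_abs, add_mul, add_mul]
  gcongr

lemma norm_e (w : ℂ) : ‖e w‖ = Real.exp (-(2 * Real.pi * w.im)) := by
  rw [e, Complex.norm_exp]
  congr 1
  simp [Complex.mul_re, Complex.mul_im]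

lemma im_real_mul_add (a b : ℝ) (τ : ℍ) :
    ((a : ℂ) * τ + (b : ℂ) * Complex.I).im = a * τ.im + b := by
  simp

lemma im_real_add (a b : ℝ) : ((a : ℂ) + (b : ℂ) * Complex.I).im = b := by
  simp

lemma heatPoly_zero_left (n : ℕ) (X : ℂ) : heatPoly 0 n X = X ^ n := by
  induction n with
  | zero => simp
  | succ n ih => rw [heatPoly_succ, ih]; ring

/-! ### Poisson summation of the theta kernel in the direction of `l`. -/

section

variable {N : ℕ} {D r m₀ : ℤ} (P : HypPair N) (G : Geom N)

/-- The value `p_z(λ) / p_z(l)` up to the contribution of `l`. -/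
def Geom.pos (x n : ℝ) : ℝ := G.ρ * x - n / (2 * G.A) - N * G.ρ ^ 2 * n

/-- The value `q_z(λ) / q_z(l)` up to the contribution of `l`. -/
def Geom.cpos (x n : ℝ) : ℂ :=
  G.pos x n + n / G.A + Complex.I * G.σ * (x - 2 * N * G.ρ * n)

/-- The summand of the theta kernel in adapted coordinates. -/
def thetaCoord (D r : ℤ) (κ : ℕ) (τ : ℍ) (h x n m : ℤ) : ℂ :=
  wgt P D r h x m n * ((m + G.pos x n) * (m + G.cpos x n) ^ κ *
    e ((((x : ℂ) ^ 2 / (4 * N) + m * n) * τ + Complex.I * τ.im * G.A * (m + G.pos x n) ^ 2) /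
      D.natAbs))

/-- The summand of the theta kernel after Poisson summation. -/
def dualTerm (D r : ℤ) (κ : ℕ) (τ : ℍ) (h x n α : ℤ) : ℂ :=
  (n * τ - α) * Complex.I ^ (κ + 1) * jTerm P G D r κ τ n α h x +
    D.natAbs / (2 * Real.pi) * κ * Complex.I ^ (κ - 1) * jTerm P G D r (κ - 1) τ n α h x

/-- The contribution of a pair `(n, α)` to the theta kernel, up to a constant. -/
def latTerm (D r : ℤ) (κ : ℕ) (τ : ℍ) (n α h : ℤ) : ℂ :=
  (n * τ - α) * Complex.I ^ (κ + 1) * jFun P G D r κ τ n α h +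
    D.natAbs / (2 * Real.pi) * κ * Complex.I ^ (κ - 1) * jFun P G D r (κ - 1) τ n α h

lemma exists_norm_wgt_le [NeZero N] (hD : IsFundamentalDiscriminant D)
    (hr : r ^ 2 - 4 * N * m₀ = D) (h : ℤ) :
    ∃ C : ℝ, 0 ≤ C ∧ ∀ x m n : ℤ, ‖(wgt P D r h x m n : ℂ)‖ ≤ C := by
  have : NeZero D.natAbs := ⟨by simpa using hD.ne_zero⟩
  have hd : (0 : ℤ) < D.natAbs := by exact_mod_cast NeZero.pos D.natAbs
  have hM : (0 : ℤ) < (2 * N * D.natAbs : ℕ) := by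
    exact_mod_cast NeZero.pos (2 * N * D.natAbs)
  refine ⟨∑ x ∈ Finset.range (2 * N * D.natAbs), ∑ m ∈ Finset.range D.natAbs,
    ∑ n ∈ Finset.range D.natAbs, ‖(wgt P D r h x m n : ℂ)‖, by positivity, fun x m n => ?_⟩
  have key : ∀ (M : ℕ) (y : ℤ), (0 : ℤ) < M → ∃ i ∈ Finset.range M, (M : ℤ) ∣ y - i := by
    intro M y hM
    refine ⟨(y % M).toNat, ?_, ?_⟩
    · rw [Finset.mem_range]
      have := Int.emod_lt_of_pos y hM
      have := Int.emod_nonneg y hM.ne'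
      omega
    · rw [Int.toNat_of_nonneg (Int.emod_nonneg y hM.ne')]
      exact Int.dvd_self_sub_emod
  obtain ⟨x', hx', hxd⟩ := key _ x hM
  obtain ⟨m', hm', hmd⟩ := key _ m hd
  obtain ⟨n', hn', hnd⟩ := key _ n hd
  rw [wgt_congr P hD hr (by simp : ((2 * N : ℕ) : ℤ) ∣ h - h) hxd hmd hnd]
  refine le_trans ?_ (Finset.single_le_sum (f := fun x : ℕ => ∑ m ∈ Finset.range D.natAbs,
    ∑ n ∈ Finset.range D.natAbs, ‖(wgt P D r h x m n : ℂ)‖) (fun _ _ => by positivity) hx')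
  refine le_trans ?_ (Finset.single_le_sum (f := fun m : ℕ =>
    ∑ n ∈ Finset.range D.natAbs, ‖(wgt P D r h x' m n : ℂ)‖) (fun _ _ => by positivity) hm')
  exact Finset.single_le_sum (f := fun n : ℕ => ‖(wgt P D r h x' m' n : ℂ)‖)
    (fun _ _ => by positivity) hn'

lemma exists_norm_wgtF_le [NeZero N] (hD : IsFundamentalDiscriminant D)
    (hr : r ^ 2 - 4 * N * m₀ = D) (h : ℤ) :
    ∃ C : ℝ, 0 ≤ C ∧ ∀ x α n : ℤ, ‖wgtF P D r h x α n‖ ≤ C := by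
  obtain ⟨C, hC0, hC⟩ := exists_norm_wgt_le P hD hr h
  refine ⟨D.natAbs * C, by positivity, fun x α n => ?_⟩
  rw [wgtF]
  refine (norm_sum_le _ _).trans ?_
  have : ∀ t ∈ Finset.range D.natAbs, ‖(wgt P D r h x t n : ℂ) * er D.natAbs (α * t)‖ ≤ C := by
    intro t _
    rw [norm_mul]
    have h1 : ‖er D.natAbs (α * t)‖ = 1 := by
      rw [er, norm_e]
      have : (((α * t : ℤ) : ℂ) / (D.natAbs : ℂ)) = (((α * t : ℤ) / D.natAbs : ℝ) : ℂ) := by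
        push_cast; rfl
      rw [this, Complex.ofReal_im]; simp
    rw [h1, mul_one]
    exact hC _ _ _
  refine (Finset.sum_le_sum this).trans ?_
  simp

lemma quad_lower {c₁ c₂ c₃ : ℝ} (h₁ : 0 < c₁) (h₂ : 0 < c₂) (h₃ : 0 < c₃) (s p q : ℝ) :
    ∃ a, 0 < a ∧ ∀ x n m : ℝ, a * radSq s p q x n m ≤
      c₁ * (m - p * (x - s * n) - q * n) ^ 2 + c₂ * n ^ 2 + c₃ * (x - s * n) ^ 2 := by
  refine ⟨min c₁ (min c₂ c₃), by positivity, fun x n m => ?_⟩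
  have e1 : min c₁ (min c₂ c₃) ≤ c₁ := min_le_left _ _
  have e2 : min c₁ (min c₂ c₃) ≤ c₂ := (min_le_right _ _).trans (min_le_left _ _)
  have e3 : min c₁ (min c₂ c₃) ≤ c₃ := (min_le_right _ _).trans (min_le_right _ _)
  rw [radSq, mul_add, mul_add]
  gcongr

lemma summable_thetaCoord [NeZero N] (hD : IsFundamentalDiscriminant D)
    (hr : r ^ 2 - 4 * N * m₀ = D) (κ : ℕ) (τ : ℍ) (h : ℤ) :
    Summable fun y : (ℤ × ℤ) × ℤ => thetaCoord P G D r κ τ h y.1.1 y.1.2 y.2 := by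
  have hN : (0 : ℝ) < N := Nat.cast_pos.mpr (NeZero.pos N)
  have hd : (0 : ℝ) < D.natAbs := Nat.cast_pos.mpr (by simpa using hD.ne_zero)
  have hA := G.A_pos
  have hv := τ.im_pos
  obtain ⟨C, hC0, hC⟩ := exists_norm_wgt_le P hD hr h
  obtain ⟨a, ha, hle⟩ := quad_lower (c₁ := 2 * Real.pi * τ.im / D.natAbs * G.A)
    (c₂ := 2 * Real.pi * τ.im / D.natAbs * (1 / (4 * G.A)))
    (c₃ := 2 * Real.pi * τ.im / D.natAbs * (1 / (4 * N))) (by positivity) (by positivity)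
    (by positivity) (2 * N * G.ρ) (-G.ρ) (-(N * G.ρ ^ 2))
  obtain ⟨c, hc⟩ : ∃ c : ℝ, c = ‖(1 : ℂ)‖ + ‖(-(1 / (2 * G.A)) : ℂ)‖ + ‖(0 : ℂ)‖ := ⟨_, rfl⟩
  obtain ⟨c', hc'⟩ : ∃ c : ℝ, c = ‖(1 : ℂ)‖ + ‖((1 / (2 * G.A)) : ℂ)‖ + ‖(Complex.I * G.σ : ℂ)‖ :=
    ⟨_, rfl⟩
  have hc0 : 0 ≤ c := by rw [hc]; positivity
  have hc0' : 0 ≤ c' := by rw [hc']; positivity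
  refine summable_of_radSq_bound (2 * N * G.ρ) (-G.ρ) (-(N * G.ρ ^ 2)) ha
    (C := C * (c * c' ^ κ)) (by positivity) (κ + 1) fun x n m => ?_
  have b1 := norm_linear_le (2 * N * G.ρ) (-G.ρ) (-(N * G.ρ ^ 2)) x n m 1 (-(1 / (2 * G.A))) 0
  have b2 := norm_linear_le (2 * N * G.ρ) (-G.ρ) (-(N * G.ρ ^ 2)) x n m 1 ((1 / (2 * G.A)))
    (Complex.I * G.σ)
  have b3 := hle x n m
  rw [← hc] at b1
  rw [← hc'] at b2
  set R := radSq (2 * N * G.ρ) (-G.ρ) (-(N * G.ρ ^ 2)) x n m with hR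
  have hR0 : 0 ≤ R := radSq_nonneg _ _ _ _ _ _
  have hAc : (G.A : ℂ) ≠ 0 := by exact_mod_cast hA.ne'
  have e1 : (m + G.pos x n : ℂ) = 1 * ((m - -G.ρ * (x - 2 * N * G.ρ * n) -
      -(N * G.ρ ^ 2) * n : ℝ) : ℂ) + -(1 / (2 * G.A)) * ((n : ℝ) : ℂ) +
      0 * ((x - 2 * N * G.ρ * n : ℝ) : ℂ) := by
    rw [Geom.pos]; push_cast; field_simp; ring
  have e2 : (m + G.cpos x n : ℂ) = 1 * ((m - -G.ρ * (x - 2 * N * G.ρ * n) -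
      -(N * G.ρ ^ 2) * n : ℝ) : ℂ) + (1 / (2 * G.A)) * ((n : ℝ) : ℂ) +
      Complex.I * G.σ * ((x - 2 * N * G.ρ * n : ℝ) : ℂ) := by
    rw [Geom.cpos, Geom.pos]; push_cast; field_simp; ring
  rw [thetaCoord, norm_mul, norm_mul, norm_mul, norm_pow, norm_e]
  rw [← e1] at b1
  rw [← e2] at b2
  -- This is `v / |D|` times the majorant `Q_z`, diagonalised as a sum of three squares.
  have e3 : ((((x : ℂ) ^ 2 / (4 * N) + m * n) * τ +
      Complex.I * τ.im * G.A * (m + G.pos x n) ^ 2) / D.natAbs).im =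
      τ.im / D.natAbs * (G.A * (m - -G.ρ * (x - 2 * N * G.ρ * n) - -(N * G.ρ ^ 2) * n) ^ 2 +
        1 / (4 * G.A) * n ^ 2 + 1 / (4 * N) * (x - 2 * N * G.ρ * n) ^ 2) := by
    have : ((((x : ℂ) ^ 2 / (4 * N) + m * n) * τ +
      Complex.I * τ.im * G.A * (m + G.pos x n) ^ 2) / D.natAbs) =
      ((((x : ℝ) ^ 2 / (4 * N) + m * n) / D.natAbs : ℝ) : ℂ) * τ +
        ((τ.im * G.A * (m + G.pos x n) ^ 2 / D.natAbs : ℝ) : ℂ) * Complex.I := by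
      push_cast; ring
    rw [this, im_real_mul_add]
    rw [Geom.pos]
    field_simp
    ring
  rw [e3]
  have b4 : Real.exp (-(2 * Real.pi * (τ.im / D.natAbs * (G.A *
      (m - -G.ρ * (x - 2 * N * G.ρ * n) - -(N * G.ρ ^ 2) * n) ^ 2 +
        1 / (4 * G.A) * n ^ 2 + 1 / (4 * N) * (x - 2 * N * G.ρ * n) ^ 2)))) ≤
      Real.exp (-(a * R)) := by
    rw [Real.exp_le_exp]
    refine neg_le_neg (b3.trans_eq ?_)
    ring
  calc _ ≤ C * ((c * (1 + R)) * (c' * (1 + R)) ^ κ * Real.exp (-(a * R))) := by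
        gcongr
        exact hC x m n
    _ = _ := by rw [mul_pow]; ring

lemma conj_eq (τ : ℍ) : (starRingEnd ℂ) (τ : ℂ) = (τ : ℂ) - 2 * Complex.I * τ.im := by
  apply Complex.ext <;> simp
  ring

lemma summable_jTerm_mul [NeZero N] (hD : IsFundamentalDiscriminant D)
    (hr : r ^ 2 - 4 * N * m₀ = D) (κ : ℕ) (τ : ℍ) (h : ℤ) (c₀ c₁ : ℂ) :
    Summable fun y : (ℤ × ℤ) × ℤ =>
      (c₀ + c₁ * (y.1.2 * τ - y.2)) * jTerm P G D r κ τ y.1.2 y.2 h y.1.1 := by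
  have hN : (0 : ℝ) < N := Nat.cast_pos.mpr (NeZero.pos N)
  have hd : (0 : ℝ) < D.natAbs := Nat.cast_pos.mpr (by simpa using hD.ne_zero)
  have hA := G.A_pos
  have hv := τ.im_pos
  have hvc : (τ.im : ℂ) ≠ 0 := by exact_mod_cast hv.ne'
  have hAc : (G.A : ℂ) ≠ 0 := by exact_mod_cast hA.ne'
  obtain ⟨C, hC0, hC⟩ := exists_norm_wgtF_le P hD hr h
  obtain ⟨H, hH0, hH⟩ := exists_norm_heatPoly_le (-(D.natAbs / (8 * Real.pi * τ.im * G.A))) κ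
  obtain ⟨a, ha, hle⟩ := quad_lower (c₁ := 2 * Real.pi / D.natAbs * (1 / (4 * τ.im * G.A)))
    (c₂ := 2 * Real.pi / D.natAbs * (τ.im / (4 * G.A)))
    (c₃ := 2 * Real.pi / D.natAbs * (τ.im / (4 * N))) (by positivity) (by positivity)
    (by positivity) (2 * N * G.ρ) 0 τ.re
  obtain ⟨c, hc⟩ : ∃ c : ℝ, c = ‖(-1 : ℂ)‖ + ‖(Complex.I * τ.im : ℂ)‖ + ‖(0 : ℂ)‖ := ⟨_, rfl⟩
  obtain ⟨c', hc'⟩ : ∃ c : ℝ, c = ‖(-(1 / (2 * τ.im * G.A)) : ℂ)‖ +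
    ‖(-Complex.I / (2 * G.A) : ℂ)‖ + ‖(G.σ : ℂ)‖ := ⟨_, rfl⟩
  have hc0 : 0 ≤ c := by rw [hc]; positivity
  have hc0' : 0 ≤ c' := by rw [hc']; positivity
  refine summable_of_radSq_bound (2 * N * G.ρ) 0 τ.re ha
    (C := (‖c₀‖ + ‖c₁‖ * c) * (C * (H * (1 + c') ^ κ))) (by positivity) (κ + 1) fun x n m => ?_
  have b1 := norm_linear_le (2 * N * G.ρ) 0 τ.re x n m (-1) (Complex.I * τ.im) 0
  have b2 := norm_linear_le (2 * N * G.ρ) 0 τ.re x n m (-(1 / (2 * τ.im * G.A)))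
    (-Complex.I / (2 * G.A)) G.σ
  have b3 := hle x n m
  rw [← hc] at b1
  rw [← hc'] at b2
  set R := radSq (2 * N * G.ρ) 0 τ.re x n m with hR
  have hR0 : 0 ≤ R := radSq_nonneg _ _ _ _ _ _
  have hτ : (τ : ℂ) = τ.re + Complex.I * τ.im := by
    apply Complex.ext <;> simp
  have e1 : (n * τ - m : ℂ) = -1 * ((m - 0 * (x - 2 * N * G.ρ * n) - τ.re * n : ℝ) : ℂ) +
      Complex.I * τ.im * ((n : ℝ) : ℂ) + 0 * ((x - 2 * N * G.ρ * n : ℝ) : ℂ) := by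
    rw [hτ]; push_cast; ring
  have e2 : (G.σ * (x - 2 * N * G.ρ * n) + (n * (starRingEnd ℂ) (τ : ℂ) - m) /
      (2 * τ.im * G.A) : ℂ) = -(1 / (2 * τ.im * G.A)) *
      ((m - 0 * (x - 2 * N * G.ρ * n) - τ.re * n : ℝ) : ℂ) +
      -Complex.I / (2 * G.A) * ((n : ℝ) : ℂ) + G.σ * ((x - 2 * N * G.ρ * n : ℝ) : ℂ) := by
    rw [conj_eq, hτ]; push_cast; field_simp; ring
  rw [← e1] at b1
  rw [← e2] at b2
  rw [jTerm, norm_mul, norm_mul, norm_mul, norm_e]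
  have e3 : (((τ * (x - 2 * N * G.ρ * n) ^ 2 / (4 * N) + m * G.ρ * (x - 2 * N * G.ρ * n) +
      N * G.ρ ^ 2 * n * m + Complex.I * (n * τ - m) * (n * (starRingEnd ℂ) (τ : ℂ) - m) /
        (4 * τ.im * G.A)) / D.natAbs : ℂ)).im = 1 / D.natAbs * ((1 / (4 * τ.im * G.A)) *
        (m - 0 * (x - 2 * N * G.ρ * n) - τ.re * n) ^ 2 + τ.im / (4 * G.A) * n ^ 2 +
        τ.im / (4 * N) * (x - 2 * N * G.ρ * n) ^ 2) := by
    have : ((τ * (x - 2 * N * G.ρ * n) ^ 2 / (4 * N) + m * G.ρ * (x - 2 * N * G.ρ * n) +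
      N * G.ρ ^ 2 * n * m + Complex.I * (n * τ - m) * (n * (starRingEnd ℂ) (τ : ℂ) - m) /
        (4 * τ.im * G.A)) / D.natAbs : ℂ) =
      (((τ.re * (x - 2 * N * G.ρ * n) ^ 2 / (4 * N) + m * G.ρ * (x - 2 * N * G.ρ * n) +
        N * G.ρ ^ 2 * n * m) / D.natAbs : ℝ) : ℂ) +
        ((1 / D.natAbs * ((1 / (4 * τ.im * G.A)) *
        (m - 0 * (x - 2 * N * G.ρ * n) - τ.re * n) ^ 2 + τ.im / (4 * G.A) * n ^ 2 +
        τ.im / (4 * N) * (x - 2 * N * G.ρ * n) ^ 2) : ℝ) : ℂ) * Complex.I := by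
      rw [conj_eq, hτ]
      push_cast
      field_simp
      ring_nf
      simp only [Complex.I_pow_three]
      ring
    rw [this, im_real_add]
  rw [e3]
  have b4 : Real.exp (-(2 * Real.pi * (1 / D.natAbs * ((1 / (4 * τ.im * G.A)) *
        (m - 0 * (x - 2 * N * G.ρ * n) - τ.re * n) ^ 2 + τ.im / (4 * G.A) * n ^ 2 +
        τ.im / (4 * N) * (x - 2 * N * G.ρ * n) ^ 2)))) ≤ Real.exp (-(a * R)) := by
    rw [Real.exp_le_exp]
    refine neg_le_neg (b3.trans_eq ?_)
    ring
  have b5 : ‖(c₀ + c₁ * (n * τ - m) : ℂ)‖ ≤ (‖c₀‖ + ‖c₁‖ * c) * (1 + R) := by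
    refine (norm_add_le _ _).trans ?_
    rw [norm_mul, add_mul, mul_assoc]
    gcongr
    exact le_mul_of_one_le_right (norm_nonneg _) (by linarith)
  have b6 : 1 + ‖(G.σ * (x - 2 * N * G.ρ * n) + (n * (starRingEnd ℂ) (τ : ℂ) - m) /
      (2 * τ.im * G.A) : ℂ)‖ ≤ (1 + c') * (1 + R) := by
    rw [add_mul, one_mul]; linarith
  calc _ ≤ ((‖c₀‖ + ‖c₁‖ * c) * (1 + R)) * (C * (H * ((1 + c') * (1 + R)) ^ κ *
        Real.exp (-(a * R)))) := by
        refine mul_le_mul b5 (mul_le_mul (hC _ _ _) (mul_le_mul ((hH _).trans ?_) b4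
          (Real.exp_pos _).le (by positivity)) (by positivity) hC0) (by positivity) (by positivity)
        gcongr
    _ = _ := by rw [mul_pow]; ring


lemma summable_dualTerm [NeZero N] (hD : IsFundamentalDiscriminant D)
    (hr : r ^ 2 - 4 * N * m₀ = D) (κ : ℕ) (τ : ℍ) (h : ℤ) :
    Summable fun y : (ℤ × ℤ) × ℤ => dualTerm P G D r κ τ h y.1.1 y.1.2 y.2 := by
  refine ((summable_jTerm_mul P G hD hr κ τ h 0 (Complex.I ^ (κ + 1))).add
    (summable_jTerm_mul P G hD hr (κ - 1) τ h
      (D.natAbs / (2 * Real.pi) * κ * Complex.I ^ (κ - 1)) 0)).congr fun y => ?_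
  rw [dualTerm]
  ring

/-- Poisson summation in the direction of `l`. -/
theorem tsum_thetaCoord_fibre [NeZero N] (hD : IsFundamentalDiscriminant D)
    (hr : r ^ 2 - 4 * N * m₀ = D) (κ : ℕ) (τ : ℍ) (h x n : ℤ) :
    ∑' m, thetaCoord P G D r κ τ h x n m =
      1 / (D.natAbs * ((√(2 * τ.im * G.A / D.natAbs) : ℝ) : ℂ) * (2 * τ.im * G.A)) *
        ∑' α, dualTerm P G D r κ τ h x n α := by
  have : NeZero D.natAbs := ⟨by simpa using hD.ne_zero⟩
  have hN : (0 : ℝ) < N := Nat.cast_pos.mpr (NeZero.pos N)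
  have hd : (0 : ℝ) < D.natAbs := Nat.cast_pos.mpr (by simpa using hD.ne_zero)
  have hA := G.A_pos
  have hv := τ.im_pos
  have hNc : (N : ℂ) ≠ 0 := by exact_mod_cast hN.ne'
  have hdc : (D.natAbs : ℂ) ≠ 0 := by exact_mod_cast hd.ne'
  have hvc : (τ.im : ℂ) ≠ 0 := by exact_mod_cast hv.ne'
  have hAc : (G.A : ℂ) ≠ 0 := by exact_mod_cast hA.ne'
  have hpi : (Real.pi : ℂ) ≠ 0 := by exact_mod_cast Real.pi_ne_zero
  obtain ⟨ar, har⟩ : ∃ ar : ℝ, ar = 2 * τ.im * G.A / D.natAbs := ⟨_, rfl⟩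
  have har0 : 0 < ar := by rw [har]; positivity
  have ha : 0 < (ar : ℂ).re := by rwa [Complex.ofReal_re]
  have harc : (ar : ℂ) = 2 * τ.im * G.A / D.natAbs := by rw [har]; push_cast; rfl
  set γ : ℂ := 2 * Real.pi * Complex.I * n * τ / D.natAbs -
    4 * Real.pi * τ.im * G.A * G.pos x n / D.natAbs with hγ
  set E : ℂ := e (((x : ℂ) ^ 2 / (4 * N) * τ + Complex.I * τ.im * G.A * G.pos x n ^ 2) / D.natAbs)
    with hE
  have hper : ∀ m : ℤ, (wgt P D r h x (m + D.natAbs) n : ℂ) = wgt P D r h x m n := fun m =>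
    (wgt_periodic P hD hr).2.2.1 h x n _ _ (by simp)
  -- Writing `m + pos` as `(m + cpos) + (pos - cpos)` turns the polynomial into a combination of the
  -- powers `κ + 1` and `κ` of `m + cpos`, which are heat polynomials at time zero.
  have hsplit : ∀ m : ℤ, thetaCoord P G D r κ τ h x n m =
      E * (wgt P D r h x m n * (heatPoly 0 (κ + 1) (1 * m + G.cpos x n) *
        Complex.exp (-Real.pi * ar * m ^ 2 + γ * m))) +
      E * (G.pos x n - G.cpos x n) * (wgt P D r h x m n * (heatPoly 0 κ (1 * m + G.cpos x n) *
        Complex.exp (-Real.pi * ar * m ^ 2 + γ * m))) := by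
    intro m
    have h1 : e ((((x : ℂ) ^ 2 / (4 * N) + m * n) * τ +
        Complex.I * τ.im * G.A * (m + G.pos x n) ^ 2) / D.natAbs) =
        E * Complex.exp (-Real.pi * ar * m ^ 2 + γ * m) := by
      rw [hE, e, e, ← Complex.exp_add, hγ, harc]
      congr 1
      field_simp
      ring_nf
      simp only [Complex.I_sq]
      ring
    rw [thetaCoord, h1, heatPoly_zero_left, heatPoly_zero_left]
    ring
  have hsum : ∀ j : ℕ, Summable fun m : ℤ => (wgt P D r h x m n : ℂ) *
      (heatPoly 0 j (1 * m + G.cpos x n) * Complex.exp (-Real.pi * ar * m ^ 2 + γ * m)) := by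
    intro j
    obtain ⟨C, hC⟩ := exists_norm_le_of_periodic (c := fun m => (wgt P D r h x m n : ℂ)) hper
    refine Summable.of_norm_bounded
      (((summable_heatPoly_gauss ha 0 1 (G.cpos x n) γ j).norm).mul_left C) fun m => ?_
    rw [norm_mul]
    exact mul_le_mul_of_nonneg_right (hC m) (norm_nonneg _)
  have hdual : ∀ j : ℕ, Summable fun k : ℤ => ((1 / D.natAbs : ℂ) * wgtF P D r h x k n) *
        ((1 / (ar : ℂ) ^ (1 / 2 : ℂ)) *
        Complex.exp ((γ - 2 * Real.pi * Complex.I * (k / D.natAbs)) ^ 2 / (4 * Real.pi * ar)) *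
        heatPoly (0 + 1 ^ 2 / (4 * Real.pi * ar)) j
          (G.cpos x n + 1 * (γ - 2 * Real.pi * Complex.I * (k / D.natAbs)) /
            (2 * Real.pi * ar))) := by
    intro j
    obtain ⟨C, hC0, hC⟩ := exists_norm_wgtF_le P hD hr h
    have hapos : 0 < ((ar : ℂ) * D.natAbs ^ 2).re := by
      have : ((ar : ℂ) * D.natAbs ^ 2) = ((ar * (D.natAbs : ℝ) ^ 2 : ℝ) : ℂ) := by push_cast; rfl
      rw [this, Complex.ofReal_re]; positivity
    have hs := summable_heatPoly_gauss_dual hapos (0 + 1 ^ 2 / (4 * Real.pi * ar)) D.natAbs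
      (G.cpos x n) (γ * D.natAbs) j
    have harc0 : (ar : ℂ) ≠ 0 := by exact_mod_cast har0.ne'
    rw [cpow_half_mul_sq harc0 (NeZero.ne _)] at hs
    refine Summable.of_norm_bounded ((hs.norm).mul_left C) fun k => ?_
    have h1 : ((γ * D.natAbs - 2 * Real.pi * Complex.I * k) ^ 2 /
        (4 * Real.pi * (ar * D.natAbs ^ 2)) : ℂ) =
        (γ - 2 * Real.pi * Complex.I * (k / D.natAbs)) ^ 2 / (4 * Real.pi * ar) := by
      field_simp
    have h2 : (G.cpos x n + D.natAbs * (γ * D.natAbs - 2 * Real.pi * Complex.I * k) /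
        (2 * Real.pi * (ar * D.natAbs ^ 2)) : ℂ) = G.cpos x n +
          1 * (γ - 2 * Real.pi * Complex.I * (k / D.natAbs)) / (2 * Real.pi * ar) := by
      field_simp
    rw [h1, h2]
    generalize Complex.exp _ = X
    generalize heatPoly _ _ _ = Y
    have h3 : (1 / (D.natAbs : ℂ) * wgtF P D r h x k n) * (1 / (ar : ℂ) ^ (1 / 2 : ℂ) * X * Y) =
        wgtF P D r h x k n * (1 / ((ar : ℂ) ^ (1 / 2 : ℂ) * D.natAbs) * X * Y) := by
      field_simp
    rw [h3, norm_mul]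
    exact mul_le_mul_of_nonneg_right (hC _ _ _) (norm_nonneg _)
  have hpois : ∀ j : ℕ, ∑' m : ℤ, (wgt P D r h x m n : ℂ) *
      (heatPoly 0 j (1 * m + G.cpos x n) * Complex.exp (-Real.pi * ar * m ^ 2 + γ * m)) =
      ∑' k : ℤ, ((1 / D.natAbs : ℂ) * wgtF P D r h x k n) *
        ((1 / (ar : ℂ) ^ (1 / 2 : ℂ)) *
        Complex.exp ((γ - 2 * Real.pi * Complex.I * (k / D.natAbs)) ^ 2 / (4 * Real.pi * ar)) *
        heatPoly (0 + 1 ^ 2 / (4 * Real.pi * ar)) j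
          (G.cpos x n + 1 * (γ - 2 * Real.pi * Complex.I * (k / D.natAbs)) /
            (2 * Real.pi * ar))) := by
    intro j
    rw [tsum_periodic_heatPoly_gauss ha 0 1 (G.cpos x n) γ j D.natAbs _ hper]
    refine tsum_congr fun k => ?_
    congr 2
    rw [wgtF]
    refine Finset.sum_congr rfl fun t _ => ?_
    rw [er]
    push_cast
    rfl
  have hexp : ∀ α : ℤ, E * Complex.exp ((γ - 2 * Real.pi * Complex.I * (α / D.natAbs)) ^ 2 /
      (4 * Real.pi * ar)) = e ((τ * (x - 2 * N * G.ρ * n) ^ 2 / (4 * N) +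
      α * G.ρ * (x - 2 * N * G.ρ * n) + N * G.ρ ^ 2 * n * α +
      Complex.I * (n * τ - α) * (n * (starRingEnd ℂ) (τ : ℂ) - α) / (4 * τ.im * G.A)) /
        D.natAbs) := by
    intro α
    rw [hE, e, e, ← Complex.exp_add, hγ, harc, conj_eq, Geom.pos]
    congr 1
    push_cast
    field_simp
    ring_nf
    simp only [Complex.I_sq, Complex.I_pow_three]
    ring
  have harg : ∀ α : ℤ, G.cpos x n + 1 * (γ - 2 * Real.pi * Complex.I * (α / D.natAbs)) /
            (2 * Real.pi * ar) = Complex.I * (G.σ * (x - 2 * N * G.ρ * n) +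
              (n * (starRingEnd ℂ) (τ : ℂ) - α) / (2 * τ.im * G.A)) := by
    intro α
    rw [hγ, harc, conj_eq, Geom.cpos, Geom.pos]
    push_cast
    field_simp
    ring_nf
    simp only [Complex.I_sq]
    ring
  -- The two Poisson transforms recombine here: after the recursion in degree `κ + 1`, the
  -- coefficient of degree `κ` collapses to a multiple of `n τ - α`, free of `x`.
  have hdiff : ∀ α : ℤ, Complex.I * (G.σ * (x - 2 * N * G.ρ * n) +
      (n * (starRingEnd ℂ) (τ : ℂ) - α) / (2 * τ.im * G.A)) + (G.pos x n - G.cpos x n) =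
      Complex.I * (n * τ - α) / (2 * τ.im * G.A) := by
    intro α
    rw [conj_eq, Geom.cpos, Geom.pos]
    push_cast
    field_simp
    ring_nf
    simp only [Complex.I_sq]
    ring
  have hroot : (ar : ℂ) ^ (1 / 2 : ℂ) = ((√ar : ℝ) : ℂ) := by
    rw [Real.sqrt_eq_rpow, Complex.ofReal_cpow har0.le]
    norm_num
  have ht : ∀ j X, heatPoly (0 + 1 ^ 2 / (4 * Real.pi * ar)) j (Complex.I * X) =
      Complex.I ^ j * heatPoly (-(D.natAbs / (8 * Real.pi * τ.im * G.A))) j X := by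
    intro j X
    rw [← heatPoly_mul]
    congr 1
    rw [harc, Complex.I_sq]
    field_simp
    ring
  simp only [hsplit]
  rw [((hsum (κ + 1)).mul_left E).tsum_add ((hsum κ).mul_left _), tsum_mul_left, tsum_mul_left,
    hpois, hpois, ← tsum_mul_left, ← tsum_mul_left,
    ← ((hdual (κ + 1)).mul_left E).tsum_add ((hdual κ).mul_left _), ← tsum_mul_left, ← har]
  refine tsum_congr fun α => ?_
  rw [harg, heatPoly_succ, dualTerm, jTerm, jTerm, ← hexp α, ht, ht, hroot]
  have hs0 : ((√ar : ℝ) : ℂ) ≠ 0 := by exact_mod_cast (Real.sqrt_pos.mpr har0).ne'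
  have h1 := hdiff α
  generalize G.σ * (x - 2 * N * G.ρ * n) +
      (n * (starRingEnd ℂ) (τ : ℂ) - α) / (2 * τ.im * G.A) = X at h1 ⊢
  have h2 : (1 ^ 2 / (4 * Real.pi * ar) : ℂ) = D.natAbs / (8 * Real.pi * τ.im * G.A) := by
    rw [harc]; field_simp; ring
  rw [zero_add, h2]
  generalize Complex.exp ((γ - 2 * Real.pi * Complex.I * (α / D.natAbs)) ^ 2 /
      (4 * Real.pi * ar)) = F at *
  generalize heatPoly (-(D.natAbs / (8 * Real.pi * τ.im * G.A))) κ X = H₁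
  generalize heatPoly (-(D.natAbs / (8 * Real.pi * τ.im * G.A))) (κ - 1) X = H₂
  have h3 : (G.pos x n - G.cpos x n : ℂ) = Complex.I * (n * τ - α) / (2 * τ.im * G.A) -
    Complex.I * X := by linear_combination h1
  rw [h3]
  field_simp
  ring

lemma tsum_dualTerm [NeZero N] (hD : IsFundamentalDiscriminant D)
    (hr : r ^ 2 - 4 * N * m₀ = D) (κ : ℕ) (τ : ℍ) (n α h : ℤ) :
    ∑' x, dualTerm P G D r κ τ h x n α = latTerm P G D r κ τ n α h := by
  simp only [dualTerm]
  rw [((summable_jTerm P G hD hr κ τ n α h).mul_left _).tsum_add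
    ((summable_jTerm P G hD hr (κ - 1) τ n α h).mul_left _), tsum_mul_left, tsum_mul_left]
  rfl

/-- The cyclic permutation of the coordinates. -/
def cyc : (ℤ × ℤ) × ℤ ≃ (ℤ × ℤ) × ℤ where
  toFun y := ((y.2, y.1.1), y.1.2)
  invFun y := ((y.1.2, y.2), y.1.1)
  left_inv _ := rfl
  right_inv _ := rfl

lemma summable_latTerm [NeZero N] (hD : IsFundamentalDiscriminant D)
    (hr : r ^ 2 - 4 * N * m₀ = D) (κ : ℕ) (τ : ℍ) (h : ℤ) :
    Summable fun y : ℤ × ℤ => latTerm P G D r κ τ y.1 y.2 h :=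
  ((cyc.summable_iff.mpr (summable_dualTerm P G hD hr κ τ h)).prod).congr fun y =>
    tsum_dualTerm P G hD hr κ τ y.1 y.2 h

/-- The theta kernel as a sum over pairs `(n, α)`. -/
theorem tsum_thetaCoord [NeZero N] (hD : IsFundamentalDiscriminant D)
    (hr : r ^ 2 - 4 * N * m₀ = D) (κ : ℕ) (τ : ℍ) (h : ℤ) :
    ∑' y : (ℤ × ℤ) × ℤ, thetaCoord P G D r κ τ h y.1.1 y.1.2 y.2 =
      1 / (D.natAbs * ((√(2 * τ.im * G.A / D.natAbs) : ℝ) : ℂ) * (2 * τ.im * G.A)) *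
        ∑' y : ℤ × ℤ, latTerm P G D r κ τ y.1 y.2 h := by
  have hs := summable_dualTerm P G hD hr κ τ h
  rw [(summable_thetaCoord P G hD hr κ τ h).tsum_prod]
  simp only [tsum_thetaCoord_fibre P G hD hr]
  rw [tsum_mul_left]
  congr 1
  -- Absolute convergence over all triples allows the sum over `x` to be taken first, for fixed `(n,
  -- α)`.
  rw [← hs.tsum_prod, ← cyc.tsum_eq]
  refine ((cyc.summable_iff.mpr hs).tsum_prod).trans ?_
  exact tsum_congr fun y => tsum_dualTerm P G hD hr κ τ y.1 y.2 h

end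

/-! ### The quadratic space in adapted coordinates -/

/-- The traceless matrix with coefficients `a, b, c`. -/
def coeffVec (N : ℕ) (a b c : ℝ) : V := !![b / (2 * N), -a / N; c, -(b / (2 * N))]

lemma coeffVec_add (N : ℕ) (a b c a' b' c' : ℝ) :
    coeffVec N a b c + coeffVec N a' b' c' = coeffVec N (a + a') (b + b') (c + c') := by
  ext i j; fin_cases i <;> fin_cases j <;> simp [coeffVec] <;> ring

lemma smul_coeffVec (N : ℕ) (s a b c : ℝ) :
    s • coeffVec N a b c = coeffVec N (s * a) (s * b) (s * c) := by
  ext i j; fin_cases i <;> fin_cases j <;> simp [coeffVec] <;> ring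

lemma form_coeffVec (N : ℕ) [NeZero N] (a b c a' b' c' : ℝ) :
    form N (coeffVec N a b c) (coeffVec N a' b' c') =
      (b * b' - 2 * N * (a * c' + a' * c)) / (2 * N) := by
  have hN : (N : ℝ) ≠ 0 := Nat.cast_ne_zero.mpr (NeZero.ne N)
  simp [form, coeffVec, Matrix.trace_fin_two]
  field_simp
  ring

lemma Q_coeffVec (N : ℕ) [NeZero N] (a b c : ℝ) :
    Q N (coeffVec N a b c) = form N (coeffVec N a b c) (coeffVec N a b c) / 2 := by
  have hN : (N : ℝ) ≠ 0 := Nat.cast_ne_zero.mpr (NeZero.ne N)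
  rw [form_coeffVec, Q, Matrix.det_fin_two]
  simp [coeffVec]
  field_simp
  ring

lemma form_add_left (N : ℕ) (x y w : V) : form N (x + y) w = form N x w + form N y w := by
  simp [form, add_mul, Matrix.trace_add, mul_add]

lemma form_smul_left (N : ℕ) (s : ℝ) (x w : V) : form N (s • x) w = s * form N x w := by
  simp [form, Matrix.trace_smul]; ring

lemma form_comm (N : ℕ) (x y : V) : form N x y = form N y x := by
  rw [form, form, Matrix.trace_mul_comm]

lemma form_add_right (N : ℕ) (x y w : V) : form N w (x + y) = form N w x + form N w y := by
  rw [form_comm, form_add_left, form_comm, form_comm N y]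

lemma form_smul_right (N : ℕ) (s : ℝ) (x w : V) : form N w (s • x) = s * form N w x := by
  rw [form_comm, form_smul_left, form_comm]

lemma form_sub_right (N : ℕ) (x y w : V) : form N w (x - y) = form N w x - form N w y := by
  rw [sub_eq_add_neg, form_add_right, ← neg_one_smul ℝ y, form_smul_right]; ring

lemma sqrt_two_mul_sq (N : ℕ) : √(2 * (N : ℝ)) ^ 2 = 2 * N := Real.sq_sqrt (by positivity)

section

variable (N : ℕ) [NeZero N] (z : ℍ)

lemma gz_inv : (gz z)⁻¹ = !![1 / √z.im, -(z.re / √z.im); 0, √z.im] := by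
  have hs : √z.im ≠ 0 := (Real.sqrt_pos.mpr z.im_pos).ne'
  refine Matrix.inv_eq_right_inv ?_
  ext i j; fin_cases i <;> fin_cases j <;> simp [gz] <;> field_simp
  ring

lemma b1_eq : b1 N z = coeffVec N (N / √(2 * N) * (z.re ^ 2 / z.im - z.im))
    (2 * N / √(2 * N) * (z.re / z.im)) (1 / √(2 * N) * (1 / z.im)) := by
  have hs : √z.im ≠ 0 := (Real.sqrt_pos.mpr z.im_pos).ne'
  have hs2 : √z.im ^ 2 = z.im := Real.sq_sqrt z.im_pos.le
  have hs4 : √z.im ^ 4 = z.im ^ 2 := by linear_combination (√z.im ^ 2 + z.im) * hs2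
  have hN : (N : ℝ) ≠ 0 := Nat.cast_ne_zero.mpr (NeZero.ne N)
  have hN2 : √(2 * (N : ℝ)) ≠ 0 := by
    have := Nat.pos_of_neZero N
    positivity
  rw [b1, gz_inv]
  ext i j; fin_cases i <;> fin_cases j <;> simp [gz, coeffVec] <;> field_simp <;>
    simp only [hs2] <;> field_simp <;> ring_nf
  rw [hs4]

lemma b2_eq : b2 N z = coeffVec N (2 * N / √(2 * N) * z.re) (2 * N / √(2 * N)) 0 := by
  have hs : √z.im ≠ 0 := (Real.sqrt_pos.mpr z.im_pos).ne'
  have hs2 : √z.im ^ 2 = z.im := Real.sq_sqrt z.im_pos.le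
  have hs4 : √z.im ^ 4 = z.im ^ 2 := by linear_combination (√z.im ^ 2 + z.im) * hs2
  have hN : (N : ℝ) ≠ 0 := Nat.cast_ne_zero.mpr (NeZero.ne N)
  rw [b2, gz_inv]
  ext i j; fin_cases i <;> fin_cases j <;> simp [gz, coeffVec] <;> field_simp
  ring

lemma b3_eq : b3 N z = coeffVec N (-(N / √(2 * N) * (z.re ^ 2 / z.im + z.im)))
    (-(2 * N / √(2 * N) * (z.re / z.im))) (-(1 / √(2 * N) * (1 / z.im))) := by
  have hs : √z.im ≠ 0 := (Real.sqrt_pos.mpr z.im_pos).ne'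
  have hs2 : √z.im ^ 2 = z.im := Real.sq_sqrt z.im_pos.le
  have hs4 : √z.im ^ 4 = z.im ^ 2 := by linear_combination (√z.im ^ 2 + z.im) * hs2
  have hN : (N : ℝ) ≠ 0 := Nat.cast_ne_zero.mpr (NeZero.ne N)
  rw [b3, gz_inv]
  ext i j; fin_cases i <;> fin_cases j <;> simp [gz, coeffVec] <;> field_simp <;>
    simp only [hs2] <;> field_simp <;> ring_nf
  rw [hs4]

/-- The vectors `b_1(z)`, `b_2(z)`, `b_3(z)` form an orthogonal basis with norms `1`, `1`, `-1`. -/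
lemma form_eq_frame (a b c a' b' c' : ℝ) :
    form N (coeffVec N a b c) (coeffVec N a' b' c') =
      form N (coeffVec N a b c) (b1 N z) * form N (coeffVec N a' b' c') (b1 N z) +
      form N (coeffVec N a b c) (b2 N z) * form N (coeffVec N a' b' c') (b2 N z) -
      form N (coeffVec N a b c) (b3 N z) * form N (coeffVec N a' b' c') (b3 N z) := by
  have hy : z.im ≠ 0 := z.im_pos.ne'
  have hN : (N : ℝ) ≠ 0 := Nat.cast_ne_zero.mpr (NeZero.ne N)
  have hN2 : √(2 * (N : ℝ)) ≠ 0 := by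
    have := Nat.pos_of_neZero N
    positivity
  have hs := sqrt_two_mul_sq N
  rw [b1_eq, b2_eq, b3_eq]
  simp only [form_coeffVec]
  generalize √(2 * (N : ℝ)) = s at *
  have hs' : (N : ℝ) = s ^ 2 / 2 := by rw [hs]; ring
  rw [hs']
  field_simp
  ring

lemma form_b3_b3 : form N (b3 N z) (b3 N z) = -1 := by
  have hy : z.im ≠ 0 := z.im_pos.ne'
  have hN : (N : ℝ) ≠ 0 := Nat.cast_ne_zero.mpr (NeZero.ne N)
  have hN2 : √(2 * (N : ℝ)) ≠ 0 := by
    have := Nat.pos_of_neZero N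
    positivity
  have hs := sqrt_two_mul_sq N
  rw [b3_eq, form_coeffVec]
  generalize √(2 * (N : ℝ)) = s at *
  have hs' : (N : ℝ) = s ^ 2 / 2 := by rw [hs]; ring
  rw [hs']
  field_simp
  ring

lemma form_b3_b1 : form N (b3 N z) (b1 N z) = 0 := by
  have hy : z.im ≠ 0 := z.im_pos.ne'
  have hN : (N : ℝ) ≠ 0 := Nat.cast_ne_zero.mpr (NeZero.ne N)
  rw [b3_eq, b1_eq, form_coeffVec]
  field_simp
  ring

lemma form_b3_b2 : form N (b3 N z) (b2 N z) = 0 := by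
  have hy : z.im ≠ 0 := z.im_pos.ne'
  have hN : (N : ℝ) ≠ 0 := Nat.cast_ne_zero.mpr (NeZero.ne N)
  rw [b3_eq, b2_eq, form_coeffVec]
  field_simp
  ring

lemma projNeg_eq (x : V) : projNeg N z x = (-form N x (b3 N z)) • b3 N z := by
  rw [projNeg, form_b3_b3, div_neg, div_one]

lemma Qz_coeffVec (a b c : ℝ) : Qz N z (coeffVec N a b c) =
    Q N (coeffVec N a b c) + form N (coeffVec N a b c) (b3 N z) ^ 2 := by
  obtain ⟨a', b', c', h3⟩ : ∃ a' b' c', b3 N z = coeffVec N a' b' c' := ⟨_, _, _, b3_eq N z⟩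
  have h33 := form_b3_b3 N z
  rw [Qz, projPos, projNeg_eq]
  set t := form N (coeffVec N a b c) (b3 N z) with ht
  have h1 : coeffVec N a b c - (-t) • b3 N z = coeffVec N (a + t * a') (b + t * b') (c + t * c') := by
    rw [h3, _root_.neg_smul, sub_neg_eq_add, smul_coeffVec, coeffVec_add]
  have h2 : (-t) • b3 N z = coeffVec N (-t * a') (-t * b') (-t * c') := by rw [h3, smul_coeffVec]
  rw [h1, Q_coeffVec, ← h1, h2, Q_coeffVec, ← h2, Q_coeffVec, _root_.neg_smul, sub_neg_eq_add, ← _root_.neg_smul]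
  simp only [form_add_left, form_add_right, form_smul_left, form_smul_right, h33]
  rw [form_comm N (b3 N z), ← ht]
  ring

end

/-! ### The basis `k`, `l`, `l'` and the frame of `z`. -/

namespace HypPair

variable {N : ℕ} (P : HypPair N)

/-- The vector `x k + m l + n l'`. -/
def vec (x m n : ℝ) : V :=
  coeffVec N (x * P.kA + m * P.a₀ + n * P.a₁) (x * P.kB + 2 * N * (m * P.b₀ + n * P.b₁))
    (x * P.kC + m * P.c₀ + n * P.c₁)

lemma vec_intCast (x m n : ℤ) : P.vec x m n = coeffVec N (P.toA x m n) (P.toB x m n)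
    (P.toC x m n) := by
  rw [vec, toA, toB, toC]; push_cast; rfl

lemma vec_add (x m n x' m' n' : ℝ) :
    P.vec x m n + P.vec x' m' n' = P.vec (x + x') (m + m') (n + n') := by
  rw [vec, vec, vec, coeffVec_add]; congr 1 <;> ring

lemma smul_vec (s x m n : ℝ) : s • P.vec x m n = P.vec (s * x) (s * m) (s * n) := by
  rw [vec, vec, smul_coeffVec]; congr 1 <;> ring

lemma neg_vec (x m n : ℝ) : -P.vec x m n = P.vec (-x) (-m) (-n) := by
  rw [← neg_one_smul ℝ, smul_vec]; simp only [neg_one_mul]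

lemma sub_vec (x m n x' m' n' : ℝ) :
    P.vec x m n - P.vec x' m' n' = P.vec (x - x') (m - m') (n - n') := by
  rw [sub_eq_add_neg, neg_vec, vec_add]; simp only [sub_eq_add_neg]

lemma vec_zero : P.vec 0 0 0 = 0 := by
  ext i j; fin_cases i <;> fin_cases j <;> simp [vec, coeffVec]

lemma relations : (N : ℝ) * P.b₀ ^ 2 = P.a₀ * P.c₀ ∧ (N : ℝ) * P.b₁ ^ 2 = P.a₁ * P.c₁ ∧
    2 * (N : ℝ) * P.b₀ * P.b₁ - P.a₀ * P.c₁ - P.a₁ * P.c₀ = 1 :=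
  ⟨by exact_mod_cast P.iso₀, by exact_mod_cast P.iso₁, by exact_mod_cast P.pair⟩

lemma form_vec [NeZero N] (x m n x' m' n' : ℝ) :
    form N (P.vec x m n) (P.vec x' m' n') = x * x' / (2 * N) + m * n' + m' * n := by
  have hN : (N : ℝ) ≠ 0 := Nat.cast_ne_zero.mpr (NeZero.ne N)
  obtain ⟨h0, h1, h2⟩ := P.relations
  rw [vec, vec, form_coeffVec, div_eq_iff (by positivity)]
  rw [show (x * x' / (2 * N) + m * n' + m' * n) * (2 * N) = x * x' + 2 * N * (m * n' + m' * n) by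
    field_simp; ring]
  unfold kA kB kC
  push_cast
  generalize (P.a₀ : ℝ) = a₀ at *
  generalize (P.b₀ : ℝ) = b₀ at *
  generalize (P.c₀ : ℝ) = c₀ at *
  generalize (P.a₁ : ℝ) = a₁ at *
  generalize (P.b₁ : ℝ) = b₁ at *
  generalize (P.c₁ : ℝ) = c₁ at *
  grind

lemma Q_vec [NeZero N] (x m n : ℝ) : Q N (P.vec x m n) = x ^ 2 / (4 * N) + m * n := by
  have hN : (N : ℝ) ≠ 0 := Nat.cast_ne_zero.mpr (NeZero.ne N)
  have h := P.form_vec x m n x m n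
  rw [vec] at *
  rw [Q_coeffVec, h]
  field_simp
  ring

lemma exists_vec (a b c : ℝ) : ∃ x m n, coeffVec N a b c = P.vec x m n := by
  obtain ⟨h0, h1, h2⟩ := P.relations
  refine ⟨b * P.kB - 2 * N * (a * P.kC + P.kA * c), b * P.b₁ - a * P.c₁ - P.a₁ * c,
    b * P.b₀ - a * P.c₀ - P.a₀ * c, ?_⟩
  unfold vec kA kB kC
  push_cast
  generalize (P.a₀ : ℝ) = a₀ at *
  generalize (P.b₀ : ℝ) = b₀ at *
  generalize (P.c₀ : ℝ) = c₀ at *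
  generalize (P.a₁ : ℝ) = a₁ at *
  generalize (P.b₁ : ℝ) = b₁ at *
  generalize (P.c₁ : ℝ) = c₁ at *
  congr 1 <;> grind

/-- The isotropic vector `l`. -/
abbrev l : V := P.vec 0 1 0

/-- The isotropic vector `l'`. -/
abbrev l' : V := P.vec 0 0 1

/-- A generator of `K'`. -/
abbrev k : V := P.vec 1 0 0

lemma exists_eq [NeZero N] {l l' : V} (hl : l ∈ latL N) (hl' : l' ∈ latL N) (hQl : Q N l = 0)
    (hQl' : Q N l' = 0) (hll' : form N l l' = 1) : ∃ P : HypPair N, l = P.l ∧ l' = P.l' := by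
  have hN : (N : ℝ) ≠ 0 := Nat.cast_ne_zero.mpr (NeZero.ne N)
  obtain ⟨a, b, c, rfl⟩ := hl
  obtain ⟨a', b', c', rfl⟩ := hl'
  simp only [Q, Matrix.det_fin_two, form, Matrix.trace_fin_two, Matrix.mul_apply,
    Fin.sum_univ_two] at hQl hQl' hll'
  simp at hQl hQl' hll'
  have e0 : (N : ℝ) * b ^ 2 = a * c := by
    rcases hQl with h | h
    · exact absurd h (NeZero.ne N)
    · field_simp at h; linarith
  have e1 : (N : ℝ) * b' ^ 2 = a' * c' := by
    rcases hQl' with h | h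
    · exact absurd h (NeZero.ne N)
    · field_simp at h; linarith
  have e2 : 2 * (N : ℝ) * b * b' - a * c' - a' * c = 1 := by
    field_simp at hll'; linarith
  refine ⟨⟨a, b, c, a', b', c', by exact_mod_cast e0, by exact_mod_cast e1, by exact_mod_cast e2⟩,
    ?_, ?_⟩ <;>
  · ext i j; fin_cases i <;> fin_cases j <;> simp [HypPair.l, HypPair.l', vec, coeffVec]
    · field_simp
    · field_simp

lemma vec_eq (x m n : ℝ) : P.vec x m n = x • P.k + m • P.l + n • P.l' := by
  simp only [smul_vec, vec_add]; congr 1 <;> ring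

lemma form_vec_left (x m n : ℝ) (w : V) :
    form N (P.vec x m n) w = x * form N P.k w + m * form N P.l w + n * form N P.l' w := by
  rw [vec_eq, form_add_left, form_add_left, form_smul_left, form_smul_left, form_smul_left]

lemma form_wPerp (z : ℍ) (w : V) : form N w (wPerp N z P.l) =
    form N P.l (b2 N z) * form N w (b1 N z) - form N P.l (b1 N z) * form N w (b2 N z) := by
  rw [wPerp, form_sub_right, form_smul_right, form_smul_right]

variable [NeZero N] (z : ℍ)

lemma form_frame (x m n x' m' n' : ℝ) :
    form N (P.vec x m n) (P.vec x' m' n') =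
      form N (P.vec x m n) (b1 N z) * form N (P.vec x' m' n') (b1 N z) +
      form N (P.vec x m n) (b2 N z) * form N (P.vec x' m' n') (b2 N z) -
      form N (P.vec x m n) (b3 N z) * form N (P.vec x' m' n') (b3 N z) :=
  form_eq_frame N z _ _ _ _ _ _

lemma exists_b3 : ∃ x m n, b3 N z = P.vec x m n := by
  rw [b3_eq]; exact P.exists_vec _ _ _

/-- The expansion of products with `b_3(z)` in the basis `k, l, l'`. -/
lemma form_b3_eq {w : V} (hw : ∃ x m n, w = P.vec x m n) :
    form N (b3 N z) w = 2 * N * form N P.k (b3 N z) * form N P.k w +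
      form N P.l (b3 N z) * form N P.l' w + form N P.l' (b3 N z) * form N P.l w := by
  obtain ⟨x, m, n, rfl⟩ := hw
  have hN : (N : ℝ) ≠ 0 := Nat.cast_ne_zero.mpr (NeZero.ne N)
  obtain ⟨x', m', n', h⟩ := P.exists_b3 z
  simp only [h, form_vec]
  field_simp
  ring

lemma wPerp_eq_vec : ∃ x m n, wPerp N z P.l = P.vec x m n := by
  rw [wPerp]
  obtain ⟨x, m, n, h1⟩ : ∃ x m n, b1 N z = P.vec x m n := by rw [b1_eq]; exact P.exists_vec _ _ _
  obtain ⟨x', m', n', h2⟩ : ∃ x m n, b2 N z = P.vec x m n := by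
    rw [b2_eq]; exact P.exists_vec _ _ _
  generalize form N P.l (b2 N z) = s
  generalize form N P.l (b1 N z) = t
  exact ⟨_, _, _, by rw [h1, h2, smul_vec, smul_vec, sub_vec]⟩

/-- The first four are entries of the Gram matrix of `k`, `l`, `l'` computed in the frame. The last
two pair the expansion of `b_3(z)` in the basis `k`, `l`, `l'` with `b_3(z)` and with `𝔴^⊥`; both
`l` and `b_3(z)` are orthogonal to `𝔴^⊥`. -/
lemma frame_relations :
    form N P.l (b1 N z) ^ 2 + form N P.l (b2 N z) ^ 2 = form N P.l (b3 N z) ^ 2 ∧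
    form N P.k (b1 N z) * form N P.l (b1 N z) + form N P.k (b2 N z) * form N P.l (b2 N z) =
      form N P.k (b3 N z) * form N P.l (b3 N z) ∧
    form N P.l' (b1 N z) * form N P.l (b1 N z) + form N P.l' (b2 N z) * form N P.l (b2 N z) =
      1 + form N P.l' (b3 N z) * form N P.l (b3 N z) ∧
    form N P.k (b1 N z) ^ 2 + form N P.k (b2 N z) ^ 2 = 1 / (2 * N) + form N P.k (b3 N z) ^ 2 ∧
    2 * N * form N P.k (b3 N z) ^ 2 + 2 * form N P.l (b3 N z) * form N P.l' (b3 N z) = -1 ∧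
    2 * N * form N P.k (b3 N z) * form N P.k (wPerp N z P.l) +
      form N P.l (b3 N z) * form N P.l' (wPerp N z P.l) = 0 := by
  have h1 := P.form_frame z 0 1 0 0 1 0
  have h2 := P.form_frame z 1 0 0 0 1 0
  have h3 := P.form_frame z 0 0 1 0 1 0
  have h4 := P.form_frame z 1 0 0 1 0 0
  have h5 := P.form_b3_eq z (P.exists_b3 z)
  have h6 := P.form_b3_eq z (P.wPerp_eq_vec z)
  have h7 : form N P.l (wPerp N z P.l) = 0 := by rw [form_wPerp]; ring
  have h8 : form N (b3 N z) (wPerp N z P.l) = 0 := by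
    rw [form_wPerp, form_b3_b1, form_b3_b2]; ring
  rw [form_vec] at h1 h2 h3 h4
  rw [form_b3_b3] at h5
  rw [h7, h8] at h6
  norm_num at h1 h2 h3 h4
  refine ⟨?_, ?_, ?_, ?_, ?_, ?_⟩
  · linear_combination -h1
  · linear_combination -h2
  · linear_combination -h3
  · rw [one_div, mul_inv]; linear_combination -h4
  · linear_combination -h5
  · linear_combination -h6

/-- The real parameters attached to `z`. -/
def geom (hz : 0 < pz N z P.l) : Geom N where
  A := pz N z P.l ^ 2
  ρ := pz N z P.k / pz N z P.l
  σ := -form N P.k (wPerp N z P.l) / pz N z P.l ^ 2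
  A_pos := by positivity
  sq := by
    have hN : (N : ℝ) ≠ 0 := Nat.cast_ne_zero.mpr (NeZero.ne N)
    have hz' := hz.ne'
    obtain ⟨h1, h2, h3, h4, h5, h6⟩ := P.frame_relations z
    rw [form_wPerp]
    rw [pz] at *
    have h4' : 2 * N * (form N P.k (b1 N z) ^ 2 + form N P.k (b2 N z) ^ 2) =
        1 + 2 * N * form N P.k (b3 N z) ^ 2 := by rw [h4]; field_simp
    generalize form N P.k (b1 N z) = k1 at *
    generalize form N P.k (b2 N z) = k2 at *
    generalize form N P.k (b3 N z) = k3 at *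
    generalize form N P.l (b1 N z) = l1 at *
    generalize form N P.l (b2 N z) = l2 at *
    generalize form N P.l (b3 N z) = l3 at *
    have hz2 : l3 ≠ 0 := fun h => hz' (by rw [h, neg_zero])
    field_simp
    -- Lagrange's identity reduces the square of `(k, 𝔴^⊥)` to Gram entries.
    have h7 : (l2 * k1 - l1 * k2) ^ 2 = (k1 ^ 2 + k2 ^ 2) * (l1 ^ 2 + l2 ^ 2) -
      (k1 * l1 + k2 * l2) ^ 2 := by ring
    rw [h7, h1, h2]
    linear_combination l3 ^ 2 * h4'

variable (hz : 0 < pz N z P.l)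

lemma Qz_l : Qz N z P.l = (P.geom z hz).A := by
  have h : P.l = coeffVec N _ _ _ := rfl
  rw [h, Qz_coeffVec, ← h, Q_vec]
  simp only [geom, pz]
  ring

lemma form_wPerp_vec (x : ℝ) : form N (P.vec x 0 0) (wPerp N z P.l) =
    -((P.geom z hz).A * (P.geom z hz).σ * x) := by
  rw [form_vec_left]
  simp only [geom]
  field_simp
  ring

lemma pz_vec (x m n : ℝ) : pz N z (P.vec x m n) =
    pz N z P.l * (m + (P.geom z hz).pos x n) := by
  obtain ⟨-, -, -, -, h5, -⟩ := P.frame_relations z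
  have hz' := hz.ne'
  rw [Geom.pos, pz, P.form_vec_left x m n]
  simp only [geom]
  simp only [pz] at *
  generalize form N P.k (b3 N z) = k3 at *
  generalize form N P.l (b3 N z) = l3 at *
  generalize form N P.l' (b3 N z) = l3' at *
  have hz2 : l3 ≠ 0 := fun h => hz' (by rw [h, neg_zero])
  field_simp
  linear_combination -n * h5

lemma qz_vec (x m n : ℝ) : qz N z (P.vec x m n) =
    qz N z P.l * (m + (P.geom z hz).cpos x n) := by
  obtain ⟨h1, h2, h3, h4, h5, h6⟩ := P.frame_relations z
  have hN : (N : ℝ) ≠ 0 := Nat.cast_ne_zero.mpr (NeZero.ne N)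
  have hz' := hz.ne'
  rw [Geom.cpos, Geom.pos, qz, qz, P.form_vec_left x m n, P.form_vec_left x m n]
  simp only [geom]
  rw [form_wPerp] at *
  rw [form_wPerp] at h6
  simp only [pz] at *
  generalize form N P.k (b1 N z) = k1 at *
  generalize form N P.k (b2 N z) = k2 at *
  generalize form N P.k (b3 N z) = k3 at *
  generalize form N P.l (b1 N z) = l1 at *
  generalize form N P.l (b2 N z) = l2 at *
  generalize form N P.l (b3 N z) = l3 at *
  generalize form N P.l' (b1 N z) = m1 at *
  generalize form N P.l' (b2 N z) = m2 at *
  generalize form N P.l' (b3 N z) = m3 at *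
  have hz2 : l3 ≠ 0 := fun h => hz' (by rw [h, neg_zero])
  have hz3 : (l3 : ℂ) ≠ 0 := by exact_mod_cast hz2
  have hNc : (N : ℂ) ≠ 0 := Nat.cast_ne_zero.mpr (NeZero.ne N)
  have c1 : (l1 : ℂ) ^ 2 + l2 ^ 2 = l3 ^ 2 := by exact_mod_cast h1
  have c2 : (k1 : ℂ) * l1 + k2 * l2 = k3 * l3 := by exact_mod_cast h2
  have c3 : (m1 : ℂ) * l1 + m2 * l2 = 1 + m3 * l3 := by exact_mod_cast h3
  have c5 : 2 * (N : ℂ) * k3 ^ 2 + 2 * l3 * m3 = -1 := by exact_mod_cast h5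
  have c6 : 2 * (N : ℂ) * k3 * (l2 * k1 - l1 * k2) + l3 * (l2 * m1 - l1 * m2) = 0 := by
    exact_mod_cast h6
  -- Since `l1² + l2² = l3²`, the quotient of `k1 + i k2` by `l1 + i l2` is `(k1 + i k2)(l1 - i l2)
  -- / l3²`, whose real part is a Gram relation. The same holds for `l'`.
  have hk : ((k1 : ℂ) + Complex.I * k2) * l3 ^ 2 =
      (l1 + Complex.I * l2) * (k3 * l3 + Complex.I * (l1 * k2 - l2 * k1)) := by
    rw [← c1, ← c2]
    linear_combination (k1 * l2 ^ 2 - k2 * l1 * l2 : ℂ) * Complex.I_sq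
  have hm : ((m1 : ℂ) + Complex.I * m2) * l3 ^ 2 =
      (l1 + Complex.I * l2) * (1 + m3 * l3 + Complex.I * (l1 * m2 - l2 * m1)) := by
    rw [← c1, ← c3]
    linear_combination (m1 * l2 ^ 2 - m2 * l1 * l2 : ℂ) * Complex.I_sq
  have hk' : (k1 : ℂ) + Complex.I * k2 = (l1 + Complex.I * l2) *
      (k3 / l3 + Complex.I * (l1 * k2 - l2 * k1) / l3 ^ 2) := by
    field_simp
    linear_combination hk
  have hm' : (m1 : ℂ) + Complex.I * m2 = (l1 + Complex.I * l2) *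
      (1 / (2 * l3 ^ 2) - N * (k3 / l3) ^ 2 -
        2 * N * (k3 / l3) * (Complex.I * (l1 * k2 - l2 * k1) / l3 ^ 2)) := by
    field_simp
    linear_combination 2 * l3 * hm + (l1 + Complex.I * l2) * (l3 * c5 - 2 * Complex.I * c6)
  push_cast
  have e1 : (z.im : ℂ) * (x * k1 + m * l1 + n * m1 + Complex.I * (x * k2 + m * l2 + n * m2)) =
      z.im * (x * (k1 + Complex.I * k2) + m * (l1 + Complex.I * l2) +
        n * (m1 + Complex.I * m2)) := by ring
  rw [e1, hk', hm']
  field_simp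
  ring

lemma Qz_vec (x m n : ℝ) : Qz N z (P.vec x m n) =
    x ^ 2 / (4 * N) + m * n + (P.geom z hz).A * (m + (P.geom z hz).pos x n) ^ 2 := by
  have h : P.vec x m n = coeffVec N _ _ _ := rfl
  have h1 : form N (P.vec x m n) (b3 N z) ^ 2 = pz N z (P.vec x m n) ^ 2 := by rw [pz]; ring
  rw [h, Qz_coeffVec, ← h, Q_vec, h1, P.pz_vec z hz, mul_pow]
  rfl

/-- The norms of `l_z` and `l_{z^⊥}` are `-(l, b_3)²` and `(l, b_3)²`. The last two terms of `μ`
therefore add up to a multiple of `l` plus `b_3 / (l, b_3)`, and only the latter has a component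
along `k`. -/
lemma muK_eq : muK N P.l P.l' z = P.vec (2 * N * (P.geom z hz).ρ) 0 0 := by
  have hN : (N : ℝ) ≠ 0 := Nat.cast_ne_zero.mpr (NeZero.ne N)
  obtain ⟨x, m, n, hb⟩ := P.exists_b3 z
  have h33 := form_b3_b3 N z
  have hl : form N P.l (b3 N z) = n := by rw [hb, form_vec]; ring
  have hk : form N P.k (b3 N z) = x / (2 * N) := by rw [hb, form_vec]; ring
  have hn : n ≠ 0 := by
    intro h
    rw [pz, hl, h, neg_zero] at hz
    exact lt_irrefl _ hz
  have h1 : projNeg N z P.l = (-n) • b3 N z := by rw [projNeg_eq, hl]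
  have h2 : projPos N z P.l = P.l + n • b3 N z := by
    rw [projPos, h1, _root_.neg_smul, sub_neg_eq_add]
  have h3 : form N (projNeg N z P.l) (projNeg N z P.l) = -n ^ 2 := by
    rw [h1, form_smul_left, form_smul_right, h33]; ring
  have h4 : form N (projPos N z P.l) (projPos N z P.l) = n ^ 2 := by
    rw [h2, form_add_left, form_add_right, form_add_right, form_smul_left, form_smul_right,
      form_smul_right, form_smul_left, form_comm N (b3 N z) P.l, h33, hl, form_vec]; ring
  obtain ⟨m', n', hmu⟩ : ∃ m' n', mu N P.l P.l' z = P.vec (x / n) m' n' := by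
    rw [mu, h3, h4, h1, h2, hb]
    simp only [smul_vec, vec_add, neg_vec]
    refine ⟨_, _, congrArg₂ (fun a b => P.vec a b _) ?_ rfl⟩
    field_simp
    ring
  rw [muK, hmu, form_vec, form_vec]
  simp only [smul_vec, sub_vec]
  simp only [geom, pz, hl, hk]
  congr 1
  · field_simp; ring
  · ring
  · ring

end HypPair

/-! ### The lattices and discriminant groups in adapted coordinates -/

lemma coeffVec_mem_latL {N : ℕ} [NeZero N] {a b c : ℤ} :
    coeffVec N a b c ∈ latL N ↔ (2 * N : ℤ) ∣ b := by
  have hN : (N : ℝ) ≠ 0 := Nat.cast_ne_zero.mpr (NeZero.ne N)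
  constructor
  · rintro ⟨a', b', c', h⟩
    have h1 := congrFun (congrFun h 0) 0
    simp [coeffVec] at h1
    rw [div_eq_iff (by positivity)] at h1
    refine ⟨b', ?_⟩
    have : (b : ℝ) = ((2 * N * b' : ℤ) : ℝ) := by push_cast; linarith
    exact_mod_cast this
  · rintro ⟨t, rfl⟩
    refine ⟨a, t, c, ?_⟩
    ext i j; fin_cases i <;> fin_cases j <;> simp [coeffVec] <;> field_simp

lemma genusChar_coeffVec {N : ℕ} [NeZero N] (D a b c : ℤ) :
    genusChar N D (coeffVec N a b c) = genusCharCoeff N D a b c := by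
  have hN : (N : ℝ) ≠ 0 := Nat.cast_ne_zero.mpr (NeZero.ne N)
  have h1 : -(N : ℝ) * coeffVec N a b c 0 1 = (a : ℤ) := by simp [coeffVec]; field_simp
  have h2 : 2 * (N : ℝ) * coeffVec N a b c 0 0 = (b : ℤ) := by simp [coeffVec]; field_simp
  have h3 : coeffVec N a b c 1 0 = (c : ℤ) := by simp [coeffVec]
  rw [genusChar, h1, h2, h3, Int.floor_intCast, Int.floor_intCast, Int.floor_intCast]

lemma abs_cast (D : ℤ) : ((|D| : ℤ) : ℂ) = D.natAbs := by
  rw [Int.abs_eq_natAbs, Int.cast_natCast]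

namespace HypPair

variable {N : ℕ} (P : HypPair N)

lemma vec_mem_latL' (x m n : ℤ) : P.vec x m n ∈ latL' N := by
  rw [vec_intCast]; exact ⟨_, _, _, rfl⟩

lemma exists_of_mem_latL' {y : V} (hy : y ∈ latL' N) : ∃ x m n : ℤ, y = P.vec x m n := by
  obtain ⟨a, b, c, rfl⟩ := hy
  refine ⟨P.ofX a b c, P.ofM a b c, P.ofN a b c, ?_⟩
  rw [vec_intCast, toA_of, toB_of, toC_of]; rfl

variable [NeZero N]

lemma vec_injective {x m n x' m' n' : ℝ} (h : P.vec x m n = P.vec x' m' n') :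
    x = x' ∧ m = m' ∧ n = n' := by
  have hN : (N : ℝ) ≠ 0 := Nat.cast_ne_zero.mpr (NeZero.ne N)
  have h1 := congrArg (fun w => form N w P.k) h
  have h2 := congrArg (fun w => form N w P.l') h
  have h3 := congrArg (fun w => form N w P.l) h
  simp only [form_vec, mul_zero, zero_div, zero_add, add_zero, mul_one, zero_mul, one_mul]
    at h1 h2 h3
  field_simp at h1
  exact ⟨by linarith, by linarith, by linarith⟩

lemma vec_mem_latL {x m n : ℤ} : P.vec x m n ∈ latL N ↔ (2 * N : ℤ) ∣ x := by
  rw [vec_intCast, coeffVec_mem_latL, toB, dvd_add_left ⟨_, rfl⟩, mul_comm x, dvd_kB_mul]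

lemma vec_mem_perp {x m n : ℝ} : P.vec x m n ∈ perp N P.l P.l' ↔ m = 0 ∧ n = 0 := by
  change form N _ _ = 0 ∧ form N _ _ = 0 ↔ _
  rw [form_vec, form_vec]
  simp only [mul_zero, zero_div, mul_one, zero_add, add_zero, zero_mul, one_mul]
  exact and_comm

/-- The dual lattice `L'` in adapted coordinates. -/
def vecEquiv : (ℤ × ℤ) × ℤ ≃ latL' N :=
  Equiv.ofBijective (fun y => ⟨P.vec y.1.1 y.2 y.1.2, P.vec_mem_latL' _ _ _⟩) <| by
    constructor
    · rintro ⟨⟨x, n⟩, m⟩ ⟨⟨x', n'⟩, m'⟩ h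
      obtain ⟨h1, h2, h3⟩ := P.vec_injective (Subtype.ext_iff.mp h)
      simp only [Int.cast_inj] at h1 h2 h3
      rw [h1, h2, h3]
    · rintro ⟨y, hy⟩
      obtain ⟨x, m, n, rfl⟩ := P.exists_of_mem_latL' hy
      exact ⟨((x, n), m), rfl⟩

/-- The dual lattice `K'` in adapted coordinates. -/
def vecEquivK : ℤ ≃ latK' N P.l P.l' :=
  Equiv.ofBijective (fun x => ⟨P.vec x 0 0, by
    have h1 := P.vec_mem_latL' x 0 0
    rw [Int.cast_zero] at h1
    exact ⟨h1, P.vec_mem_perp.mpr ⟨rfl, rfl⟩⟩⟩) <| by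
    constructor
    · intro x x' h
      obtain ⟨h1, -, -⟩ := P.vec_injective (Subtype.ext_iff.mp h)
      exact_mod_cast h1
    · rintro ⟨y, hy, hy'⟩
      obtain ⟨x, m, n, rfl⟩ := P.exists_of_mem_latL' hy
      obtain ⟨h1, h2⟩ := P.vec_mem_perp.mp hy'
      exact ⟨x, Subtype.ext (by simp only [h1, h2])⟩

lemma coe_vecEquiv (x n m : ℤ) : (P.vecEquiv ((x, n), m) : V) = P.vec x m n := rfl

lemma coe_vecEquivK (x : ℤ) : (P.vecEquivK x : V) = P.vec x 0 0 := rfl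

lemma mk_vec_eq {x n m x' n' m' : ℤ} :
    (QuotientAddGroup.mk (P.vecEquiv ((x, n), m)) : DiscL N) =
      QuotientAddGroup.mk (P.vecEquiv ((x', n'), m')) ↔ (2 * N : ℤ) ∣ x - x' := by
  rw [QuotientAddGroup.eq, AddSubgroup.mem_addSubgroupOf]
  have : ((-P.vecEquiv ((x, n), m) + P.vecEquiv ((x', n'), m') : latL' N) : V) =
      P.vec ((x' - x : ℤ)) ((m' - m : ℤ)) ((n' - n : ℤ)) := by
    push_cast
    rw [coe_vecEquiv, coe_vecEquiv, neg_vec, vec_add]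
    congr 1 <;> ring
  rw [this, vec_mem_latL, dvd_sub_comm]

lemma mk_vecK_eq {x x' : ℤ} :
    (QuotientAddGroup.mk (P.vecEquivK x) : DiscK N P.l P.l') =
      QuotientAddGroup.mk (P.vecEquivK x') ↔ (2 * N : ℤ) ∣ x - x' := by
  rw [QuotientAddGroup.eq, AddSubgroup.mem_addSubgroupOf]
  have : ((-P.vecEquivK x + P.vecEquivK x' : latK' N P.l P.l') : V) =
      P.vec ((x' - x : ℤ)) ((0 : ℤ)) ((0 : ℤ)) := by
    push_cast
    rw [coe_vecEquivK, coe_vecEquivK, neg_vec, vec_add]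
    congr 1 <;> ring
  rw [this, latK, AddSubgroup.mem_inf, vec_mem_latL, dvd_sub_comm]
  refine and_iff_left ?_
  rw [Int.cast_zero, vec_mem_perp]
  exact ⟨rfl, rfl⟩

/-- The coordinate of the chosen representative of a class in `K'/K`. -/
def idx (h : DiscK N P.l P.l') : ℤ := P.vecEquivK.symm (Quotient.out h)

lemma repK_eq (h : DiscK N P.l P.l') : repK N P.l P.l' h = P.vec (P.idx h) 0 0 := by
  rw [← coe_vecEquivK, idx, Equiv.apply_symm_apply]; rfl

lemma mk_idx (h : DiscK N P.l P.l') :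
    (QuotientAddGroup.mk (P.vecEquivK (P.idx h)) : DiscK N P.l P.l') = h := by
  rw [idx, Equiv.apply_symm_apply]
  exact Quotient.out_eq h

lemma mk_eq_iff {x : ℤ} {h : DiscK N P.l P.l'} :
    (QuotientAddGroup.mk (P.vecEquivK x) : DiscK N P.l P.l') = h ↔ (2 * N : ℤ) ∣ x - P.idx h := by
  rw [← mk_vecK_eq, mk_idx]

lemma vecEquivK_add (x x' : ℤ) : P.vecEquivK (x + x') = P.vecEquivK x + P.vecEquivK x' := by
  apply Subtype.ext
  rw [AddSubgroup.coe_add, coe_vecEquivK, coe_vecEquivK, coe_vecEquivK, vec_add]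
  push_cast
  congr 1 <;> simp

/-- The coordinates on `K'` as a homomorphism. -/
def vecHomK : ℤ →+ latK' N P.l P.l' := AddMonoidHom.mk' P.vecEquivK P.vecEquivK_add

lemma zsmul_eq (r : ℤ) (h : DiscK N P.l P.l') :
    r • h = QuotientAddGroup.mk (P.vecEquivK (r * P.idx h)) := by
  conv_lhs => rw [← P.mk_idx h]
  rw [← QuotientAddGroup.mk_zsmul]
  congr 1
  have := map_zsmul P.vecHomK r (P.idx h)
  rw [smul_eq_mul] at this
  exact this.symm

lemma mk_eq_zsmul_iff {r x : ℤ} {h : DiscK N P.l P.l'} :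
    (QuotientAddGroup.mk (P.vecEquivK x) : DiscK N P.l P.l') = r • h ↔
      (2 * N : ℤ) ∣ x - r * P.idx h := by
  rw [zsmul_eq, mk_vecK_eq]

lemma discMap_mk (x : ℤ) : discMap N P.l P.l' (QuotientAddGroup.mk (P.vecEquivK x)) =
    QuotientAddGroup.mk (P.vecEquiv ((x, 0), 0)) := by
  change QuotientAddGroup.mk (AddSubgroup.inclusion _ (P.vecEquivK x)) = _
  congr 1
  apply Subtype.ext
  rw [coe_vecEquiv, Int.cast_zero]
  rfl

/-- The inclusion induces an isomorphism of discriminant groups. -/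
theorem discMap_bijective : Function.Bijective (discMap N P.l P.l') := by
  constructor
  · intro h h' heq
    rw [← P.mk_idx h, ← P.mk_idx h', discMap_mk, discMap_mk, mk_vec_eq] at heq
    rw [← P.mk_idx h, ← P.mk_idx h', mk_vecK_eq]
    exact heq
  · intro q
    induction q using QuotientAddGroup.induction_on with
    | H y =>
      obtain ⟨⟨⟨x, n⟩, m⟩, rfl⟩ := P.vecEquiv.surjective y
      refine ⟨QuotientAddGroup.mk (P.vecEquivK x), ?_⟩
      rw [discMap_mk, mk_vec_eq, sub_self]
      exact dvd_zero _

/-- The discriminant group `K'/K` is cyclic of order `2N`. -/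
def discEquiv : Fin (2 * N) ≃ DiscK N P.l P.l' :=
  Equiv.ofBijective (fun i => QuotientAddGroup.mk (P.vecEquivK (i : ℕ))) <| by
    have hpos : (0 : ℤ) < 2 * N := by
      have := Nat.pos_of_neZero N; omega
    constructor
    · intro i j h
      rw [mk_vecK_eq] at h
      have hi := i.2
      have hj := j.2
      apply Fin.ext
      have := Int.eq_zero_of_abs_lt_dvd h (by rw [abs_lt]; omega)
      omega
    · intro h
      have h0 := Int.emod_nonneg (P.idx h) hpos.ne'
      have h1 := Int.emod_lt_of_pos (P.idx h) hpos
      refine ⟨⟨(P.idx h % (2 * N)).toNat, by omega⟩, ?_⟩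
      rw [mk_eq_iff]
      simp only [Int.toNat_of_nonneg h0]
      rw [dvd_sub_comm]
      exact Int.dvd_self_sub_emod

lemma card_discK : Fintype.card (DiscK N P.l P.l') = 2 * N := by
  rw [← Fintype.card_congr P.discEquiv, Fintype.card_fin]

lemma sum_discK {f : ℤ → ℂ} (hf : PeriodicMod (2 * N) f) :
    ∑ h : DiscK N P.l P.l', f (P.idx h) = ∑ i ∈ Finset.range (2 * N), f i := by
  rw [← P.discEquiv.sum_comp, Finset.sum_range]
  refine Finset.sum_congr rfl fun i _ => ?_
  refine hf _ _ ?_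
  rw [dvd_sub_comm]
  push_cast
  exact P.mk_eq_iff.mp (show (QuotientAddGroup.mk (P.vecEquivK ((i : ℕ) : ℤ)) :
    DiscK N P.l P.l') = P.discEquiv i from rfl)

lemma mem_thetaIndex_iff {D r : ℤ} {h : DiscK N P.l P.l'} {x n m : ℤ} :
    P.vecEquiv ((x, n), m) ∈ thetaIndex N D r (discMap N P.l P.l' h) ↔
      (2 * N : ℤ) ∣ x - r * P.idx h ∧ 4 * N * D ∣ x ^ 2 + 4 * N * m * n - D * P.idx h ^ 2 := by
  have hN : (N : ℝ) ≠ 0 := Nat.cast_ne_zero.mpr (NeZero.ne N)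
  refine and_congr ?_ ?_
  · rw [← map_zsmul, zsmul_eq, discMap_mk, mk_vec_eq]
  -- The representative chosen in `L'/L` need not lie in `K'`; passing to `idx h` changes `D Q(h)`
  -- only by a multiple of `D`, which the quantifier over `q` absorbs.
  · obtain ⟨⟨⟨x', n'⟩, m'⟩, hy⟩ :=
      P.vecEquiv.surjective (Quotient.out (discMap N P.l P.l' h))
    have h1 : repL N (discMap N P.l P.l' h) = P.vec x' m' n' := by
      rw [repL, ← hy]; rfl
    have h2 : (2 * N : ℤ) ∣ x' - P.idx h := by
      rw [← P.mk_vec_eq (n := n') (m := m') (n' := 0) (m' := 0), hy, ← discMap_mk, mk_idx]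
      exact Quotient.out_eq _
    obtain ⟨t, ht⟩ := h2
    have hx' : x' = P.idx h + 2 * N * t := by linarith
    rw [h1, coe_vecEquiv, Q_vec, Q_vec]
    have key : ∀ q : ℤ, ((x : ℝ) ^ 2 / (4 * N) + m * n - D * ((x' : ℝ) ^ 2 / (4 * N) + m' * n') =
        D * q ↔ x ^ 2 + 4 * N * m * n - D * P.idx h ^ 2 =
          4 * N * D * (q + m' * n' + t * P.idx h + N * t ^ 2)) := by
      intro q
      rw [← @Int.cast_inj ℝ, hx']
      push_cast
      constructor
      · intro h; field_simp at h; linear_combination h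
      · intro h; field_simp; linear_combination h
    simp only [key]
    constructor
    · rintro ⟨q, hq⟩; exact ⟨_, hq⟩
    · rintro ⟨q, hq⟩
      refine ⟨q - m' * n' - t * P.idx h - N * t ^ 2, ?_⟩
      rw [hq]; ring

/-! ### The theta kernel as a sum over pairs -/

lemma genusChar_vec (D x m n : ℤ) : genusChar N D (P.vec x m n) =
    genusCharCoeff N D (P.toA x m n) (P.toB x m n) (P.toC x m n) := by
  rw [vec_intCast, genusChar_coeffVec]

variable (z : ℍ) {D r m₀ : ℤ}

lemma indicator_thetaTerm (hz : 0 < pz N z P.l) (k : ℕ) (τ : ℍ) (h : DiscK N P.l P.l') (y : (ℤ × ℤ) × ℤ) :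
    (thetaIndex N D r (discMap N P.l P.l' h)).indicator
      (fun x => thetaTerm N D k τ z (x : latL' N)) (P.vecEquiv y) =
    (pz N z P.l * qz N z P.l ^ (k - 1)) *
      thetaCoord P (P.geom z hz) D r (k - 1) τ (P.idx h) y.1.1 y.1.2 y.2 := by
  obtain ⟨⟨x, n⟩, m⟩ := y
  rw [thetaCoord, wgt_eq_ite]
  by_cases hy : P.vecEquiv ((x, n), m) ∈ thetaIndex N D r (discMap N P.l P.l' h)
  · rw [Set.indicator_of_mem hy, if_pos (P.mem_thetaIndex_iff.mp hy), thetaTerm, coe_vecEquiv,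
      genusChar_vec, P.pz_vec z hz, P.qz_vec z hz, P.Qz_vec z hz, Q_vec, abs_cast, mul_pow]
    have hτ : (τ : ℂ) = τ.re + Complex.I * τ.im := by
      apply Complex.ext <;> simp
    have h1 : ((((x : ℝ) ^ 2 / (4 * N) + m * n : ℝ) : ℂ) / D.natAbs * τ.re +
        (((x : ℝ) ^ 2 / (4 * N) + m * n +
          (P.geom z hz).A * (m + (P.geom z hz).pos x n) ^ 2 : ℝ) : ℂ) / D.natAbs * Complex.I *
          τ.im) = (((x : ℂ) ^ 2 / (4 * N) + m * n) * τ + Complex.I * τ.im * (P.geom z hz).A *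
          (m + (P.geom z hz).pos x n) ^ 2) / D.natAbs := by
      rw [hτ]; push_cast; ring
    rw [h1]
    push_cast
    ring
  · rw [Set.indicator_of_notMem hy, if_neg fun h' => hy (P.mem_thetaIndex_iff.mpr h')]
    simp

lemma summable_thetaTerm (hz : 0 < pz N z P.l) (hD : IsFundamentalDiscriminant D)
    (hr : r ^ 2 - 4 * N * m₀ = D) (k : ℕ)
    (τ : ℍ) (h : DiscK N P.l P.l') :
    Summable fun x : thetaIndex N D r (discMap N P.l P.l' h) =>
      thetaTerm N D k τ z (x : latL' N) := by
  rw [show (fun x : thetaIndex N D r (discMap N P.l P.l' h) =>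
      thetaTerm N D k τ z (x : latL' N)) = (fun x : latL' N => thetaTerm N D k τ z x) ∘
      ((↑) : thetaIndex N D r (discMap N P.l P.l' h) → latL' N) from rfl,
    summable_subtype_iff_indicator, ← P.vecEquiv.summable_iff]
  refine ((summable_thetaCoord P (P.geom z hz) hD hr (k - 1) τ (P.idx h)).mul_left
    (pz N z P.l * qz N z P.l ^ (k - 1))).congr fun y => ?_
  exact (P.indicator_thetaTerm z hz k τ h y).symm

/-- The theta kernel as a sum over pairs `(n, α)`. -/
theorem Theta_eq (hz : 0 < pz N z P.l) (hD : IsFundamentalDiscriminant D)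
    (hr : r ^ 2 - 4 * N * m₀ = D) (k : ℕ)
    (τ : ℍ) (h : DiscK N P.l P.l') :
    Theta N D r k τ z (discMap N P.l P.l' h) =
      qz N z P.l ^ (k - 1) / (2 * (P.geom z hz).A * ((√(2 * D.natAbs) : ℝ) : ℂ)) *
        ∑' y : ℤ × ℤ, latTerm P (P.geom z hz) D r (k - 1) τ y.1 y.2 (P.idx h) := by
  have hd : (0 : ℝ) < D.natAbs := Nat.cast_pos.mpr (by simpa using hD.ne_zero)
  rw [Theta, tsum_subtype (thetaIndex N D r (discMap N P.l P.l' h))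
    (fun x => thetaTerm N D k τ z (x : latL' N)), ← P.vecEquiv.tsum_eq]
  simp only [P.indicator_thetaTerm z hz]
  rw [tsum_mul_left, tsum_thetaCoord P _ hD hr, ← mul_assoc, ← mul_assoc]
  congr 1
  have hv := τ.im_pos
  have hA : (P.geom z hz).A = pz N z P.l ^ 2 := rfl
  rw [hA]
  clear hA
  obtain ⟨p, hp⟩ : ∃ p, p = pz N z P.l := ⟨_, rfl⟩
  rw [← hp] at hz ⊢
  -- The powers of `v` cancel: `v^{3/2}` against the root of `v` and the factor `v` in the
  -- denominator left by Poisson summation.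
  have e1 : τ.im ^ (3 / 2 : ℝ) = √τ.im ^ 3 := by
    rw [Real.sqrt_eq_rpow, ← Real.rpow_natCast, ← Real.rpow_mul hv.le]
    norm_num
  have e2 : √(2 * τ.im * p ^ 2 / D.natAbs) = √2 * √τ.im * p / √(D.natAbs : ℝ) := by
    rw [Real.sqrt_div' _ hd.le, Real.sqrt_mul (by positivity), Real.sqrt_mul (by norm_num),
      Real.sqrt_sq hz.le]
  have e3 : √(2 * D.natAbs : ℝ) = √2 * √(D.natAbs : ℝ) := Real.sqrt_mul (by norm_num) _
  have e4 : ((√τ.im : ℝ) : ℂ) ^ 2 = τ.im := by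
    rw [← Complex.ofReal_pow, Real.sq_sqrt hv.le]
  have e5 : ((√(D.natAbs : ℝ) : ℝ) : ℂ) ^ 2 = D.natAbs := by
    rw [← Complex.ofReal_pow, Real.sq_sqrt hd.le, Complex.ofReal_natCast]
  have n1 : ((√τ.im : ℝ) : ℂ) ≠ 0 := by exact_mod_cast (Real.sqrt_pos.mpr hv).ne'
  have n2 : ((√(D.natAbs : ℝ) : ℝ) : ℂ) ≠ 0 := by exact_mod_cast (Real.sqrt_pos.mpr hd).ne'
  have n3 : ((√2 : ℝ) : ℂ) ≠ 0 := by
    exact_mod_cast (Real.sqrt_pos.mpr (by norm_num : (0 : ℝ) < 2)).ne'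
  have n4 : (p : ℂ) ≠ 0 := by exact_mod_cast hz.ne'
  rw [e1, e2, e3]
  push_cast
  rw [← e4, ← e5]
  field_simp

end HypPair

/-! ### The theta functions of `K` in adapted coordinates -/

namespace HypPair

lemma wgtF_of_not_dvd {N : ℕ} (P : HypPair N) {D r h x α n : ℤ} (hx : ¬ (2 * N : ℤ) ∣ x - r * h) :
    wgtF P D r h x α n = 0 := by
  rw [wgtF]
  refine Finset.sum_eq_zero fun t _ => ?_
  rw [wgt_of_not_dvd P hx]; simp

variable {N : ℕ} [NeZero N] (P : HypPair N) (z : ℍ) {D r m₀ : ℤ}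

/-- The summand of `ξ` in adapted coordinates, up to the weight. -/
def xiCoord (G : Geom N) (D : ℤ) (κ : ℕ) (τ : ℍ) (y : ℝ) (α β x : ℤ) : ℂ :=
  hermiteH κ (((√Real.pi : ℝ) : ℂ) * (α - β * (starRingEnd ℂ) (τ : ℂ) +
      2 * τ.im * (G.A * G.σ * (x + β * y))) / ((√(2 * D.natAbs * τ.im * G.A) : ℝ) : ℂ)) *
    e ((x + β * y : ℂ) ^ 2 / (4 * N) * τ / D.natAbs -
      (x + β / 2 * y) * (α * y) / (2 * N) / D.natAbs)

lemma exists_congr_iff {h : DiscK N P.l P.l'} {x m n : ℤ} :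
    (∃ q : ℤ, Q N (P.vec x m n) - D * Q N (repK N P.l P.l' h) = D * q) ↔
      4 * N * D ∣ x ^ 2 + 4 * N * m * n - D * P.idx h ^ 2 := by
  have hN : (N : ℝ) ≠ 0 := Nat.cast_ne_zero.mpr (NeZero.ne N)
  rw [repK_eq, Q_vec, Q_vec]
  refine exists_congr fun q => ?_
  rw [← @Int.cast_inj ℝ]
  push_cast
  constructor
  · intro h; field_simp at h; linear_combination h
  · intro h; field_simp; linear_combination h

lemma xiTerm_eq (hz : 0 < pz N z P.l) (κ : ℕ) (τ : ℍ) (y : ℝ) (α β : ℤ)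
    {h : DiscK N P.l P.l'} {x : ℤ} (hx : (2 * N : ℤ) ∣ x - r * P.idx h) :
    xiTerm N D P.l P.l' z κ τ (P.vec y 0 0) α β h (P.vecEquivK x) =
      wgtF P D r (P.idx h) x (-α) (-β) * xiCoord (P.geom z hz) D κ τ y α β x := by
  have hN : (N : ℂ) ≠ 0 := Nat.cast_ne_zero.mpr (NeZero.ne N)
  rw [xiTerm, wgtF, Finset.sum_mul]
  refine Finset.sum_congr rfl fun t _ => ?_
  have h1 : (P.vecEquivK x : V) - (β : ℝ) • P.l' + (t : ℝ) • P.l =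
      P.vec x ((t : ℤ) : ℝ) ((-β : ℤ) : ℝ) := by
    rw [coe_vecEquivK, smul_vec, smul_vec, sub_vec, vec_add]
    push_cast
    congr 1 <;> ring
  have h2 : (P.vecEquivK x : V) + (β : ℝ) • P.vec y 0 0 = P.vec (x + β * y) 0 0 := by
    rw [coe_vecEquivK, smul_vec, vec_add]
    congr 1 <;> ring
  have h3 : (P.vecEquivK x : V) + ((β : ℝ) / 2) • P.vec y 0 0 = P.vec (x + β / 2 * y) 0 0 := by
    rw [coe_vecEquivK, smul_vec, vec_add]
    congr 1 <;> ring
  rw [h1, h2, h3, smul_vec, P.form_wPerp_vec z hz, P.Qz_l z hz, P.Q_vec (x + β * y) 0 0, form_vec, genusChar_vec,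
    abs_cast, wgt_eq_ite]
  simp only [exists_congr_iff, hx, true_and]
  split_ifs with hc
  · rw [xiCoord, er]
    have e1 : (((√(2 * (|D| : ℤ) * τ.im * (P.geom z hz).A) : ℝ) : ℂ)) =
        ((√(2 * D.natAbs * τ.im * (P.geom z hz).A) : ℝ) : ℂ) := by
      rw [Int.abs_eq_natAbs, Int.cast_natCast]
    rw [e1]
    push_cast
    have e2 : (α - β * (starRingEnd ℂ) (τ : ℂ) - 2 * τ.im *
        -((P.geom z hz).A * (P.geom z hz).σ * (x + β * y)) : ℂ) =
        α - β * (starRingEnd ℂ) (τ : ℂ) +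
          2 * τ.im * ((P.geom z hz).A * (P.geom z hz).σ * (x + β * y)) := by ring
    rw [e2]
    have e3 : (((x : ℂ) + β * y) ^ 2 / (4 * N) + 0 * 0) * τ / D.natAbs -
        ((x + β / 2 * y) * (α * y) / (2 * N) + 0 * (α * 0) + α * 0 * 0) / D.natAbs =
        (x + β * y : ℂ) ^ 2 / (4 * N) * τ / D.natAbs -
          (x + β / 2 * y) * (α * y) / (2 * N) / D.natAbs := by ring
    rw [e3]
    ring
  · simp

/-- The coset `K + rh` in `K'`. -/
def coset (r : ℤ) (h : DiscK N P.l P.l') : Set (latK' N P.l P.l') :=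
  {x | (QuotientAddGroup.mk x : DiscK N P.l P.l') = r • h}

lemma mem_coset {h : DiscK N P.l P.l'} {x : ℤ} :
    P.vecEquivK x ∈ P.coset r h ↔ (2 * N : ℤ) ∣ x - r * P.idx h := P.mk_eq_zsmul_iff

lemma indicator_xiTerm (hz : 0 < pz N z P.l) (κ : ℕ) (τ : ℍ) (y : ℝ) (α β : ℤ)
    (h : DiscK N P.l P.l') (x : ℤ) :
    ((P.coset r h).indicator (fun x => xiTerm N D P.l P.l' z κ τ (P.vec y 0 0) α β h (x : V)))
        (P.vecEquivK x) =
      wgtF P D r (P.idx h) x (-α) (-β) * xiCoord (P.geom z hz) D κ τ y α β x := by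
  by_cases hx : (2 * N : ℤ) ∣ x - r * P.idx h
  · rw [Set.indicator_of_mem (P.mem_coset.mpr hx), P.xiTerm_eq z hz κ τ y α β hx]
  · rw [Set.indicator_of_notMem (fun h' => hx (P.mem_coset.mp h')), wgtF_of_not_dvd P hx,
      zero_mul]

lemma summable_wgtF_xiCoord (G : Geom N) (hD : IsFundamentalDiscriminant D)
    (hr : r ^ 2 - 4 * N * m₀ = D) (κ : ℕ) (τ : ℍ) (y : ℝ) (α β h : ℤ) :
    Summable fun x : ℤ => wgtF P D r h x (-α) (-β) * xiCoord G D κ τ y α β x := by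
  have hN : (N : ℂ) ≠ 0 := Nat.cast_ne_zero.mpr (NeZero.ne N)
  have hd : (D.natAbs : ℂ) ≠ 0 := Nat.cast_ne_zero.mpr (by simpa using hD.ne_zero)
  obtain ⟨C, hC0, hC⟩ := exists_norm_wgtF_le P hD hr h
  set R : ℂ := ((√(2 * D.natAbs * τ.im * G.A) : ℝ) : ℂ) with hR
  set p : ℂ := ((√Real.pi : ℝ) : ℂ) with hp
  have hs := summable_heatPoly_gauss (gauss_re_pos (N := N) hD.ne_zero τ) (-1)
    (2 * p * (2 * τ.im * (G.A * G.σ)) / R)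
    (2 * p * (α - β * (starRingEnd ℂ) (τ : ℂ) + 2 * τ.im * (G.A * G.σ * (β * y))) / R)
    (2 * Real.pi * Complex.I * (β * y / (2 * N) * τ / D.natAbs - α * y / (2 * N) / D.natAbs)) κ
  refine Summable.of_norm_bounded (((hs.mul_left (e ((β * y) ^ 2 / (4 * N) * τ / D.natAbs -
    β / 2 * y * (α * y) / (2 * N) / D.natAbs))).norm).mul_left C) fun x => ?_
  have h1 : xiCoord G D κ τ y α β x = e ((β * y) ^ 2 / (4 * N) * τ / D.natAbs -
    β / 2 * y * (α * y) / (2 * N) / D.natAbs) * (heatPoly (-1) κ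
    (2 * p * (2 * τ.im * (G.A * G.σ)) / R * x +
      2 * p * (α - β * (starRingEnd ℂ) (τ : ℂ) + 2 * τ.im * (G.A * G.σ * (β * y))) / R) *
      Complex.exp (-Real.pi * (-(Complex.I * τ) / (2 * N * D.natAbs)) * x ^ 2 +
        2 * Real.pi * Complex.I * (β * y / (2 * N) * τ / D.natAbs -
          α * y / (2 * N) / D.natAbs) * x)) := by
    rw [xiCoord, hermiteH_eq_heatPoly, ← hR, ← hp]
    refine Eq.trans (congrArg₂ (fun a b : ℂ => a * b) ?_ ?_) (mul_left_comm _ _ _)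
    · congr 1
      ring
    · rw [e, e, ← Complex.exp_add]
      congr 1
      field_simp
      ring
  rw [norm_mul, ← h1]
  exact mul_le_mul_of_nonneg_right (hC _ _ _) (norm_nonneg _)

lemma summable_xiTerm (hz : 0 < pz N z P.l) (hD : IsFundamentalDiscriminant D)
    (hr : r ^ 2 - 4 * N * m₀ = D) (κ : ℕ) (τ : ℍ) (y : ℝ) (α β : ℤ) (h : DiscK N P.l P.l') :
    Summable fun x : P.coset r h =>
      xiTerm N D P.l P.l' z κ τ (P.vec y 0 0) α β h (x : latK' N P.l P.l') := by
  obtain ⟨f, hf⟩ : ∃ f : latK' N P.l P.l' → ℂ,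
    f = fun x : latK' N P.l P.l' => xiTerm N D P.l P.l' z κ τ (P.vec y 0 0) α β h (x : V) := ⟨_, rfl⟩
  have h2 : Summable ((P.coset r h).indicator f) := by
    rw [← P.vecEquivK.summable_iff]
    refine (summable_wgtF_xiCoord P (P.geom z hz) hD hr κ τ y α β (P.idx h)).congr fun x => ?_
    rw [hf]
    exact (P.indicator_xiTerm z hz κ τ y α β h x).symm
  refine (summable_subtype_iff_indicator.mpr h2).congr fun x => ?_
  rw [Function.comp, hf]

lemma Xi_eq_tsum (hz : 0 < pz N z P.l) (κ : ℕ) (τ : ℍ) (y : ℝ) (α β : ℤ)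
    (h : DiscK N P.l P.l') :
    Xi N D r P.l P.l' z κ τ (P.vec y 0 0) α β h = ((τ.im ^ (-(κ : ℝ) / 2) : ℝ) : ℂ) *
      ∑' x : ℤ, wgtF P D r (P.idx h) x (-α) (-β) * xiCoord (P.geom z hz) D κ τ y α β x := by
  rw [Xi]
  congr 1
  set f : latK' N P.l P.l' → ℂ :=
    fun x => xiTerm N D P.l P.l' z κ τ (P.vec y 0 0) α β h (x : V) with hf
  have h1 := tsum_subtype (P.coset r h) f
  rw [← P.vecEquivK.tsum_eq ((P.coset r h).indicator f)] at h1
  exact h1.trans (tsum_congr fun x => P.indicator_xiTerm z hz κ τ y α β h x)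

/-- The theta functions `Ξ` at `β = 0` in terms of the functions `jFun`. -/
theorem Xi_eq (hz : 0 < pz N z P.l) (hD : IsFundamentalDiscriminant D) (κ : ℕ) (τ : ℍ) (y : ℝ)
    (n : ℤ) (hy : n * y = n * (2 * N * (P.geom z hz).ρ)) (h : DiscK N P.l P.l') :
    e (-(n : ℂ) ^ 2 / (4 * (|D| : ℤ) * Complex.I * (τ.im : ℂ) * (Qz N z P.l : ℂ))) *
      Xi N D r P.l P.l' z κ τ (P.vec y 0 0) (-n) 0 h =
    ((√(8 * Real.pi * (P.geom z hz).A / D.natAbs) : ℝ) : ℂ) ^ κ *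
      jFun P (P.geom z hz) D r κ τ 0 n (P.idx h) := by
  have hN : (N : ℂ) ≠ 0 := Nat.cast_ne_zero.mpr (NeZero.ne N)
  have hd : (0 : ℝ) < D.natAbs := Nat.cast_pos.mpr (by simpa using hD.ne_zero)
  have hdc : (D.natAbs : ℂ) ≠ 0 := by exact_mod_cast hd.ne'
  rw [Xi_eq_tsum P z hz, P.Qz_l z hz, abs_cast, jFun, ← tsum_mul_left, ← tsum_mul_left,
    ← tsum_mul_left]
  refine tsum_congr fun x => ?_
  generalize P.geom z hz = G at *
  have hA := G.A_pos
  have hv := τ.im_pos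
  have hAc : (G.A : ℂ) ≠ 0 := by exact_mod_cast hA.ne'
  have hvc : (τ.im : ℂ) ≠ 0 := by exact_mod_cast hv.ne'
  rw [jTerm, xiCoord, neg_neg, neg_zero, hermiteH_eq_heatPoly]
  -- Only the product with `n` is prescribed, so that `n = 0`, `y = 0` is included; this case gives
  -- the term outside the Poincaré series.
  have hyc : (n : ℂ) * y = n * (2 * N * G.ρ) := by exact_mod_cast hy
  set c : ℝ := √(8 * Real.pi * G.A / D.natAbs) with hc
  have hc2 : (c : ℂ) ^ 2 = 8 * Real.pi * G.A / D.natAbs := by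
    rw [hc, ← Complex.ofReal_pow, Real.sq_sqrt (by positivity)]; push_cast; rfl
  have e1 : ((√τ.im : ℝ) : ℂ) ^ 2 = τ.im := by
    rw [← Complex.ofReal_pow, Real.sq_sqrt hv.le]
  have n1 : ((√τ.im : ℝ) : ℂ) ≠ 0 := by exact_mod_cast (Real.sqrt_pos.mpr hv).ne'
  have e2 : ((τ.im ^ (-(κ : ℝ) / 2) : ℝ) : ℂ) * ((√τ.im : ℝ) : ℂ) ^ κ = 1 := by
    rw [← Complex.ofReal_pow, ← Complex.ofReal_mul, Real.sqrt_eq_rpow, ← Real.rpow_natCast,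
      ← Real.rpow_mul hv.le, ← Real.rpow_add hv]
    rw [show -(κ : ℝ) / 2 + 1 / 2 * κ = 0 by ring, Real.rpow_zero, Complex.ofReal_one]
  -- The argument of the Hermite polynomial is `√v c` times that of `jTerm`. Homogeneity then yields
  -- `c ^ κ` and a power of `√v` that cancels `v^{-κ/2}`.
  have e3 : (2 * (((√Real.pi : ℝ) : ℂ) * (((-n : ℤ) : ℂ) - ((0 : ℤ) : ℂ) *
      (starRingEnd ℂ) (τ : ℂ) + 2 * τ.im * (G.A * G.σ * (x + ((0 : ℤ) : ℂ) * y))) /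
      ((√(2 * D.natAbs * τ.im * G.A) : ℝ) : ℂ))) =
      (((√τ.im : ℝ) : ℂ) * c) * (G.σ * (x - 2 * N * G.ρ * ((0 : ℤ) : ℂ)) +
        (((0 : ℤ) : ℂ) * (starRingEnd ℂ) (τ : ℂ) - n) / (2 * τ.im * G.A)) := by
    have q1 : √(2 * D.natAbs * τ.im * G.A) * (√τ.im * c) = √Real.pi * (4 * (τ.im * G.A)) := by
      rw [hc, ← Real.sqrt_mul (by positivity), ← Real.sqrt_mul (by positivity)]
      rw [show (2 * D.natAbs * τ.im * G.A * (τ.im * (8 * Real.pi * G.A / D.natAbs)) : ℝ) =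
        Real.pi * (4 * (τ.im * G.A)) ^ 2 by field_simp; ring, Real.sqrt_mul Real.pi_pos.le,
        Real.sqrt_sq (by positivity)]
    have q2 : ((√(2 * D.natAbs * τ.im * G.A) : ℝ) : ℂ) * (((√τ.im : ℝ) : ℂ) * c) =
        ((√Real.pi : ℝ) : ℂ) * (4 * (τ.im * G.A)) := by exact_mod_cast q1
    have q3 : ((√(2 * D.natAbs * τ.im * G.A) : ℝ) : ℂ) ≠ 0 := by
      exact_mod_cast (Real.sqrt_pos.mpr (mul_pos (mul_pos (mul_pos two_pos hd) hv) hA)).ne'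
    rw [← mul_div_assoc, div_eq_iff q3]
    push_cast
    field_simp
    linear_combination (-(G.σ * x * (2 * τ.im * G.A) - n) : ℂ) * q2
  have e4 : (((√τ.im : ℝ) : ℂ) * c) ^ 2 * (-(D.natAbs / (8 * Real.pi * τ.im * G.A))) = -1 := by
    have hpi : (Real.pi : ℂ) ≠ 0 := by exact_mod_cast Real.pi_ne_zero
    rw [mul_pow, e1, hc2]
    field_simp
  rw [e3, ← e4, heatPoly_mul, mul_pow]
  have e5 : e (-(n : ℂ) ^ 2 / (4 * D.natAbs * Complex.I * τ.im * G.A)) *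
      e (((x : ℂ) + ((0 : ℤ) : ℂ) * y) ^ 2 / (4 * N) * τ / D.natAbs -
      (x + ((0 : ℤ) : ℂ) / 2 * y) * (((-n : ℤ) : ℂ) * y) / (2 * N) / D.natAbs) =
      e ((τ * (x - 2 * N * G.ρ * ((0 : ℤ) : ℂ)) ^ 2 / (4 * N) +
      n * G.ρ * (x - 2 * N * G.ρ * ((0 : ℤ) : ℂ)) + N * G.ρ ^ 2 * ((0 : ℤ) : ℂ) * n +
      Complex.I * (((0 : ℤ) : ℂ) * τ - n) * (((0 : ℤ) : ℂ) * (starRingEnd ℂ) (τ : ℂ) - n) /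
        (4 * τ.im * G.A)) / D.natAbs) := by
    rw [← e_add]
    congr 1
    push_cast
    have q4 : -(n : ℂ) ^ 2 / (4 * D.natAbs * Complex.I * τ.im * G.A) =
        Complex.I * n ^ 2 / (4 * D.natAbs * τ.im * G.A) := by
      field_simp
      rw [Complex.I_sq]; ring
    rw [q4]
    field_simp
    linear_combination (8 * τ.im * G.A * x : ℂ) * hyc
  rw [← e5]
  generalize e (-(n : ℂ) ^ 2 / _) = E₁
  generalize e _ = E₂
  generalize heatPoly _ _ _ = H
  generalize wgtF _ _ _ _ _ _ _ = W
  linear_combination ((c : ℂ) ^ κ * E₁ * E₂ * H * W) * e2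

end HypPair

/-! ### Transformation under the metaplectic group -/

/-- The twist of an operator: itself if `D > 0`, its complex conjugate otherwise. -/
def twist {n : Type*} (D : ℤ) (M : Matrix n n ℂ) : Matrix n n ℂ :=
  if 0 < D then M else M.map (starRingEnd ℂ)

lemma twist_mul {n : Type*} [Fintype n] (D : ℤ) (A B : Matrix n n ℂ) :
    twist D (A * B) = twist D A * twist D B := by
  unfold twist
  split_ifs
  · rfl
  · exact Matrix.map_mul

lemma twist_one {n : Type*} [DecidableEq n] (D : ℤ) : twist D (1 : Matrix n n ℂ) = 1 := by
  unfold twist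
  split_ifs
  · rfl
  · exact Matrix.map_one _ (map_zero _) (map_one _)

lemma twist_e (D : ℤ) (hD : D ≠ 0) (x : ℝ) :
    (if 0 < D then e x else (starRingEnd ℂ) (e x)) = e (D.sign * x) := by
  split_ifs with h
  · rw [Int.sign_eq_one_of_pos h, Int.cast_one, one_mul]
  · have : D < 0 := lt_of_le_of_ne (not_lt.mp h) hD
    rw [Int.sign_eq_neg_one_of_neg this, conj_e, Complex.conj_ofReal]
    congr 1
    push_cast
    ring

lemma PeriodicMod.const {M : ℕ} (c : ℂ) : PeriodicMod M fun _ => c := fun _ _ _ => rfl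

lemma isUnit_twist {n : Type*} [Fintype n] [DecidableEq n] (D : ℤ) {A : Matrix n n ℂ}
    (hA : IsUnit A) : IsUnit (twist D A) := by
  obtain ⟨u, rfl⟩ := hA
  refine IsUnit.of_mul_eq_one (twist D (↑u⁻¹ : Matrix n n ℂ)) ?_
  rw [← twist_mul, Units.mul_inv, twist_one]

namespace HypPair

variable {N : ℕ} [NeZero N] (P : HypPair N) (G : Geom N) {D r m₀ : ℤ}

lemma isUnit_weilT : IsUnit (weilT N P.l P.l') := by
  rw [weilT, Matrix.isUnit_diagonal, Pi.isUnit_iff]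
  exact fun h => (e_ne_zero _).isUnit

lemma twist_weilT (hD : D ≠ 0) : twist D (weilT N P.l P.l') =
    Matrix.diagonal fun h => e (D.sign * (P.idx h : ℂ) ^ 2 / (4 * N)) := by
  have h1 : ∀ h : DiscK N P.l P.l', e (D.sign * (P.idx h : ℂ) ^ 2 / (4 * N)) =
      if 0 < D then e (Q N (repK N P.l P.l' h)) else
        (starRingEnd ℂ) (e (Q N (repK N P.l P.l' h))) := by
    intro h
    rw [twist_e D hD, repK_eq, Q_vec]
    congr 1
    push_cast
    ring
  simp only [h1]
  unfold twist weilT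
  split_ifs
  · rfl
  · exact Matrix.diagonal_map (map_zero _)

lemma twist_weilS (hD : D ≠ 0) : twist D (weilS N P.l P.l') =
    Matrix.of fun h h' => e (-D.sign / 8) / ((√(2 * N : ℝ) : ℝ) : ℂ) *
      er (2 * N) (-(D.sign * P.idx h * P.idx h')) := by
  have hN : (N : ℂ) ≠ 0 := Nat.cast_ne_zero.mpr (NeZero.ne N)
  have h1 : ∀ h h' : DiscK N P.l P.l', er (2 * N) (-(D.sign * P.idx h * P.idx h')) =
      if 0 < D then e (-(form N (repK N P.l P.l' h') (repK N P.l P.l' h) : ℂ)) else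
        (starRingEnd ℂ) (e (-(form N (repK N P.l P.l' h') (repK N P.l P.l' h) : ℂ))) := by
    intro h h'
    have := twist_e D hD (-(form N (repK N P.l P.l' h') (repK N P.l P.l' h)))
    rw [Complex.ofReal_neg] at this
    rw [this, repK_eq, repK_eq, form_vec, er]
    congr 1
    push_cast
    ring
  have h2 : e (-D.sign / 8) = if 0 < D then e (-1 / 8) else (starRingEnd ℂ) (e (-1 / 8)) := by
    have := twist_e D hD (-1 / 8)
    push_cast at this
    rw [this]
    congr 1
    ring
  have h3 : ((√(2 * N : ℝ) : ℝ) : ℂ) = ((√(Fintype.card (DiscK N P.l P.l')) : ℝ) : ℂ) := by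
    rw [card_discK]; push_cast; rfl
  ext h h'
  rw [h2, h3, Matrix.of_apply, h1]
  unfold twist weilS
  split_ifs
  · rfl
  · simp [Matrix.map_apply, Matrix.of_apply]

/-- The complex conjugate is an inverse, by orthogonality of the characters modulo `2 N`. The cases
`D = 1` and `D = -1` of `twist_weilS` supply the entries of both matrices. -/
lemma isUnit_weilS : IsUnit (weilS N P.l P.l') := by
  have hN : (0 : ℝ) < N := Nat.cast_pos.mpr (NeZero.pos N)
  have h0 : weilS N P.l P.l' = twist 1 (weilS N P.l P.l') := by
    rw [twist, if_pos one_pos]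
  have h1 : (weilS N P.l P.l').map (starRingEnd ℂ) = twist (-1) (weilS N P.l P.l') := by
    rw [twist, if_neg (by norm_num)]
  refine IsUnit.of_mul_eq_one ((weilS N P.l P.l').map (starRingEnd ℂ)) ?_
  rw [h1, P.twist_weilS (by norm_num : (-1 : ℤ) ≠ 0), h0.trans (P.twist_weilS one_ne_zero)]
  ext h h'
  rw [Matrix.mul_apply]
  simp only [Matrix.of_apply, Int.sign_one, Int.sign_neg]
  have key : ∀ i : ℤ, e (-((1 : ℤ) : ℂ) / 8) / ((√(2 * N : ℝ) : ℝ) : ℂ) *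
      er (2 * N) (-(1 * P.idx h * i)) * (e (-((-1 : ℤ) : ℂ) / 8) / ((√(2 * N : ℝ) : ℝ) : ℂ) *
      er (2 * N) (-(-1 * i * P.idx h'))) = 1 / (2 * N) *
        er (2 * N) ((P.idx h' - P.idx h) * i) := by
    intro i
    have q1 : er (2 * N) (-(1 * P.idx h * i)) * er (2 * N) (-(-1 * i * P.idx h')) =
        er (2 * N) ((P.idx h' - P.idx h) * i) := by
      rw [← er_add]; congr 1; ring
    have q2 : e (-((1 : ℤ) : ℂ) / 8) * e (-((-1 : ℤ) : ℂ) / 8) = 1 := by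
      rw [← e_add, ← e_zero]
      congr 1
      push_cast
      ring
    have q3 : ((√(2 * N : ℝ) : ℝ) : ℂ) ^ 2 = 2 * N := by
      rw [← Complex.ofReal_pow, sqrt_two_mul_sq]; push_cast; rfl
    have q4 : ((√(2 * N : ℝ) : ℝ) : ℂ) ≠ 0 := by
      exact_mod_cast (Real.sqrt_pos.mpr (mul_pos two_pos hN)).ne'
    rw [← q1, ← q3]
    generalize e (-((1 : ℤ) : ℂ) / 8) = E₁ at *
    generalize e (-((-1 : ℤ) : ℂ) / 8) = E₂ at *
    field_simp
    linear_combination (er (2 * N) (-(1 * P.idx h * i)) * er (2 * N) (-(-1 * i * P.idx h'))) * q2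
  have hper : PeriodicMod (2 * N) fun i => 1 / (2 * N : ℂ) *
      er (2 * N) ((P.idx h' - P.idx h) * i) :=
    (PeriodicMod.const _).mul (er_comp_periodic fun x y h => by
      rw [← mul_sub]; exact h.mul_left _)
  refine (Finset.sum_congr rfl fun i _ => key (P.idx i)).trans ((P.sum_discK hper).trans ?_)
  have h2 := sum_er (2 * N) (P.idx h' - P.idx h)
  rw [← Finset.mul_sum]
  simp only [mul_comm (P.idx h' - P.idx h)]
  rw [h2, Matrix.one_apply]
  have h3 : h = h' ↔ ((2 * N : ℕ) : ℤ) ∣ P.idx h' - P.idx h := by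
    conv_lhs => rw [← P.mk_idx h, ← P.mk_idx h', mk_vecK_eq, dvd_sub_comm]
    push_cast
    rfl
  simp only [h3]
  split_ifs
  · have hNc : (N : ℂ) ≠ 0 := Nat.cast_ne_zero.mpr (NeZero.ne N)
    push_cast
    field_simp
  · simp

lemma jFun_periodic (hD : IsFundamentalDiscriminant D) (hr : r ^ 2 - 4 * N * m₀ = D) (κ : ℕ)
    (τ : ℍ) (n α : ℤ) : PeriodicMod (2 * N) fun h => jFun P G D r κ τ n α h := by
  intro h h' hh
  refine tsum_congr fun x => ?_
  exact congrArg (fun w => w * _) ((wgtF_periodic P hD hr).1 x α n h h' hh)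

lemma latTerm_periodic (hD : IsFundamentalDiscriminant D) (hr : r ^ 2 - 4 * N * m₀ = D) (κ : ℕ)
    (τ : ℍ) (n α : ℤ) : PeriodicMod (2 * N) fun h => latTerm P G D r κ τ n α h := by
  intro h h' hh
  exact congrArg₂ (fun a b => _ * a + _ * b) (P.jFun_periodic G hD hr κ τ n α h h' hh)
    (P.jFun_periodic G hD hr (κ - 1) τ n α h h' hh)

/-- The vector of contributions of a row vector `u = (n, -α)`. -/
def latVec (D r : ℤ) (κ : ℕ) (u : Fin 2 → ℤ) (τ : ℍ) : DiscK N P.l P.l' → ℂ :=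
  fun h => latTerm P G D r κ τ (u 0) (-u 1) (P.idx h)

lemma coe_T_smul (τ : ℍ) : ((Mp2Z.T.g • τ : ℍ) : ℂ) = τ + 1 := by
  change ((ModularGroup.T • τ : ℍ) : ℂ) = _
  rw [modular_T_smul]
  simp [add_comm]

lemma coe_S_smul (τ : ℍ) : ((Mp2Z.S.g • τ : ℍ) : ℂ) = -1 / τ := by
  change ((ModularGroup.S • τ : ℍ) : ℂ) = _
  rw [modular_S_smul]
  change (-(τ : ℂ))⁻¹ = _
  rw [inv_neg, neg_div, one_div]

/-- The substitution of `α - n` for `α` in `jFun_add_one` is right multiplication of `(n, -α)` by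
`T`, and it is also what `τ + 1` does to the factor `n τ - α`. -/
lemma latVec_T (hD : IsFundamentalDiscriminant D) (κ : ℕ) (u : Fin 2 → ℤ) (τ : ℍ) :
    P.latVec G D r κ u (Mp2Z.T.g • τ) = Mp2Z.T.φ τ ^ (2 * (κ : ℤ) - 1) •
      (twist D (weilT N P.l P.l') *ᵥ P.latVec G D r κ (u ᵥ* (Mp2Z.T.g : Matrix _ _ ℤ)) τ) := by
  have hφ : Mp2Z.T.φ τ = 1 := rfl
  rw [hφ, _root_.one_zpow, one_smul, P.twist_weilT hD.ne_zero]
  funext h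
  rw [Matrix.mulVec_diagonal]
  have h0 : (u ᵥ* (Mp2Z.T.g : Matrix (Fin 2) (Fin 2) ℤ)) 0 = u 0 := by
    simp [Matrix.vecMul, dotProduct, Fin.sum_univ_two, Mp2Z.T, ModularGroup.T]
  have h1 : -(u ᵥ* (Mp2Z.T.g : Matrix (Fin 2) (Fin 2) ℤ)) 1 = -u 1 - u 0 := by
    simp [Matrix.vecMul, dotProduct, Fin.sum_univ_two, Mp2Z.T, ModularGroup.T]
    ring
  simp only [latVec]
  rw [h0, h1, latTerm, latTerm, jFun_add_one P G hD.ne_zero κ (coe_T_smul τ),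
    jFun_add_one P G hD.ne_zero (κ - 1) (coe_T_smul τ), coe_T_smul]
  push_cast
  ring

/-- Degree `κ` contributes `τ^{κ + 1/2}`, but the factor `n τ - α` loses one power of `τ` under
inversion. Degree `κ - 1` contributes `τ^{κ - 1/2}` directly. So the two terms of `latTerm` have the
common weight `κ - 1/2`, and the value of the Gauss sum turns the constant into that of the Weil
representation. -/
lemma latVec_S (hD : IsFundamentalDiscriminant D) (hr : r ^ 2 - 4 * N * m₀ = D) (κ : ℕ)
    (u : Fin 2 → ℤ) (τ : ℍ) :
    P.latVec G D r κ u (Mp2Z.S.g • τ) = Mp2Z.S.φ τ ^ (2 * (κ : ℤ) - 1) •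
      (twist D (weilS N P.l P.l') *ᵥ P.latVec G D r κ (u ᵥ* (Mp2Z.S.g : Matrix _ _ ℤ)) τ) := by
  have hd : (0 : ℝ) < D.natAbs := Nat.cast_pos.mpr (by simpa using hD.ne_zero)
  have hN : (0 : ℝ) < N := Nat.cast_pos.mpr (NeZero.pos N)
  have hφ : Mp2Z.S.φ τ = (τ : ℂ) ^ (1 / 2 : ℂ) := rfl
  rw [hφ, P.twist_weilS hD.ne_zero]
  have h0 : (u ᵥ* (Mp2Z.S.g : Matrix (Fin 2) (Fin 2) ℤ)) 0 = u 1 := by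
    simp [Matrix.vecMul, dotProduct, Fin.sum_univ_two, Mp2Z.S, ModularGroup.S]
  have h1 : -(u ᵥ* (Mp2Z.S.g : Matrix (Fin 2) (Fin 2) ℤ)) 1 = u 0 := by
    simp [Matrix.vecMul, dotProduct, Fin.sum_univ_two, Mp2Z.S, ModularGroup.S]
  funext h
  rw [Pi.smul_apply, Matrix.mulVec, dotProduct, smul_eq_mul]
  simp only [latVec, Matrix.of_apply]
  rw [h0, h1]
  set s : ℂ := (τ : ℂ) ^ (1 / 2 : ℂ) with hs
  have hs2 : s ^ 2 = τ := cpow_half_sq _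
  have hs0 : s ≠ 0 := by
    intro h
    rw [h] at hs2
    exact τ.ne_zero (by rw [← hs2]; norm_num)
  have hC : gauss D / ((√(2 * N * D.natAbs : ℝ) : ℝ) : ℂ) * e (-1 / 8) =
      e (-D.sign / 8) / ((√(2 * N : ℝ) : ℝ) : ℂ) := by
    have q1 : ((√(2 * N * D.natAbs : ℝ) : ℝ) : ℂ) =
        ((√(2 * N : ℝ) : ℝ) : ℂ) * ((√(D.natAbs : ℝ) : ℝ) : ℂ) := by
      rw [Real.sqrt_mul (by positivity)]; push_cast; rfl
    have q2 : ((√(D.natAbs : ℝ) : ℝ) : ℂ) ≠ 0 := by exact_mod_cast (Real.sqrt_pos.mpr hd).ne'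
    have q3 : e ((1 - D.sign) / 8) * e (-1 / 8) = e (-D.sign / 8) := by
      rw [← e_add]; congr 1; ring
    rw [gauss_eq hD, q1, ← q3]
    field_simp
  have hper : PeriodicMod (2 * N) fun i => e (-D.sign / 8) / ((√(2 * N : ℝ) : ℝ) : ℂ) *
      er (2 * N) (-(D.sign * P.idx h * i)) * latTerm P G D r κ τ (u 1) (u 0) i :=
    ((PeriodicMod.const _).mul (er_comp_periodic fun x y hxy => by
      rw [neg_sub_neg, ← mul_sub, ← neg_sub, mul_neg, dvd_neg]; exact hxy.mul_left _)).mul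
      (P.latTerm_periodic G hD hr κ τ (u 1) (u 0))
  rw [P.sum_discK hper, latTerm, jFun_inv P G hD hr κ (coe_S_smul τ),
    jFun_inv P G hD hr (κ - 1) (coe_S_smul τ), neg_neg, coe_S_smul, ← hs]
  simp only [latTerm]
  generalize hS₁ : ∑ i ∈ Finset.range (2 * N), er (2 * N) (-(D.sign * P.idx h * i)) *
    jFun P G D r κ τ (u 1) (u 0) i = S₁
  generalize hS₂ : ∑ i ∈ Finset.range (2 * N), er (2 * N) (-(D.sign * P.idx h * i)) *
    jFun P G D r (κ - 1) τ (u 1) (u 0) i = S₂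
  have hsum : ∑ i ∈ Finset.range (2 * N), e (-D.sign / 8) / ((√(2 * N : ℝ) : ℝ) : ℂ) *
      er (2 * N) (-(D.sign * P.idx h * i)) *
        ((((u 1 : ℤ) : ℂ) * τ - ((u 0 : ℤ) : ℂ)) * Complex.I ^ (κ + 1) *
          jFun P G D r κ τ (u 1) (u 0) i + D.natAbs / (2 * Real.pi) * κ * Complex.I ^ (κ - 1) *
          jFun P G D r (κ - 1) τ (u 1) (u 0) i) =
      e (-D.sign / 8) / ((√(2 * N : ℝ) : ℝ) : ℂ) *
        ((((u 1 : ℤ) : ℂ) * τ - ((u 0 : ℤ) : ℂ)) * Complex.I ^ (κ + 1) * S₁ +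
          D.natAbs / (2 * Real.pi) * κ * Complex.I ^ (κ - 1) * S₂) := by
    rw [← hS₁, ← hS₂, Finset.mul_sum, Finset.mul_sum, ← Finset.sum_add_distrib, Finset.mul_sum]
    exact Finset.sum_congr rfl fun i _ => by ring
  rw [hsum, ← hC]
  generalize gauss D / ((√(2 * N * D.natAbs : ℝ) : ℝ) : ℂ) = c₁
  rcases κ with - | κ
  · rw [← hs2]
    simp only [Nat.cast_zero, mul_zero, zero_mul, add_zero, zero_sub, _root_.zpow_neg_one, pow_zero]
    push_cast
    field_simp
    ring
  · have hz : s ^ (2 * ((κ + 1 : ℕ) : ℤ) - 1) = s * (s ^ 2) ^ κ := by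
      rw [← pow_mul, ← pow_succ', ← zpow_natCast]
      congr 1
      push_cast
      ring
    rw [hz, ← hs2, Nat.add_sub_cancel]
    push_cast
    field_simp
    ring

/-- The transformation law along words in the generators. -/
lemma latVec_word (hD : IsFundamentalDiscriminant D) (hr : r ^ 2 - 4 * N * m₀ = D) (κ : ℕ)
    (w : FreeMonoid (Fin 2)) : ∀ (u : Fin 2 → ℤ) (τ : ℍ),
    P.latVec G D r κ u ((Mp2Z.evalWord w).g • τ) = (Mp2Z.evalWord w).φ τ ^ (2 * (κ : ℤ) - 1) •
      (twist D (weilWord N P.l P.l' w) *ᵥ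
        P.latVec G D r κ (u ᵥ* ((Mp2Z.evalWord w).g : Matrix _ _ ℤ)) τ) := by
  have step : ∀ (γ : Mp2Z) (M : Matrix (DiscK N P.l P.l') (DiscK N P.l P.l') ℂ),
      (∀ (u : Fin 2 → ℤ) (τ : ℍ), P.latVec G D r κ u (γ.g • τ) = γ.φ τ ^ (2 * (κ : ℤ) - 1) •
        (twist D M *ᵥ P.latVec G D r κ (u ᵥ* (γ.g : Matrix _ _ ℤ)) τ)) →
      ∀ (γ' : Mp2Z) (M' : Matrix (DiscK N P.l P.l') (DiscK N P.l P.l') ℂ),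
      (∀ (u : Fin 2 → ℤ) (τ : ℍ), P.latVec G D r κ u (γ'.g • τ) = γ'.φ τ ^ (2 * (κ : ℤ) - 1) •
        (twist D M' *ᵥ P.latVec G D r κ (u ᵥ* (γ'.g : Matrix _ _ ℤ)) τ)) →
      ∀ (u : Fin 2 → ℤ) (τ : ℍ), P.latVec G D r κ u ((γ * γ').g • τ) =
        (γ * γ').φ τ ^ (2 * (κ : ℤ) - 1) •
        (twist D (M * M') *ᵥ P.latVec G D r κ (u ᵥ* ((γ * γ').g : Matrix _ _ ℤ)) τ) := by
    intro γ M hγ γ' M' hγ' u τ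
    rw [Mp2Z.mul_g, mul_smul, hγ, hγ', Matrix.mulVec_smul, smul_smul, Mp2Z.mul_φ, mul_zpow,
      Matrix.mulVec_mulVec, ← twist_mul, Matrix.vecMul_vecMul]
    rfl
  induction w using FreeMonoid.recOn with
  | one =>
    intro u τ
    rw [map_one, map_one, twist_one, Matrix.one_mulVec]
    simp
  | of_mul i w ih =>
    rw [map_mul, map_mul]
    refine step _ _ ?_ _ _ ih
    fin_cases i
    · exact P.latVec_T G hD κ
    · exact P.latVec_S G hD hr κ

lemma isUnit_weilWord (w : FreeMonoid (Fin 2)) : IsUnit (weilWord N P.l P.l' w) := by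
  induction w using FreeMonoid.recOn with
  | one => rw [map_one]; exact isUnit_one
  | of_mul i w ih =>
    rw [map_mul]
    refine IsUnit.mul ?_ ih
    fin_cases i
    · exact P.isUnit_weilT
    · exact P.isUnit_weilS

/-- The slash operators permute the contributions of row vectors. -/
theorem slash_latVec (hD : IsFundamentalDiscriminant D) (hr : r ^ 2 - 4 * N * m₀ = D) (κ : ℕ)
    (u : Fin 2 → ℤ) (γ : Mp2Z) (τ : ℍ) :
    slash N D P.l P.l' (2 * (κ : ℤ) - 1) (P.latVec G D r κ u) γ τ =
      P.latVec G D r κ (u ᵥ* (γ.g : Matrix _ _ ℤ)) τ := by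
  -- The law holds along every word, so it holds along the chosen word for `γ`; the independence of
  -- the operator from the word is not needed.
  have h1 := P.latVec_word G hD hr κ (Function.surjInv Mp2Z.evalWord_surjective γ) u τ
  have h2 := isUnit_twist D (P.isUnit_weilWord (Function.surjInv Mp2Z.evalWord_surjective γ))
  rw [Function.surjInv_eq Mp2Z.evalWord_surjective γ] at h1
  have h3 : weilRepTwisted N D P.l P.l' γ =
    twist D (weilWord N P.l P.l' (Function.surjInv Mp2Z.evalWord_surjective γ)) := rfl
  rw [slash, h1, h3, Matrix.mulVec_smul, Matrix.mulVec_mulVec,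
    Matrix.nonsing_inv_mul _ ((Matrix.isUnit_iff_isUnit_det _).mp h2), Matrix.one_mulVec,
    smul_smul, ← zpow_add₀ (γ.φ_ne_zero τ), neg_add_cancel, zpow_zero, one_smul]

end HypPair

/-! ### The summands of the Poincaré series -/

namespace HypPair

variable {N : ℕ} [NeZero N] (P : HypPair N) (z : ℍ) (hz : 0 < pz N z P.l) {D r m₀ : ℤ}

/-- The constant relating the theta kernel to the contributions of row vectors. -/
def kernelConst (D : ℤ) (κ : ℕ) : ℂ :=
  qz N z P.l ^ κ / (2 * (P.geom z hz).A * ((√(2 * D.natAbs) : ℝ) : ℂ))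

/-- The root on the left is the factor that `Xi_eq` introduces between `Ξ_κ` and `jFun`. Once it is
included, `c_{z,k,0}` is the first coefficient of `latTerm` up to the constant of the kernel;
`cConst_one` does the same for the second. -/
lemma cConst_zero (hD : D ≠ 0) {k κ : ℕ} (hk : k = κ + 1) :
    cConst N D P.l z k 0 * ((√(8 * Real.pi * (P.geom z hz).A / D.natAbs) : ℝ) : ℂ) ^ κ =
      P.kernelConst z hz D κ * Complex.I ^ (κ + 1) := by
  have hd : (0 : ℝ) < D.natAbs := Nat.cast_pos.mpr (by simpa using hD)
  have hA := (P.geom z hz).A_pos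
  rw [cConst, kernelConst, P.Qz_l z hz, pow_zero, mul_one, hk, Nat.add_sub_cancel,
    Int.abs_eq_natAbs, Int.cast_natCast]
  generalize (P.geom z hz).A = A at *
  have h1 : √(D.natAbs : ℝ) * √(8 * Real.pi * A / D.natAbs) = 2 * √(2 * Real.pi * A) := by
    rw [← Real.sqrt_mul hd.le, show (2 : ℝ) = √4 by
      rw [show (4 : ℝ) = 2 ^ 2 by norm_num, Real.sqrt_sq (by norm_num)], ← Real.sqrt_mul (by norm_num)]
    rw [show √4 = 2 by rw [show (4 : ℝ) = 2 ^ 2 by norm_num, Real.sqrt_sq (by norm_num)]]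
    congr 1
    field_simp
    norm_num
  have h2 : ((√(D.natAbs : ℝ) : ℝ) : ℂ) * ((√(8 * Real.pi * A / D.natAbs) : ℝ) : ℂ) =
      2 * ((√(2 * Real.pi * A) : ℝ) : ℂ) := by exact_mod_cast h1
  have h3 : ((√(2 * Real.pi * A) : ℝ) : ℂ) ≠ 0 := by
    exact_mod_cast (Real.sqrt_pos.mpr (by positivity)).ne'
  rw [mul_assoc, ← mul_pow]
  have h4 : qz N z P.l * Complex.I * ((√(D.natAbs : ℝ) : ℝ) : ℂ) /
      (2 * ((√(2 * Real.pi * A) : ℝ) : ℂ)) * ((√(8 * Real.pi * A / D.natAbs) : ℝ) : ℂ) =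
      qz N z P.l * Complex.I := by
    rw [div_mul_eq_mul_div, mul_assoc (qz N z P.l * Complex.I), h2]
    field_simp
  rw [h4, mul_pow]
  ring

lemma cConst_one (hD : D ≠ 0) {k κ : ℕ} (hk : k = κ + 2) :
    cConst N D P.l z k 1 * ((√(8 * Real.pi * (P.geom z hz).A / D.natAbs) : ℝ) : ℂ) ^ κ =
      P.kernelConst z hz D (κ + 1) *
        (D.natAbs / (2 * Real.pi) * ((κ + 1 : ℕ) : ℂ) * Complex.I ^ κ) := by
  have hd : (0 : ℝ) < D.natAbs := Nat.cast_pos.mpr (by simpa using hD)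
  have hA := (P.geom z hz).A_pos
  have h0 := P.cConst_zero z hz hD (k := k) (κ := κ + 1) hk
  have h1 : cConst N D P.l z k 1 = cConst N D P.l z k 0 * (((1 - (k : ℂ)) *
      ((√(2 * (|D| : ℤ) * Qz N z P.l) : ℝ) : ℂ) / ((√Real.pi : ℝ) : ℂ))) := by
    rw [cConst, cConst, pow_zero, pow_one, mul_one]
  rw [P.Qz_l z hz, Int.abs_eq_natAbs, Int.cast_natCast] at h1
  rw [h1]
  generalize (P.geom z hz).A = A at *
  have h2 : √(8 * Real.pi * A / D.natAbs) * D.natAbs =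
      2 * (√(2 * D.natAbs * A) * √Real.pi) := by
    rw [← Real.sqrt_mul (by positivity)]
    have e1 : (D.natAbs : ℝ) = √((D.natAbs : ℝ) ^ 2) := (Real.sqrt_sq hd.le).symm
    have e2 : (2 : ℝ) = √4 := by
      rw [show (4 : ℝ) = 2 ^ 2 by norm_num, Real.sqrt_sq (by norm_num)]
    calc √(8 * Real.pi * A / D.natAbs) * D.natAbs
        = √(8 * Real.pi * A / D.natAbs) * √((D.natAbs : ℝ) ^ 2) := by rw [← e1]
      _ = √(4 * (2 * D.natAbs * A * Real.pi)) := by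
        rw [← Real.sqrt_mul (by positivity)]
        congr 1
        field_simp
        norm_num
      _ = √4 * √(2 * D.natAbs * A * Real.pi) := Real.sqrt_mul (by norm_num) _
      _ = _ := by rw [← e2]
  have h3 : ((√(8 * Real.pi * A / D.natAbs) : ℝ) : ℂ) * D.natAbs =
      2 * (((√(2 * D.natAbs * A) : ℝ) : ℂ) * ((√Real.pi : ℝ) : ℂ)) := by exact_mod_cast h2
  have h4 : ((√Real.pi : ℝ) : ℂ) ^ 2 = Real.pi := by
    rw [← Complex.ofReal_pow, Real.sq_sqrt Real.pi_pos.le]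
  have h5 : ((√Real.pi : ℝ) : ℂ) ≠ 0 := by
    exact_mod_cast (Real.sqrt_pos.mpr Real.pi_pos).ne'
  have h6 : ((√(2 * D.natAbs * A) : ℝ) : ℂ) / ((√Real.pi : ℝ) : ℂ) =
      ((√(8 * Real.pi * A / D.natAbs) : ℝ) : ℂ) * (D.natAbs / (2 * Real.pi)) := by
    rw [← h4]
    generalize ((√(8 * Real.pi * A / D.natAbs) : ℝ) : ℂ) = R at h3 ⊢
    generalize ((√(2 * D.natAbs * A) : ℝ) : ℂ) = R' at h3 ⊢
    field_simp
    linear_combination -h3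
  rw [mul_div_assoc, h6]
  rw [hk]
  rw [hk] at h0
  push_cast
  rw [pow_succ] at h0
  linear_combination (-(κ + 1) * (D.natAbs / (2 * Real.pi)) : ℂ) * h0 +
    (-(κ + 1) * (D.natAbs / (2 * Real.pi)) * P.kernelConst z hz D (κ + 1) * Complex.I ^ κ) *
      Complex.I_sq

lemma seed_eq (hD : IsFundamentalDiscriminant D) (k j n : ℕ) (τ : ℍ) (h : DiscK N P.l P.l') :
    seed N D r P.l P.l' z k j n τ h =
      ((√(8 * Real.pi * (P.geom z hz).A / D.natAbs) : ℝ) : ℂ) ^ (k - 1 - j) *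
        jFun P (P.geom z hz) D r (k - 1 - j) τ 0 n (P.idx h) := by
  have := P.Xi_eq z (r := r) hz hD (k - 1 - j) τ (2 * N * (P.geom z hz).ρ) n rfl h
  rw [← this, ← P.muK_eq z hz]
  rfl

/-- For the row `(0, -n)` the factor `n τ - α` of `latTerm` is `-n`, which accounts for
`(-n)^{1-j}`. The term `j = 1` is the one of lower degree; for `k = 1` it is absent because its
coefficient contains the factor `κ = 0`. -/
lemma sum_seed (hD : IsFundamentalDiscriminant D) {k κ : ℕ} (hk : k = κ + 1) (n : ℕ) (τ : ℍ) :
    ∑ j ∈ Finset.range (min (k - 1) 1 + 1), (cConst N D P.l z k j * (-(n : ℂ)) ^ (1 - j)) •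
      seed N D r P.l P.l' z k j n τ =
    P.kernelConst z hz D κ • P.latVec (P.geom z hz) D r κ ![0, -n] τ := by
  funext h
  rw [Finset.sum_apply]
  simp only [Pi.smul_apply, smul_eq_mul, P.seed_eq z hz hD, latVec, latTerm]
  have h0 := P.cConst_zero z hz hD.ne_zero hk
  rcases κ with - | κ
  · subst hk
    simp at h0 ⊢
    linear_combination (n * jFun P (P.geom z hz) D r 0 τ 0 n (P.idx h)) * h0
  · have h1 := P.cConst_one z hz hD.ne_zero hk
    subst hk
    have hm : min (κ + 1 + 1 - 1) 1 + 1 = 2 := by omega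
    rw [hm, Finset.sum_range_succ, Finset.sum_range_one]
    simp at h0 h1 ⊢
    linear_combination (-(n : ℂ) * jFun P (P.geom z hz) D r (κ + 1) τ 0 n (P.idx h)) * h0 +
      jFun P (P.geom z hz) D r κ τ 0 n (P.idx h) * h1

lemma slash_sum {l l' : V} (D m : ℤ) {ι : Type*} (s : Finset ι) (c : ι → ℂ)
    (f : ι → ℍ → DiscK N l l' → ℂ) (γ : Mp2Z) (τ : ℍ) :
    ∑ j ∈ s, c j • slash N D l l' m (f j) γ τ =
      slash N D l l' m (fun τ => ∑ j ∈ s, c j • f j τ) γ τ := by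
  simp only [slash]
  rw [Matrix.mulVec_sum, Finset.smul_sum]
  refine Finset.sum_congr rfl fun j _ => ?_
  rw [Matrix.mulVec_smul, smul_comm]

lemma poincareTerm_eq (hD : IsFundamentalDiscriminant D) (hr : r ^ 2 - 4 * N * m₀ = D) {k κ : ℕ}
    (hk : k = κ + 1) (n : ℕ) (γ : Mp2Z) (τ : ℍ) :
    poincareTerm N D r P.l P.l' z k n γ τ =
      P.kernelConst z hz D κ • P.latVec (P.geom z hz) D r κ
        (-(n : ℤ) • (γ.g : Matrix (Fin 2) (Fin 2) ℤ) 1) τ := by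
  have hm : 2 * (k : ℤ) - 3 = 2 * (κ : ℤ) - 1 := by rw [hk]; push_cast; ring
  rw [poincareTerm, slash_sum, hm]
  simp only [P.sum_seed z hz hD hk]
  have h1 : ![0, -(n : ℤ)] ᵥ* (γ.g : Matrix (Fin 2) (Fin 2) ℤ) =
      -(n : ℤ) • (γ.g : Matrix (Fin 2) (Fin 2) ℤ) 1 := by
    funext i
    simp [Matrix.vecMul, dotProduct, Fin.sum_univ_two]
  rw [← h1, ← P.slash_latVec (P.geom z hz) hD hr κ _ γ τ, slash, slash, Matrix.mulVec_smul,
    smul_comm]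

/-- For the zero vector the factor `n τ - α` vanishes, so only the term of lower degree survives,
and for `k = 1` not even that. -/
lemma kernelConst_smul_latVec_zero (hD : IsFundamentalDiscriminant D) {k κ : ℕ}
    (hk : k = κ + 1) (τ : ℍ) :
    P.kernelConst z hz D κ • P.latVec (P.geom z hz) D r κ 0 τ =
      if 2 ≤ k then cConst N D P.l z k 1 • Xi N D r P.l P.l' z (k - 2) τ 0 0 0 else 0 := by
  funext h
  rcases κ with - | κ
  · rw [if_neg (by omega)]
    simp [latVec, latTerm]
  · have h1 := P.cConst_one z hz hD.ne_zero hk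
    have h2 := P.Xi_eq z (r := r) hz hD κ τ 0 0 (by simp) h
    rw [if_pos (by omega)]
    subst hk
    simp only [Pi.smul_apply, smul_eq_mul, latVec, latTerm]
    simp [e_zero, vec_zero] at h1 h2 ⊢
    rw [h2]
    linear_combination -(jFun P (P.geom z hz) D r κ τ 0 0 (P.idx h)) * h1

end HypPair

/-! ### Cosets and coprime pairs -/

namespace Mp2Z

/-- The bottom row of the matrix. -/
def row (γ : Mp2Z) : Fin 2 → ℤ := (γ.g : Matrix (Fin 2) (Fin 2) ℤ) 1

lemma row_mul (γ γ' : Mp2Z) : (γ * γ').row = γ.row ᵥ* (γ'.g : Matrix (Fin 2) (Fin 2) ℤ) := by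
  change ((γ.g * γ'.g : SL(2, ℤ)) : Matrix (Fin 2) (Fin 2) ℤ) 1 = _
  rw [Matrix.SpecialLinearGroup.coe_mul, Matrix.mul_apply_eq_vecMul]
  rfl

/-- The elements with bottom row `(0, 1)` and trivial root. -/
def unipotent : Subgroup Mp2Z where
  carrier := {δ | δ.row = (1 : Mp2Z).row ∧ ∀ τ, δ.φ τ = 1}
  one_mem' := ⟨rfl, fun _ => rfl⟩
  mul_mem' := by
    rintro x y ⟨h1, h2⟩ ⟨h3, h4⟩
    refine ⟨?_, fun τ => ?_⟩
    · rw [row_mul, h1, ← row_mul, one_mul, h3]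
    · rw [mul_φ, h2, h4, one_mul]
  inv_mem' := by
    rintro x ⟨h1, h2⟩
    refine ⟨?_, fun τ => ?_⟩
    · have h3 := row_mul x x⁻¹
      rw [h1, ← row_mul, one_mul, mul_inv_cancel] at h3
      exact h3.symm
    · rw [inv_φ, h2, inv_one]

lemma gammaInf_le : GammaInf ≤ unipotent := by
  rw [GammaInf, Subgroup.zpowers_le]
  refine ⟨?_, fun τ => rfl⟩
  funext i
  fin_cases i <;> simp [row, T, ModularGroup.T]

lemma row_mul_of_mem {δ : Mp2Z} (hδ : δ ∈ GammaInf) (γ : Mp2Z) : (δ * γ).row = γ.row := by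
  rw [row_mul, (gammaInf_le hδ).1, ← row_mul, one_mul]

lemma φ_mul_of_mem {δ : Mp2Z} (hδ : δ ∈ GammaInf) (γ : Mp2Z) (τ : ℍ) :
    (δ * γ).φ τ = γ.φ τ := by
  rw [mul_φ, (gammaInf_le hδ).2, one_mul]

lemma T_zpow_g (m : ℤ) : (T ^ m).g = ModularGroup.T ^ m := by
  let pr : Mp2Z →* SL(2, ℤ) := { toFun := Mp2Z.g, map_one' := rfl, map_mul' := fun _ _ => rfl }
  exact map_zpow pr T m

/-- Equal bottom rows make the matrix of the quotient a translation. Its root is then constant, `1`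
or `-1`, and agreement of the roots at one point excludes `-1`. -/
lemma mem_gammaInf {γ γ' : Mp2Z} (hrow : γ.row = γ'.row) {τ : ℍ} (hφ : γ.φ τ = γ'.φ τ) :
    γ' * γ⁻¹ ∈ GammaInf := by
  have h1 : (γ' * γ⁻¹).row = (1 : Mp2Z).row := by
    rw [row_mul, ← hrow, ← row_mul, mul_inv_cancel]
  set δ := γ' * γ⁻¹ with hδ
  have h10 : δ.g 1 0 = 0 := by
    have := congrFun h1 0
    simpa [row] using this
  have h11 : δ.g 1 1 = 1 := by
    have := congrFun h1 1
    simpa [row] using this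
  have h00 : δ.g 0 0 = 1 := by
    have := δ.g.det_coe
    rw [Matrix.det_fin_two, h10, h11] at this
    linarith
  have hg : δ.g = (T ^ (δ.g 0 1)).g := by
    rw [T_zpow_g]
    apply Subtype.ext
    rw [ModularGroup.coe_T_zpow]
    ext i j
    fin_cases i <;> fin_cases j
    · exact h00
    · rfl
    · exact h10
    · exact h11
  have hT : T ^ (δ.g 0 1) ∈ GammaInf := ⟨_, rfl⟩
  have hTφ := (gammaInf_le hT).2
  rcases eq_or_eq_of_g_eq hg with h | h
  · have : δ = T ^ (δ.g 0 1) := Mp2Z.ext hg h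
    rw [this]
    exact hT
  · exfalso
    have h2 : δ.φ (γ.g • τ) = 1 := by
      rw [hδ, mul_φ, inv_φ, inv_g, inv_smul_smul, ← hφ]
      exact mul_inv_cancel₀ (γ.φ_ne_zero τ)
    have h3 := congrFun h (γ.g • τ)
    rw [h2, Pi.neg_apply, hTφ] at h3
    norm_num at h3

lemma exists_g_eq (g : SL(2, ℤ)) : ∃ γ : Mp2Z, γ.g = g := by
  let pr : Mp2Z →* SL(2, ℤ) := { toFun := Mp2Z.g, map_one' := rfl, map_mul' := fun _ _ => rfl }
  have htop : pr.range = ⊤ := by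
    rw [eq_top_iff, ← SpecialLinearGroup.SL2Z_generators, Subgroup.closure_le]
    rintro x (rfl | rfl)
    · exact ⟨S, rfl⟩
    · exact ⟨T, rfl⟩
  have : g ∈ pr.range := htop ▸ Subgroup.mem_top g
  exact this

/-- Whether the root agrees with the principal one at the point `i`. -/
def bit (γ : Mp2Z) : Bool :=
  open Classical in decide (γ.φ I = ((γ.row 0 : ℂ) * (I : ℍ) + γ.row 1) ^ (1 / 2 : ℂ))

lemma φ_I_sq (γ : Mp2Z) : γ.φ I ^ 2 = (((γ.row 0 : ℂ) * (I : ℍ) + γ.row 1) ^ (1 / 2 : ℂ)) ^ 2 := by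
  rw [cpow_half_sq, γ.sq]; rfl

lemma φ_I_eq_of_bit {γ γ' : Mp2Z} (hrow : γ.row = γ'.row) (hbit : γ.bit = γ'.bit) :
    γ.φ I = γ'.φ I := by
  have h1 := sq_eq_sq_iff_eq_or_eq_neg.mp γ.φ_I_sq
  have h2 := sq_eq_sq_iff_eq_or_eq_neg.mp γ'.φ_I_sq
  rw [bit, bit, ← hrow, decide_eq_decide] at hbit
  rw [← hrow] at h2
  by_cases h : γ.φ I = ((γ.row 0 : ℂ) * (I : ℍ) + γ.row 1) ^ (1 / 2 : ℂ)
  · rw [h, hbit.mp h]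
  · rw [h1.resolve_left h, h2.resolve_left fun h' => h (hbit.mpr h')]

/-- The element `S⁴` has trivial matrix and root `-1`; multiplication by it reverses the sign of the
root and keeps the row. -/
lemma exists_row_bit {c : Fin 2 → ℤ} (hc : IsCoprime (c 0) (c 1)) (b : Bool) :
    ∃ γ : Mp2Z, γ.row = c ∧ γ.bit = b := by
  obtain ⟨g, -, hg⟩ := ModularGroup.bottom_row_surj (R := ℤ) hc
  obtain ⟨γ, rfl⟩ := exists_g_eq g
  by_cases hb : γ.bit = b
  · exact ⟨γ, hg, hb⟩
  · have h1 : (γ * (S * S * (S * S))).row = γ.row := by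
      rw [row_mul, S_four.1]; simp
    refine ⟨γ * (S * S * (S * S)), h1.trans hg, ?_⟩
    have h2 : (γ * (S * S * (S * S))).φ I = -γ.φ I := by
      rw [mul_φ, S_four.1, S_four.2, one_smul]; ring
    have h3 : (γ * (S * S * (S * S))).bit ≠ γ.bit := by
      intro h
      have := φ_I_eq_of_bit h1 h
      rw [h2] at this
      exact γ.φ_ne_zero I (by linear_combination -this / 2)
    revert hb h3
    cases γ.bit <;> cases b <;> cases (γ * (S * S * (S * S))).bit <;> simp

lemma isCoprime_row (γ : Mp2Z) : IsCoprime (γ.row 0) (γ.row 1) :=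
  ModularGroup.bottom_row_coprime γ.g

lemma out_eq (γ : Mp2Z) : ∃ δ ∈ GammaInf,
    (Quotient.mk (QuotientGroup.rightRel GammaInf) γ).out = δ * γ := by
  have h : (QuotientGroup.rightRel GammaInf) (Quotient.mk _ γ).out γ := Quotient.mk_out γ
  rw [QuotientGroup.rightRel_apply] at h
  refine ⟨_, inv_mem h, ?_⟩
  group

/-- Pairs of a positive integer and a coset correspond to nonzero row vectors with a sign. -/
def cosetEquiv : ℕ+ × CosetSpace ≃ {u : Fin 2 → ℤ // u ∉ ({0} : Finset (Fin 2 → ℤ))} × Bool :=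
  Equiv.ofBijective (fun p => (⟨-((p.1 : ℕ) : ℤ) • p.2.out.row, by
    rw [Finset.mem_singleton, smul_eq_zero, not_or]
    refine ⟨by simp, fun h => ?_⟩
    have := p.2.out.isCoprime_row
    rw [h] at this
    exact not_isCoprime_zero_zero this⟩, p.2.out.bit)) <| by
    constructor
    · rintro ⟨n, c⟩ ⟨n', c'⟩ h
      rw [Prod.mk.injEq, Subtype.mk.injEq] at h
      obtain ⟨h1, h2⟩ := h
      -- The integer `n` is recovered as the greatest common divisor of the entries, since bottom
      -- rows are primitive.
      have hgcd : ∀ (n : ℕ) (γ : Mp2Z), Int.gcd ((-(n : ℤ) • γ.row) 0) ((-(n : ℤ) • γ.row) 1) = n := by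
        intro n γ
        rw [Pi.smul_apply, Pi.smul_apply, smul_eq_mul, smul_eq_mul, Int.gcd_mul_left,
          Int.isCoprime_iff_gcd_eq_one.mp γ.isCoprime_row]
        simp
      have hn : (n : ℕ) = n' := by
        rw [← hgcd n c.out, ← hgcd n' c'.out]
        simp only at h1
        rw [h1]
      have hn' : n = n' := PNat.coe_inj.mp hn
      subst hn'
      have hrow : c.out.row = c'.out.row :=
        smul_right_injective _ (by simp : -((n : ℕ) : ℤ) ≠ 0) h1
      have hφ := φ_I_eq_of_bit hrow h2
      have := mem_gammaInf hrow hφ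
      rw [← QuotientGroup.rightRel_apply] at this
      have h3 := Quotient.sound this
      rw [Quotient.out_eq, Quotient.out_eq] at h3
      rw [h3]
    · rintro ⟨⟨u, hu⟩, b⟩
      rw [Finset.mem_singleton] at hu
      have hg : Int.gcd (u 0) (u 1) ≠ 0 := by
        intro h
        rw [Int.gcd_eq_zero_iff] at h
        apply hu
        funext i
        fin_cases i
        · exact h.1
        · exact h.2
      obtain ⟨a, ha⟩ := Int.gcd_dvd_left (u 0) (u 1)
      obtain ⟨a', ha'⟩ := Int.gcd_dvd_right (u 0) (u 1)
      have hc : IsCoprime (-a) (-a') := by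
        rw [IsCoprime.neg_left_iff, IsCoprime.neg_right_iff, Int.isCoprime_iff_gcd_eq_one]
        have h1 : Int.gcd (u 0) (u 1) = Int.gcd (u 0) (u 1) * Int.gcd a a' := by
          generalize hg' : Int.gcd (u 0) (u 1) = g at ha ha'
          rw [ha, ha', Int.gcd_mul_left, Int.natAbs_natCast] at hg'
          exact hg'.symm
        exact (Nat.mul_eq_left hg).mp h1.symm
      -- The signs compensate for the factor `-n` in the map.
      obtain ⟨γ, hγ, hb⟩ := exists_row_bit (c := ![-a, -a']) hc b
      obtain ⟨δ, hδ, hout⟩ := out_eq γ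
      refine ⟨(⟨Int.gcd (u 0) (u 1), Nat.pos_of_ne_zero hg⟩,
        Quotient.mk (QuotientGroup.rightRel GammaInf) γ), ?_⟩
      have hrow : (δ * γ).row = γ.row := row_mul_of_mem hδ γ
      refine Prod.ext (Subtype.ext ?_) ?_
      · simp only
        rw [hout, hrow, hγ]
        funext i
        fin_cases i
        · simp [← ha]
        · simp [← ha']
      · simp only
        rw [hout, ← hb, bit, bit, hrow, φ_mul_of_mem hδ]

end Mp2Z

/-! ### Unfolding the Poincaré series -/

lemma summable_prod_bool {α E : Type*} [AddCommGroup E] [TopologicalSpace E]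
    [IsTopologicalAddGroup E] {f : α → E} (hf : Summable f) :
    Summable fun q : α × Bool => f q.1 := by
  rw [← (Equiv.prodComm Bool α).summable_iff, ← (Equiv.boolProdEquivSum α).symm.summable_iff]
  exact Summable.sum _ hf hf

lemma tsum_prod_bool {α E : Type*} [AddCommGroup E] [TopologicalSpace E] [T2Space E]
    [IsTopologicalAddGroup E] {f : α → E} (hf : Summable f) :
    ∑' q : α × Bool, f q.1 = 2 • ∑' a, f a := by
  rw [← (Equiv.prodComm Bool α).tsum_eq, ← (Equiv.boolProdEquivSum α).symm.tsum_eq, two_smul]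
  exact Summable.tsum_sum (f := fun c => f ((Equiv.prodComm Bool α)
    ((Equiv.boolProdEquivSum α).symm c)).1) hf hf

namespace HypPair

variable {N : ℕ} [NeZero N] (P : HypPair N) (z : ℍ) {D r m₀ : ℤ}

lemma exists_eq_vec_of_mem_span {μ : V} (hμ : μ ∈ Submodule.span ℝ (latK N P.l P.l' : Set V)) :
    ∃ y : ℝ, μ = P.vec y 0 0 := by
  induction hμ using Submodule.span_induction with
  | mem x hx =>
    obtain ⟨a, b, c, rfl⟩ := hx.1
    obtain ⟨x, m, n, h⟩ := P.exists_of_mem_latL' (y := !![(b : ℝ), -a / N; c, -b])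
      ⟨a, 2 * N * b, c, by
        have hN : (N : ℝ) ≠ 0 := Nat.cast_ne_zero.mpr (NeZero.ne N)
        push_cast
        rw [mul_div_cancel_left₀ _ (by positivity)]⟩
    rw [h] at hx ⊢
    obtain ⟨h1, h2⟩ := P.vec_mem_perp.mp hx.2
    exact ⟨x, by simp only [h1, h2]⟩
  | zero => exact ⟨0, by simp [vec_zero]⟩
  | add x y _ _ hx hy =>
    obtain ⟨a, rfl⟩ := hx
    obtain ⟨b, rfl⟩ := hy
    exact ⟨a + b, by rw [vec_add, add_zero]⟩
  | smul c x _ hx =>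
    obtain ⟨a, rfl⟩ := hx
    exact ⟨c * a, by rw [smul_vec, mul_zero]⟩

/-- Row vectors `(n, -α)` and pairs `(n, α)`. -/
def rowEquiv : (Fin 2 → ℤ) ≃ ℤ × ℤ :=
  (finTwoArrowEquiv ℤ).trans ((Equiv.refl ℤ).prodCongr (Equiv.neg ℤ))

lemma summable_latVec (hz : 0 < pz N z P.l) (hD : IsFundamentalDiscriminant D)
    (hr : r ^ 2 - 4 * N * m₀ = D) (κ : ℕ)
    (τ : ℍ) : Summable fun u => P.latVec (P.geom z hz) D r κ u τ :=
  Pi.summable.mpr fun h => (rowEquiv.summable_iff (f := fun y : ℤ × ℤ =>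
    latTerm P (P.geom z hz) D r κ τ y.1 y.2 (P.idx h))).mpr
    (summable_latTerm P (P.geom z hz) hD hr κ τ (P.idx h))

lemma Theta_eq_tsum_latVec (hz : 0 < pz N z P.l) (hD : IsFundamentalDiscriminant D)
    (hr : r ^ 2 - 4 * N * m₀ = D)
    {k κ : ℕ} (hk : k = κ + 1) (τ : ℍ) :
    (fun h => Theta N D r k τ z (discMap N P.l P.l' h)) =
      P.kernelConst z hz D κ • ∑' u, P.latVec (P.geom z hz) D r κ u τ := by
  funext h
  rw [P.Theta_eq z hz hD hr, Pi.smul_apply, tsum_apply (P.summable_latVec z hz hD hr κ τ), hk,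
    Nat.add_sub_cancel, ← rowEquiv.tsum_eq]
  rfl

lemma poincareTerm_out_eq (hz : 0 < pz N z P.l) (hD : IsFundamentalDiscriminant D)
    (hr : r ^ 2 - 4 * N * m₀ = D)
    {k κ : ℕ} (hk : k = κ + 1) (τ : ℍ) (p : ℕ+ × CosetSpace) :
    poincareTerm N D r P.l P.l' z k p.1 p.2.out τ =
      P.kernelConst z hz D κ •
        P.latVec (P.geom z hz) D r κ (Mp2Z.cosetEquiv p).1 τ :=
  P.poincareTerm_eq z hz hD hr hk p.1 p.2.out τ

lemma summable_poincareTerm (hz : 0 < pz N z P.l) (hD : IsFundamentalDiscriminant D)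
    (hr : r ^ 2 - 4 * N * m₀ = D)
    {k κ : ℕ} (hk : k = κ + 1) (τ : ℍ) :
    Summable fun p : ℕ+ × CosetSpace => poincareTerm N D r P.l P.l' z k p.1 p.2.out τ := by
  simp only [P.poincareTerm_out_eq z hz hD hr hk]
  refine Summable.const_smul _ ?_
  have h1 := (P.summable_latVec z hz hD hr κ τ).subtype
    {u : Fin 2 → ℤ | u ∉ ({0} : Finset (Fin 2 → ℤ))}
  exact Mp2Z.cosetEquiv.summable_iff.mpr (summable_prod_bool h1)

/-- The theta kernel as the sum of the contribution of the zero vector and a Poincaré series. -/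
theorem Theta_eq_poincare (hz : 0 < pz N z P.l) (hD : IsFundamentalDiscriminant D)
    (hr : r ^ 2 - 4 * N * m₀ = D)
    {k κ : ℕ} (hk : k = κ + 1) (τ : ℍ) :
    (fun h : DiscK N P.l P.l' => Theta N D r k τ z (discMap N P.l P.l' h)) =
      (1 / 2 : ℂ) • (∑' n : ℕ+, ∑' γ : CosetSpace, poincareTerm N D r P.l P.l' z k n γ.out τ) +
        (if 2 ≤ k then cConst N D P.l z k 1 • Xi N D r P.l P.l' z (k - 2) τ 0 0 0 else 0) := by
  have hs := P.summable_latVec z hz hD hr κ τ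
  have hp := P.summable_poincareTerm z hz hD hr hk τ
  have h1 : Summable fun u : {u : Fin 2 → ℤ // u ∉ ({0} : Finset (Fin 2 → ℤ))} =>
      P.latVec (P.geom z hz) D r κ u τ :=
    hs.subtype {u : Fin 2 → ℤ | u ∉ ({0} : Finset (Fin 2 → ℤ))}
  rw [← P.kernelConst_smul_latVec_zero z hz hD hk τ, P.Theta_eq_tsum_latVec z hz hD hr hk,
    ← hp.tsum_prod]
  simp only [P.poincareTerm_out_eq z hz hD hr hk]
  -- Every nonzero row vector occurs once for each of the two square roots; this is the origin of
  -- the factor `1/2`.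
  have h2 : ∑' p, P.latVec (P.geom z hz) D r κ (Mp2Z.cosetEquiv p).1 τ =
      (2 : ℂ) • ∑' u : {u : Fin 2 → ℤ // u ∉ ({0} : Finset (Fin 2 → ℤ))},
        P.latVec (P.geom z hz) D r κ u τ := by
    rw [Mp2Z.cosetEquiv.tsum_eq
      (fun q : {u : Fin 2 → ℤ // u ∉ ({0} : Finset (Fin 2 → ℤ))} × Bool =>
        P.latVec (P.geom z hz) D r κ q.1 τ), tsum_prod_bool h1, two_smul, two_smul]
  rw [tsum_const_smul'', h2, ← hs.sum_add_tsum_subtype_compl {0}, Finset.sum_singleton, smul_add,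
    smul_comm (P.kernelConst z hz D κ) (2 : ℂ), smul_smul, add_comm]
  norm_num

end HypPair

end ShimuraTheta

end

/-! ### The theorem on the theta kernel. -/

theorem theorem5p8 (N : ℕ) [NeZero N] (Δ r : ℤ) (hΔ : IsFundamentalDiscriminant Δ)
    (hr : Δ ≡ r ^ 2 [ZMOD 4 * N]) (k : ℕ) (hk : 1 ≤ k)
    (l l' : V) (hl : l ∈ latL N) (hl' : l' ∈ latL N) (hQl : Q N l = 0) (hQl' : Q N l' = 0)
    (hll' : form N l l' = 1) (z τ : ℍ) (hz : 0 < -form N l (b3 N z)) :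
    -- the natural map `K'/K → L'/L` is an isomorphism
    Function.Bijective (discMap N l l') ∧
    -- the series that define the two kinds of theta functions converge absolutely
    (∀ h : DiscL N, Summable fun x : thetaIndex N Δ r h => thetaTerm N Δ k τ z (x : latL' N)) ∧
    (∀ (κ : ℕ) (τ' : ℍ), ∀ μ ∈ Submodule.span ℝ (latK N l l' : Set V), ∀ (α β : ℤ)
      (h : DiscK N l l'), Summable
        fun x : {x : latK' N l l' // (QuotientAddGroup.mk x : DiscK N l l') = r • h} =>
          xiTerm N Δ l l' z κ τ' μ α β h (x : latK' N l l')) ∧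
    -- the summand of the Poincaré series depends only on the coset of `γ`
    (∀ n : ℕ, 1 ≤ n → ∀ δ ∈ Mp2Z.GammaInf, ∀ γ : Mp2Z,
      poincareTerm N Δ r l l' z k n (δ * γ) τ = poincareTerm N Δ r l l' z k n γ τ) ∧
    -- the Poincaré series converges absolutely
    (Summable fun p : ℕ+ × CosetSpace => poincareTerm N Δ r l l' z k p.1 p.2.out τ) ∧
    -- the identity, with `ℂ[L'/L]` and `ℂ[K'/K]` identified through the natural isomorphism
    (fun h : DiscK N l l' => Theta N Δ r k τ z (discMap N l l' h)) =
      (1 / 2 : ℂ) • (∑' n : ℕ+, ∑' γ : CosetSpace, poincareTerm N Δ r l l' z k n γ.out τ) +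
        (if 2 ≤ k then cConst N Δ l z k 1 • Xi N Δ r l l' z (k - 2) τ 0 0 0 else 0) := by
  obtain ⟨P, rfl, rfl⟩ := HypPair.exists_eq hl hl' hQl hQl' hll'
  obtain ⟨m₀, hm₀⟩ := hr.dvd
  have hr' : r ^ 2 - 4 * N * m₀ = Δ := by linarith
  have hk' : k = k - 1 + 1 := (Nat.sub_add_cancel hk).symm
  refine ⟨P.discMap_bijective, fun h => ?_, fun κ τ' μ hμ α β h => ?_, fun n _ δ hδ γ => ?_,
    P.summable_poincareTerm z hz hΔ hr' hk' τ, P.Theta_eq_poincare z hz hΔ hr' hk' τ⟩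
  · obtain ⟨h, rfl⟩ := P.discMap_bijective.surjective h
    exact P.summable_thetaTerm z hz hΔ hr' k τ h
  · obtain ⟨y, rfl⟩ := P.exists_eq_vec_of_mem_span hμ
    exact P.summable_xiTerm z hz hΔ hr' κ τ' y α β h
  · rw [P.poincareTerm_eq z hz hΔ hr' hk', P.poincareTerm_eq z hz hΔ hr' hk']
    exact congrArg (fun c => P.kernelConst z hz Δ (k - 1) •
      P.latVec (P.geom z hz) Δ r (k - 1) (-(n : ℤ) • c) τ) (Mp2Z.row_mul_of_mem hδ γ)
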